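/- Let $\mathbb{T}^2=\mathbb{R}^2/\mathbb{Z}^2$, $e_m(x)=e^{2\pi i m\cdot x}$ and $\hat f(m)=\int_{\mathbb{T}^2} f(x)e^{-2\pi i m\cdot x}\,dx$ for $m\in\mathbb{Z}^2$, $\langle f,\varphi\rangle=\sum_m \hat f(m)\overline{\hat\varphi(m)}$, and $\Pi_n f=\sum_{|m|\le n}\hat f(m)e_m$. Fix a smooth radial dyadic partition of unity: $\chi_{-1},\chi:\mathbb{R}^2\to[0,1]$ smooth and radial, $\operatorname{supp}\chi_{-1}\subset B(0,4/3)$, $\operatorname{supp}\chi\subset B(0,8/3)\setminus B(0,3/4)$, $\chi_{-1}+\sum_{k\ge0}\chi(\cdot/2^k)=1$; put $\chi_k=\chi(\cdot/2^k)$ for $k\ge 0$ and $\Delta_k f=\sum_m\chi_k(m)\hat f(m)e_m$. For $\gamma\in\mathbb{R}$ let $\mathcal{C}^{\gamma}$ be the completion of $C^\infty(\mathbb{T}^2;\mathbb{C})$ under $\|f\|_{\mathcal{C}^\gamma}=\sup_{k\ge-1}2^{\gamma k}\|\Delta_kf\|_{L^\infty}$. Fix $\alpha\in(0,\tfrac12)$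 and $\mu\in\mathbb{C}$ with $\operatorname{Re}\mu>0$, and write $\mathbb{N}=\{0,1,2,\dots\}$, $\mathbb{R}_+=[0,\infty)$. Let $\xi_{\mathbb{C}}$ be a complex space-time white noise on a probability space $(\Omega,\mathcal{F},\mathbb{P})$, that is, a centered Gaussian family $(\xi_{\mathbb{C}}(u))_{u\in L^2(\mathbb{R}\times\mathbb{T}^2;\mathbb{C})}$ with $\mathbb{E}[\xi_{\mathbb{C}}(u)\overline{\xi_{\mathbb{C}}(v)}]=\int u\bar v\,dt\,dx$ and $\mathbb{E}[\xi_{\mathbb{C}}(u)\xi_{\mathbb{C}}(v)]=0$. The stationary solution of $\partial_tZ_{\mathbb{C}}=\mu(\Delta-1)Z_{\mathbb{C}}+\xi_{\mathbb{C}}$ is the $C(\mathbb{R}_+;\mathcal{C}^{-\alpha})$-valued random variable $Z_{\mathbb{C}}$ such that, for all $t\ge0$ and $\varphi\in C^\infty(\mathbb{T}^2;\mathbb{C})$, almost surely $$\langle Z_{\mathbb{C}}(t),\varphi\rangle=\int_{\mathbb{R}\times\mathbb{T}^2}\langle\mathcal{K}(t-s,\cdot-y),\varphi\rangle\,\xi_{\mathbb{C}}(ds\,dy),\qquad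 \mathcal{K}(t,x)=\mathbf 1_{\{t\ge0\}}\sum_{m\in\mathbb{Z}^2}e^{-\mu(1+4\pi^2|m|^2)t}e_m(x).$$ For $k,l\in\mathbb{N}$ let $$H_{k,l}(z,c)=\sum_{m=0}^{\min\{k,l\}}m!\binom km\binom lm(-c)^mz^{k-m}\bar z^{\,l-m},$$ let $\mathcal{R}_n=\mathbb{E}[|\Pi_nZ_{\mathbb{C}}(t)(x)|^2]$, and let the complex Wick power $Z_{\mathbb{C}}^{:k,l:}$ be the $C(\mathbb{R}_+;\mathcal{C}^{-\alpha})$-valued random variable that is the limit of $H_{k,l}(\Pi_nZ_{\mathbb{C}},\mathcal{R}_n)$ in $L^p(\mathbb{P};C([0,T];\mathcal{C}^{-\alpha}))$ for all $p\in[1,\infty)$ and $T\ge0$. Finally let $\mathcal{H}_{\mathbb{C}}$ be the set of all $h$ of the form $$h(t)=\int_{-\infty}^te^{\mu(t-s)(\Delta-1)}g(s,\cdot)\,ds\quad(t\ge0),\qquad g\in L^2(\mathbb{R}\times\mathbb{T}^2;\mathbb{C}).$$ **Theorem.** The stationary solution $Z_{\mathbb{C}}$ and its Wick powers $(Z_{\mathbb{C}}^{:k,l:})_{k,l\in\mathbb{N}}$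 exist, and $$\operatorname{Supp}\,\operatorname{Law}\big((Z_{\mathbb{C}}^{:k,l:})_{k,l\in\mathbb{N}}\big)=\overline{\big\{(H_{k,l}(h,R))_{k,l\in\mathbb{N}}\;:\;h\in\mathcal{H}_{\mathbb{C}},\ R\in\mathbb{R}_+\big\}},$$ where the closure is taken in $C(\mathbb{R}_+;\mathcal{C}^{-\alpha})^{\mathbb{N}\times\mathbb{N}}$ with the product topology (each factor having the topology of uniform convergence on compact sets), and the support of a Borel measure is the set of points all of whose neighborhoods have positive measure. -/

import Mathlib

open MeasureTheory ProbabilityTheory Filter Topology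
open scoped NNReal ENNReal ComplexConjugate

noncomputable section

namespace ComplexSHE

/-! ### The torus, Fourier modes, smooth functions -/

/-- The two-dimensional torus `ℝ² / ℤ²`. -/
abbrev Torus : Type := UnitAddTorus (Fin 2)

/-- Fourier modes `m ∈ ℤ²`. -/
abbrev Mode : Type := Fin 2 → ℤ

/-- The normalized Haar (= Lebesgue) measure on the torus. It is the measure with respect to
which `UnitAddTorus.mFourierCoeff` is defined. -/
abbrev torusMeasure : Measure Torus := Measure.pi fun _ => AddCircle.haarAddCircle

/-- The measure `dt dx` on `ℝ × 𝕋²`. -/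
abbrev spaceTimeMeasure : Measure (ℝ × Torus) := (volume : Measure ℝ).prod torusMeasure

/-- `L²(ℝ × 𝕋²; ℂ)`. -/
abbrev SpaceTimeL2 : Type := Lp ℂ 2 spaceTimeMeasure

lemma mFourierCoeff_eq (φ : Torus → ℂ) (m : Mode) :
    UnitAddTorus.mFourierCoeff φ m = ∫ x, UnitAddTorus.mFourier (-m) x • φ x ∂torusMeasure := rfl

/-- The mode `m ∈ ℤ²` as a point of the Euclidean plane; `‖freq m‖ = |m|`. -/
def freq (m : Mode) : EuclideanSpace ℝ (Fin 2) := WithLp.toLp 2 fun i => (m i : ℝ)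

/-- `1 + 4π²|m|²`, the eigenvalue of `1 - Δ` on `e_m`. -/
def eigenvalue (m : Mode) : ℝ := 1 + 4 * Real.pi ^ 2 * ‖freq m‖ ^ 2

/-- `φ ∈ C^∞(𝕋²; ℂ)`: the periodic lift of `φ` to `ℝ²` is smooth. -/
def IsSmooth (φ : Torus → ℂ) : Prop :=
  ContDiff ℝ ((⊤ : ℕ∞) : WithTop ℕ∞) fun x : Fin 2 → ℝ => φ fun i => (x i : UnitAddCircle)

/-- The pairing `⟨f, φ⟩ = ∑ m, f̂(m) * conj (φ̂(m))` of the periodic distribution with Fourier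
coefficients `f` and a smooth function `φ`. -/
def pairing (f : Mode → ℂ) (φ : Torus → ℂ) : ℂ :=
  ∑' m, f m * conj (UnitAddTorus.mFourierCoeff φ m)

/-- The periodic distribution with Fourier coefficients `f` is the integrable function `φ`. -/
def Represents (f : Mode → ℂ) (φ : Torus → ℂ) : Prop :=
  Integrable φ torusMeasure ∧ ∀ m, f m = UnitAddTorus.mFourierCoeff φ m

lemma finite_freq_le (r : ℝ) : {m : Mode | ‖freq m‖ ≤ r}.Finite := by
  refine (Set.Finite.pi' (fun _ : Fin 2 => Set.finite_Icc (-⌈r⌉) ⌈r⌉)).subset fun m hm i => ?_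
  have h1 : |(m i : ℝ)| ≤ r := (PiLp.norm_apply_le (freq m) i).trans hm
  have h2 := abs_le.1 (h1.trans (Int.le_ceil r))
  exact ⟨by exact_mod_cast h2.1, by exact_mod_cast h2.2⟩

/-- The Fourier cutoff `Π_n f = ∑_{|m| ≤ n} f̂(m) e_m`. -/
def cutoff (n : ℕ) (f : Mode → ℂ) : C(Torus, ℂ) :=
  ∑ m ∈ (finite_freq_le n).toFinset, f m • UnitAddTorus.mFourier m

/-! ### Besov spaces -/

/-- A smooth radial dyadic partition of unity `χ_{-1} = low`, `χ_k = ann (· / 2^k)`, `k ≥ 0`. -/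
structure DyadicPartition where
  low : EuclideanSpace ℝ (Fin 2) → ℝ
  ann : EuclideanSpace ℝ (Fin 2) → ℝ
  low_smooth : ContDiff ℝ ((⊤ : ℕ∞) : WithTop ℕ∞) low
  ann_smooth : ContDiff ℝ ((⊤ : ℕ∞) : WithTop ℕ∞) ann
  low_radial : ∀ x y, ‖x‖ = ‖y‖ → low x = low y
  ann_radial : ∀ x y, ‖x‖ = ‖y‖ → ann x = ann y
  low_mem : ∀ x, low x ∈ Set.Icc (0 : ℝ) 1
  ann_mem : ∀ x, ann x ∈ Set.Icc (0 : ℝ) 1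
  low_support : tsupport low ⊆ Metric.ball 0 (4 / 3)
  ann_support : tsupport ann ⊆ Metric.ball 0 (8 / 3) \ Metric.ball 0 (3 / 4)
  sum_eq_one : ∀ x, HasSum (fun k : ℕ => ann (((2 : ℝ) ^ k)⁻¹ • x)) (1 - low x)

namespace DyadicPartition

variable (χ : DyadicPartition)

/-- The value at the mode `m` of the `j`-th function of the partition, `j = 0` standing for
`χ_{-1}` and `j = k + 1` for `χ_k`. -/
def mult (j : ℕ) (m : Mode) : ℝ :=
  match j with
  | 0 => χ.low (freq m)
  | k + 1 => χ.ann (((2 : ℝ) ^ k)⁻¹ • freq m)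

lemma finite_mult (j : ℕ) : {m : Mode | χ.mult j m ≠ 0}.Finite := by
  cases j with
  | zero =>
    refine (finite_freq_le (4 / 3)).subset fun m hm => ?_
    have h := χ.low_support (subset_tsupport _ (Function.mem_support.2 hm))
    exact (mem_ball_zero_iff.1 h).le
  | succ k =>
    refine (finite_freq_le (2 ^ k * (8 / 3))).subset fun m hm => ?_
    have h := (χ.ann_support (subset_tsupport _ (Function.mem_support.2 hm))).1
    have h2 := (mem_ball_zero_iff.1 h).le
    rw [norm_smul, norm_inv, norm_pow, Real.norm_ofNat, inv_mul_le_iff₀ (by positivity)] at h2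
    exact h2

lemma exists_mult_ne_zero (m : Mode) : ∃ j, χ.mult j m ≠ 0 := by
  by_contra! h
  have h0 : χ.low (freq m) = 0 := h 0
  have h1 := χ.sum_eq_one (freq m)
  have h2 : (fun k : ℕ => χ.ann (((2 : ℝ) ^ k)⁻¹ • freq m)) = fun _ => 0 :=
    funext fun k => h (k + 1)
  rw [h0, h2] at h1
  have := h1.unique hasSum_zero
  norm_num at this

/-- The Littlewood–Paley block `Δ_{j-1} f = ∑ m, χ_{j-1}(m) f̂(m) e_m` of the distribution with
Fourier coefficients `f`; by the Poisson summation formula this is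
`x ↦ f (∑ m, η_{j-1}(x + m - ·))` with `η` the inverse Fourier transform of `χ`. -/
def block (j : ℕ) : (Mode → ℂ) →ₗ[ℂ] C(Torus, ℂ) where
  toFun f := ∑ m ∈ (χ.finite_mult j).toFinset, ((χ.mult j m : ℂ) * f m) • UnitAddTorus.mFourier m
  map_add' f g := by
    rw [← Finset.sum_add_distrib]
    exact Finset.sum_congr rfl fun m _ => by
      ext x
      simp [mul_add, add_mul]
  map_smul' c f := by
    simp only [Pi.smul_apply, smul_eq_mul, RingHom.id_apply, Finset.smul_sum, smul_smul]
    exact Finset.sum_congr rfl fun m _ => by rw [mul_left_comm]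

lemma linearIndependent_mFourier :
    LinearIndependent ℂ (UnitAddTorus.mFourier : Mode → C(Torus, ℂ)) := by
  have h := (UnitAddTorus.orthonormal_mFourier (d := Fin 2)).linearIndependent
  exact LinearIndependent.of_comp _ h

lemma eq_zero_of_block_eq_zero {f : Mode → ℂ} (h : ∀ j, χ.block j f = 0) : f = 0 := by
  funext m
  obtain ⟨j, hj⟩ := χ.exists_mult_ne_zero m
  have h1 := linearIndependent_iff'.1 linearIndependent_mFourier _ _ (h j) m (by simpa using hj)
  exact (mul_eq_zero.1 h1).resolve_left (by exact_mod_cast hj)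

/-- The sequence `(2^{γ k} Δ_k f)_{k ≥ -1}` (with `j = k + 1`). -/
def weightedBlocks (γ : ℝ) : (Mode → ℂ) →ₗ[ℂ] ℕ → C(Torus, ℂ) where
  toFun f := fun j => (((2 : ℝ) ^ (γ * ((j : ℝ) - 1)) : ℝ) : ℂ) • χ.block j f
  map_add' f g := by
    funext j
    ext x
    simp [mul_add]
  map_smul' c f := by
    funext j
    rw [map_smul]
    exact smul_comm _ _ _

/-- The periodic distributions, given by their Fourier coefficients, whose `B^γ_{∞,∞}`-norm is
finite. (Finiteness forces at most polynomial growth of the coefficients.) -/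
def besovSubmodule (γ : ℝ) : Submodule ℂ (Mode → ℂ) where
  carrier := {f | Memℓp (χ.weightedBlocks γ f) ∞}
  zero_mem' := by
    rw [Set.mem_ofPred_eq, map_zero]
    exact zero_memℓp
  add_mem' {f g} hf hg := by
    rw [Set.mem_ofPred_eq, map_add]
    exact Memℓp.add hf hg
  smul_mem' c f hf := by
    rw [Set.mem_ofPred_eq, map_smul]
    exact Memℓp.const_smul (show Memℓp (χ.weightedBlocks γ f) ∞ from hf) c

/-- The `B^γ_{∞,∞}`-norm `sup_{k ≥ -1} 2^{γ k} ‖Δ_k f‖_{L^∞}`, possibly infinite, of the distribution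
with Fourier coefficients `f`. -/
def besovENorm (γ : ℝ) (f : Mode → ℂ) : ℝ≥0∞ :=
  ⨆ j, ‖χ.weightedBlocks γ f j‖ₑ

/-- The space of all periodic distributions of finite `B^γ_{∞,∞}`-norm. -/
def BesovInfty (γ : ℝ) : Type := χ.besovSubmodule γ

namespace BesovInfty

variable {χ} {γ : ℝ}

instance : AddCommGroup (χ.BesovInfty γ) := inferInstanceAs (AddCommGroup (χ.besovSubmodule γ))

instance : Module ℂ (χ.BesovInfty γ) := inferInstanceAs (Module ℂ (χ.besovSubmodule γ))

variable (χ γ) in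
/-- The Fourier coefficients. -/
def coeff : χ.BesovInfty γ →ₗ[ℂ] (Mode → ℂ) := (χ.besovSubmodule γ).subtype

variable (χ γ) in
/-- The map `f ↦ (2^{γ k} Δ_k f)_{k ≥ -1} ∈ ℓ^∞(L^∞)` that defines the norm. -/
def toLinf : χ.BesovInfty γ →ₗ[ℂ] lp (fun _ : ℕ => C(Torus, ℂ)) ∞ where
  toFun f := ⟨χ.weightedBlocks γ (coeff χ γ f), f.2⟩
  map_add' f g := Subtype.ext ((χ.weightedBlocks γ).map_add f.1 g.1)
  map_smul' c f := Subtype.ext ((χ.weightedBlocks γ).map_smul c f.1)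

lemma toLinf_injective : Function.Injective (toLinf χ γ) := by
  rw [injective_iff_map_eq_zero]
  intro f hf
  refine Subtype.ext (χ.eq_zero_of_block_eq_zero fun j => ?_)
  have h : (((2 : ℝ) ^ (γ * ((j : ℝ) - 1)) : ℝ) : ℂ) • χ.block j f.1 = 0 :=
    congrFun (congrArg Subtype.val hf) j
  refine (smul_eq_zero.1 h).resolve_left ?_
  exact_mod_cast (Real.rpow_pos_of_pos two_pos _).ne'

instance : NormedAddCommGroup (χ.BesovInfty γ) :=
  NormedAddCommGroup.induced _ _ (toLinf χ γ) toLinf_injective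

instance : NormedSpace ℂ (χ.BesovInfty γ) :=
  NormedSpace.induced ℂ _ _ (toLinf χ γ)

end BesovInfty

/-- The smooth functions, inside the space of distributions of finite `B^γ_{∞,∞}`-norm. -/
def smoothSubmodule (γ : ℝ) : Submodule ℂ (χ.BesovInfty γ) where
  carrier := {f | ∃ φ : C(Torus, ℂ), IsSmooth φ ∧
    ∀ m, BesovInfty.coeff χ γ f m = UnitAddTorus.mFourierCoeff φ m}
  zero_mem' := ⟨0, contDiff_const, fun m => by simp [UnitAddTorus.mFourierCoeff]⟩
  add_mem' := by
    rintro f g ⟨φ, hφ, hf⟩ ⟨ψ, hψ, hg⟩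
    refine ⟨φ + ψ, hφ.add hψ, fun m => ?_⟩
    rw [map_add, Pi.add_apply, hf, hg]
    simp only [mFourierCoeff_eq, ContinuousMap.coe_add, Pi.add_apply, smul_add]
    have h (θ : C(Torus, ℂ)) :
        Integrable (fun x => UnitAddTorus.mFourier (-m) x • θ x) torusMeasure :=
      ((UnitAddTorus.mFourier (-m)).continuous.smul
        θ.continuous).integrable_of_hasCompactSupport (HasCompactSupport.of_compactSpace _)
    exact (integral_add (h φ) (h ψ)).symm
  smul_mem' := by
    rintro c f ⟨φ, hφ, hf⟩
    refine ⟨c • φ, hφ.const_smul c, fun m => ?_⟩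
    rw [map_smul, Pi.smul_apply, hf]
    simp only [mFourierCoeff_eq, ContinuousMap.coe_smul, Pi.smul_apply]
    rw [← integral_smul]
    exact integral_congr_ae (.of_forall fun x => smul_comm _ _ _)

/-- The Besov space `𝒞^γ = B^γ_{∞,∞}(𝕋²)`: the completion of `C^∞(𝕋²)` under the
`B^γ_{∞,∞}`-norm, realized as the closure of `C^∞(𝕋²)` in the Banach space of distributions of
finite `B^γ_{∞,∞}`-norm. -/
abbrev HolderBesov (γ : ℝ) : Type := (χ.smoothSubmodule γ).topologicalClosure

variable {χ} in
/-- The Fourier coefficients of an element of `𝒞^γ`. -/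
def HolderBesov.coeff {γ : ℝ} (f : χ.HolderBesov γ) : Mode → ℂ := BesovInfty.coeff χ γ f.1

/-- `C(ℝ₊; 𝒞^γ)`, with the topology of uniform convergence on compact sets. -/
abbrev PathSpace (γ : ℝ) : Type := C(ℝ≥0, χ.HolderBesov γ)

instance (γ : ℝ) : MeasurableSpace (χ.PathSpace γ) := borel _

instance (γ : ℝ) : BorelSpace (χ.PathSpace γ) := ⟨rfl⟩

/-- The space `C(ℝ₊; 𝒞^γ)^{ℕ × ℕ}`, with the product topology and product `σ`-algebra. -/
abbrev WickSpace (γ : ℝ) : Type := ℕ → ℕ → χ.PathSpace γ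

end DyadicPartition

/-! ### Noise, solution, Wick powers -/

variable {Ω : Type*} [MeasurableSpace Ω]

/-- Complex space-time white noise on `ℝ × 𝕋²`: a centered (jointly) Gaussian family of complex
random variables with `E[ξ(u) conj ξ(v)] = ∫ u conj v dt dx` and `E[ξ(u) ξ(v)] = 0`. The random
variable `ξ u` is the complex Itô–Wiener integral `∫ u(s, y) ξ(ds dy)`. -/
structure IsComplexWhiteNoise (P : Measure Ω) (ξ : SpaceTimeL2 → Ω → ℂ) : Prop where
  measurable : ∀ u, Measurable (ξ u)
  gaussian : IsGaussianProcess ξ P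
  mean : ∀ u, ∫ ω, ξ u ω ∂P = 0
  cov : ∀ u v, ∫ ω, ξ u ω * conj (ξ v ω) ∂P = ∫ p, u p * conj (v p) ∂spaceTimeMeasure
  pseudoCov : ∀ u v, ∫ ω, ξ u ω * ξ v ω ∂P = 0

/-- The Fourier coefficients of the distribution `𝒦_μ(τ, · - y)`, where
`𝒦_μ(τ, x) = 1_{τ ≥ 0} ∑ m, e^{-μ(1 + 4π²|m|²)τ} e_m(x)`. -/
def kernelCoeff (μ : ℂ) (τ : ℝ) (y : Torus) (m : Mode) : ℂ :=
  if 0 ≤ τ then Complex.exp (-μ * eigenvalue m * τ) * UnitAddTorus.mFourier (-m) y else 0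

/-- `Z` is the stationary solution of `∂_t Z = μ(Δ - 1)Z + ξ`: a `C(ℝ₊; 𝒞^γ)`-valued random
variable such that, for all `t ≥ 0` and `φ ∈ C^∞(𝕋²; ℂ)`, almost surely
`⟨Z(t), φ⟩ = ∫ ⟨𝒦_μ(t - s, · - y), φ⟩ ξ(ds dy)`. -/
structure IsStationarySolution (χ : DyadicPartition) (γ : ℝ) (μ : ℂ) (P : Measure Ω)
    (ξ : SpaceTimeL2 → Ω → ℂ) (Z : Ω → χ.PathSpace γ) : Prop where
  measurable : Measurable Z
  mild : ∀ (t : ℝ≥0) (φ : Torus → ℂ), IsSmooth φ → ∃ u : SpaceTimeL2,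
    (∀ᵐ p ∂spaceTimeMeasure, u p = pairing (kernelCoeff μ ((t : ℝ) - p.1) p.2) φ) ∧
    ∀ᵐ ω ∂P, pairing (Z ω t).coeff φ = ξ u ω

/-- The complex Hermite polynomial
`H_{k,l}(z, c) = ∑_{m ≤ min(k,l)} m! (k choose m) (l choose m) (-c)^m z^{k-m} (conj z)^{l-m}`. -/
def hermite (k l : ℕ) (z : ℂ) (c : ℝ) : ℂ :=
  ∑ m ∈ Finset.range (min k l + 1),
    (m.factorial : ℂ) * (k.choose m : ℂ) * (l.choose m : ℂ) * (-(c : ℂ)) ^ m *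
      z ^ (k - m) * (conj z) ^ (l - m)

section WickPowers

variable {χ : DyadicPartition} {γ : ℝ}

/-- The renormalization constant `ℛ_n = E[|Π_n Z(t)(x)|²]` (by stationarity it depends neither on
`t` nor on `x`). -/
def renorm (P : Measure Ω) (Z : Ω → χ.PathSpace γ) (n : ℕ) (t : ℝ≥0) (x : Torus) : ℝ :=
  ∫ ω, ‖cutoff n (Z ω t).coeff x‖ ^ 2 ∂P

/-- The approximation `H_{k,l}(Π_n Z, ℛ_n)`. -/
def approxWick (P : Measure Ω) (Z : Ω → χ.PathSpace γ) (k l n : ℕ) (ω : Ω) (t : ℝ≥0)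
    (x : Torus) : ℂ :=
  hermite k l (cutoff n (Z ω t).coeff x) (renorm P Z n t x)

/-- `W k l = Z^{:k,l:}` for all `k, l`: the random variable `W` is such that, for all `k, l`, all
`p ∈ [1, ∞)` and all `T ≥ 0`, `H_{k,l}(Π_n Z, ℛ_n) → W k l` in `L^p(P; C([0, T]; 𝒞^γ))`. -/
structure IsWickPowers (P : Measure Ω) (Z : Ω → χ.PathSpace γ) (W : Ω → χ.WickSpace γ) :
    Prop where
  measurable : Measurable W
  tendsto : ∀ (k l : ℕ) (p : ℝ) (T : ℝ≥0), 1 ≤ p →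
    Tendsto (fun n : ℕ => ∫⁻ ω, (⨆ (t : ℝ≥0) (_ : t ≤ T),
      χ.besovENorm γ ((W ω k l t).coeff -
        UnitAddTorus.mFourierCoeff (approxWick P Z k l n ω t))) ^ p ∂P) atTop (𝓝 0)

end WickPowers

/-! ### The Cameron–Martin space and the skeleton -/

/-- The space `ℋ_ℂ` of all `h` of the form `h(t) = ∫_{-∞}^t e^{μ(t-s)(Δ-1)} g(s, ·) ds`, `t ≥ 0`, with
`g ∈ L²(ℝ × 𝕋²; ℂ)`. Here `e^{μτ(Δ-1)}` is the Fourier multiplier `e^{-μ(1 + 4π²|m|²)τ}`, and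
`h(t)` is the function in `L²(𝕋²)` with the resulting Fourier coefficients. -/
def cameronMartin (μ : ℂ) : Set (ℝ≥0 → Torus → ℂ) :=
  {h | ∃ g : SpaceTimeL2, ∀ t : ℝ≥0, MemLp (h t) 2 torusMeasure ∧ ∀ m : Mode,
    UnitAddTorus.mFourierCoeff (h t) m =
      ∫ s in Set.Iic (t : ℝ), Complex.exp (-μ * eigenvalue m * ((t : ℝ) - s)) *
        UnitAddTorus.mFourierCoeff (fun y => g (s, y)) m}

/-- The set `{(H_{k,l}(h, R))_{k,l} | h ∈ ℋ_ℂ, R ≥ 0}` in `C(ℝ₊; 𝒞^γ)^{ℕ × ℕ}`. -/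
def hermiteSet (χ : DyadicPartition) (γ : ℝ) (μ : ℂ) : Set (χ.WickSpace γ) :=
  {z | ∃ h ∈ cameronMartin μ, ∃ R : ℝ, 0 ≤ R ∧ ∀ (k l : ℕ) (t : ℝ≥0),
    Represents (z k l t).coeff fun x => hermite k l (h t x) R}

end ComplexSHE

end

open ComplexSHE

open MeasureTheory ProbabilityTheory Filter Topology
open scoped NNReal ENNReal ComplexConjugate

noncomputable section

namespace ComplexSHE

/-! ### Modes -/

/-! Existence. The Fourier coefficients of the solution are stationary Ornstein–Uhlenbeck processes,
uncorrelated for distinct modes, with variance `ouVar μ m` of order `|m|⁻²`; in two dimensions these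
variances have a logarithmically divergent sum, so everything rests on estimates for Wick
polynomials that are uniform in the cutoff. They come from decoupling: if `Y` is an independent copy
of a complex Gaussian `X`, then `H_{k,l}(X, E|X|²)` is the average over `Y` of `(X + Y)^k conj (X -
Y)^l` (`herm_eq_integral`), and `X + Y`, `X - Y` are independent. A polynomial that is holomorphic
in one Gaussian vector and antiholomorphic in an independent one has no internal contractions, so
Wick's formula bounds its second moment by the `ℓ²` norm of its coefficients; since its powers are
polynomials of the same kind, all even moments follow without hypercontractivity
(`integral_pow_decoupled_le`). A lattice sum (`sum_br_totalMode_le`) and a Bernstein inequality turn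
this into moments of the Besov norm, and dyadic chaining in time gives `IsOU.exists_sup_moments`.

These estimates are stated for fields whose modes are multiplied by weights `θ`, and they control
the change of the Wick powers when `θ` changes by at most `ρ * br m ^ (κ / 2)`. The cutoff at level
`n` is a weight that is close to `1` in this sense, which gives convergence of the approximate Wick
powers. The same continuity, used near the weight `0`, gives the constants in the support below.

The support lies in the closure. The approximations `H_{k,l}(Π_n Z, ℛ_n)` are Hermite polynomials of
a continuous path of trigonometric polynomials with `R = ℛ_n ≥ 0`. Such a path is a limit of smooth
compactly supported ones, and these solve the equation with square integrable forcing
(`mem_closure_hermiteSet`).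

The closure lies in the support, in three steps.

Translation. By the binomial formula for `H_{k,l}`, adding a path of trigonometric polynomials to
the field acts on the family of Wick powers through a continuous map `translate`. By the
Cameron–Martin theorem (`IsStationarySolution.absolutelyContinuous_map_add`) the support is
invariant under translation by smooth paths, and by density under translation by all continuous
paths of trigonometric polynomials (`translate_mem_support`).

Constants. Choose weights `θ` that vanish on modes up to `n`, are slightly larger than `1` on a
shell, equal `1` beyond it, and lower the total variance by exactly `R` (`exists_weight`); this is
possible because the variances have infinite sum. Passing from `Z` to the weighted field is a
translation by a trigonometric path, so the translated Wick powers stay in the support. They equal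
Hermite polynomials of the weighted field with a variance too large by `R`, hence combinations of
its correctly renormalized Wick powers. As `n → ∞` those of positive order tend to `0`, and what
remains is `H_{k,l}(0, R)` (`hermPath_zero_mem_support`).

Conclusion. Translating the constants gives `H_{k,l}(h, R)` for all trigonometric paths `h`. A path
in the Cameron–Martin space is bounded in `H¹`, with summable bounds on its coefficients that do not
depend on time, so its Hermite polynomials are limits, uniformly in time, of those of its partial
Fourier sums (`tendsto_hermPath`). -/

/-- The Japanese bracket `1 + |m|`. -/
def br (m : Mode) : ℝ := 1 + ‖freq m‖

lemma freq_add (m n : Mode) : freq (m + n) = freq m + freq n := by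
  ext i; simp [freq]

lemma freq_neg (m : Mode) : freq (-m) = -freq m := by
  ext i; simp [freq]

lemma freq_sub (m n : Mode) : freq (m - n) = freq m - freq n := by
  rw [sub_eq_add_neg, freq_add, freq_neg, sub_eq_add_neg]

lemma freq_zero : freq 0 = 0 := by
  ext i; simp [freq]

lemma one_le_br (m : Mode) : 1 ≤ br m := le_add_of_nonneg_right (norm_nonneg _)

lemma br_pos (m : Mode) : 0 < br m := zero_lt_one.trans_le (one_le_br m)

lemma br_neg (m : Mode) : br (-m) = br m := by rw [br, br, freq_neg, norm_neg]

/-- Submultiplicativity lets a shift of frequency by `n` cost only the factor `br n`, and lets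
negative powers of `br` be distributed over a sum of modes. -/
lemma br_add_le (m n : Mode) : br (m + n) ≤ br m * br n := by
  have := norm_add_le (freq m) (freq n)
  have h1 := norm_nonneg (freq m)
  have h2 := norm_nonneg (freq n)
  rw [br, br, br, freq_add]
  nlinarith

lemma br_le_add (m n : Mode) : br n ≤ br m * br (m + n) := by
  have := br_add_le (-m) (m + n)
  rwa [br_neg, neg_add_cancel_left] at this

lemma abs_le_br (m : Mode) (i : Fin 2) : |(m i : ℝ)| ≤ br m :=
  (PiLp.norm_apply_le (freq m) i).trans (le_add_of_nonneg_left zero_le_one)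

/-- The modes with `|m| ≤ r`. -/
def ball (r : ℝ) : Finset Mode := (finite_freq_le r).toFinset

lemma mem_ball {r : ℝ} {m : Mode} : m ∈ ball r ↔ ‖freq m‖ ≤ r := by simp [ball]

lemma card_ball_le {r : ℝ} (hr : 0 ≤ r) : ((ball r).card : ℝ) ≤ (2 * r + 1) ^ 2 := by
  have h1 : ball r ⊆ Fintype.piFinset fun _ : Fin 2 => Finset.Icc (-⌊r⌋) ⌊r⌋ := by
    intro m hm
    rw [Fintype.mem_piFinset]
    intro i
    have h := abs_le.1 ((PiLp.norm_apply_le (freq m) i).trans (mem_ball.1 hm))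
    rw [Finset.mem_Icc]
    constructor
    · have : -m i ≤ ⌊r⌋ := Int.le_floor.2 (by push_cast; linarith [h.1, show freq m i = m i from rfl])
      linarith
    · exact Int.le_floor.2 h.2
  have h2 := Finset.card_le_card h1
  have h0 : 0 ≤ ⌊r⌋ := Int.floor_nonneg.2 hr
  have h4 : (((⌊r⌋ + 1 - -⌊r⌋).toNat : ℕ) : ℝ) ≤ 2 * r + 1 := by
    have h3 : (((⌊r⌋ + 1 - -⌊r⌋).toNat : ℕ) : ℤ) = 2 * ⌊r⌋ + 1 := by
      rw [Int.toNat_of_nonneg (by omega)]; ring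
    have h3' : (((⌊r⌋ + 1 - -⌊r⌋).toNat : ℕ) : ℝ) = 2 * ⌊r⌋ + 1 := by exact_mod_cast h3
    rw [h3']
    linarith [Int.floor_le r]
  calc ((ball r).card : ℝ) ≤ (((⌊r⌋ + 1 - -⌊r⌋).toNat : ℕ) : ℝ) ^ 2 := by
        rw [Fintype.card_piFinset] at h2
        simp only [Int.card_Icc, Finset.prod_const, Finset.card_univ, Fintype.card_fin] at h2
        exact_mod_cast h2
    _ ≤ _ := by gcongr

lemma norm_le_br (m : Mode) : ‖m‖ ≤ br m := by
  rw [pi_norm_le_iff_of_nonneg (br_pos m).le]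
  intro i
  rw [Int.norm_eq_abs]
  exact abs_le_br m i

/-- Comparison with the sup-norm lattice sum of Eisenstein series; the origin, where the sup-norm
vanishes, is the one exceptional mode. -/
lemma summable_br_rpow {s : ℝ} (hs : 2 < s) : Summable fun m : Mode => br m ^ (-s) := by
  have h := EisensteinSeries.summable_one_div_norm_rpow hs
  refine Summable.of_norm_bounded_eventually h ?_
  rw [Filter.eventually_cofinite]
  refine (Set.finite_singleton (0 : Mode)).subset fun m hm => ?_
  by_contra h0
  refine hm ?_
  have h0 : m ≠ 0 := h0
  rw [Real.norm_of_nonneg (Real.rpow_nonneg (br_pos m).le _)]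
  exact Real.rpow_le_rpow_of_nonpos (norm_pos_iff.2 h0) (norm_le_br m) (by linarith)

lemma one_le_eigenvalue (m : Mode) : 1 ≤ eigenvalue m :=
  le_add_of_nonneg_right (by positivity)

lemma eigenvalue_pos (m : Mode) : 0 < eigenvalue m := zero_lt_one.trans_le (one_le_eigenvalue m)

lemma br_sq_le (m : Mode) : br m ^ 2 ≤ 2 * eigenvalue m := by
  have h1 := norm_nonneg (freq m)
  have : (1 : ℝ) ≤ 4 * Real.pi ^ 2 := by nlinarith [Real.pi_gt_three]
  have h2 : ‖freq m‖ ^ 2 ≤ 4 * Real.pi ^ 2 * ‖freq m‖ ^ 2 := by nlinarith [sq_nonneg ‖freq m‖]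
  rw [br, eigenvalue]
  nlinarith [sq_nonneg (‖freq m‖ - 1)]

lemma eigenvalue_le (m : Mode) : eigenvalue m ≤ 64 * br m ^ 2 := by
  have h1 := norm_nonneg (freq m)
  have : 4 * Real.pi ^ 2 ≤ 64 := by nlinarith [Real.pi_le_four, Real.pi_pos]
  rw [br, eigenvalue]
  nlinarith [sq_nonneg ‖freq m‖]

/-! ### Fourier coefficients of continuous functions -/

lemma integrable_continuousMap (φ : C(Torus, ℂ)) : Integrable φ torusMeasure :=
  φ.continuous.integrable_of_hasCompactSupport (HasCompactSupport.of_compactSpace _)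

/-- The Fourier coefficients of a continuous function. -/
def fc : C(Torus, ℂ) →ₗ[ℂ] (Mode → ℂ) where
  toFun φ := UnitAddTorus.mFourierCoeff φ
  map_add' φ ψ := by
    funext m
    simp only [mFourierCoeff_eq, Pi.add_apply, ContinuousMap.coe_add, smul_add]
    exact integral_add (integrable_continuousMap (UnitAddTorus.mFourier (-m) * φ))
      (integrable_continuousMap (UnitAddTorus.mFourier (-m) * ψ))
  map_smul' c φ := by
    funext m
    simp only [mFourierCoeff_eq, ContinuousMap.coe_smul, Pi.smul_apply, RingHom.id_apply]
    rw [← integral_smul]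
    exact integral_congr_ae (.of_forall fun x => smul_comm _ _ _)

lemma fc_apply (φ : C(Torus, ℂ)) (m : Mode) :
    fc φ m = ∫ x, UnitAddTorus.mFourier (-m) x * φ x ∂torusMeasure := rfl

lemma fc_eq_mFourierCoeff (φ : C(Torus, ℂ)) : fc φ = UnitAddTorus.mFourierCoeff φ := rfl

lemma fc_mFourier (n : Mode) : fc (UnitAddTorus.mFourier n) = Pi.single n 1 := by
  funext m
  have h := orthonormal_iff_ite.1 (UnitAddTorus.orthonormal_mFourier (d := Fin 2)) m n
  have h2 := UnitAddTorus.mFourierCoeff_toLp (d := Fin 2) (UnitAddTorus.mFourier n) m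
  rw [← UnitAddTorus.mFourierBasis_repr, HilbertBasis.repr_apply_apply,
    UnitAddTorus.coe_mFourierBasis] at h2
  rw [fc_eq_mFourierCoeff, ← h2, Pi.single_apply]
  exact h.trans (by simp [eq_comm])

lemma fc_mul_mFourier (φ : C(Torus, ℂ)) (n m : Mode) :
    fc (UnitAddTorus.mFourier n * φ) m = fc φ (m - n) := by
  rw [fc_apply, fc_apply]
  congr 1
  funext x
  rw [ContinuousMap.mul_apply, ← mul_assoc, ← UnitAddTorus.mFourier_add]
  congr 3
  abel

lemma norm_fc_le (φ : C(Torus, ℂ)) (m : Mode) : ‖fc φ m‖ ≤ ‖φ‖ := by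
  rw [fc_apply]
  refine (norm_integral_le_of_norm_le_const (C := ‖φ‖) (.of_forall fun x => ?_)).trans (by simp)
  rw [norm_mul]
  calc _ ≤ 1 * ‖φ‖ := by
        gcongr
        · exact ((UnitAddTorus.mFourier (-m)).norm_coe_le_norm x).trans_eq UnitAddTorus.mFourier_norm
        · exact φ.norm_coe_le_norm x
    _ = _ := one_mul _

lemma hasSum_sq_fc (φ : C(Torus, ℂ)) :
    HasSum (fun m => ‖fc φ m‖ ^ 2) (∫ x, ‖φ x‖ ^ 2 ∂torusMeasure) := by
  have h := UnitAddTorus.hasSum_sq_mFourierCoeff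
    (ContinuousMap.toLp 2 (torusMeasure : Measure Torus) ℂ φ)
  have h1 : ∀ m, UnitAddTorus.mFourierCoeff
      (ContinuousMap.toLp 2 (torusMeasure : Measure Torus) ℂ φ : Torus → ℂ) m = fc φ m :=
    fun m => UnitAddTorus.mFourierCoeff_toLp φ m
  simp_rw [h1] at h
  convert h using 1
  refine integral_congr_ae ?_
  filter_upwards [ContinuousMap.coeFn_toLp (p := 2) (𝕜 := ℂ) torusMeasure φ] with x hx
  rw [hx]

lemma sum_sq_fc_le (φ : C(Torus, ℂ)) (S : Finset Mode) :
    ∑ m ∈ S, ‖fc φ m‖ ^ 2 ≤ ∫ x, ‖φ x‖ ^ 2 ∂torusMeasure :=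
  sum_le_hasSum _ (fun _ _ => by positivity) (hasSum_sq_fc φ)

lemma integral_sq_le (φ : C(Torus, ℂ)) : ∫ x, ‖φ x‖ ^ 2 ∂torusMeasure ≤ ‖φ‖ ^ 2 := by
  have : ‖∫ x, ‖φ x‖ ^ 2 ∂torusMeasure‖ ≤ ‖φ‖ ^ 2 := by
    refine (norm_integral_le_of_norm_le_const (C := ‖φ‖ ^ 2) (.of_forall fun x => ?_)).trans
      (by simp)
    rw [norm_pow, norm_norm]
    gcongr
    exact φ.norm_coe_le_norm x
  exact (le_abs_self _).trans this

lemma fc_sum_smul (S : Finset Mode) (c : Mode → ℂ) (m : Mode) :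
    fc (∑ n ∈ S, c n • UnitAddTorus.mFourier n) m = if m ∈ S then c m else 0 := by
  classical
  rw [map_sum, Finset.sum_apply]
  simp_rw [map_smul, fc_mFourier, Pi.smul_apply, Pi.single_apply, smul_eq_mul, mul_ite, mul_one,
    mul_zero]
  rw [Finset.sum_ite_eq]

lemma norm_mFourier_apply (n : Mode) (x : Torus) : ‖UnitAddTorus.mFourier n x‖ = 1 := by
  rw [UnitAddTorus.mFourier, ContinuousMap.coe_mk, norm_prod]
  exact Finset.prod_eq_one fun i _ => Circle.norm_coe _

lemma norm_sum_smul_mFourier_le (S : Finset Mode) (c : Mode → ℂ) :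
    ‖∑ n ∈ S, c n • UnitAddTorus.mFourier n‖ ≤ ∑ n ∈ S, ‖c n‖ :=
  (norm_sum_le _ _).trans (Finset.sum_le_sum fun n _ => by
    rw [norm_smul, UnitAddTorus.mFourier_norm, mul_one])

/-! ### The dyadic partition -/

namespace DyadicPartition

variable (χ : DyadicPartition)

lemma mult_mem (j : ℕ) (m : Mode) : χ.mult j m ∈ Set.Icc (0 : ℝ) 1 := by
  cases j with
  | zero => exact χ.low_mem _
  | succ k => exact χ.ann_mem _

lemma hasSum_mult (m : Mode) : HasSum (fun j => χ.mult j m) 1 := by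
  have h := χ.sum_eq_one (freq m)
  have h2 : HasSum (fun k => χ.mult (k + 1) m) (1 - χ.mult 0 m) := h
  rw [hasSum_nat_add_iff (f := fun j => χ.mult j m) 1] at h2
  simpa using h2

lemma br_le_of_mult_ne_zero {j : ℕ} {m : Mode} (h : χ.mult j m ≠ 0) : br m ≤ 3 * 2 ^ j := by
  cases j with
  | zero =>
    have h := χ.low_support (subset_tsupport _ (Function.mem_support.2 h))
    have h2 := (mem_ball_zero_iff.1 h).le
    rw [br, pow_zero]; linarith
  | succ k =>
    have h := (χ.ann_support (subset_tsupport _ (Function.mem_support.2 h))).1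
    have h2 := (mem_ball_zero_iff.1 h).le
    rw [norm_smul, norm_inv, norm_pow, Real.norm_ofNat, inv_mul_le_iff₀ (by positivity)] at h2
    have : (1 : ℝ) ≤ 2 ^ k := one_le_pow₀ one_le_two
    have := norm_nonneg (freq m)
    rw [br, pow_succ]; linarith

lemma le_br_of_mult_ne_zero {j : ℕ} {m : Mode} (h : χ.mult j m ≠ 0) : 2 ^ j ≤ 3 * br m := by
  cases j with
  | zero => have := one_le_br m; rw [pow_zero]; linarith
  | succ k =>
    have h := (χ.ann_support (subset_tsupport _ (Function.mem_support.2 h))).2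
    rw [mem_ball_zero_iff, not_lt, norm_smul, norm_inv, norm_pow, Real.norm_ofNat,
      le_inv_mul_iff₀ (by positivity)] at h
    have := norm_nonneg (freq m)
    rw [br, pow_succ]; linarith

/-- The annular multipliers are dilations of one smooth compactly supported function, so their
Lipschitz constants scale like `2 ^ (-j)`. -/
lemma exists_lipschitz_mult : ∃ L : ℝ, 0 ≤ L ∧ ∀ j m n,
    |χ.mult j m - χ.mult j n| ≤ L * ((2 : ℝ) ^ j)⁻¹ * br (m - n) := by
  have hc1 : HasCompactSupport χ.low := (ProperSpace.isCompact_closedBall (0 : EuclideanSpace ℝ (Fin 2)) (4 / 3)).of_isClosed_subset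
    (isClosed_tsupport _) (χ.low_support.trans Metric.ball_subset_closedBall)
  have hc2 : HasCompactSupport χ.ann := (ProperSpace.isCompact_closedBall (0 : EuclideanSpace ℝ (Fin 2)) (8 / 3)).of_isClosed_subset
    (isClosed_tsupport _) ((χ.ann_support.trans Set.sdiff_subset).trans Metric.ball_subset_closedBall)
  obtain ⟨K, hK⟩ := ContDiff.lipschitzWith_of_hasCompactSupport hc1 (χ.low_smooth) (by simp)
  obtain ⟨K', hK'⟩ := ContDiff.lipschitzWith_of_hasCompactSupport hc2 (χ.ann_smooth) (by simp)
  refine ⟨K + 2 * K', by positivity, fun j m n => ?_⟩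
  have hf : ‖freq m - freq n‖ ≤ br (m - n) := by
    rw [br, freq_sub]; linarith
  have hb := (br_pos (m - n)).le
  cases j with
  | zero =>
    have := hK.dist_le_mul (freq m) (freq n)
    rw [Real.dist_eq, dist_eq_norm] at this
    refine this.trans ?_
    rw [pow_zero, inv_one, mul_one]
    have h0 : (0 : ℝ) ≤ K' := K'.2
    calc (K : ℝ) * ‖freq m - freq n‖ ≤ K * br (m - n) := by gcongr
      _ ≤ _ := by gcongr; linarith
  | succ k =>
    have := hK'.dist_le_mul (((2 : ℝ) ^ k)⁻¹ • freq m) (((2 : ℝ) ^ k)⁻¹ • freq n)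
    rw [Real.dist_eq, dist_eq_norm, ← smul_sub, norm_smul, norm_inv, norm_pow,
      Real.norm_ofNat] at this
    refine this.trans ?_
    have h0 : (0 : ℝ) ≤ K := K.2
    calc (K' : ℝ) * (((2 : ℝ) ^ k)⁻¹ * ‖freq m - freq n‖) ≤ K' * (((2 : ℝ) ^ k)⁻¹ * br (m - n)) := by
          gcongr
      _ = (2 * K') * ((2 : ℝ) ^ (k + 1))⁻¹ * br (m - n) := by
          rw [pow_succ]; field_simp
      _ ≤ _ := by gcongr; linarith

lemma block_apply (j : ℕ) (f : Mode → ℂ) : χ.block j f =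
    ∑ m ∈ (χ.finite_mult j).toFinset, ((χ.mult j m : ℂ) * f m) • UnitAddTorus.mFourier m := rfl

lemma fc_block (j : ℕ) (f : Mode → ℂ) (m : Mode) : fc (χ.block j f) m = χ.mult j m * f m := by
  rw [block_apply, fc_sum_smul _ (fun m => (χ.mult j m : ℂ) * f m)]
  split_ifs with h
  · rfl
  · have : χ.mult j m = 0 := by simpa using h
    rw [this, Complex.ofReal_zero, zero_mul]

lemma norm_mult_mul_le (j : ℕ) (f : Mode → ℂ) (m : Mode) :
    χ.mult j m * ‖f m‖ ≤ ‖χ.block j f‖ := by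
  have := norm_fc_le (χ.block j f) m
  rwa [fc_block, norm_mul, Complex.norm_real, Real.norm_of_nonneg (χ.mult_mem j m).1] at this

lemma norm_block_le (j : ℕ) (f : Mode → ℂ) :
    ‖χ.block j f‖ ≤ ∑ m ∈ (χ.finite_mult j).toFinset, χ.mult j m * ‖f m‖ := by
  refine (norm_sum_smul_mFourier_le _ (fun m => (χ.mult j m : ℂ) * f m)).trans_eq ?_
  refine Finset.sum_congr rfl fun m _ => ?_
  rw [norm_mul, Complex.norm_real, Real.norm_of_nonneg (χ.mult_mem j m).1]

lemma support_mult_subset (j : ℕ) : (χ.finite_mult j).toFinset ⊆ ball (3 * 2 ^ j) := by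
  intro m hm
  have := χ.br_le_of_mult_ne_zero (by simpa using hm)
  rw [br] at this
  rw [mem_ball]
  linarith

lemma card_support_mult_le (j : ℕ) : ((χ.finite_mult j).toFinset.card : ℝ) ≤ 49 * 4 ^ j := by
  have h1 : (1 : ℝ) ≤ 2 ^ j := one_le_pow₀ one_le_two
  calc ((χ.finite_mult j).toFinset.card : ℝ) ≤ (ball (3 * 2 ^ j)).card := by
        exact_mod_cast Finset.card_le_card (χ.support_mult_subset j)
    _ ≤ (2 * (3 * 2 ^ j) + 1) ^ 2 := card_ball_le (by positivity)
    _ ≤ (7 * 2 ^ j) ^ 2 := by gcongr; linarith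
    _ = 49 * 4 ^ j := by rw [mul_pow, ← pow_mul, mul_comm j 2, pow_mul]; norm_num

/-- Bernstein-type bound of the `ℓ¹`-norm of the coefficients of a block. -/
lemma sum_mult_mul_le (j : ℕ) (f : Mode → ℂ) (S : Finset Mode) :
    ∑ m ∈ S, χ.mult j m * ‖f m‖ ≤ 7 * 2 ^ j * ‖χ.block j f‖ := by
  classical
  set A := (χ.finite_mult j).toFinset
  have h1 : ∑ m ∈ S, χ.mult j m * ‖f m‖ ≤ ∑ m ∈ A, χ.mult j m * ‖f m‖ := by
    rw [← Finset.sum_filter_ne_zero]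
    refine Finset.sum_le_sum_of_subset_of_nonneg (fun m hm => ?_) fun m _ _ =>
      mul_nonneg (χ.mult_mem j m).1 (norm_nonneg _)
    have := left_ne_zero_of_mul (Finset.mem_filter.1 hm).2
    simpa [A] using this
  -- Cauchy–Schwarz over the at most `49 * 4 ^ j` modes of the block, then Parseval and the bound of
  -- the `L²` norm by the sup norm.
  refine h1.trans (abs_le_of_sq_le_sq' ?_ (by positivity)).2
  calc (∑ m ∈ A, χ.mult j m * ‖f m‖) ^ 2 ≤ A.card * ∑ m ∈ A, (χ.mult j m * ‖f m‖) ^ 2 :=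
        sq_sum_le_card_mul_sum_sq
    _ ≤ (49 * 4 ^ j) * ‖χ.block j f‖ ^ 2 := by
        gcongr
        · exact χ.card_support_mult_le j
        · refine le_trans (le_of_eq ?_) ((sum_sq_fc_le (χ.block j f) A).trans (integral_sq_le _))
          refine Finset.sum_congr rfl fun m _ => ?_
          rw [fc_block, norm_mul, Complex.norm_real, Real.norm_of_nonneg (χ.mult_mem j m).1]
    _ = (7 * 2 ^ j * ‖χ.block j f‖) ^ 2 := by
        rw [mul_pow, mul_pow, ← pow_mul, mul_comm j 2, pow_mul]; norm_num

lemma weightedBlocks_apply (γ : ℝ) (f : Mode → ℂ) (j : ℕ) : χ.weightedBlocks γ f j =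
    (((2 : ℝ) ^ (γ * ((j : ℝ) - 1)) : ℝ) : ℂ) • χ.block j f := rfl

lemma norm_weightedBlocks (γ : ℝ) (f : Mode → ℂ) (j : ℕ) :
    ‖χ.weightedBlocks γ f j‖ = (2 : ℝ) ^ (γ * ((j : ℝ) - 1)) * ‖χ.block j f‖ := by
  rw [weightedBlocks_apply, norm_smul, Complex.norm_real,
    Real.norm_of_nonneg (Real.rpow_nonneg zero_le_two _)]

/-! ### The Banach space of distributions of finite Besov norm. -/

namespace BesovInfty

variable {χ} {γ : ℝ}

lemma coeff_injective : Function.Injective (coeff χ γ) := Subtype.val_injective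

lemma norm_weightedBlocks_le (f : χ.BesovInfty γ) (j : ℕ) :
    ‖χ.weightedBlocks γ (coeff χ γ f) j‖ ≤ ‖f‖ :=
  lp.norm_apply_le_norm (p := ∞) (by simp) (toLinf χ γ f) j

lemma norm_le_of_forall {f : χ.BesovInfty γ} {C : ℝ} (hC : 0 ≤ C)
    (h : ∀ j, ‖χ.weightedBlocks γ (coeff χ γ f) j‖ ≤ C) : ‖f‖ ≤ C :=
  lp.norm_le_of_forall_le (f := toLinf χ γ f) hC h

variable (χ γ) in
/-- A family of Fourier coefficients with bounded weighted blocks. -/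
def ofBound (f : Mode → ℂ) (C : ℝ) (h : ∀ j, ‖χ.weightedBlocks γ f j‖ ≤ C) : χ.BesovInfty γ :=
  ⟨f, memℓp_infty ⟨C, by rintro _ ⟨j, rfl⟩; exact h j⟩⟩

lemma enorm_eq (f : χ.BesovInfty γ) : ‖f‖ₑ = χ.besovENorm γ (coeff χ γ f) := by
  refine le_antisymm ?_ (iSup_le fun j => ?_)
  · by_cases htop : χ.besovENorm γ (coeff χ γ f) = ∞
    · rw [htop]; exact le_top
    rw [← ofReal_norm, ← ENNReal.ofReal_toReal htop]
    refine ENNReal.ofReal_le_ofReal (norm_le_of_forall ENNReal.toReal_nonneg fun j => ?_)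
    rw [← toReal_enorm]
    exact ENNReal.toReal_mono htop (le_iSup (fun j => ‖χ.weightedBlocks γ (coeff χ γ f) j‖ₑ) j)
  · rw [← ofReal_norm, ← ofReal_norm]
    exact ENNReal.ofReal_le_ofReal (norm_weightedBlocks_le f j)

lemma exists_norm_coeff_le (χ : DyadicPartition) (γ : ℝ) (m : Mode) :
    ∃ C : ℝ, 0 ≤ C ∧ ∀ f : χ.BesovInfty γ, ‖coeff χ γ f m‖ ≤ C * ‖f‖ := by
  obtain ⟨j, hj⟩ := χ.exists_mult_ne_zero m
  have hj' : 0 < χ.mult j m := lt_of_le_of_ne (χ.mult_mem j m).1 hj.symm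
  have h2 : 0 < (2 : ℝ) ^ (γ * ((j : ℝ) - 1)) := Real.rpow_pos_of_pos two_pos _
  refine ⟨(χ.mult j m * (2 : ℝ) ^ (γ * ((j : ℝ) - 1)))⁻¹, by positivity, fun f => ?_⟩
  have h3 := norm_weightedBlocks_le f j
  rw [norm_weightedBlocks] at h3
  have h4 := χ.norm_mult_mul_le j (coeff χ γ f) m
  rw [inv_mul_eq_div, le_div_iff₀ (by positivity)]
  calc _ = 2 ^ (γ * ((j : ℝ) - 1)) * (χ.mult j m * ‖coeff χ γ f m‖) := by ring
    _ ≤ 2 ^ (γ * ((j : ℝ) - 1)) * ‖χ.block j (coeff χ γ f)‖ := by gcongr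
    _ ≤ _ := h3

variable (χ γ) in
/-- The `m`-th Fourier coefficient as a continuous linear functional. -/
def coeffCLM (m : Mode) : χ.BesovInfty γ →L[ℂ] ℂ :=
  LinearMap.mkContinuousOfExistsBound ((LinearMap.proj m).comp (coeff χ γ))
    ((exists_norm_coeff_le χ γ m).imp fun _ h => h.2)

lemma continuous_weightedBlocks (j : ℕ) :
    Continuous fun f : Mode → ℂ => χ.weightedBlocks γ f j := by
  simp_rw [weightedBlocks_apply, block_apply]
  fun_prop

/-- Coefficients are continuous functionals, so a Cauchy sequence converges coefficientwise. Each
block involves finitely many modes, hence converges too, and the norm bounds pass to the limit block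
by block. -/
instance : CompleteSpace (χ.BesovInfty γ) := by
  refine Metric.complete_of_cauchySeq_tendsto fun u hu => ?_
  have h1 : ∀ m, ∃ l, Tendsto (fun n => coeff χ γ (u n) m) atTop (𝓝 l) := fun m =>
    cauchySeq_tendsto_of_complete (hu.map (coeffCLM χ γ m).uniformContinuous)
  choose f hf using h1
  have hf' : Tendsto (fun n => coeff χ γ (u n)) atTop (𝓝 f) := tendsto_pi_nhds.2 hf
  have hb : ∀ j, Tendsto (fun n => χ.weightedBlocks γ (coeff χ γ (u n)) j) atTop
      (𝓝 (χ.weightedBlocks γ f j)) := fun j => ((continuous_weightedBlocks j).tendsto f).comp hf'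
  obtain ⟨R, hR⟩ := hu.norm_bddAbove
  have hfR : ∀ j, ‖χ.weightedBlocks γ f j‖ ≤ R := fun j =>
    le_of_tendsto (hb j).norm (.of_forall fun n =>
      (norm_weightedBlocks_le (u n) j).trans (hR ⟨n, rfl⟩))
  refine ⟨ofBound χ γ f R hfR, ?_⟩
  rw [Metric.tendsto_atTop]
  intro ε hε
  obtain ⟨N, hN⟩ := Metric.cauchySeq_iff.1 hu (ε / 2) (half_pos hε)
  refine ⟨N, fun n hn => lt_of_le_of_lt ?_ (half_lt_self hε)⟩
  rw [dist_eq_norm]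
  refine norm_le_of_forall (half_pos hε).le fun j => ?_
  rw [map_sub, map_sub, Pi.sub_apply]
  refine le_of_tendsto ((tendsto_const_nhds.sub (hb j)).norm) ?_
  filter_upwards [eventually_ge_atTop N] with k hk
  have h5 := norm_weightedBlocks_le (u n - u k) j
  rw [map_sub, map_sub, Pi.sub_apply] at h5
  exact h5.trans ((dist_eq_norm (u n) (u k)).symm.le.trans (hN n hn k hk).le)

end BesovInfty

end DyadicPartition

/-! ### Uniqueness of Fourier coefficients, and multiplication by characters on Besov spaces. -/

lemma fc_injective : Function.Injective fc := by
  rw [injective_iff_map_eq_zero]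
  intro φ h
  have h0 : ∀ m, UnitAddTorus.mFourierCoeff φ m = 0 := fun m => congrFun h m
  have h1 := UnitAddTorus.hasSum_mFourier_series_apply_of_summable (f := φ)
    (summable_zero.congr fun m => (h0 m).symm)
  ext x
  have h2 := h1 x
  simp only [h0, zero_smul] at h2
  exact h2.unique hasSum_zero

lemma eq_sum_fc {φ : C(Torus, ℂ)} {S : Finset Mode} (h : ∀ m ∉ S, fc φ m = 0) :
    φ = ∑ m ∈ S, fc φ m • UnitAddTorus.mFourier m := by
  refine fc_injective (funext fun m => ?_)
  rw [fc_sum_smul]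
  split_ifs with hm
  · rfl
  · exact h m hm

lemma norm_le_sum_fc {φ : C(Torus, ℂ)} {S : Finset Mode} (h : ∀ m ∉ S, fc φ m = 0) :
    ‖φ‖ ≤ ∑ m ∈ S, ‖fc φ m‖ := by
  conv_lhs => rw [eq_sum_fc h]
  exact norm_sum_smul_mFourier_le S _

lemma isSmooth_mFourier (n : Mode) : IsSmooth (UnitAddTorus.mFourier n) := by
  have : (fun x : Fin 2 → ℝ => UnitAddTorus.mFourier n fun i => (x i : UnitAddCircle)) =
      fun x => ∏ i, Complex.exp (2 * Real.pi * Complex.I * n i * (x i : ℝ) / (1 : ℝ)) := by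
    funext x
    rw [UnitAddTorus.mFourier, ContinuousMap.coe_mk]
    exact Finset.prod_congr rfl fun i _ => fourier_coe_apply
  rw [IsSmooth, this]
  refine contDiff_prod fun i _ => ContDiff.cexp (ContDiff.div_const (contDiff_const.mul ?_) _)
  exact Complex.ofRealCLM.contDiff.comp (contDiff_apply ℝ ℝ i)

lemma IsSmooth.mul {φ ψ : Torus → ℂ} (hφ : IsSmooth φ) (hψ : IsSmooth ψ) : IsSmooth (φ * ψ) :=
  ContDiff.mul hφ hψ

lemma IsSmooth.continuous {φ : Torus → ℂ} (hφ : IsSmooth φ) : Continuous φ := by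
  have h : IsOpenQuotientMap (Pi.map fun _ : Fin 2 => ((↑) : ℝ → UnitAddCircle)) :=
    IsOpenQuotientMap.piMap fun _ => QuotientAddGroup.isOpenQuotientMap_mk
  rw [h.isQuotientMap.continuous_iff]
  exact ContDiff.continuous hφ

namespace DyadicPartition

variable (χ : DyadicPartition) (γ : ℝ)

/-- Multiplication by `e_n` commutes with a block up to a commutator with coefficients `(χ_j(m) -
χ_j(m - n)) f(m - n)`. The Lipschitz bound gains `2 ^ (-j)`, which exactly compensates the factor `2
^ j` lost when a sup norm is estimated by the sum of the coefficients. -/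
lemma exists_norm_weightedBlocks_shift_le (n : Mode) : ∃ C : ℝ, ∀ (f : χ.BesovInfty γ) (j : ℕ),
    ‖χ.weightedBlocks γ (fun m => BesovInfty.coeff χ γ f (m - n)) j‖ ≤ C * ‖f‖ := by
  classical
  obtain ⟨L, hL, hlip⟩ := χ.exists_lipschitz_mult
  set b := br n
  have hb : 1 ≤ b := one_le_br n
  -- The mode `m - n` is comparable to `2 ^ j` up to `3 * b` and to `2 ^ i` up to `3`; `2 ^ c`
  -- exceeds the product of the two factors, so only the blocks with `|i - j| ≤ c` interact with
  -- block `j`.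
  obtain ⟨c, hc⟩ := pow_unbounded_of_one_lt (9 * b) one_lt_two
  refine ⟨1 + L * b * ((2 * c + 1) * (7 * 2 ^ c * 2 ^ (|γ| * c))), fun f j => ?_⟩
  set F := BesovInfty.coeff χ γ f
  set w : ℕ → ℝ := fun i => (2 : ℝ) ^ (γ * ((i : ℝ) - 1)) with hw
  have hwpos : ∀ i, 0 < w i := fun i => Real.rpow_pos_of_pos two_pos _
  have hFb : ∀ i, w i * ‖χ.block i F‖ ≤ ‖f‖ := fun i => by
    have := BesovInfty.norm_weightedBlocks_le f i
    rwa [norm_weightedBlocks] at this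
  set Φ := UnitAddTorus.mFourier n * χ.block j F
  set D := χ.block j (fun m => F (m - n)) - Φ with hD
  have hDfc : ∀ m, fc D m = ((χ.mult j m - χ.mult j (m - n) : ℝ) : ℂ) * F (m - n) := by
    intro m
    rw [hD, map_sub, Pi.sub_apply, fc_block, fc_mul_mFourier, fc_block]
    push_cast
    ring
  set S := (χ.finite_mult j).toFinset ∪ (χ.finite_mult j).toFinset.image (· + n)
  have hS : ∀ m ∉ S, fc D m = 0 := by
    intro m hm
    rw [Finset.mem_union, not_or] at hm
    have h1 : χ.mult j m = 0 := by simpa using hm.1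
    have h2 : χ.mult j (m - n) = 0 := by
      by_contra h
      exact hm.2 (Finset.mem_image.2 ⟨m - n, by simpa using h, sub_add_cancel m n⟩)
    rw [hDfc, h1, h2]
    simp
  set I := Finset.Icc (j - c) (j + c)
  have hterm : ∀ m, ‖fc D m‖ ≤
      L * ((2 : ℝ) ^ j)⁻¹ * b * ∑ i ∈ I, χ.mult i (m - n) * ‖F (m - n)‖ := by
    intro m
    rw [hDfc, norm_mul, Complex.norm_real, Real.norm_eq_abs, ← Finset.sum_mul, ← mul_assoc]
    by_cases h0 : χ.mult j m = 0 ∧ χ.mult j (m - n) = 0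
    · rw [h0.1, h0.2, sub_zero, abs_zero, zero_mul]
      have : 0 ≤ ∑ i ∈ I, χ.mult i (m - n) := Finset.sum_nonneg fun i _ => (χ.mult_mem i _).1
      positivity
    -- If one of the two multipliers is nonzero, every block that sees `m - n` has index in `I`, so
    -- the blocks in `I` already sum to one at this mode.
    have hone : ∑ i ∈ I, χ.mult i (m - n) = 1 := by
      rw [← (χ.hasSum_mult (m - n)).tsum_eq]
      refine (tsum_eq_sum fun i hi => ?_).symm
      by_contra hne
      refine hi ?_
      have e1 := χ.br_le_of_mult_ne_zero hne
      have e2 := χ.le_br_of_mult_ne_zero hne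
      have e3 : br (m - n) ≤ 3 * b * 2 ^ j ∧ (2 : ℝ) ^ j ≤ 3 * b * br (m - n) := by
        rcases not_and_or.1 h0 with h0 | h0
        · have e4 := χ.br_le_of_mult_ne_zero h0
          have e5 := χ.le_br_of_mult_ne_zero h0
          have e6 := br_add_le (m - n) n
          rw [sub_add_cancel] at e6
          have e7 := br_add_le m (-n)
          rw [← sub_eq_add_neg, br_neg] at e7
          constructor
          · calc _ ≤ br m * b := e7
              _ ≤ (3 * 2 ^ j) * b := by gcongr
              _ = _ := by ring
          · calc _ ≤ 3 * br m := e5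
              _ ≤ 3 * (br (m - n) * b) := by gcongr
              _ = _ := by ring
        · have e4 := χ.br_le_of_mult_ne_zero h0
          have e5 := χ.le_br_of_mult_ne_zero h0
          have e6 := br_pos (m - n)
          have e7 : (0 : ℝ) < 2 ^ j := by positivity
          constructor <;> nlinarith [mul_le_mul_of_nonneg_right hb e6.le,
            mul_le_mul_of_nonneg_right hb e7.le]
      have e8 : (2 : ℝ) ^ i < 2 ^ (j + c) := by
        have : (0 : ℝ) < 2 ^ j := by positivity
        rw [pow_add]
        calc (2 : ℝ) ^ i ≤ 3 * (3 * b * 2 ^ j) := by linarith [e3.1]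
          _ = 2 ^ j * (9 * b) := by ring
          _ < _ := by gcongr
      have e9 : (2 : ℝ) ^ j < 2 ^ (i + c) := by
        have : (0 : ℝ) < 2 ^ i := by positivity
        rw [pow_add]
        calc (2 : ℝ) ^ j ≤ 3 * b * (3 * 2 ^ i) := e3.2.trans (by gcongr)
          _ = 2 ^ i * (9 * b) := by ring
          _ < _ := by gcongr
      have e8 := (pow_lt_pow_iff_right₀ (one_lt_two (α := ℝ))).1 e8
      have e9 := (pow_lt_pow_iff_right₀ (one_lt_two (α := ℝ))).1 e9
      rw [Finset.mem_Icc]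
      omega
    rw [hone, mul_one]
    gcongr
    have := hlip j m (m - n)
    rwa [sub_sub_cancel] at this
  have hDn : ‖D‖ ≤ L * ((2 : ℝ) ^ j)⁻¹ * b * ∑ i ∈ I, 7 * 2 ^ i * ‖χ.block i F‖ := by
    refine (norm_le_sum_fc hS).trans ((Finset.sum_le_sum fun m _ => hterm m).trans ?_)
    rw [← Finset.mul_sum, Finset.sum_comm]
    gcongr with i _
    have := χ.sum_mult_mul_le i F (S.image (· - n))
    rwa [Finset.sum_image fun x _ y _ h => sub_left_injective h] at this
  have hi : ∀ i ∈ I, w j * (((2 : ℝ) ^ j)⁻¹ * (7 * 2 ^ i * ‖χ.block i F‖)) ≤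
      7 * 2 ^ c * 2 ^ (|γ| * c) * ‖f‖ := by
    intro i hi
    rw [Finset.mem_Icc] at hi
    have e1 : w j ≤ 2 ^ (|γ| * c) * w i := by
      rw [hw, ← Real.rpow_add two_pos]
      refine Real.rpow_le_rpow_of_exponent_le one_le_two ?_
      have h1 : |(j : ℝ) - i| ≤ c := by
        rw [abs_le]
        have a1 : (j : ℝ) ≤ i + c := by exact_mod_cast (by omega : j ≤ i + c)
        have a2 : (i : ℝ) ≤ j + c := by exact_mod_cast hi.2
        constructor <;> linarith
      have h2 : γ * ((j : ℝ) - i) ≤ |γ| * c := by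
        calc _ ≤ |γ * ((j : ℝ) - i)| := le_abs_self _
          _ = |γ| * |(j : ℝ) - i| := abs_mul _ _
          _ ≤ _ := by gcongr
      linarith
    have e2 : ((2 : ℝ) ^ j)⁻¹ * 2 ^ i ≤ 2 ^ c := by
      rw [inv_mul_le_iff₀ (by positivity), ← pow_add]
      exact pow_le_pow_right₀ one_le_two hi.2
    calc _ = 7 * (((2 : ℝ) ^ j)⁻¹ * 2 ^ i) * (w j * ‖χ.block i F‖) := by ring
      _ ≤ 7 * 2 ^ c * ((2 ^ (|γ| * c) * w i) * ‖χ.block i F‖) := by gcongr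
      _ = 7 * 2 ^ c * 2 ^ (|γ| * c) * (w i * ‖χ.block i F‖) := by ring
      _ ≤ _ := by gcongr; exact hFb i
  have hcard : (I.card : ℝ) ≤ 2 * c + 1 := by
    rw [Nat.card_Icc]
    exact_mod_cast (by omega : j + c + 1 - (j - c) ≤ 2 * c + 1)
  rw [norm_weightedBlocks]
  have hblock : χ.block j (fun m => F (m - n)) = Φ + D := by rw [hD]; abel
  have hΦ : ‖Φ‖ ≤ ‖χ.block j F‖ :=
    (norm_mul_le _ _).trans_eq (by rw [UnitAddTorus.mFourier_norm, one_mul])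
  calc w j * ‖χ.block j fun m => F (m - n)‖ ≤ w j * (‖χ.block j F‖ +
        L * ((2 : ℝ) ^ j)⁻¹ * b * ∑ i ∈ I, 7 * 2 ^ i * ‖χ.block i F‖) := by
        rw [hblock]
        have := hwpos j
        gcongr
        exact (norm_add_le _ _).trans (add_le_add hΦ hDn)
    _ = w j * ‖χ.block j F‖ +
        L * b * ∑ i ∈ I, w j * (((2 : ℝ) ^ j)⁻¹ * (7 * 2 ^ i * ‖χ.block i F‖)) := by
        simp only [Finset.mul_sum, mul_add]
        congr 1
        exact Finset.sum_congr rfl fun i _ => by ring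
    _ ≤ ‖f‖ + L * b * ∑ i ∈ I, 7 * 2 ^ c * 2 ^ (|γ| * c) * ‖f‖ := by
        refine add_le_add (hFb j) (mul_le_mul_of_nonneg_left (Finset.sum_le_sum hi) ?_)
        positivity
    _ ≤ ‖f‖ + L * b * ((2 * c + 1) * (7 * 2 ^ c * 2 ^ (|γ| * c) * ‖f‖)) := by
        rw [Finset.sum_const, nsmul_eq_mul]
        gcongr
    _ = _ := by ring

variable {γ}

/-- Multiplication by `e_n` on the space of distributions of finite norm. -/
def shiftInfty (n : Mode) : χ.BesovInfty γ →L[ℂ] χ.BesovInfty γ :=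
  LinearMap.mkContinuousOfExistsBound
    { toFun := fun f => BesovInfty.ofBound χ γ (fun m => BesovInfty.coeff χ γ f (m - n)) _
        ((exists_norm_weightedBlocks_shift_le χ γ n).choose_spec f)
      map_add' := fun _ _ => rfl
      map_smul' := fun _ _ => rfl } <| by
    refine ⟨max (exists_norm_weightedBlocks_shift_le χ γ n).choose 0, fun f => ?_⟩
    refine BesovInfty.norm_le_of_forall (by positivity) fun j => ?_
    refine ((exists_norm_weightedBlocks_shift_le χ γ n).choose_spec f j).trans ?_
    gcongr
    exact le_max_left _ _

lemma coeff_shiftInfty (n : Mode) (f : χ.BesovInfty γ) (m : Mode) :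
    BesovInfty.coeff χ γ (χ.shiftInfty n f) m = BesovInfty.coeff χ γ f (m - n) := rfl

lemma shiftInfty_mem (n : Mode) (f : χ.BesovInfty γ) (hf : f ∈ χ.smoothSubmodule γ) :
    χ.shiftInfty n f ∈ χ.smoothSubmodule γ := by
  obtain ⟨φ, hφ, h⟩ := hf
  refine ⟨UnitAddTorus.mFourier n * φ, (isSmooth_mFourier n).mul hφ, fun m => ?_⟩
  rw [coeff_shiftInfty, h, ← fc_eq_mFourierCoeff, ← fc_eq_mFourierCoeff, fc_mul_mFourier]

instance : CompleteSpace (χ.HolderBesov γ) :=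
  (Submodule.isClosed_topologicalClosure (χ.smoothSubmodule γ)).completeSpace_coe

/-- Multiplication by `e_n` on `𝒞^γ`. -/
def shift (n : Mode) : χ.HolderBesov γ →L[ℂ] χ.HolderBesov γ :=
  ((χ.shiftInfty n).comp (Submodule.subtypeL _)).codRestrict _ fun f =>
    show χ.shiftInfty n f.1 ∈ (χ.smoothSubmodule γ).topologicalClosure from
      map_mem_closure (χ.shiftInfty n).continuous f.2 fun g hg => χ.shiftInfty_mem n g hg

namespace HolderBesov

variable {χ}

lemma coeff_injective : Function.Injective (coeff : χ.HolderBesov γ → Mode → ℂ) := fun _ _ h =>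
  Subtype.ext (BesovInfty.coeff_injective h)

lemma coeff_shift (n : Mode) (f : χ.HolderBesov γ) (m : Mode) :
    (χ.shift n f).coeff m = f.coeff (m - n) := rfl

lemma coeff_add (f g : χ.HolderBesov γ) : (f + g).coeff = f.coeff + g.coeff := rfl

lemma coeff_sub (f g : χ.HolderBesov γ) : (f - g).coeff = f.coeff - g.coeff := rfl

lemma coeff_smul (c : ℂ) (f : χ.HolderBesov γ) : (c • f).coeff = c • f.coeff := rfl

lemma coeff_sum {ι : Type*} (S : Finset ι) (f : ι → χ.HolderBesov γ) :
    (∑ i ∈ S, f i).coeff = ∑ i ∈ S, (f i).coeff := by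
  classical
  induction S using Finset.induction_on with
  | empty => rfl
  | insert i S hi ih => rw [Finset.sum_insert hi, Finset.sum_insert hi, coeff_add, ih]

lemma continuous_coeff (m : Mode) : Continuous fun f : χ.HolderBesov γ => f.coeff m :=
  (BesovInfty.coeffCLM χ γ m).continuous.comp continuous_subtype_val

lemma enorm_eq (f : χ.HolderBesov γ) : ‖f‖ₑ = χ.besovENorm γ f.coeff :=
  BesovInfty.enorm_eq f.1

variable (χ γ) in
/-- The constant function `1`. -/
def one : χ.HolderBesov γ :=
  -- A block that sees the zero mode satisfies `2 ^ j ≤ 3`, so from index `3` on all blocks vanish.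
  have h : ∀ j, ‖χ.weightedBlocks γ (Pi.single 0 1) j‖ ≤
      ∑ j ∈ Finset.range 3, ‖χ.weightedBlocks γ (Pi.single 0 1) j‖ := by
    intro j
    by_cases hj : j ∈ Finset.range 3
    · exact Finset.single_le_sum (f := fun j => ‖χ.weightedBlocks γ (Pi.single 0 1) j‖)
        (fun _ _ => norm_nonneg _) hj
    · have hj0 : χ.mult j 0 = 0 := by
        by_contra h
        have h1 := χ.le_br_of_mult_ne_zero h
        rw [br, freq_zero, norm_zero, add_zero, mul_one] at h1
        have h2 : (2 : ℝ) ^ 3 ≤ 2 ^ j := pow_le_pow_right₀ one_le_two (by simpa using hj)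
        linarith
      have : χ.block j (Pi.single 0 1) = 0 := fc_injective <| funext fun m => by
        rw [fc_block, map_zero, Pi.zero_apply]
        by_cases hm : m = 0
        · rw [hm, hj0, Complex.ofReal_zero, zero_mul]
        · rw [Pi.single_eq_of_ne hm, mul_zero]
      rw [norm_weightedBlocks, this, norm_zero, mul_zero]
      exact Finset.sum_nonneg fun _ _ => norm_nonneg _
  ⟨BesovInfty.ofBound χ γ (Pi.single 0 1) _ h, Submodule.le_topologicalClosure _
    ⟨UnitAddTorus.mFourier 0, isSmooth_mFourier 0, fun m => by
      rw [← fc_eq_mFourierCoeff, fc_mFourier]; rfl⟩⟩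

lemma coeff_one : (one χ γ).coeff = Pi.single 0 1 := rfl

lemma coeff_shift_one (n : Mode) : (χ.shift n (one χ γ)).coeff = Pi.single n 1 := by
  funext m
  rw [coeff_shift, coeff_one, Pi.single_apply, Pi.single_apply]
  simp [sub_eq_zero]

end HolderBesov

end DyadicPartition

/-! ### Smooth functions -/

lemma mFourier_apply_add (n : Mode) (x y : Torus) : UnitAddTorus.mFourier n (x + y) =
    UnitAddTorus.mFourier n x * UnitAddTorus.mFourier n y := by
  simp only [UnitAddTorus.mFourier, ContinuousMap.coe_mk]
  rw [← Finset.prod_mul_distrib]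
  refine Finset.prod_congr rfl fun i _ => ?_
  rw [fourier_apply, fourier_apply, fourier_apply, Pi.add_apply, smul_add, AddCircle.toCircle_add,
    Circle.coe_mul]

lemma mFourier_single_coe (n : Mode) (i : Fin 2) (h : ℝ) :
    UnitAddTorus.mFourier n (Pi.single i (h : UnitAddCircle)) =
      Complex.exp (2 * Real.pi * Complex.I * n i * (h : ℝ)) := by
  simp only [UnitAddTorus.mFourier, ContinuousMap.coe_mk]
  rw [Finset.prod_eq_single i]
  · rw [Pi.single_eq_same, fourier_coe_apply]
    simp
  · intro j _ hj
    rw [Pi.single_eq_of_ne hj, fourier_eval_zero]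
  · simp

lemma fc_comp_add_right (φ : C(Torus, ℂ)) (a : Torus) (m : Mode) :
    fc (φ.comp ⟨fun x => x + a, by fun_prop⟩) m = UnitAddTorus.mFourier m a * fc φ m := by
  rw [fc_apply, fc_apply, ← integral_const_mul,
    ← integral_add_right_eq_self (fun x => UnitAddTorus.mFourier m a *
      (UnitAddTorus.mFourier (-m) x * φ x)) a]
  congr 1
  funext x
  have h1 : UnitAddTorus.mFourier m a * UnitAddTorus.mFourier (-m) a = 1 := by
    rw [← UnitAddTorus.mFourier_add, add_neg_cancel, UnitAddTorus.mFourier_zero]; rfl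
  rw [mFourier_apply_add]
  calc _ = UnitAddTorus.mFourier (-m) x * φ (x + a) := rfl
    _ = (UnitAddTorus.mFourier m a * UnitAddTorus.mFourier (-m) a) *
      (UnitAddTorus.mFourier (-m) x * φ (x + a)) := by rw [h1, one_mul]
    _ = _ := by ring

lemma norm_freq_sq (m : Mode) : ‖freq m‖ ^ 2 = (m 0 : ℝ) ^ 2 + (m 1 : ℝ) ^ 2 := by
  rw [EuclideanSpace.norm_sq_eq, Fin.sum_univ_two]
  simp [freq]

/-- Representatives in `[0,1)²` shifted by at most `1` stay in a compact convex box, on which the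
smooth lift is Lipschitz. -/
lemma IsSmooth.exists_lipschitz {φ : Torus → ℂ} (hφ : IsSmooth φ) : ∃ K : ℝ, ∀ (i : Fin 2) (h : ℝ),
    h ∈ Set.Ioc (0 : ℝ) 1 → ∀ x : Torus, ‖φ (x + Pi.single i (h : UnitAddCircle)) - φ x‖ ≤ K * h := by
  obtain ⟨K, hK⟩ := ContDiffOn.exists_lipschitzOnWith (ContDiff.contDiffOn (s := Set.Icc
    (fun _ : Fin 2 => (-1 : ℝ)) fun _ => 2) hφ) (by simp) (convex_Icc _ _) isCompact_Icc
  refine ⟨K, fun i h hh x => ?_⟩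
  choose y hy hyx using fun j => AddCircle.eq_coe_Ico (x j)
  have hx : x = fun j => (y j : UnitAddCircle) := funext fun j => (hyx j).symm
  have hx2 : x + Pi.single i (h : UnitAddCircle) =
      fun j => (((y + (Pi.single i h : Fin 2 → ℝ)) j : ℝ) : UnitAddCircle) := by
    funext j
    rw [Pi.add_apply, hx]
    by_cases hj : j = i
    · subst hj; simp
    · simp [Pi.single_eq_of_ne hj]
  have h1 : y ∈ Set.Icc (fun _ : Fin 2 => (-1 : ℝ)) fun _ => 2 :=
    ⟨fun j => by linarith [(hy j).1], fun j => by linarith [(hy j).2]⟩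
  have h2 : y + Pi.single i h ∈ Set.Icc (fun _ : Fin 2 => (-1 : ℝ)) fun _ => 2 := by
    have h3 : ∀ j, (Pi.single i h : Fin 2 → ℝ) j ∈ Set.Icc (0 : ℝ) 1 := by
      intro j
      by_cases hj : j = i
      · subst hj; rw [Pi.single_eq_same]; exact ⟨hh.1.le, hh.2⟩
      · rw [Pi.single_eq_of_ne hj]; simp
    exact ⟨fun j => by have := h3 j; rw [Pi.add_apply]; linarith [(hy j).1, this.1],
      fun j => by have := h3 j; rw [Pi.add_apply]; linarith [(hy j).2, this.2]⟩
  have h4 := hK.dist_le_mul _ h2 _ h1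
  rw [dist_eq_norm, dist_eq_norm, add_sub_cancel_left] at h4
  rw [hx2]
  conv_lhs => enter [1, 2]; rw [hx]
  refine h4.trans_eq ?_
  rw [Pi.norm_single, Real.norm_of_nonneg hh.1.le]

/-- Membership in `H¹`, through difference quotients: translation by `h` multiplies the coefficients
by `exp(2πi m_i h)`, and Parseval bounds every finite sum for the quotient by the squared Lipschitz
constant; then `h → 0`. No further decay of the coefficients of smooth functions is needed below. -/
lemma IsSmooth.summable {φ : Torus → ℂ} (hφ : IsSmooth φ) :
    Summable fun m => br m ^ 2 * ‖UnitAddTorus.mFourierCoeff φ m‖ ^ 2 := by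
  obtain ⟨K, hK⟩ := hφ.exists_lipschitz
  let Φ : C(Torus, ℂ) := ⟨φ, hφ.continuous⟩
  have key : ∀ (i : Fin 2) (S : Finset Mode), ∑ m ∈ S, (m i : ℝ) ^ 2 * ‖fc Φ m‖ ^ 2 ≤ K ^ 2 := by
    intro i S
    have hlim : ∀ m : Mode, Tendsto (fun h : ℝ =>
        ‖h⁻¹ • (UnitAddTorus.mFourier m (Pi.single i (h : UnitAddCircle)) - 1)‖ ^ 2 *
          ‖fc Φ m‖ ^ 2) (𝓝[>] 0) (𝓝 (‖2 * Real.pi * Complex.I * m i‖ ^ 2 * ‖fc Φ m‖ ^ 2)) := by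
      intro m
      have hd : HasDerivAt (fun h : ℝ => Complex.exp (2 * Real.pi * Complex.I * m i * (h : ℝ)))
          (2 * Real.pi * Complex.I * m i) 0 := by
        have := ((hasDerivAt_id (0 : ℝ)).ofReal_comp.const_mul
          (2 * Real.pi * Complex.I * m i)).cexp
        simpa using this
      have := hd.tendsto_slope_zero_right
      simp only [zero_add, Complex.ofReal_zero, mul_zero, Complex.exp_zero] at this
      simp_rw [mFourier_single_coe]
      exact (this.norm.pow 2).mul_const _
    have hlim2 := tendsto_finsetSum S fun m _ => hlim m
    have hle : ∑ m ∈ S, ‖2 * Real.pi * Complex.I * m i‖ ^ 2 * ‖fc Φ m‖ ^ 2 ≤ K ^ 2 := by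
      refine le_of_tendsto hlim2 ?_
      filter_upwards [Ioc_mem_nhdsGT (zero_lt_one (α := ℝ))] with h hh
      set Ψ : C(Torus, ℂ) := h⁻¹ • (Φ.comp ⟨fun x => x + Pi.single i (h : UnitAddCircle), by fun_prop⟩ - Φ) with hΨ
      have h1 : ∀ m, fc Ψ m = h⁻¹ • (UnitAddTorus.mFourier m (Pi.single i (h : UnitAddCircle)) - 1) * fc Φ m := by
        intro m
        have : Ψ = (((h⁻¹ : ℝ) : ℂ)) • (Φ.comp ⟨fun x => x + Pi.single i (h : UnitAddCircle), by fun_prop⟩ - Φ) := by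
          ext x; simp [hΨ]
        rw [this, map_smul, map_sub, Pi.smul_apply, Pi.sub_apply, fc_comp_add_right,
          Complex.real_smul, smul_eq_mul]
        ring
      have h2 : ‖Ψ‖ ≤ |K| := by
        rw [ContinuousMap.norm_le _ (abs_nonneg _)]
        intro x
        have h3 : ‖Ψ x‖ = h⁻¹ * ‖φ (x + Pi.single i (h : UnitAddCircle)) - φ x‖ := by
          rw [hΨ, ContinuousMap.smul_apply, norm_smul, norm_inv, Real.norm_of_nonneg hh.1.le]; rfl
        rw [h3, inv_mul_le_iff₀ hh.1]
        refine (hK i h hh x).trans ?_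
        rw [mul_comm]
        exact mul_le_mul_of_nonneg_left (le_abs_self K) hh.1.le
      have h4 := (sum_sq_fc_le Ψ S).trans (integral_sq_le Ψ)
      simp_rw [h1, norm_mul, mul_pow] at h4
      exact h4.trans ((pow_le_pow_left₀ (norm_nonneg _) h2 2).trans_eq (sq_abs K))
    refine le_trans (Finset.sum_le_sum fun m _ => ?_) hle
    gcongr ?_ * _
    have h5 : ‖2 * Real.pi * Complex.I * (m i : ℂ)‖ ^ 2 = (2 * Real.pi) ^ 2 * (m i : ℝ) ^ 2 := by
      rw [norm_mul, norm_mul, norm_mul, Complex.norm_I, Complex.norm_real, Complex.norm_intCast,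
        Real.norm_of_nonneg Real.pi_pos.le, Complex.norm_ofNat, mul_one, mul_pow, sq_abs]
    rw [h5]
    have : 1 ≤ (2 * Real.pi) ^ 2 := by nlinarith [Real.pi_gt_three]
    nlinarith [sq_nonneg (m i : ℝ)]
  refine summable_of_sum_le (c := 2 * ‖Φ‖ ^ 2 + 2 * K ^ 2 + 2 * K ^ 2) (fun m => by positivity)
    fun S => ?_
  calc ∑ m ∈ S, br m ^ 2 * ‖fc Φ m‖ ^ 2
      ≤ ∑ m ∈ S, (2 * ‖fc Φ m‖ ^ 2 + 2 * ((m 0 : ℝ) ^ 2 * ‖fc Φ m‖ ^ 2) +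
        2 * ((m 1 : ℝ) ^ 2 * ‖fc Φ m‖ ^ 2)) := by
        refine Finset.sum_le_sum fun m _ => ?_
        have h1 : br m ^ 2 ≤ 2 + 2 * (m 0 : ℝ) ^ 2 + 2 * (m 1 : ℝ) ^ 2 := by
          have := norm_freq_sq m
          rw [br]
          nlinarith [sq_nonneg (‖freq m‖ - 1)]
        nlinarith [mul_le_mul_of_nonneg_right h1 (sq_nonneg ‖fc Φ m‖)]
    _ = 2 * ∑ m ∈ S, ‖fc Φ m‖ ^ 2 + 2 * ∑ m ∈ S, (m 0 : ℝ) ^ 2 * ‖fc Φ m‖ ^ 2 +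
        2 * ∑ m ∈ S, (m 1 : ℝ) ^ 2 * ‖fc Φ m‖ ^ 2 := by
        simp only [Finset.sum_add_distrib, Finset.mul_sum]
    _ ≤ _ := by
        have h1 := (sum_sq_fc_le Φ S).trans (integral_sq_le Φ)
        linarith [key 0 S, key 1 S]

/-! ### Separability and measurability -/

namespace DyadicPartition

variable (χ : DyadicPartition) {γ : ℝ}

/-- The critical embedding of `H¹` in dimension two. On block `j` there are at most `49 * 4 ^ j`
modes and `(br m)⁻¹ ^ 2 ≤ 9 * 4 ^ (-j)`, so Cauchy–Schwarz with these weights costs `9 * 49 = 21 ^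
2`, uniformly in `j`. -/
lemma norm_block_le_of_summable (j : ℕ) {f : Mode → ℂ} (hf : Summable fun m => br m ^ 2 * ‖f m‖ ^ 2) :
    ‖χ.block j f‖ ≤ 21 * √(∑' m, br m ^ 2 * ‖f m‖ ^ 2) := by
  set A := (χ.finite_mult j).toFinset
  have h0 : 0 ≤ ∑' m, br m ^ 2 * ‖f m‖ ^ 2 := tsum_nonneg fun m => by positivity
  refine (χ.norm_block_le j f).trans ?_
  have h1 : ∑ m ∈ A, χ.mult j m * ‖f m‖ ≤ ∑ m ∈ A, (br m)⁻¹ * (br m * ‖f m‖) := by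
    refine Finset.sum_le_sum fun m _ => ?_
    rw [inv_mul_cancel_left₀ (br_pos m).ne']
    exact mul_le_of_le_one_left (norm_nonneg _) (χ.mult_mem j m).2
  refine h1.trans (abs_le_of_sq_le_sq' ?_ (by positivity)).2
  refine (Finset.sum_mul_sq_le_sq_mul_sq A _ _).trans ?_
  rw [mul_pow, Real.sq_sqrt h0]
  have h2 : ∑ m ∈ A, (br m)⁻¹ ^ 2 ≤ 21 ^ 2 := by
    calc ∑ m ∈ A, (br m)⁻¹ ^ 2 ≤ ∑ m ∈ A, 9 * ((4 : ℝ) ^ j)⁻¹ := by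
          refine Finset.sum_le_sum fun m hm => ?_
          have h3 := χ.le_br_of_mult_ne_zero (j := j) (m := m) (by simpa [A] using hm)
          have h4 : (4 : ℝ) ^ j ≤ 9 * br m ^ 2 := by
            calc (4 : ℝ) ^ j = (2 ^ j) ^ 2 := by rw [← pow_mul, mul_comm, pow_mul]; norm_num
              _ ≤ (3 * br m) ^ 2 := by gcongr
              _ = _ := by ring
          rw [inv_pow, ← div_eq_mul_inv, inv_le_iff_one_le_mul₀ (by have := br_pos m; positivity),
            div_mul_eq_mul_div, le_div_iff₀ (by positivity), one_mul]
          exact h4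
      _ = A.card * (9 * ((4 : ℝ) ^ j)⁻¹) := by rw [Finset.sum_const, nsmul_eq_mul]
      _ ≤ 49 * 4 ^ j * (9 * ((4 : ℝ) ^ j)⁻¹) := by
          gcongr
          exact χ.card_support_mult_le j
      _ = 21 ^ 2 := by field_simp; norm_num
  have h5 : ∑ m ∈ A, (br m * ‖f m‖) ^ 2 ≤ ∑' m, br m ^ 2 * ‖f m‖ ^ 2 := by
    simp_rw [mul_pow]
    exact hf.sum_le_tsum A fun m _ => by positivity
  gcongr

lemma norm_weightedBlocks_le_of_summable (hγ : γ ≤ 0) (j : ℕ) {f : Mode → ℂ}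
    (hf : Summable fun m => br m ^ 2 * ‖f m‖ ^ 2) :
    ‖χ.weightedBlocks γ f j‖ ≤ 2 ^ (-γ) * 21 * √(∑' m, br m ^ 2 * ‖f m‖ ^ 2) := by
  rw [norm_weightedBlocks, mul_assoc]
  gcongr
  · exact one_le_two
  · have : (0 : ℝ) ≤ j := j.cast_nonneg
    nlinarith
  · exact χ.norm_block_le_of_summable j hf

namespace HolderBesov

variable {χ}

lemma norm_le_of_summable (hγ : γ ≤ 0) (f : χ.HolderBesov γ)
    (hf : Summable fun m => br m ^ 2 * ‖f.coeff m‖ ^ 2) :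
    ‖f‖ ≤ 2 ^ (-γ) * 21 * √(∑' m, br m ^ 2 * ‖f.coeff m‖ ^ 2) :=
  BesovInfty.norm_le_of_forall (f := f.1) (by positivity) fun j =>
    χ.norm_weightedBlocks_le_of_summable hγ j hf

lemma coeff_sum_smul_shift_one (S : Finset Mode) (c : Mode → ℂ) (m : Mode) :
    (∑ n ∈ S, c n • χ.shift n (one χ γ)).coeff m = if m ∈ S then c m else 0 := by
  classical
  rw [coeff_sum, Finset.sum_apply]
  simp_rw [coeff_smul, coeff_shift_one, Pi.smul_apply, Pi.single_apply, smul_eq_mul, mul_ite,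
    mul_one, mul_zero]
  rw [Finset.sum_ite_eq]

lemma mem_closure_span_of_summable (hγ : γ ≤ 0) (f : χ.HolderBesov γ)
    (hf : Summable fun m => br m ^ 2 * ‖f.coeff m‖ ^ 2) :
    f ∈ closure (Submodule.span ℂ (Set.range fun n => χ.shift n (one χ γ)) : Set (χ.HolderBesov γ)) := by
  classical
  have hlim : Tendsto (fun S : Finset Mode => ∑ n ∈ S, f.coeff n • χ.shift n (one χ γ)) atTop (𝓝 f) := by
    rw [tendsto_iff_norm_sub_tendsto_zero]
    have h1 := tendsto_tsum_compl_atTop_zero fun m => br m ^ 2 * ‖f.coeff m‖ ^ 2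
    have h2 : Tendsto (fun S : Finset Mode => (2 : ℝ) ^ (-γ) * 21 *
        √(∑' m : {m // m ∉ S}, br m ^ 2 * ‖f.coeff m‖ ^ 2)) atTop (𝓝 0) := by
      have := ((Real.continuous_sqrt.tendsto 0).comp h1).const_mul ((2 : ℝ) ^ (-γ) * 21)
      rwa [Real.sqrt_zero, mul_zero] at this
    refine squeeze_zero (fun _ => norm_nonneg _) (fun S => ?_) h2
    have h3 : (fun m => br m ^ 2 * ‖(∑ n ∈ S, f.coeff n • χ.shift n (one χ γ) - f).coeff m‖ ^ 2) =
        {m | m ∉ S}.indicator fun m => br m ^ 2 * ‖f.coeff m‖ ^ 2 := by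
      funext m
      rw [coeff_sub, Pi.sub_apply, coeff_sum_smul_shift_one]
      by_cases hm : m ∈ S <;> simp [hm]
    have h4 := norm_le_of_summable hγ (∑ n ∈ S, f.coeff n • χ.shift n (one χ γ) - f)
      (by rw [h3]; exact hf.indicator _)
    rw [h3] at h4
    rw [← tsum_subtype] at h4
    exact h4
  refine mem_closure_of_tendsto hlim (.of_forall fun S => ?_)
  exact Submodule.sum_mem _ fun n _ => Submodule.smul_mem _ _ (Submodule.subset_span ⟨n, rfl⟩)

lemma dense_span (hγ : γ ≤ 0) :
    Dense (Submodule.span ℂ (Set.range fun n => χ.shift n (one χ γ)) : Set (χ.HolderBesov γ)) := by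
  have h1 : Dense {f : χ.HolderBesov γ | f.1 ∈ χ.smoothSubmodule γ} := by
    intro f
    rw [closure_subtype]
    refine closure_mono (fun g hg => ?_) f.2
    exact ⟨⟨g, Submodule.le_topologicalClosure _ hg⟩, hg, rfl⟩
  rw [← dense_closure]
  refine h1.mono fun f hf => ?_
  obtain ⟨φ, hφ, h⟩ := hf
  refine mem_closure_span_of_summable hγ f ?_
  have h2 : f.coeff = UnitAddTorus.mFourierCoeff φ := funext h
  rw [h2]
  exact hφ.summable

lemma separableSpace (hγ : γ ≤ 0) : TopologicalSpace.SeparableSpace (χ.HolderBesov γ) := by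
  have h := ((Set.countable_range fun n => χ.shift n (one χ γ)).isSeparable.span (R := ℂ)).closure
  rw [(dense_span hγ).closure_eq] at h
  exact TopologicalSpace.isSeparable_univ_iff.1 h

lemma secondCountableTopology (hγ : γ ≤ 0) : SecondCountableTopology (χ.HolderBesov γ) :=
  have := separableSpace (χ := χ) hγ
  UniformSpace.secondCountable_of_separable _

end HolderBesov

/-- Countable topological structure is needed for sums and limits of path-valued variables to be
measurable, for the Borel and product `σ`-algebras of the Wick space to agree, and for the support
to carry full measure. -/
lemma polishSpace_pathSpace (hγ : γ ≤ 0) : PolishSpace (χ.PathSpace γ) := by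
  have := HolderBesov.secondCountableTopology (χ := χ) hγ
  infer_instance

/-- The Fourier coefficients of a path at a dense sequence of times. -/
def pathCoeff (f : χ.PathSpace γ) : ℕ × Mode → ℂ :=
  fun p => (f (TopologicalSpace.denseSeq ℝ≥0 p.1)).coeff p.2

/-- Lusin–Souslin: a continuous injection between Polish spaces. It is injective because
coefficients are continuous in time and determine a distribution. Measurability and null sets in
path space are thereby reduced to countably many complex coordinates. -/
lemma measurableEmbedding_pathCoeff (hγ : γ ≤ 0) : MeasurableEmbedding (χ.pathCoeff (γ := γ)) := by
  have := χ.polishSpace_pathSpace hγ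
  refine Continuous.measurableEmbedding ?_ fun f g h => ?_
  · exact continuous_pi fun p => (HolderBesov.continuous_coeff p.2).comp
      (continuous_eval_const _)
  · refine ContinuousMap.ext fun t => HolderBesov.coeff_injective ?_
    have : ∀ m, (fun t => (f t).coeff m) = fun t => (g t).coeff m := fun m =>
      Continuous.ext_on (TopologicalSpace.denseRange_denseSeq ℝ≥0)
        ((HolderBesov.continuous_coeff m).comp f.continuous)
        ((HolderBesov.continuous_coeff m).comp g.continuous) (by
          rintro _ ⟨n, rfl⟩
          exact congrFun h (n, m))
    exact funext fun m => congrFun (this m) t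

lemma measurable_path_iff (hγ : γ ≤ 0) {Ω : Type*} [MeasurableSpace Ω] {Y : Ω → χ.PathSpace γ} :
    Measurable Y ↔ ∀ t m, Measurable fun ω => (Y ω t).coeff m := by
  refine ⟨fun h t m => ?_, fun h => ?_⟩
  · exact ((HolderBesov.continuous_coeff m).comp
      (continuous_eval_const t)).measurable.comp h
  · rw [← (χ.measurableEmbedding_pathCoeff hγ).measurable_comp_iff]
    exact measurable_pi_lambda _ fun p => h _ _

end DyadicPartition

/-! ### Standard complex Gaussian vectors -/

/-- The standard complex Gaussian law: independent real and imaginary part of variance `1 / 2`. -/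
def stdC : Measure ℂ :=
  ((gaussianReal 0 (1 / 2)).prod (gaussianReal 0 (1 / 2))).map Complex.equivRealProdCLM.symm

instance : IsGaussian stdC := by
  unfold stdC
  infer_instance

lemma lintegral_stdC {f : ℂ → ℝ≥0∞} (hf : Measurable f) : ∫⁻ z, f z ∂stdC =
    ∫⁻ z, ENNReal.ofReal (Real.pi⁻¹ * Real.exp (-‖z‖ ^ 2)) * f z := by
  have h1 : (1 / 2 : ℝ≥0) ≠ 0 := by simp
  rw [stdC, lintegral_map hf (by fun_prop), gaussianReal_of_var_ne_zero _ h1,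
    prod_withDensity (by fun_prop) (by fun_prop),
    lintegral_withDensity_eq_lintegral_mul _ (by fun_prop) (by fun_prop),
    ← (Complex.volume_preserving_equiv_real_prod.symm).lintegral_comp (by fun_prop)]
  refine lintegral_congr fun p => ?_
  have h2 : Complex.measurableEquivRealProd.symm p = Complex.equivRealProdCLM.symm p := rfl
  rw [h2, Pi.mul_apply]
  congr 1
  have h3 : ‖Complex.equivRealProdCLM.symm p‖ ^ 2 = p.1 ^ 2 + p.2 ^ 2 := by
    rw [Complex.sq_norm, Complex.normSq_apply]
    simp [sq]
  rw [gaussianPDF, gaussianPDF, ← ENNReal.ofReal_mul (gaussianPDFReal_nonneg _ _ _), gaussianPDFReal,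
    gaussianPDFReal, h3]
  congr 1
  have h4 : (√(2 * Real.pi * ((1 / 2 : ℝ≥0) : ℝ)))⁻¹ = (√Real.pi)⁻¹ := by
    congr 2; push_cast; ring
  rw [h4, mul_mul_mul_comm, ← Real.exp_add, ← mul_inv, Real.mul_self_sqrt Real.pi_pos.le]
  congr 2
  push_cast
  ring

lemma stdC_eq : stdC = volume.withDensity fun z : ℂ =>
    ENNReal.ofReal (Real.pi⁻¹ * Real.exp (-‖z‖ ^ 2)) := by
  refine Measure.ext_of_lintegral _ fun f hf => ?_
  rw [lintegral_stdC hf, lintegral_withDensity_eq_lintegral_mul _ (by fun_prop) hf]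
  rfl

lemma integral_stdC (f : ℂ → ℂ) : ∫ z, f z ∂stdC =
    ∫ z, ((Real.pi⁻¹ * Real.exp (-‖z‖ ^ 2) : ℝ) : ℂ) * f z := by
  rw [stdC_eq, integral_withDensity_eq_integral_toReal_smul (by fun_prop) (by simp)]
  refine integral_congr_ae (.of_forall fun z => ?_)
  show (ENNReal.ofReal _).toReal • f z = _
  rw [ENNReal.toReal_ofReal (by positivity), Complex.real_smul]

lemma integral_stdC_mul {c : ℂ} (hc : ‖c‖ = 1) (f : ℂ → ℂ) :
    ∫ z, f (c * z) ∂stdC = ∫ z, f z ∂stdC := by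
  rw [integral_stdC, integral_stdC]
  let e : ℂ ≃ₗᵢ[ℝ] ℂ := rotation ⟨c, by simp [Submonoid.unitSphere, hc]⟩
  have he : ∀ z, e z = c * z := fun z => rfl
  rw [← e.measurePreserving.integral_comp e.toHomeomorph.measurableEmbedding
    fun z => ((Real.pi⁻¹ * Real.exp (-‖z‖ ^ 2) : ℝ) : ℂ) * f z]
  refine integral_congr_ae (.of_forall fun z => ?_)
  show _ = ((Real.pi⁻¹ * Real.exp (-‖e z‖ ^ 2) : ℝ) : ℂ) * f (e z)
  rw [he, norm_mul, hc, one_mul]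

/-- Equal powers reduce to a Gamma integral. For unequal powers, rotation by the angle `π / (a - b)`
preserves the law and changes the sign of the integrand. -/
lemma integral_stdC_pow_mul_pow (a b : ℕ) : ∫ z, z ^ a * conj z ^ b ∂stdC =
    if a = b then (a.factorial : ℂ) else 0 := by
  split_ifs with h
  · subst h
    rw [integral_stdC]
    have h1 : ∀ z : ℂ, ((Real.pi⁻¹ * Real.exp (-‖z‖ ^ 2) : ℝ) : ℂ) * (z ^ a * conj z ^ a) =
        ((Real.pi⁻¹ * (‖z‖ ^ ((2 * a : ℕ) : ℝ) * Real.exp (-‖z‖ ^ (2 : ℝ))) : ℝ) : ℂ) := by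
      intro z
      rw [← mul_pow, Complex.mul_conj', Real.rpow_natCast, Real.rpow_two]
      push_cast
      ring
    simp_rw [h1]
    rw [integral_complex_ofReal, integral_const_mul,
      Complex.integral_rpow_mul_exp_neg_rpow one_le_two
        (by have : (0 : ℝ) ≤ ((2 * a : ℕ) : ℝ) := Nat.cast_nonneg _
            linarith)]
    have h2 : (((2 * a : ℕ) : ℝ) + 2) / 2 = a + 1 := by push_cast; ring
    rw [h2, Real.Gamma_nat_eq_factorial, ← mul_assoc]
    have : Real.pi⁻¹ * (2 * Real.pi / 2) = 1 := by field_simp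
    rw [this, one_mul, Complex.ofReal_natCast]
  · have hd : ((a : ℝ) - b) ≠ 0 := sub_ne_zero.2 (by exact_mod_cast h)
    set θ : ℝ := Real.pi / (a - b)
    have h1 := integral_stdC_mul (c := Complex.exp (θ * Complex.I)) (Complex.norm_exp_ofReal_mul_I θ)
      fun z => z ^ a * conj z ^ b
    have h2 : ∀ z : ℂ, (Complex.exp (θ * Complex.I) * z) ^ a * conj (Complex.exp (θ * Complex.I) * z) ^ b
        = -1 * (z ^ a * conj z ^ b) := by
      intro z
      have h3 : Complex.exp (θ * Complex.I) ^ a * conj (Complex.exp (θ * Complex.I)) ^ b = -1 := by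
        rw [← Complex.exp_conj, map_mul, Complex.conj_ofReal, Complex.conj_I, ← Complex.exp_nat_mul,
          ← Complex.exp_nat_mul, ← Complex.exp_add, ← Complex.exp_pi_mul_I]
        congr 1
        have h4 : (Real.pi : ℂ) = ((a : ℂ) - b) * θ := by
          have : Real.pi = ((a : ℝ) - b) * θ := by simp only [θ]; field_simp
          rw [this]; push_cast
          have : ((θ * (a - b) / (a - b) : ℝ)) = θ := by field_simp
          ring
        rw [h4]; ring
      rw [map_mul, mul_pow, mul_pow, ← h3]; ring
    simp_rw [h2] at h1
    rw [integral_const_mul] at h1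
    linear_combination (-1 / 2 : ℂ) * h1

/-! ### Vectors -/

variable {ι : Type*} [Fintype ι]

/-- The standard Gaussian law on `ι → ℂ`. -/
def stdCPi (ι : Type*) [Fintype ι] : Measure (ι → ℂ) := Measure.pi fun _ => stdC

instance : IsGaussian (stdCPi ι) := by
  have h1 : iIndepFun (fun i (z : ι → ℂ) => z i) (stdCPi ι) :=
    iIndepFun_pi (X := fun _ => id) fun _ => aemeasurable_id
  have h2 : ∀ i, HasGaussianLaw (fun z : ι → ℂ => z i) (stdCPi ι) := fun i => by
    refine ⟨?_⟩
    rw [stdCPi, (measurePreserving_eval (fun _ : ι => stdC) i).map_eq]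
    infer_instance
  have h3 := (h1.hasGaussianLaw h2).isGaussian_map
  rwa [Measure.map_id'] at h3

/-- By Fernique's theorem a Gaussian measure has moments of every order. -/
lemma integrable_of_poly_bound {E : Type*} [NormedAddCommGroup E] [NormedSpace ℝ E]
    [CompleteSpace E] [SecondCountableTopology E] [MeasurableSpace E] [BorelSpace E]
    {ν : Measure E} [IsGaussian ν] {F : Type*} [NormedAddCommGroup F] {f : E → F}
    (hf : Continuous f) [SecondCountableTopology F] {C : ℝ} {N : ℕ}
    (h : ∀ y, ‖f y‖ ≤ C * (1 + ‖y‖) ^ N) : Integrable f ν := by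
  have h1 : Integrable (fun y : E => ‖y‖ ^ N) ν := by
    have := (IsGaussian.memLp_id ν N (by simp)).integrable_norm_pow'
    simpa using this
  have h2 : Integrable (fun y : E => |C| * (2 ^ N * (1 + ‖y‖ ^ N))) ν :=
    (((integrable_const 1).add h1).const_mul _).const_mul _
  refine h2.mono' (hf.aestronglyMeasurable (μ := ν)) (.of_forall fun y => (h y).trans ?_)
  calc C * (1 + ‖y‖) ^ N ≤ |C| * (1 + ‖y‖) ^ N := by gcongr; exact le_abs_self C
    _ ≤ |C| * (2 ^ N * (1 + ‖y‖ ^ N)) := by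
      gcongr
      have h3 : 1 + ‖y‖ ≤ 2 * max 1 ‖y‖ := by
        linarith [le_max_left 1 ‖y‖, le_max_right 1 ‖y‖]
      calc (1 + ‖y‖) ^ N ≤ (2 * max 1 ‖y‖) ^ N := by gcongr
        _ = 2 ^ N * (max 1 ‖y‖) ^ N := mul_pow _ _ _
        _ ≤ 2 ^ N * (1 + ‖y‖ ^ N) := by
          gcongr
          rcases max_choice 1 ‖y‖ with h | h <;> rw [h]
          · rw [one_pow]; linarith [pow_nonneg (norm_nonneg y) N]
          · linarith

lemma norm_prod_le_of_forall {A : Type*} [Fintype A] {f : A → ℂ} {C : ℝ} (h : ∀ i, ‖f i‖ ≤ C) :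
    ‖∏ i, f i‖ ≤ C ^ Fintype.card A := by
  rw [norm_prod]
  exact (Finset.prod_le_prod (fun _ _ => norm_nonneg _) fun i _ => h i).trans_eq (by simp)

section Wick

variable {A B : Type*} [Fintype A] [Fintype B]

lemma integrable_monomial (I : A → ι) (J : B → ι) :
    Integrable (fun z : ι → ℂ => (∏ i, z (I i)) * ∏ j, conj (z (J j))) (stdCPi ι) := by
  refine integrable_of_poly_bound (C := 1) (N := Fintype.card A + Fintype.card B) (by fun_prop)
    fun z => ?_
  have h1 : ∀ i, ‖z i‖ ≤ 1 + ‖z‖ := fun i => (norm_le_pi_norm z i).trans (by linarith)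
  rw [norm_mul, one_mul, pow_add]
  gcongr
  · exact norm_prod_le_of_forall fun i => h1 _
  · exact norm_prod_le_of_forall fun i => (RCLike.norm_conj _).trans_le (h1 _)

variable [DecidableEq ι]

lemma prod_comp_eq (I : A → ι) (z : ι → ℂ) :
    ∏ i, z (I i) = ∏ r, z r ^ Fintype.card {i // I i = r} := by
  rw [← Finset.prod_fiberwise Finset.univ I]
  refine Finset.prod_congr rfl fun r _ => ?_
  rw [Finset.prod_congr rfl (g := fun _ => z r) (by intro i hi; rw [(Finset.mem_filter.1 hi).2]),
    Finset.prod_const, Fintype.card_subtype]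

lemma integral_monomial (I : A → ι) (J : B → ι) :
    ∫ z, (∏ i, z (I i)) * ∏ j, conj (z (J j)) ∂stdCPi ι =
      ∏ r, if Fintype.card {i // I i = r} = Fintype.card {j // J j = r} then
        ((Fintype.card {i // I i = r}).factorial : ℂ) else 0 := by
  have h : ∀ z : ι → ℂ, (∏ i, z (I i)) * ∏ j, conj (z (J j)) =
      ∏ r, (z r ^ Fintype.card {i // I i = r} * conj (z r) ^ Fintype.card {j // J j = r}) := by
    intro z
    rw [prod_comp_eq I z, prod_comp_eq J fun r => conj (z r), Finset.prod_mul_distrib]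
  simp_rw [h]
  rw [stdCPi, integral_fintype_prod_eq_prod (f := fun r z =>
    (z ^ Fintype.card {i // I i = r} * conj z ^ Fintype.card {j // J j = r}))]
  exact Finset.prod_congr rfl fun r _ => integral_stdC_pow_mul_pow _ _

lemma integral_monomial_eq_zero (I : A → ι) (J : B → ι) (h : Fintype.card A ≠ Fintype.card B) :
    ∫ z, (∏ i, z (I i)) * ∏ j, conj (z (J j)) ∂stdCPi ι = 0 := by
  rw [integral_monomial]
  have : ∃ r, Fintype.card {i // I i = r} ≠ Fintype.card {j // J j = r} := by
    by_contra! hr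
    refine h (Fintype.card_congr (Equiv.ofFiberEquiv (f := I) (g := J) fun r => ?_))
    exact Fintype.equivOfCardEq (hr r)
  obtain ⟨r, hr⟩ := this
  exact Finset.prod_eq_zero (Finset.mem_univ r) (if_neg hr)

/-- **Wick's formula** for monomials in a standard complex Gaussian vector. -/
lemma integral_monomial_eq_card [DecidableEq A] (I J : A → ι) :
    ∫ z, (∏ i, z (I i)) * ∏ j, conj (z (J j)) ∂stdCPi ι =
      ((Finset.univ.filter fun σ : Equiv.Perm A => I ∘ σ = J).card : ℂ) := by
  rw [integral_monomial]
  by_cases h : ∀ r, Fintype.card {i // I i = r} = Fintype.card {j // J j = r}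
  · let τ : Equiv.Perm A := Equiv.ofFiberEquiv (f := J) (g := I) fun r =>
      Fintype.equivOfCardEq (h r).symm
    have hτ : I ∘ τ = J := funext fun a => Equiv.ofFiberEquiv_map _ a
    simp_rw [if_pos (h _)]
    -- The product of factorials of the fibre sizes counts the permutations that fix `I`.
    -- Composition with `τ` matches these with the solutions of `I ∘ σ = J`.
    have h1 := DomMulAct.stabilizer_card I
    rw [Fintype.card_subtype] at h1
    have h2 : (Finset.univ.filter fun σ : Equiv.Perm A => I ∘ σ = J).card =
        (Finset.univ.filter fun σ : Equiv.Perm A => I ∘ σ = I).card := by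
      refine Finset.card_bij (fun σ _ => τ⁻¹.trans σ) (fun σ hσ => ?_) (fun σ _ σ' _ h => ?_)
        fun σ hσ => ⟨τ.trans σ, ?_, ?_⟩
      · have hσ := (Finset.mem_filter.1 hσ).2
        refine Finset.mem_filter.2 ⟨Finset.mem_univ _, ?_⟩
        funext a
        have := congrFun hσ (τ⁻¹ a)
        rw [← hτ] at this
        simpa using this
      · refine Equiv.ext fun a => ?_
        have := congrArg (fun e : Equiv.Perm A => e (τ a)) h
        simpa using this
      · have hσ := (Finset.mem_filter.1 hσ).2
        refine Finset.mem_filter.2 ⟨Finset.mem_univ _, ?_⟩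
        funext a
        have := congrFun hσ (τ a)
        rw [← hτ]
        simpa using this
      · refine Equiv.ext fun a => ?_
        simp
    rw [h2, h1]
    push_cast
    rfl
  · rw [Finset.filter_false_of_mem, Finset.card_empty, Nat.cast_zero]
    · push Not at h
      obtain ⟨r, hr⟩ := h
      exact Finset.prod_eq_zero (Finset.mem_univ r) (if_neg hr)
    · intro σ _ hσ
      refine h fun r => ?_
      refine (Fintype.card_congr (Equiv.subtypeEquiv σ fun a => ?_)).symm
      rw [← hσ]; rfl

end Wick

/-! ### Moments of decoupled chaoses -/

variable {ι : Type*} [Fintype ι]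

lemma norm_apply_le_one_add (z : ι → ℂ) (i : ι) : ‖z i‖ ≤ 1 + ‖z‖ :=
  (norm_le_pi_norm z i).trans (by linarith)

section

variable {A B : Type*} [Fintype A] [Fintype B] [DecidableEq A] [DecidableEq B]

/-- The decoupled chaos with coefficients `b`. -/
def decoupled (b : (A → ι) × (B → ι) → ℂ) (w : (ι → ℂ) × (ι → ℂ)) : ℂ :=
  ∑ p : (A → ι) × (B → ι), b p * ((∏ i, w.1 (p.1 i)) * ∏ j, conj (w.2 (p.2 j)))

lemma continuous_decoupled (b : (A → ι) × (B → ι) → ℂ) : Continuous (decoupled b) := by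
  unfold decoupled
  fun_prop

lemma norm_decoupled_le (b : (A → ι) × (B → ι) → ℂ) (w : (ι → ℂ) × (ι → ℂ)) : ‖decoupled b w‖ ≤
    (∑ p, ‖b p‖) * (1 + ‖w‖) ^ (Fintype.card A + Fintype.card B) := by
  classical
  refine (norm_sum_le _ _).trans ?_
  rw [Finset.sum_mul]
  refine Finset.sum_le_sum fun p _ => ?_
  rw [norm_mul, norm_mul, pow_add]
  gcongr
  · exact norm_prod_le_of_forall fun i => (norm_apply_le_one_add _ _).trans
      (by gcongr; exact norm_fst_le w)
  · exact norm_prod_le_of_forall fun i => ((RCLike.norm_conj _).trans_le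
      (norm_apply_le_one_add _ _)).trans (by gcongr; exact norm_snd_le w)

/-- After expanding the square, Wick's formula in each of the two independent vectors leaves a sum
over pairs of permutations of correlations of `b` with a permuted copy of itself; each is at most
the squared `ℓ²` norm. Holomorphic and antiholomorphic factors live on different vectors, so they
never contract with each other. -/
lemma integral_sq_decoupled_le
    (b : (A → ι) × (B → ι) → ℂ) :
    ∫ w, ‖decoupled b w‖ ^ 2 ∂(stdCPi ι).prod (stdCPi ι) ≤
      (Fintype.card A).factorial * (Fintype.card B).factorial * ∑ p, ‖b p‖ ^ 2 := by
  classical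
  set ν := (stdCPi ι).prod (stdCPi ι)
  have h1 : ∫ w, ((‖decoupled b w‖ ^ 2 : ℝ) : ℂ) ∂ν =
      ∑ p : (A → ι) × (B → ι), ∑ q : (A → ι) × (B → ι), b p * conj (b q) *
        (((Finset.univ.filter fun σ : Equiv.Perm A => p.1 ∘ σ = q.1).card : ℂ) *
        ((Finset.univ.filter fun τ : Equiv.Perm B => q.2 ∘ τ = p.2).card : ℂ)) := by
    have h2 : ∀ w, ((‖decoupled b w‖ ^ 2 : ℝ) : ℂ) = ∑ p : (A → ι) × (B → ι), ∑ q : (A → ι) × (B → ι),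
        b p * conj (b q) * (((∏ i, w.1 (p.1 i)) * ∏ j, conj (w.1 (q.1 j))) *
          ((∏ i, w.2 (q.2 i)) * ∏ j, conj (w.2 (p.2 j)))) := by
      intro w
      rw [Complex.ofReal_pow, ← Complex.mul_conj', decoupled, map_sum, Finset.sum_mul_sum]
      refine Finset.sum_congr rfl fun p _ => Finset.sum_congr rfl fun q _ => ?_
      simp only [map_mul, map_prod, Complex.conj_conj]
      ring
    simp_rw [h2]
    have hint : ∀ p q : (A → ι) × (B → ι), Integrable (fun w : (ι → ℂ) × (ι → ℂ) =>
        b p * conj (b q) * (((∏ i, w.1 (p.1 i)) * ∏ j, conj (w.1 (q.1 j))) *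
          ((∏ i, w.2 (q.2 i)) * ∏ j, conj (w.2 (p.2 j))))) ν := fun p q =>
      ((integrable_monomial p.1 q.1).mul_prod (integrable_monomial q.2 p.2)).const_mul _
    rw [integral_finsetSum _ fun p _ => integrable_finsetSum _ fun q _ => hint p q]
    refine Finset.sum_congr rfl fun p _ => ?_
    rw [integral_finsetSum _ fun q _ => hint p q]
    refine Finset.sum_congr rfl fun q _ => ?_
    rw [integral_const_mul, integral_prod_mul (μ := stdCPi ι) (ν := stdCPi ι)
      (fun z => (∏ i, z (p.1 i)) * ∏ j, conj (z (q.1 j)))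
      (fun z => (∏ i, z (q.2 i)) * ∏ j, conj (z (p.2 j))),
      integral_monomial_eq_card, integral_monomial_eq_card]
  rw [integral_complex_ofReal] at h1
  have h3 : ∀ p q : (A → ι) × (B → ι), ‖b p * conj (b q) *
        (((Finset.univ.filter fun σ : Equiv.Perm A => p.1 ∘ σ = q.1).card : ℂ) *
        ((Finset.univ.filter fun τ : Equiv.Perm B => q.2 ∘ τ = p.2).card : ℂ))‖ =
      ∑ σ : Equiv.Perm A, ∑ τ : Equiv.Perm B,
        if q = (p.1 ∘ σ, p.2 ∘ τ) then ‖b p‖ * ‖b q‖ else 0 := by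
    intro p q
    rw [norm_mul, norm_mul, norm_mul, RCLike.norm_conj, RCLike.norm_natCast, RCLike.norm_natCast]
    have e1 : (Finset.univ.filter fun τ : Equiv.Perm B => q.2 ∘ τ = p.2).card =
        (Finset.univ.filter fun τ : Equiv.Perm B => p.2 ∘ τ = q.2).card := by
      refine Finset.card_bij (fun τ _ => τ⁻¹) (fun τ hτ => ?_) (fun _ _ _ _ h => inv_injective h)
        fun τ hτ => ⟨τ⁻¹, ?_, inv_inv τ⟩
      · refine Finset.mem_filter.2 ⟨Finset.mem_univ _, ?_⟩
        rw [← (Finset.mem_filter.1 hτ).2]; funext a; simp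
      · refine Finset.mem_filter.2 ⟨Finset.mem_univ _, ?_⟩
        rw [← (Finset.mem_filter.1 hτ).2]; funext a; simp
    rw [e1, Finset.card_filter, Finset.card_filter]
    push_cast
    rw [Finset.sum_mul_sum, Finset.mul_sum]
    refine Finset.sum_congr rfl fun σ _ => ?_
    rw [Finset.mul_sum]
    refine Finset.sum_congr rfl fun τ _ => ?_
    have e2 : q = (p.1 ∘ σ, p.2 ∘ τ) ↔ p.1 ∘ σ = q.1 ∧ p.2 ∘ τ = q.2 := by
      rw [Prod.ext_iff]; simp only [eq_comm]
    rw [if_congr e2 rfl rfl]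
    by_cases c1 : p.1 ∘ σ = q.1 <;> by_cases c2 : p.2 ∘ τ = q.2 <;> simp [c1, c2]
  have h4 : ∀ (σ : Equiv.Perm A) (τ : Equiv.Perm B), ∑ p : (A → ι) × (B → ι),
      ‖b p‖ * ‖b (p.1 ∘ σ, p.2 ∘ τ)‖ ≤ ∑ p, ‖b p‖ ^ 2 := by
    intro σ τ
    let e : (A → ι) × (B → ι) ≃ (A → ι) × (B → ι) :=
      (Equiv.arrowCongr σ.symm (Equiv.refl ι)).prodCongr (Equiv.arrowCongr τ.symm (Equiv.refl ι))
    have he : ∀ p, e p = (p.1 ∘ σ, p.2 ∘ τ) := fun p => rfl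
    have h5 : ∑ p, ‖b (e p)‖ ^ 2 = ∑ p, ‖b p‖ ^ 2 := e.sum_comp fun p => ‖b p‖ ^ 2
    calc ∑ p : (A → ι) × (B → ι), ‖b p‖ * ‖b (p.1 ∘ σ, p.2 ∘ τ)‖
        ≤ ∑ p, (‖b p‖ ^ 2 + ‖b (e p)‖ ^ 2) / 2 := by
          refine Finset.sum_le_sum fun p _ => ?_
          rw [he]
          nlinarith [sq_nonneg (‖b p‖ - ‖b (p.1 ∘ σ, p.2 ∘ τ)‖)]
      _ = ∑ p, ‖b p‖ ^ 2 := by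
          rw [← Finset.sum_div, Finset.sum_add_distrib, h5]; ring
  have h0 : 0 ≤ ∫ w, ‖decoupled b w‖ ^ 2 ∂ν := integral_nonneg fun _ => by positivity
  calc ∫ w, ‖decoupled b w‖ ^ 2 ∂ν = ‖((∫ w, ‖decoupled b w‖ ^ 2 ∂ν : ℝ) : ℂ)‖ := by
        rw [Complex.norm_real, Real.norm_of_nonneg h0]
    _ ≤ ∑ p : (A → ι) × (B → ι), ∑ q : (A → ι) × (B → ι), ∑ σ : Equiv.Perm A, ∑ τ : Equiv.Perm B,
        if q = (p.1 ∘ σ, p.2 ∘ τ) then ‖b p‖ * ‖b q‖ else 0 := by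
        rw [h1]
        refine (norm_sum_le _ _).trans (Finset.sum_le_sum fun p _ => (norm_sum_le _ _).trans
          (Finset.sum_le_sum fun q _ => (h3 p q).le))
    _ = ∑ σ : Equiv.Perm A, ∑ τ : Equiv.Perm B, ∑ p : (A → ι) × (B → ι),
        ‖b p‖ * ‖b (p.1 ∘ σ, p.2 ∘ τ)‖ := by
        have e1 : ∀ p : (A → ι) × (B → ι), (∑ q : (A → ι) × (B → ι), ∑ σ : Equiv.Perm A,
            ∑ τ : Equiv.Perm B, if q = (p.1 ∘ σ, p.2 ∘ τ) then ‖b p‖ * ‖b q‖ else 0) =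
            ∑ σ : Equiv.Perm A, ∑ τ : Equiv.Perm B, ‖b p‖ * ‖b (p.1 ∘ σ, p.2 ∘ τ)‖ := by
          intro p
          rw [Finset.sum_comm]
          refine Finset.sum_congr rfl fun σ _ => ?_
          rw [Finset.sum_comm]
          refine Finset.sum_congr rfl fun τ _ => ?_
          rw [Finset.sum_ite_eq' Finset.univ]
          simp
        simp_rw [e1]
        rw [Finset.sum_comm]
        exact Finset.sum_congr rfl fun σ _ => Finset.sum_comm
    _ ≤ ∑ _σ : Equiv.Perm A, ∑ _τ : Equiv.Perm B, ∑ p, ‖b p‖ ^ 2 :=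
        Finset.sum_le_sum fun σ _ => Finset.sum_le_sum fun τ _ => h4 σ τ
    _ = _ := by
        rw [Finset.sum_const, Finset.sum_const, Finset.card_univ, Finset.card_univ,
          Fintype.card_perm, Fintype.card_perm, nsmul_eq_mul, nsmul_eq_mul, mul_assoc]

/-- The `n`-th power of a decoupled chaos is a decoupled chaos with `n` times as many factors and
product coefficients, so the second moment bound applies to it. This takes the place of
hypercontractivity. -/
lemma integral_pow_decoupled_le (n : ℕ) (b : (A → ι) × (B → ι) → ℂ) :
    ∫ w, ‖decoupled b w‖ ^ (2 * n) ∂(stdCPi ι).prod (stdCPi ι) ≤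
      ((n * Fintype.card A).factorial * (n * Fintype.card B).factorial : ℝ) *
        (∑ p, ‖b p‖ ^ 2) ^ n := by
  classical
  let e : (Fin n → (A → ι) × (B → ι)) ≃ (Fin n × A → ι) × (Fin n × B → ι) :=
    (Equiv.arrowProdEquivProdArrow _ _ _).trans
      ((Equiv.curry _ _ _).symm.prodCongr (Equiv.curry _ _ _).symm)
  let b' : (Fin n × A → ι) × (Fin n × B → ι) → ℂ := fun q => ∏ i, b (e.symm q i)
  have h1 : ∀ w, decoupled b w ^ n = decoupled b' w := by
    intro w
    rw [decoupled, decoupled, Fintype.sum_pow]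
    refine Fintype.sum_equiv e _ _ fun P => ?_
    simp only [b', Equiv.symm_apply_apply]
    rw [Finset.prod_mul_distrib, Finset.prod_mul_distrib, Fintype.prod_prod_type,
      Fintype.prod_prod_type]
    rfl
  have h2 : ∑ q, ‖b' q‖ ^ 2 = (∑ p, ‖b p‖ ^ 2) ^ n := by
    rw [Fintype.sum_pow]
    refine (Fintype.sum_equiv e _ _ fun P => ?_).symm
    simp only [b', Equiv.symm_apply_apply]
    rw [norm_prod, Finset.prod_pow]
  have h3 := integral_sq_decoupled_le b'
  rw [h2, Fintype.card_prod, Fintype.card_prod, Fintype.card_fin] at h3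
  refine le_trans (le_of_eq (integral_congr_ae (.of_forall fun w => ?_))) h3
  show ‖decoupled b w‖ ^ (2 * n) = ‖decoupled b' w‖ ^ 2
  rw [← h1, norm_pow, ← pow_mul, mul_comm]

end

/-! ### Complex Hermite polynomials in an algebra -/

/-- `H_{k,l}` as a polynomial in `z` and `conj z`, evaluated in an algebra. -/
def herm {R : Type*} [Ring R] [Algebra ℂ R] (k l : ℕ) (x y : R) (c : ℂ) : R :=
  ∑ m ∈ Finset.range (min k l + 1),
    ((m.factorial : ℂ) * (k.choose m : ℂ) * (l.choose m : ℂ) * (-c) ^ m) •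
      (x ^ (k - m) * y ^ (l - m))

lemma hermite_eq_herm (k l : ℕ) (z : ℂ) (c : ℝ) : hermite k l z c = herm k l z (conj z) c := by
  simp only [hermite, herm, smul_eq_mul, mul_assoc]

/-- The linear form `c · y = ∑ c_i y_i`. -/
def lin (c y : ι → ℂ) : ℂ := ∑ i, c i * y i

/-- Both powers are expanded into monomials. For equal exponents each permutation in Wick's formula
selects the same product of squared moduli, and there are `a!` of them. -/
lemma integral_lin_pow (c : ι → ℂ) (a b : ℕ) :
    ∫ y, lin c y ^ a * conj (lin c y) ^ b ∂stdCPi ι =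
      if a = b then (a.factorial : ℂ) * ((∑ i, ‖c i‖ ^ 2 : ℝ) : ℂ) ^ a else 0 := by
  classical
  have h1 : ∀ y : ι → ℂ, lin c y ^ a * conj (lin c y) ^ b = ∑ I : Fin a → ι, ∑ J : Fin b → ι,
      ((∏ i, c (I i)) * ∏ j, conj (c (J j))) * ((∏ i, y (I i)) * ∏ j, conj (y (J j))) := by
    intro y
    rw [lin, map_sum, Fintype.sum_pow, Fintype.sum_pow, Finset.sum_mul_sum]
    refine Finset.sum_congr rfl fun I _ => Finset.sum_congr rfl fun J _ => ?_
    simp only [map_mul, Finset.prod_mul_distrib]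
    ring
  simp_rw [h1]
  have hint : ∀ (I : Fin a → ι) (J : Fin b → ι), Integrable (fun y : ι → ℂ =>
      ((∏ i, c (I i)) * ∏ j, conj (c (J j))) * ((∏ i, y (I i)) * ∏ j, conj (y (J j)))) (stdCPi ι) :=
    fun I J => (integrable_monomial I J).const_mul _
  rw [integral_finsetSum _ fun I _ => integrable_finsetSum _ fun J _ => hint I J]
  simp_rw [integral_finsetSum _ fun J _ => hint _ J, integral_const_mul]
  split_ifs with h
  · subst h
    simp_rw [integral_monomial_eq_card, Finset.card_filter]
    push_cast
    have h2 : ∀ I : Fin a → ι, ∑ J : Fin a → ι, ((∏ i, c (I i)) * ∏ j, conj (c (J j))) *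
        ∑ σ : Equiv.Perm (Fin a), (if I ∘ σ = J then (1 : ℂ) else 0) =
        ∑ _σ : Equiv.Perm (Fin a), ∏ i, (‖c (I i)‖ ^ 2 : ℂ) := by
      intro I
      simp_rw [Finset.mul_sum]
      rw [Finset.sum_comm]
      refine Finset.sum_congr rfl fun σ _ => ?_
      simp_rw [mul_ite, mul_one, mul_zero]
      rw [Finset.sum_ite_eq Finset.univ, if_pos (Finset.mem_univ _)]
      have h3 : ∏ j, conj (c ((I ∘ σ) j)) = ∏ j, conj (c (I j)) :=
        Equiv.prod_comp σ fun j => conj (c (I j))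
      rw [h3, ← Finset.prod_mul_distrib]
      exact Finset.prod_congr rfl fun i _ => Complex.mul_conj' _
    simp_rw [h2]
    rw [Finset.sum_comm, Finset.sum_const, Finset.card_univ, Fintype.card_perm, Fintype.card_fin,
      nsmul_eq_mul, Fintype.sum_pow]
  · refine Finset.sum_eq_zero fun I _ => Finset.sum_eq_zero fun J _ => ?_
    rw [integral_monomial_eq_zero I J (by simpa using h), mul_zero]

lemma continuous_lin (c : ι → ℂ) : Continuous (lin c) := by
  unfold lin; fun_prop

lemma lin_add (c y z : ι → ℂ) : lin c (y + z) = lin c y + lin c z := by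
  simp only [lin, Pi.add_apply, mul_add, Finset.sum_add_distrib]

lemma lin_sub (c y z : ι → ℂ) : lin c (y - z) = lin c y - lin c z := by
  simp only [lin, Pi.sub_apply, mul_sub, Finset.sum_sub_distrib]

lemma norm_lin_le (c y : ι → ℂ) : ‖lin c y‖ ≤ (∑ i, ‖c i‖) * (1 + ‖y‖) := by
  refine (norm_sum_le _ _).trans ?_
  rw [Finset.sum_mul]
  refine Finset.sum_le_sum fun i _ => ?_
  rw [norm_mul]
  gcongr
  exact norm_apply_le_one_add y i

lemma integrable_lin_pow (c : ι → ℂ) (a b : ℕ) :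
    Integrable (fun y => lin c y ^ a * conj (lin c y) ^ b) (stdCPi ι) := by
  have h1 : 0 ≤ ∑ i, ‖c i‖ := Finset.sum_nonneg fun _ _ => norm_nonneg _
  have h2 := continuous_lin c
  refine integrable_of_poly_bound (C := (∑ i, ‖c i‖) ^ (a + b)) (N := a + b) (by fun_prop)
    fun y => ?_
  rw [norm_mul, norm_pow, norm_pow, RCLike.norm_conj, ← pow_add, ← mul_pow]
  gcongr
  exact norm_lin_le c y

/-- Decoupling: `H_{k,l}(x, E|Y|²) = E[(x + Y)^k conj (x - Y)^l]` for `Y` complex Gaussian. -/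
lemma herm_eq_integral (c : ι → ℂ) (k l : ℕ) (x : ℂ) :
    herm k l x (conj x) ((∑ i, ‖c i‖ ^ 2 : ℝ) : ℂ) =
      ∫ y, (x + lin c y) ^ k * conj (x - lin c y) ^ l ∂stdCPi ι := by
  set R : ℂ := ((∑ i, ‖c i‖ ^ 2 : ℝ) : ℂ)
  have h1 : ∀ y, (x + lin c y) ^ k * conj (x - lin c y) ^ l =
      ∑ i ∈ Finset.range (k + 1), ∑ j ∈ Finset.range (l + 1),
        ((-1) ^ j * x ^ (k - i) * conj x ^ (l - j) * (k.choose i : ℂ) * (l.choose j : ℂ)) *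
          (lin c y ^ i * conj (lin c y) ^ j) := by
    intro y
    rw [add_comm x, map_sub, sub_eq_neg_add, add_pow, add_pow, Finset.sum_mul_sum]
    refine Finset.sum_congr rfl fun i _ => Finset.sum_congr rfl fun j _ => ?_
    rw [neg_pow]
    ring
  simp_rw [h1]
  rw [integral_finsetSum _ fun i _ => integrable_finsetSum _ fun j _ =>
    (integrable_lin_pow c i j).const_mul _]
  simp_rw [integral_finsetSum _ fun j _ => (integrable_lin_pow c _ j).const_mul _,
    integral_const_mul, integral_lin_pow]
  -- Mixed moments with unequal powers vanish, so only the diagonal `i = j` survives; its terms are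
  -- the coefficients of the Hermite polynomial.
  have h2 : ∀ i ∈ Finset.range (k + 1), (∑ j ∈ Finset.range (l + 1),
      ((-1) ^ j * x ^ (k - i) * conj x ^ (l - j) * (k.choose i : ℂ) * (l.choose j : ℂ)) *
        (if i = j then (i.factorial : ℂ) * R ^ i else 0)) =
      if i ∈ Finset.range (l + 1) then ((-1) ^ i * x ^ (k - i) * conj x ^ (l - i) * (k.choose i : ℂ) *
        (l.choose i : ℂ)) * ((i.factorial : ℂ) * R ^ i) else 0 := by
    intro i _
    simp_rw [mul_ite, mul_zero]
    rw [Finset.sum_ite_eq]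
  rw [Finset.sum_congr rfl h2, ← Finset.sum_filter, herm]
  refine Finset.sum_congr ?_ fun m _ => ?_
  · ext m; simp only [Finset.mem_range, Finset.mem_filter]; omega
  · rw [smul_eq_mul, neg_pow]; ring

/-! ### Moment bounds for Hermite polynomials of Gaussian trigonometric polynomials -/

variable {ι : Type*} [Fintype ι]

/-- The trigonometric polynomial `∑ i, a i • e_{mode i}`. -/
def trigPoly (mode : ι → Mode) (a : ι → ℂ) : C(Torus, ℂ) := ∑ i, a i • UnitAddTorus.mFourier (mode i)

lemma trigPoly_apply (mode : ι → Mode) (a : ι → ℂ) (x : Torus) :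
    trigPoly mode a x = ∑ i, a i * UnitAddTorus.mFourier (mode i) x := by
  simp [trigPoly, ContinuousMap.sum_apply]

/-- The Wick-type polynomial `H_{k,l}(∑ i, c_i z_i e_{mode i}, ∑ i, |c_i|²)`. -/
def hermTrig (mode : ι → Mode) (k l : ℕ) (c z : ι → ℂ) : C(Torus, ℂ) :=
  herm k l (trigPoly mode (c * z)) (star (trigPoly mode (c * z))) ((∑ i, ‖c i‖ ^ 2 : ℝ) : ℂ)

lemma herm_continuousMap_apply (k l : ℕ) (f g : C(Torus, ℂ)) (c : ℂ) (x : Torus) :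
    herm k l f g c x = herm k l (f x) (g x) c := by
  simp [herm, ContinuousMap.sum_apply]

section

variable {k l : ℕ}

/-- The coefficients of the decoupled chaos of `hermTrig`. -/
def chaosCoeff (c : ι → ℂ) (p : (Fin k → ι) × (Fin l → ι)) : ℂ :=
  (∏ i, c (p.1 i)) * ∏ j, conj (c (p.2 j))

/-- The total frequency of a chaos component. -/
def totalMode (mode : ι → Mode) (p : (Fin k → ι) × (Fin l → ι)) : Mode :=
  ∑ i, mode (p.1 i) - ∑ j, mode (p.2 j)

lemma mFourier_sum_apply {A : Type*} (s : Finset A) (f : A → Mode) (x : Torus) :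
    UnitAddTorus.mFourier (∑ i ∈ s, f i) x = ∏ i ∈ s, UnitAddTorus.mFourier (f i) x := by
  classical
  induction s using Finset.induction_on with
  | empty => simp [UnitAddTorus.mFourier_zero]
  | insert a s ha ih => rw [Finset.sum_insert ha, Finset.prod_insert ha, UnitAddTorus.mFourier_add, ih]

lemma mFourier_totalMode (mode : ι → Mode) (p : (Fin k → ι) × (Fin l → ι)) (x : Torus) :
    UnitAddTorus.mFourier (totalMode mode p) x = (∏ i, UnitAddTorus.mFourier (mode (p.1 i)) x) *
      ∏ j, conj (UnitAddTorus.mFourier (mode (p.2 j)) x) := by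
  rw [totalMode, sub_eq_add_neg, UnitAddTorus.mFourier_add, UnitAddTorus.mFourier_neg,
    mFourier_sum_apply, mFourier_sum_apply, map_prod]

lemma norm_mFourier_apply_eq_one (m : Mode) (x : Torus) : ‖UnitAddTorus.mFourier m x‖ = 1 :=
  norm_mFourier_apply m x

lemma integrable_decoupled_shift (b : (Fin k → ι) × (Fin l → ι) → ℂ) (z : ι → ℂ) :
    Integrable (fun y => decoupled b (z + y, z - y)) (stdCPi ι) := by
  refine integrable_of_poly_bound (C := (∑ p, ‖b p‖) * (1 + ‖z‖) ^ (k + l)) (N := k + l)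
    ((continuous_decoupled b).comp (by fun_prop)) fun y => ?_
  refine (norm_decoupled_le b _).trans ?_
  rw [mul_assoc, ← mul_pow, Fintype.card_fin, Fintype.card_fin]
  have h1 : ‖(z + y, z - y)‖ ≤ ‖z‖ + ‖y‖ := max_le (norm_add_le _ _) (norm_sub_le _ _)
  gcongr
  nlinarith [norm_nonneg z, norm_nonneg y]

lemma integrable_shift_monomial (I : Fin k → ι) (J : Fin l → ι) (z : ι → ℂ) :
    Integrable (fun y : ι → ℂ => (∏ i, (z + y) (I i)) * ∏ j, conj ((z - y) (J j))) (stdCPi ι) := by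
  classical
  have h := integrable_decoupled_shift (fun p : (Fin k → ι) × (Fin l → ι) => if p = (I, J) then 1 else 0) z
  simpa [decoupled] using h

/-- At a fixed point `x` the phases `e_m(x)` are absorbed into the coefficients without changing the
variance, and `herm_eq_integral` applies. The result is the Fourier expansion of the Wick
polynomial, so that Littlewood–Paley multipliers act termwise. -/
lemma hermTrig_eq_sum (mode : ι → Mode) (c z : ι → ℂ) : hermTrig mode k l c z =
    ∑ p : (Fin k → ι) × (Fin l → ι), (chaosCoeff c p * ∫ y, (∏ i, (z + y) (p.1 i)) *
      ∏ j, conj ((z - y) (p.2 j)) ∂stdCPi ι) • UnitAddTorus.mFourier (totalMode mode p) := by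
  ext x
  set c' : ι → ℂ := fun i => c i * UnitAddTorus.mFourier (mode i) x
  have h1 : trigPoly mode (c * z) x = lin c' z := by
    rw [trigPoly_apply, lin]
    exact Finset.sum_congr rfl fun i _ => by simp only [Pi.mul_apply, c']; ring
  have h2 : ∑ i, ‖c i‖ ^ 2 = ∑ i, ‖c' i‖ ^ 2 :=
    Finset.sum_congr rfl fun i _ => by simp only [c']; rw [norm_mul, norm_mFourier_apply, mul_one]
  have h3 : ∀ y, (lin c' z + lin c' y) ^ k * conj (lin c' z - lin c' y) ^ l =
      ∑ p : (Fin k → ι) × (Fin l → ι), (chaosCoeff c p * UnitAddTorus.mFourier (totalMode mode p) x) *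
        ((∏ i, (z + y) (p.1 i)) * ∏ j, conj ((z - y) (p.2 j))) := by
    intro y
    rw [← lin_add, ← lin_sub, lin, lin, map_sum, Fintype.sum_pow, Fintype.sum_pow,
      Finset.sum_mul_sum, Fintype.sum_prod_type]
    refine Finset.sum_congr rfl fun I _ => Finset.sum_congr rfl fun J _ => ?_
    simp only [map_mul, Finset.prod_mul_distrib, mFourier_totalMode, chaosCoeff, c']
    ring
  rw [hermTrig, herm_continuousMap_apply, ContinuousMap.star_apply, h1, h2]
  refine (herm_eq_integral c' k l (lin c' z)).trans ?_
  simp_rw [h3]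
  rw [integral_finsetSum _ fun p _ => (integrable_shift_monomial p.1 p.2 z).const_mul _,
    ContinuousMap.sum_apply]
  refine Finset.sum_congr rfl fun p _ => ?_
  rw [integral_const_mul, ContinuousMap.smul_apply, smul_eq_mul]
  ring

end

/-- The Littlewood–Paley blocks of a continuous function. -/
def blockFun (χ : DyadicPartition) (j : ℕ) : C(Torus, ℂ) →ₗ[ℂ] C(Torus, ℂ) := (χ.block j).comp fc

lemma blockFun_mFourier (χ : DyadicPartition) (j : ℕ) (m : Mode) :
    blockFun χ j (UnitAddTorus.mFourier m) = (χ.mult j m : ℂ) • UnitAddTorus.mFourier m := by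
  refine fc_injective ?_
  funext q
  rw [blockFun, LinearMap.comp_apply, χ.fc_block, map_smul, fc_mFourier]
  by_cases h : q = m
  · subst h; simp
  · simp [Pi.single_eq_of_ne h]

lemma blockFun_hermTrig_apply (χ : DyadicPartition) (j k l : ℕ) (mode : ι → Mode) (c z : ι → ℂ)
    (x : Torus) : blockFun χ j (hermTrig mode k l c z) x =
    ∫ y, decoupled (fun p : (Fin k → ι) × (Fin l → ι) => (χ.mult j (totalMode mode p) : ℂ) *
      UnitAddTorus.mFourier (totalMode mode p) x * chaosCoeff c p) (z + y, z - y) ∂stdCPi ι := by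
  rw [hermTrig_eq_sum, map_sum, ContinuousMap.sum_apply]
  simp only [decoupled]
  rw [integral_finsetSum _ fun p _ => (integrable_shift_monomial p.1 p.2 z).const_mul _]
  refine Finset.sum_congr rfl fun p _ => ?_
  rw [map_smul, blockFun_mFourier, integral_const_mul]
  simp only [ContinuousMap.smul_apply, smul_eq_mul]
  ring

lemma decoupled_smul_smul {k l : ℕ} (b : (Fin k → ι) × (Fin l → ι) → ℂ) (r s : ℝ)
    (u v : ι → ℂ) : decoupled b (r • u, s • v) = (r ^ k * s ^ l : ℝ) * decoupled b (u, v) := by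
  simp only [decoupled, Pi.smul_apply, Complex.real_smul, map_mul, Complex.conj_ofReal,
    Finset.prod_mul_distrib, Finset.prod_const, Finset.card_univ, Fintype.card_fin]
  rw [Finset.mul_sum]
  refine Finset.sum_congr rfl fun p _ => ?_
  push_cast
  ring

lemma decoupled_sub {A B : Type*} [Fintype A] [Fintype B] [DecidableEq A] [DecidableEq B]
    (b b' : (A → ι) × (B → ι) → ℂ) (w : (ι → ℂ) × (ι → ℂ)) :
    decoupled (fun p => b p - b' p) w = decoupled b w - decoupled b' w := by
  simp only [decoupled, sub_mul, Finset.sum_sub_distrib]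

lemma integral_id_stdCPi : ∫ z, id z ∂stdCPi ι = 0 := by
  classical
  have hint : Integrable (id : (ι → ℂ) → ι → ℂ) (stdCPi ι) :=
    (IsGaussian.memLp_id (stdCPi ι) 1 (by simp)).integrable le_rfl
  funext i
  rw [eval_integral (fun i => hint.eval i)]
  have := integral_monomial_eq_zero (ι := ι) (A := Fin 1) (B := Fin 0) (fun _ => i) Fin.elim0
    (by simp)
  simpa using this

lemma integrable_pow_decoupled {k l : ℕ} (n : ℕ) (b : (Fin k → ι) × (Fin l → ι) → ℂ) :
    Integrable (fun w => ‖decoupled b w‖ ^ n) ((stdCPi ι).prod (stdCPi ι)) := by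
  have := continuous_decoupled b
  refine integrable_of_poly_bound (C := (∑ p, ‖b p‖) ^ n) (N := (k + l) * n) (by fun_prop)
    fun w => ?_
  rw [norm_pow, norm_norm, pow_mul, ← mul_pow]
  gcongr
  simpa using norm_decoupled_le b w

/-- Rotation invariance of a product of two copies of a centered Gaussian, at the angle `π / 4`:
normalized sum and difference are again independent and standard. -/
lemma map_rotation_stdCPi : ((stdCPi ι).prod (stdCPi ι)).map
    (fun w => ((Real.sqrt 2)⁻¹ • (w.1 + w.2), (Real.sqrt 2)⁻¹ • (w.2 - w.1))) =
    (stdCPi ι).prod (stdCPi ι) := by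
  have h := IsGaussian.map_rotation_eq_self (μ := stdCPi ι) integral_id_stdCPi (Real.pi / 4)
  have h2 : Real.sqrt 2 / 2 = (Real.sqrt 2)⁻¹ := by
    rw [div_eq_iff two_ne_zero]
    field_simp
    norm_num
  convert h using 2
  funext w
  rw [ContinuousLinearMap.rotation_apply, Real.cos_pi_div_four, Real.sin_pi_div_four, h2]
  simp only [smul_add, smul_sub, neg_smul]
  rw [sub_eq_neg_add]

lemma pow_norm_integral_le {X : Type*} [MeasurableSpace X] {ν : Measure X} [IsProbabilityMeasure ν]
    {f : X → ℂ} (n : ℕ) (hf : Integrable f ν) (hfn : Integrable (fun x => ‖f x‖ ^ n) ν) :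
    ‖∫ x, f x ∂ν‖ ^ n ≤ ∫ x, ‖f x‖ ^ n ∂ν := by
  calc ‖∫ x, f x ∂ν‖ ^ n ≤ (∫ x, ‖f x‖ ∂ν) ^ n := by gcongr; exact norm_integral_le_integral_norm _
    _ ≤ ∫ x, ‖f x‖ ^ n ∂ν :=
      (convexOn_pow n).map_integral_le (continuous_pow n).continuousOn isClosed_Ici
        (.of_forall fun x => norm_nonneg _) hf.norm hfn

/-- Moments of a Littlewood–Paley block of a difference of two `hermTrig`s. -/
lemma integral_pow_blockFun_hermTrig_le (χ : DyadicPartition) (j k l n : ℕ) (mode : ι → Mode)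
    (c c' : ι → ℂ) (x : Torus) :
    Integrable (fun z => ‖blockFun χ j (hermTrig mode k l c z - hermTrig mode k l c' z) x‖ ^ (2 * n))
      (stdCPi ι) ∧
    ∫ z, ‖blockFun χ j (hermTrig mode k l c z - hermTrig mode k l c' z) x‖ ^ (2 * n) ∂stdCPi ι ≤
      2 ^ ((k + l) * n) * ((n * k).factorial * (n * l).factorial : ℝ) *
        (∑ p : (Fin k → ι) × (Fin l → ι), χ.mult j (totalMode mode p) ^ 2 *
          ‖chaosCoeff c p - chaosCoeff c' p‖ ^ 2) ^ n := by
  set b : (Fin k → ι) × (Fin l → ι) → ℂ := fun p => (χ.mult j (totalMode mode p) : ℂ) *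
      UnitAddTorus.mFourier (totalMode mode p) x * (chaosCoeff c p - chaosCoeff c' p)
  set Q := stdCPi ι
  have h1 : ∀ z, blockFun χ j (hermTrig mode k l c z - hermTrig mode k l c' z) x =
      ∫ y, decoupled b (z + y, z - y) ∂Q := by
    intro z
    rw [map_sub, ContinuousMap.sub_apply, blockFun_hermTrig_apply, blockFun_hermTrig_apply,
      ← integral_sub (integrable_decoupled_shift _ z) (integrable_decoupled_shift _ z)]
    refine integral_congr_ae (.of_forall fun y => ?_)
    simp only [b, mul_sub]
    rw [← decoupled_sub]
  have hs : Real.sqrt 2 * (Real.sqrt 2)⁻¹ = 1 := mul_inv_cancel₀ (by positivity)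
  -- Up to sign, `(z + y, z - y)` is `√2` times a rotation of `(z, y)`. By homogeneity of degree
  -- `(k, l)` the factor is `2 ^ ((k + l) * n)` and the sign disappears in the norm.
  have h2 : ∀ w : (ι → ℂ) × (ι → ℂ), ‖decoupled b (w.1 + w.2, w.1 - w.2)‖ ^ (2 * n) =
      2 ^ ((k + l) * n) * ‖decoupled b ((Real.sqrt 2)⁻¹ • (w.1 + w.2),
        (Real.sqrt 2)⁻¹ • (w.2 - w.1))‖ ^ (2 * n) := by
    intro w
    have e1 : (w.1 + w.2, w.1 - w.2) = (Real.sqrt 2 • (Real.sqrt 2)⁻¹ • (w.1 + w.2),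
        (-Real.sqrt 2) • (Real.sqrt 2)⁻¹ • (w.2 - w.1)) := by
      rw [smul_smul, smul_smul, hs, neg_mul, hs, one_smul, neg_one_smul, neg_sub]
    rw [e1, decoupled_smul_smul, norm_mul, mul_pow, Complex.norm_real, Real.norm_eq_abs, abs_mul,
      abs_pow, abs_pow, abs_neg, ← pow_add, ← pow_mul,
      abs_of_nonneg (Real.sqrt_nonneg 2)]
    congr 1
    rw [show (k + l) * (2 * n) = 2 * ((k + l) * n) by ring, pow_mul, Real.sq_sqrt zero_le_two]
  have hmeas : Measurable fun w : (ι → ℂ) × (ι → ℂ) =>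
      ((Real.sqrt 2)⁻¹ • (w.1 + w.2), (Real.sqrt 2)⁻¹ • (w.2 - w.1)) := by fun_prop
  have hcont : Continuous fun w : (ι → ℂ) × (ι → ℂ) => ‖decoupled b w‖ ^ (2 * n) :=
    (continuous_decoupled b).norm.pow _
  have hI := integrable_pow_decoupled (2 * n) b
  have h3 : Integrable (fun w : (ι → ℂ) × (ι → ℂ) => ‖decoupled b (w.1 + w.2, w.1 - w.2)‖ ^ (2 * n))
      (Q.prod Q) := by
    simp_rw [h2]
    refine Integrable.const_mul ?_ _
    rw [← map_rotation_stdCPi] at hI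
    exact (integrable_map_measure hcont.aestronglyMeasurable hmeas.aemeasurable).1 hI
  have h4 : ∫ w, ‖decoupled b (w.1 + w.2, w.1 - w.2)‖ ^ (2 * n) ∂Q.prod Q =
      2 ^ ((k + l) * n) * ∫ w, ‖decoupled b w‖ ^ (2 * n) ∂Q.prod Q := by
    simp_rw [h2]
    rw [integral_const_mul]
    conv_rhs => rw [← map_rotation_stdCPi]
    rw [integral_map hmeas.aemeasurable hcont.aestronglyMeasurable]
  -- Jensen's inequality for the average over the auxiliary copy `y`; afterwards both vectors are
  -- integrated together.
  have h5 : ∀ z, ‖∫ y, decoupled b (z + y, z - y) ∂Q‖ ^ (2 * n) ≤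
      ∫ y, ‖decoupled b (z + y, z - y)‖ ^ (2 * n) ∂Q := by
    intro z
    refine pow_norm_integral_le _ (integrable_decoupled_shift b z) ?_
    refine integrable_of_poly_bound (C := ((∑ p, ‖b p‖) * (1 + ‖z‖) ^ (k + l)) ^ (2 * n))
      (N := (k + l) * (2 * n)) (hcont.comp (by fun_prop)) fun y => ?_
    rw [norm_pow, norm_norm, pow_mul (1 + ‖y‖), ← mul_pow]
    gcongr
    refine (norm_decoupled_le b _).trans ?_
    rw [mul_assoc, ← mul_pow, Fintype.card_fin, Fintype.card_fin]
    have h1 : ‖(z + y, z - y)‖ ≤ ‖z‖ + ‖y‖ := max_le (norm_add_le _ _) (norm_sub_le _ _)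
    gcongr
    nlinarith [norm_nonneg z, norm_nonneg y]
  have hm : AEStronglyMeasurable (fun z => ‖∫ y, decoupled b (z + y, z - y) ∂Q‖ ^ (2 * n)) Q := by
    refine (AEStronglyMeasurable.norm ?_).pow _
    have : Continuous fun w : (ι → ℂ) × (ι → ℂ) => decoupled b (w.1 + w.2, w.1 - w.2) :=
      (continuous_decoupled b).comp (by fun_prop)
    exact (this.aestronglyMeasurable (μ := Q.prod Q)).integral_prod_right'
  simp_rw [h1]
  have h6 : Integrable (fun z => ‖∫ y, decoupled b (z + y, z - y) ∂Q‖ ^ (2 * n)) Q := by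
    refine h3.integral_prod_left.mono hm (.of_forall fun z => ?_)
    rw [norm_pow, norm_norm]
    exact (h5 z).trans (le_abs_self _)
  refine ⟨h6, ?_⟩
  calc ∫ z, ‖∫ y, decoupled b (z + y, z - y) ∂Q‖ ^ (2 * n) ∂Q
      ≤ ∫ z, ∫ y, ‖decoupled b (z + y, z - y)‖ ^ (2 * n) ∂Q ∂Q :=
        integral_mono h6 h3.integral_prod_left h5
    _ = ∫ w, ‖decoupled b (w.1 + w.2, w.1 - w.2)‖ ^ (2 * n) ∂Q.prod Q := (integral_prod _ h3).symm
    _ ≤ _ := by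
        rw [h4, mul_assoc]
        refine mul_le_mul_of_nonneg_left ?_ (by positivity)
        refine (integral_pow_decoupled_le n b).trans_eq ?_
        rw [Fintype.card_fin, Fintype.card_fin]
        congr 2
        refine Finset.sum_congr rfl fun p _ => ?_
        simp only [b]
        rw [norm_mul, norm_mul, norm_mFourier_apply, Complex.norm_real, mul_one, mul_pow,
          Real.norm_eq_abs, sq_abs]

/-! ### Trigonometric polynomials and a Bernstein inequality -/

/-- The trigonometric polynomials with frequencies in the ball of radius `r`. -/
def Trig (r : ℝ) : Submodule ℂ C(Torus, ℂ) where
  carrier := {f | ∀ m ∉ ball r, fc f m = 0}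
  zero_mem' m _ := by rw [map_zero]; rfl
  add_mem' {f g} hf hg m hm := by rw [map_add, Pi.add_apply, hf m hm, hg m hm, add_zero]
  smul_mem' c f hf m hm := by rw [map_smul, Pi.smul_apply, hf m hm, smul_zero]

lemma mFourier_mem_Trig {r : ℝ} {m : Mode} (hm : ‖freq m‖ ≤ r) : UnitAddTorus.mFourier m ∈ Trig r := by
  intro q hq
  rw [fc_mFourier, Pi.single_eq_of_ne]
  rintro rfl
  exact hq (mem_ball.2 hm)

lemma Trig_mono {r s : ℝ} (h : r ≤ s) : Trig r ≤ Trig s := fun _ hf m hm =>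
  hf m fun hm' => hm (mem_ball.2 ((mem_ball.1 hm').trans h))

lemma one_mem_Trig {r : ℝ} (hr : 0 ≤ r) : (1 : C(Torus, ℂ)) ∈ Trig r := by
  rw [← UnitAddTorus.mFourier_zero]
  exact mFourier_mem_Trig (by rwa [freq_zero, norm_zero])

lemma mul_mem_Trig {r s : ℝ} {f g : C(Torus, ℂ)} (hf : f ∈ Trig r) (hg : g ∈ Trig s) :
    f * g ∈ Trig (r + s) := by
  rw [eq_sum_fc hf, Finset.sum_mul]
  refine Submodule.sum_mem _ fun m hm => ?_
  rw [smul_mul_assoc]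
  refine Submodule.smul_mem _ _ fun q hq => ?_
  rw [fc_mul_mFourier]
  refine hg _ fun h => hq (mem_ball.2 ?_)
  have h1 := mem_ball.1 hm
  have h2 := mem_ball.1 h
  rw [freq_sub] at h2
  calc ‖freq q‖ = ‖freq m + (freq q - freq m)‖ := by rw [add_sub_cancel]
    _ ≤ r + s := (norm_add_le _ _).trans (add_le_add h1 h2)

lemma pow_mem_Trig {r : ℝ} {f : C(Torus, ℂ)} (hf : f ∈ Trig r) (n : ℕ) :
    f ^ n ∈ Trig (n * r) := by
  induction n with
  | zero => simpa using one_mem_Trig le_rfl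
  | succ n ih =>
    rw [pow_succ]
    convert mul_mem_Trig ih hf using 2
    push_cast; ring

lemma star_mFourier (m : Mode) : star (UnitAddTorus.mFourier m) = UnitAddTorus.mFourier (-m) := by
  ext x
  rw [ContinuousMap.star_apply, UnitAddTorus.mFourier_neg]
  rfl

lemma star_mem_Trig {r : ℝ} {f : C(Torus, ℂ)} (hf : f ∈ Trig r) : star f ∈ Trig r := by
  rw [eq_sum_fc hf, star_sum]
  refine Submodule.sum_mem _ fun m hm => ?_
  rw [star_smul, star_mFourier]
  exact Submodule.smul_mem _ _ (mFourier_mem_Trig (by rw [freq_neg, norm_neg]; exact mem_ball.1 hm))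

lemma herm_mem_Trig {r : ℝ} (hr : 0 ≤ r) {f g : C(Torus, ℂ)} (hf : f ∈ Trig r) (hg : g ∈ Trig r)
    (k l : ℕ) (c : ℂ) : herm k l f g c ∈ Trig ((k + l) * r) := by
  refine Submodule.sum_mem _ fun m _ => Submodule.smul_mem _ _ ?_
  refine Trig_mono ?_ (mul_mem_Trig (pow_mem_Trig hf (k - m)) (pow_mem_Trig hg (l - m)))
  rw [← add_mul]
  have h1 : ((k - m : ℕ) : ℝ) ≤ k := by exact_mod_cast Nat.sub_le _ _
  have h2 : ((l - m : ℕ) : ℝ) ≤ l := by exact_mod_cast Nat.sub_le _ _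
  gcongr

lemma sq_norm_le_of_mem_Trig {r : ℝ} (hr : 0 ≤ r) {f : C(Torus, ℂ)} (hf : f ∈ Trig r) :
    ‖f‖ ^ 2 ≤ (2 * r + 1) ^ 2 * ∫ x, ‖f x‖ ^ 2 ∂torusMeasure := by
  calc ‖f‖ ^ 2 ≤ (∑ m ∈ ball r, ‖fc f m‖) ^ 2 := by gcongr; exact norm_le_sum_fc hf
    _ ≤ (ball r).card * ∑ m ∈ ball r, ‖fc f m‖ ^ 2 := sq_sum_le_card_mul_sum_sq
    _ ≤ _ := by
      gcongr
      · exact card_ball_le hr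
      · exact sum_sq_fc_le f _

/-- The `L²` bound is applied to `f ^ n`, a trigonometric polynomial of degree `n * r`. The `2n`-th
power of the sup norm thus loses only a square of the degree, a loss of regularity `1 / n` that
vanishes for large moments. -/
lemma pow_norm_le_of_mem_Trig {r : ℝ} (hr : 0 ≤ r) {f : C(Torus, ℂ)} (hf : f ∈ Trig r) (n : ℕ) :
    ‖f‖ ^ (2 * n) ≤ (2 * (n * r) + 1) ^ 2 * ∫ x, ‖f x‖ ^ (2 * n) ∂torusMeasure := by
  have h := sq_norm_le_of_mem_Trig (by positivity) (pow_mem_Trig hf n)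
  have h1 : ‖f ^ n‖ = ‖f‖ ^ n := by
    refine le_antisymm ?_ ?_
    · refine (ContinuousMap.norm_le _ (by positivity)).2 fun x => ?_
      rw [ContinuousMap.pow_apply, norm_pow]
      gcongr
      exact f.norm_coe_le_norm x
    · obtain ⟨x, -, hx⟩ := isCompact_univ.exists_isMaxOn Set.univ_nonempty f.continuous.norm.continuousOn
      rw [(f.norm_le_of_nonempty.2 fun y => hx (Set.mem_univ y)).antisymm (f.norm_coe_le_norm x),
        ← norm_pow]
      exact (f ^ n).norm_coe_le_norm x
  rw [h1, ← pow_mul, mul_comm n 2] at h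
  refine h.trans_eq ?_
  congr 2
  funext x
  rw [ContinuousMap.pow_apply, norm_pow, ← pow_mul, mul_comm n 2]

lemma blockFun_mem_Trig (χ : DyadicPartition) (j : ℕ) (f : C(Torus, ℂ)) :
    blockFun χ j f ∈ Trig (3 * 2 ^ j) := by
  intro m hm
  rw [blockFun, LinearMap.comp_apply, χ.fc_block]
  by_cases h : χ.mult j m = 0
  · rw [h, Complex.ofReal_zero, zero_mul]
  · exact absurd (χ.support_mult_subset j (by simpa using h)) hm

lemma pow_norm_blockFun_le (χ : DyadicPartition) (j : ℕ) (f : C(Torus, ℂ)) {n : ℕ} (hn : 1 ≤ n) :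
    ‖blockFun χ j f‖ ^ (2 * n) ≤
      49 * n ^ 2 * 4 ^ j * ∫ x, ‖blockFun χ j f x‖ ^ (2 * n) ∂torusMeasure := by
  refine (pow_norm_le_of_mem_Trig (by positivity) (blockFun_mem_Trig χ j f) n).trans ?_
  refine mul_le_mul_of_nonneg_right ?_ (integral_nonneg fun x => by positivity)
  have h1 : (1 : ℝ) ≤ 2 ^ j := one_le_pow₀ one_le_two
  have h2 : (1 : ℝ) ≤ n := by exact_mod_cast hn
  calc (2 * (n * (3 * 2 ^ j)) + 1 : ℝ) ^ 2 ≤ (7 * n * 2 ^ j) ^ 2 := by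
        gcongr; nlinarith
    _ = _ := by
      rw [mul_pow, mul_pow, ← pow_mul, mul_comm j 2, pow_mul]; norm_num

lemma continuous_fc (m : Mode) : Continuous fun f : C(Torus, ℂ) => fc f m := by
  refine (LinearMap.mkContinuous ((LinearMap.proj m).comp fc) 1 fun f => ?_).continuous
  rw [one_mul]
  exact norm_fc_le f m

lemma continuous_blockFun (χ : DyadicPartition) (j : ℕ) : Continuous (blockFun χ j) := by
  have : ⇑(blockFun χ j) = fun f => ∑ m ∈ (χ.finite_mult j).toFinset,
      ((χ.mult j m : ℂ) * fc f m) • UnitAddTorus.mFourier m := rfl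
  rw [this]
  have := continuous_fc
  fun_prop

lemma continuous_herm {X R : Type*} [TopologicalSpace X] [Ring R] [Algebra ℂ R] [TopologicalSpace R]
    [ContinuousAdd R] [ContinuousMul R] [ContinuousConstSMul ℂ R] {f g : X → R} (hf : Continuous f)
    (hg : Continuous g) (k l : ℕ) (c : ℂ) : Continuous fun x => herm k l (f x) (g x) c := by
  unfold herm
  fun_prop

lemma continuous_hermTrig {ι : Type*} [Fintype ι] (mode : ι → Mode) (k l : ℕ) (c : ι → ℂ) :
    Continuous (hermTrig mode k l c) := by
  have h : Continuous fun z : ι → ℂ => trigPoly mode (c * z) := by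
    unfold trigPoly
    simp only [Pi.mul_apply]
    fun_prop
  exact continuous_herm h (continuous_star.comp h) k l _

/-! ### Sums over modes -/

/-- Every mode is attained at most twice. -/
def AtMostTwo {ι : Type*} [Fintype ι] (mode : ι → Mode) : Prop :=
  ∀ m, (Finset.univ.filter fun i => mode i = m).card ≤ 2

lemma AtMostTwo.add {ι : Type*} [Fintype ι] {mode : ι → Mode} (h : AtMostTwo mode) (q : Mode) :
    AtMostTwo fun i => q + mode i := by
  intro m
  have h1 : ∀ i, q + mode i = m ↔ mode i = m - q := fun i => eq_sub_iff_add_eq'.symm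
  simp_rw [h1]
  exact h (m - q)

lemma AtMostTwo.sum_le {ι : Type*} [Fintype ι] {mode : ι → Mode} (h : AtMostTwo mode)
    {G : Mode → ℝ} (h0 : ∀ m, 0 ≤ G m) (hG : Summable G) : ∑ i, G (mode i) ≤ 2 * ∑' m, G m := by
  classical
  rw [Finset.sum_comp]
  calc ∑ m ∈ Finset.univ.image mode, (Finset.univ.filter fun i => mode i = m).card • G m
      ≤ ∑ m ∈ Finset.univ.image mode, 2 * G m := by
        refine Finset.sum_le_sum fun m _ => ?_
        rw [nsmul_eq_mul]
        gcongr
        · exact h0 m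
        · exact_mod_cast h m
    _ ≤ 2 * ∑' m, G m := by
        rw [← Finset.mul_sum]
        gcongr
        exact hG.sum_le_tsum _ fun m _ => h0 m

/-- Replacing the larger base by the smaller one merges the two exponents, so a product of decays
becomes a sum of two separately summable terms. -/
lemma rpow_neg_mul_rpow_neg_le {u v a b s : ℝ} (hu : 1 ≤ u) (hv : 1 ≤ v) (ha : 0 ≤ a) (hb : 0 ≤ b)
    (hs : s ≤ a + b) : u ^ (-a) * v ^ (-b) ≤ u ^ (-s) + v ^ (-s) := by
  wlog h : u ≤ v generalizing u v a b
  · rw [mul_comm, add_comm]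
    exact this hv hu hb ha (by linarith) (le_of_not_ge h)
  have hu0 : 0 < u := by linarith
  calc u ^ (-a) * v ^ (-b) ≤ u ^ (-a) * u ^ (-b) := by
        exact mul_le_mul_of_nonneg_left (Real.rpow_le_rpow_of_nonpos hu0 h (neg_nonpos.2 hb))
          (Real.rpow_nonneg hu0.le _)
    _ = u ^ (-a + -b) := (Real.rpow_add hu0 _ _).symm
    _ ≤ u ^ (-s) := Real.rpow_le_rpow_of_exponent_le hu (by linarith)
    _ ≤ _ := le_add_of_nonneg_right (by positivity)

/-- A discrete convolution bound. From `br q ≤ u * v` the factor `br q ^ (-δ / 2)` is extracted; the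
exponents left over add up to `2 + 3δ/4`, which exceeds the two-dimensional threshold. -/
lemma sum_br_mul_br_le {δ : ℝ} (hδ : 0 < δ) (hδ1 : δ ≤ 1) : ∃ C : ℝ, 0 ≤ C ∧
    ∀ (ι : Type) [Fintype ι] (mode : ι → Mode), AtMostTwo mode → ∀ (q : Mode) (κ : ℝ), κ ≤ δ / 4 →
      ∑ i, br (q + mode i) ^ (-(2 * δ)) * br (mode i) ^ (-2 + κ) ≤ C * br q ^ (-(2 * (δ / 4))) := by
  have hs : 2 < 2 + δ / 2 := by linarith
  have hsum := summable_br_rpow hs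
  refine ⟨4 * ∑' m, br m ^ (-(2 + δ / 2)), mul_nonneg (by norm_num) (tsum_nonneg fun m =>
    Real.rpow_nonneg (br_pos m).le _), ?_⟩
  intro ι _ mode hm q κ hκ
  have h1 : ∀ i, br (q + mode i) ^ (-(2 * δ)) * br (mode i) ^ (-2 + κ) ≤
      br q ^ (-(2 * (δ / 4))) *
        (br (q + mode i) ^ (-(2 + δ / 2)) + br (mode i) ^ (-(2 + δ / 2))) := by
    intro i
    set u := br (q + mode i)
    set v := br (mode i)
    have hu := one_le_br (q + mode i)
    have hv := one_le_br (mode i)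
    have hu0 := br_pos (q + mode i)
    have hv0 := br_pos (mode i)
    have hw : br q ≤ u * v := by
      have := br_le_add (mode i) q
      rwa [add_comm, mul_comm] at this
    have e1 : u ^ (-(2 * δ)) * v ^ (-2 + δ / 4) = (u * v) ^ (-(2 * (δ / 4))) *
        (u ^ (-(3 * δ / 2)) * v ^ (-(2 - 3 * δ / 4))) := by
      rw [Real.mul_rpow hu0.le hv0.le, mul_mul_mul_comm, ← Real.rpow_add hu0, ← Real.rpow_add hv0]
      congr 2 <;> ring
    calc u ^ (-(2 * δ)) * v ^ (-2 + κ) ≤ u ^ (-(2 * δ)) * v ^ (-2 + δ / 4) := by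
          gcongr
      _ = _ := e1
      _ ≤ _ := by
        refine mul_le_mul (Real.rpow_le_rpow_of_nonpos (br_pos q) hw (by linarith))
          (rpow_neg_mul_rpow_neg_le hu hv (by linarith) (by linarith) (by linarith)) ?_
          (Real.rpow_nonneg (br_pos q).le _)
        exact mul_nonneg (Real.rpow_nonneg hu0.le _) (Real.rpow_nonneg hv0.le _)
  calc _ ≤ _ := Finset.sum_le_sum fun i _ => h1 i
    _ ≤ br q ^ (-(2 * (δ / 4))) * (2 * ∑' m, br m ^ (-(2 + δ / 2)) + 2 * ∑' m, br m ^ (-(2 + δ / 2))) := by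
        rw [← Finset.mul_sum, Finset.sum_add_distrib]
        have := (hm.add q).sum_le (G := fun m => br m ^ (-(2 + δ / 2)))
          (fun m => Real.rpow_nonneg (br_pos m).le _) hsum
        have := hm.sum_le (G := fun m => br m ^ (-(2 + δ / 2)))
          (fun m => Real.rpow_nonneg (br_pos m).le _) hsum
        gcongr
        exact Real.rpow_nonneg (br_pos q).le _
    _ = _ := by ring

/-- The modes are summed out one at a time. Each factor is borderline non-summable by itself, but an
arbitrarily small decay in the total frequency repairs it; the decay exponent shrinks by a factor
`4` per step and stays positive. -/
lemma sum_br_mul_prod_br_le (K : ℕ) {δ : ℝ} (hδ : 0 < δ) (hδ1 : δ ≤ 1) : ∃ δ' C : ℝ, 0 < δ' ∧ δ' ≤ 1 ∧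
    0 ≤ C ∧ ∀ (ι : Type) [Fintype ι] (mode : ι → Mode), AtMostTwo mode → ∀ (q : Mode) (κ : ℝ), κ ≤ δ' →
      ∑ I : Fin K → ι, br (q + ∑ i, mode (I i)) ^ (-(2 * δ)) * ∏ i, br (mode (I i)) ^ (-2 + κ) ≤
        C * br q ^ (-(2 * δ')) := by
  induction K generalizing δ with
  | zero => exact ⟨δ, 1, hδ, hδ1, zero_le_one, fun ι _ mode hm q κ hκ => by simp⟩
  | succ K ih =>
    obtain ⟨δ', C, h1, h2, h3, h4⟩ := ih hδ hδ1
    obtain ⟨C', h5, h6⟩ := sum_br_mul_br_le h1 h2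
    refine ⟨δ' / 4, C * C', by linarith, by linarith, by positivity, fun ι _ mode hm q κ hκ => ?_⟩
    rw [← (Fin.consEquiv fun _ => ι).sum_comp, Fintype.sum_prod_type]
    calc _ ≤ ∑ i, br (mode i) ^ (-2 + κ) * (C * br (q + mode i) ^ (-(2 * δ'))) := by
          refine Finset.sum_le_sum fun i _ => ?_
          refine le_trans (le_of_eq ?_) (mul_le_mul_of_nonneg_left
            (h4 ι mode hm (q + mode i) κ (by linarith)) (Real.rpow_nonneg (br_pos _).le _))
          rw [Finset.mul_sum]
          refine Finset.sum_congr rfl fun I _ => ?_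
          simp only [Fin.consEquiv_apply, Fin.sum_univ_succ, Fin.prod_univ_succ, Fin.cons_zero,
            Fin.cons_succ, add_assoc]
          ring
      _ = C * ∑ i, br (q + mode i) ^ (-(2 * δ')) * br (mode i) ^ (-2 + κ) := by
          rw [Finset.mul_sum]
          exact Finset.sum_congr rfl fun i _ => by ring
      _ ≤ _ := by
          rw [mul_assoc]
          exact mul_le_mul_of_nonneg_left (h6 ι mode hm q κ hκ) h3

/-- The variance of a Wick power of any order, measured with the negative regularity `-δ`, is
finite. The antiholomorphic modes are summed first, then the holomorphic ones, ending at `q = 0`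
where the bracket is `1`. -/
lemma sum_br_totalMode_le (k l : ℕ) {δ : ℝ} (hδ : 0 < δ) (hδ1 : δ ≤ 1) : ∃ κ₀ C : ℝ, 0 < κ₀ ∧ κ₀ ≤ 1 ∧
    0 ≤ C ∧ ∀ (ι : Type) [Fintype ι] (mode : ι → Mode), AtMostTwo mode → ∀ κ : ℝ, κ ≤ κ₀ →
      ∑ p : (Fin k → ι) × (Fin l → ι), br (totalMode mode p) ^ (-(2 * δ)) *
        ((∏ i, br (mode (p.1 i)) ^ (-2 + κ)) * ∏ j, br (mode (p.2 j)) ^ (-2 + κ)) ≤ C := by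
  obtain ⟨δ', C, h1, h2, h3, h4⟩ := sum_br_mul_prod_br_le l hδ hδ1
  obtain ⟨δ'', C', h1', h2', h3', h4'⟩ := sum_br_mul_prod_br_le k h1 h2
  refine ⟨min δ' δ'', C * C', lt_min h1 h1', (min_le_left _ _).trans h2, by positivity,
    fun ι _ mode hm κ hκ => ?_⟩
  rw [Fintype.sum_prod_type]
  calc _ ≤ ∑ I : Fin k → ι, (∏ i, br (mode (I i)) ^ (-2 + κ)) *
        (C * br (-∑ i, mode (I i)) ^ (-(2 * δ'))) := by
        refine Finset.sum_le_sum fun I _ => ?_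
        refine le_trans (le_of_eq ?_) (mul_le_mul_of_nonneg_left
            (h4 ι mode hm (-∑ i, mode (I i)) κ (hκ.trans (min_le_left _ _)))
            (Finset.prod_nonneg fun _ _ => Real.rpow_nonneg (br_pos _).le _))
        rw [Finset.mul_sum]
        refine Finset.sum_congr rfl fun J _ => ?_
        rw [totalMode, ← br_neg, neg_sub, sub_eq_neg_add]
        ring
    _ = C * ∑ I : Fin k → ι, br (0 + ∑ i, mode (I i)) ^ (-(2 * δ')) *
        ∏ i, br (mode (I i)) ^ (-2 + κ) := by
        rw [Finset.mul_sum]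
        exact Finset.sum_congr rfl fun I _ => by rw [br_neg, zero_add]; ring
    _ ≤ C * (C' * br 0 ^ (-(2 * δ''))) := by
        gcongr
        exact h4' ι mode hm 0 κ (hκ.trans (min_le_right _ _))
    _ = C * C' := by rw [br, freq_zero, norm_zero, add_zero, Real.one_rpow, mul_one]

lemma norm_prod_sub_prod_le {A : Type*} (s : Finset A) (a b : A → ℂ) (D : A → ℝ) {ρ : ℝ}
    (hρ : 0 ≤ ρ) (ha : ∀ i, ‖a i‖ ≤ D i) (hb : ∀ i, ‖b i‖ ≤ D i) (hab : ∀ i, ‖a i - b i‖ ≤ ρ * D i) :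
    ‖∏ i ∈ s, a i - ∏ i ∈ s, b i‖ ≤ s.card * ρ * ∏ i ∈ s, D i := by
  classical
  have hD : ∀ i, 0 ≤ D i := fun i => (norm_nonneg _).trans (ha i)
  induction s using Finset.induction_on with
  | empty => simp
  | insert i s hi ih =>
    rw [Finset.prod_insert hi, Finset.prod_insert hi, Finset.prod_insert hi,
      Finset.card_insert_of_notMem hi]
    have h1 : ‖∏ j ∈ s, b j‖ ≤ ∏ j ∈ s, D j := by
      rw [norm_prod]; exact Finset.prod_le_prod (fun _ _ => norm_nonneg _) fun j _ => hb j
    have h2 : 0 ≤ ∏ j ∈ s, D j := Finset.prod_nonneg fun j _ => hD j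
    calc ‖a i * ∏ j ∈ s, a j - b i * ∏ j ∈ s, b j‖
        = ‖a i * (∏ j ∈ s, a j - ∏ j ∈ s, b j) + (a i - b i) * ∏ j ∈ s, b j‖ := by ring_nf
      _ ≤ D i * (s.card * ρ * ∏ j ∈ s, D j) + ρ * D i * ∏ j ∈ s, D j := by
        refine (norm_add_le _ _).trans ?_
        rw [norm_mul, norm_mul]
        have := hD i
        exact add_le_add (mul_le_mul (ha i) ih (norm_nonneg _) this)
          (mul_le_mul (hab i) h1 (norm_nonneg _) (by positivity))
      _ = _ := by push_cast; ring

lemma norm_chaosCoeff_sub_le {ι : Type*} [Fintype ι] {k l : ℕ} {c c' : ι → ℂ} {D : ι → ℝ} {ρ : ℝ}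
    (hρ : 0 ≤ ρ) (ha : ∀ i, ‖c i‖ ≤ D i) (hb : ∀ i, ‖c' i‖ ≤ D i)
    (hab : ∀ i, ‖c i - c' i‖ ≤ ρ * D i) (p : (Fin k → ι) × (Fin l → ι)) :
    ‖chaosCoeff c p - chaosCoeff c' p‖ ≤
      (k + l) * ρ * ((∏ i, D (p.1 i)) * ∏ j, D (p.2 j)) := by
  have hD : ∀ i, 0 ≤ D i := fun i => (norm_nonneg _).trans (ha i)
  have h1 := norm_prod_sub_prod_le Finset.univ (fun i => c (p.1 i)) (fun i => c' (p.1 i))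
    (fun i => D (p.1 i)) hρ (fun i => ha _) (fun i => hb _) fun i => hab _
  have h2 := norm_prod_sub_prod_le Finset.univ (fun i => conj (c (p.2 i))) (fun i => conj (c' (p.2 i)))
    (fun i => D (p.2 i)) hρ (fun i => (RCLike.norm_conj _).trans_le (ha _))
    (fun i => (RCLike.norm_conj _).trans_le (hb _))
    fun i => by rw [← map_sub, RCLike.norm_conj]; exact hab _
  have h3 : ‖∏ j, conj (c (p.2 j))‖ ≤ ∏ j, D (p.2 j) := by
    rw [norm_prod]
    exact Finset.prod_le_prod (fun _ _ => norm_nonneg _) fun j _ =>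
      (RCLike.norm_conj _).trans_le (ha _)
  have h4 : ‖∏ j, c' (p.1 j)‖ ≤ ∏ j, D (p.1 j) := by
    rw [norm_prod]; exact Finset.prod_le_prod (fun _ _ => norm_nonneg _) fun j _ => hb _
  have h5 : 0 ≤ ∏ j, D (p.1 j) := Finset.prod_nonneg fun j _ => hD _
  have h6 : 0 ≤ ∏ j, D (p.2 j) := Finset.prod_nonneg fun j _ => hD _
  rw [Finset.card_univ, Fintype.card_fin] at h1 h2
  calc _ = ‖(∏ i, c (p.1 i) - ∏ i, c' (p.1 i)) * ∏ j, conj (c (p.2 j)) +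
        (∏ i, c' (p.1 i)) * (∏ j, conj (c (p.2 j)) - ∏ j, conj (c' (p.2 j)))‖ := by
        rw [chaosCoeff, chaosCoeff]; ring_nf
    _ ≤ (k * ρ * ∏ i, D (p.1 i)) * ∏ j, D (p.2 j) + (∏ i, D (p.1 i)) * (l * ρ * ∏ j, D (p.2 j)) := by
        refine (norm_add_le _ _).trans ?_
        rw [norm_mul, norm_mul]
        exact add_le_add (mul_le_mul h1 h3 (norm_nonneg _) (by positivity))
          (mul_le_mul h4 h2 (norm_nonneg _) (by positivity))
    _ = _ := by ring

/-- Uniform moment bounds in the Besov norm for differences of Wick polynomials. -/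
lemma exists_lintegral_besovENorm_hermTrig_le (χ : DyadicPartition) {α : ℝ} (hα : 0 < α) (hα1 : α ≤ 1)
    (k l : ℕ) : ∃ κ₀ : ℝ, 0 < κ₀ ∧ κ₀ ≤ 1 ∧ ∀ n : ℕ, 2 < n * α → ∀ M : ℝ, 0 ≤ M → ∃ C : ℝ≥0,
      ∀ (ι : Type) [Fintype ι] (mode : ι → Mode), AtMostTwo mode → ∀ (c c' : ι → ℂ) (ρ κ : ℝ),
      0 ≤ ρ → κ ≤ κ₀ → (∀ i, ‖c i‖ ≤ M * br (mode i) ^ (-1 + κ / 2)) →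
      (∀ i, ‖c' i‖ ≤ M * br (mode i) ^ (-1 + κ / 2)) →
      (∀ i, ‖c i - c' i‖ ≤ ρ * (M * br (mode i) ^ (-1 + κ / 2))) →
      ∫⁻ z, χ.besovENorm (-α) (fc (hermTrig mode k l c z - hermTrig mode k l c' z)) ^ (2 * n)
        ∂stdCPi ι ≤ C * ENNReal.ofReal ρ ^ (2 * n) := by
  -- Half of the regularity `α` pays for the lattice sum; the other half makes the sum over blocks
  -- converge.
  obtain ⟨κ₀, C₁, hκ₀, hκ₁, hC₁, hsum⟩ := sum_br_totalMode_le k l (half_pos hα) (by linarith)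
  refine ⟨κ₀, hκ₀, hκ₁, fun n hn M hM => ?_⟩
  have hn1 : 1 ≤ n := by
    rcases Nat.eq_zero_or_pos n with h | h
    · rw [h] at hn; norm_num at hn
    · exact h
  set t : ℝ := 2 ^ α
  have ht : 0 < t := Real.rpow_pos_of_pos two_pos _
  set V : ℝ := (k + l) ^ 2 * M ^ (2 * (k + l)) * 3 ^ α * C₁
  set A : ℝ := 2 ^ ((k + l) * n) * ((n * k).factorial * (n * l).factorial : ℝ)
  have hA : 0 ≤ A := by positivity
  have hV : 0 ≤ V := by positivity
  set B : ℝ := t ^ (2 * n) * (49 * n ^ 2) * A * V ^ n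
  have hB : 0 ≤ B := by positivity
  -- Block `j` carries `t ^ (-2 * n * j)` from the Besov weight, `4 ^ j` from the Bernstein
  -- inequality and `t ^ (n * j)` from the chaos sum. The resulting geometric ratio is below one
  -- exactly when `2 < n * α`.
  set q : ℝ := 4 / t ^ n
  have hq0 : 0 ≤ q := by positivity
  have hq1 : q < 1 := by
    rw [div_lt_one (by positivity), ← Real.rpow_natCast, ← Real.rpow_mul zero_le_two]
    calc (4 : ℝ) = 2 ^ (2 : ℝ) := by norm_num
      _ < _ := Real.rpow_lt_rpow_of_exponent_lt one_lt_two (by linarith)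
  refine ⟨Real.toNNReal (B * (1 - q)⁻¹), ?_⟩
  intro ι _ mode hm c c' ρ κ hρ hκ hc hc' hcc'
  set D : ι → ℝ := fun i => M * br (mode i) ^ (-1 + κ / 2)
  have hD2 : ∀ i, D i ^ 2 = M ^ 2 * br (mode i) ^ (-2 + κ) := by
    intro i
    simp only [D]
    rw [mul_pow, ← Real.rpow_natCast (br _ ^ _), ← Real.rpow_mul (br_pos _).le]
    congr 2
    push_cast; ring
  have hVj : ∀ j, ∑ p : (Fin k → ι) × (Fin l → ι), χ.mult j (totalMode mode p) ^ 2 *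
      ‖chaosCoeff c p - chaosCoeff c' p‖ ^ 2 ≤ V * t ^ j * ρ ^ 2 := by
    intro j
    have h1 : ∀ p : (Fin k → ι) × (Fin l → ι), χ.mult j (totalMode mode p) ^ 2 *
        ‖chaosCoeff c p - chaosCoeff c' p‖ ^ 2 ≤ ((k + l) ^ 2 * M ^ (2 * (k + l)) * 3 ^ α) * t ^ j * ρ ^ 2 *
          (br (totalMode mode p) ^ (-(2 * (α / 2))) *
        ((∏ i, br (mode (p.1 i)) ^ (-2 + κ)) * ∏ j, br (mode (p.2 j)) ^ (-2 + κ))) := by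
      intro p
      -- On the support of the multiplier `br ≤ 3 * 2 ^ j`, so the decay `br ^ (-α)` may be inserted
      -- at the price `3 ^ α * t ^ j`.
      have e1 : χ.mult j (totalMode mode p) ^ 2 ≤
          3 ^ α * t ^ j * br (totalMode mode p) ^ (-(2 * (α / 2))) := by
        by_cases h0 : χ.mult j (totalMode mode p) = 0
        · rw [h0, zero_pow two_ne_zero]
          have := Real.rpow_nonneg (br_pos (totalMode mode p)).le (-(2 * (α / 2)))
          positivity
        have e2 := χ.br_le_of_mult_ne_zero h0
        have e3 := χ.mult_mem j (totalMode mode p)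
        calc χ.mult j (totalMode mode p) ^ 2 ≤ 1 := pow_le_one₀ e3.1 e3.2
          _ = br (totalMode mode p) ^ α * br (totalMode mode p) ^ (-(2 * (α / 2))) := by
              rw [← Real.rpow_add (br_pos _), show α + -(2 * (α / 2)) = 0 by ring, Real.rpow_zero]
          _ ≤ (3 * 2 ^ j) ^ α * br (totalMode mode p) ^ (-(2 * (α / 2))) := by
              have := Real.rpow_nonneg (br_pos (totalMode mode p)).le (-(2 * (α / 2)))
              have := (br_pos (totalMode mode p)).le
              gcongr
          _ = _ := by
              rw [Real.mul_rpow (by norm_num) (by positivity), ← Real.rpow_natCast 2 j,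
                ← Real.rpow_mul zero_le_two, mul_comm (j : ℝ), Real.rpow_mul zero_le_two,
                Real.rpow_natCast]
      have e4 : ‖chaosCoeff c p - chaosCoeff c' p‖ ^ 2 ≤ (k + l) ^ 2 * ρ ^ 2 * (M ^ (2 * (k + l)) *
          ((∏ i, br (mode (p.1 i)) ^ (-2 + κ)) * ∏ j, br (mode (p.2 j)) ^ (-2 + κ))) := by
        calc _ ≤ ((k + l) * ρ * ((∏ i, D (p.1 i)) * ∏ j, D (p.2 j))) ^ 2 := by
              gcongr
              exact norm_chaosCoeff_sub_le hρ hc hc' hcc' p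
          _ = _ := by
              rw [mul_pow, mul_pow, mul_pow, ← Finset.prod_pow, ← Finset.prod_pow]
              simp_rw [hD2, Finset.prod_mul_distrib]
              simp only [Finset.prod_const, Finset.card_univ, Fintype.card_fin]
              ring
      have e5 : 0 ≤ ((∏ i, br (mode (p.1 i)) ^ (-2 + κ)) * ∏ j, br (mode (p.2 j)) ^ (-2 + κ)) :=
        mul_nonneg (Finset.prod_nonneg fun _ _ => Real.rpow_nonneg (br_pos _).le _)
          (Finset.prod_nonneg fun _ _ => Real.rpow_nonneg (br_pos _).le _)
      refine (mul_le_mul e1 e4 (by positivity) ?_).trans_eq (by ring)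
      have := Real.rpow_nonneg (br_pos (totalMode mode p)).le (-(2 * (α / 2)))
      positivity
    calc _ ≤ _ := Finset.sum_le_sum fun p _ => h1 p
      _ ≤ ((k + l) ^ 2 * M ^ (2 * (k + l)) * 3 ^ α) * t ^ j * ρ ^ 2 * C₁ := by
        rw [← Finset.mul_sum]
        gcongr
        exact hsum ι mode hm κ hκ
      _ = _ := by ring
  set F : (ι → ℂ) → C(Torus, ℂ) := fun z => hermTrig mode k l c z - hermTrig mode k l c' z
  have hF : Continuous F := (continuous_hermTrig mode k l c).sub (continuous_hermTrig mode k l c')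
  have hG : ∀ j, Continuous fun w : (ι → ℂ) × Torus => blockFun χ j (F w.1) w.2 := fun j =>
    ((continuous_blockFun χ j).comp (hF.comp continuous_fst)).eval continuous_snd
  set a : ℕ → ℝ≥0∞ := fun j => ENNReal.ofReal (((2 : ℝ) ^ (-α * ((j : ℝ) - 1))) ^ (2 * n) *
    (49 * n ^ 2 * 4 ^ j))
  have hpt : ∀ z, χ.besovENorm (-α) (fc (F z)) ^ (2 * n) ≤
      ∑' j, a j * ∫⁻ x, ‖blockFun χ j (F z) x‖ₑ ^ (2 * n) ∂torusMeasure := by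
    intro z
    have h1 : ∀ j, ‖χ.weightedBlocks (-α) (fc (F z)) j‖ₑ ^ (2 * n) ≤
        a j * ∫⁻ x, ‖blockFun χ j (F z) x‖ₑ ^ (2 * n) ∂torusMeasure := by
      intro j
      have e1 : ∫⁻ x, ‖blockFun χ j (F z) x‖ₑ ^ (2 * n) ∂torusMeasure =
          ENNReal.ofReal (∫ x, ‖blockFun χ j (F z) x‖ ^ (2 * n) ∂torusMeasure) := by
        rw [ofReal_integral_eq_lintegral_ofReal]
        · refine lintegral_congr fun x => ?_
          rw [ENNReal.ofReal_pow (norm_nonneg _), ofReal_norm]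
        · exact ((blockFun χ j (F z)).continuous.norm.pow _).integrable_of_hasCompactSupport
            (HasCompactSupport.of_compactSpace _)
        · exact .of_forall fun x => by positivity
      rw [e1, ← ofReal_norm, ← ENNReal.ofReal_pow (norm_nonneg _), ← ENNReal.ofReal_mul (by positivity)]
      refine ENNReal.ofReal_le_ofReal ?_
      rw [χ.norm_weightedBlocks, mul_pow, mul_assoc]
      gcongr
      exact pow_norm_blockFun_le χ j (F z) hn1
    have h2 : Monotone fun x : ℝ≥0∞ => x ^ (2 * n) := fun x y h => by
      show x ^ (2 * n) ≤ y ^ (2 * n)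
      gcongr
    rw [DyadicPartition.besovENorm, h2.map_iSup_of_continuousAt
      (ENNReal.continuous_pow (2 * n)).continuousAt (by simp; omega)]
    exact iSup_le fun j => (h1 j).trans (ENNReal.le_tsum j)
  calc ∫⁻ z, χ.besovENorm (-α) (fc (F z)) ^ (2 * n) ∂stdCPi ι
      ≤ ∫⁻ z, ∑' j, a j * ∫⁻ x, ‖blockFun χ j (F z) x‖ₑ ^ (2 * n) ∂torusMeasure ∂stdCPi ι :=
        lintegral_mono hpt
    _ = ∑' j, a j * ∫⁻ z, ∫⁻ x, ‖blockFun χ j (F z) x‖ₑ ^ (2 * n) ∂torusMeasure ∂stdCPi ι := by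
        have hmeas : ∀ j, Measurable fun z => ∫⁻ x, ‖blockFun χ j (F z) x‖ₑ ^ (2 * n) ∂torusMeasure :=
          fun j => ((hG j).enorm.measurable.pow_const _).lintegral_prod_right'
        rw [lintegral_tsum fun j => ((hmeas j).const_mul _).aemeasurable]
        exact tsum_congr fun j => lintegral_const_mul _ (hmeas j)
    _ ≤ ∑' j : ℕ, ENNReal.ofReal (B * ρ ^ (2 * n) * q ^ j) := by
        refine ENNReal.tsum_le_tsum fun j => ?_
        rw [lintegral_lintegral_swap ((hG j).enorm.measurable.pow_const _).aemeasurable]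
        have e1 : ∀ x, ∫⁻ z, ‖blockFun χ j (F z) x‖ₑ ^ (2 * n) ∂stdCPi ι ≤
            ENNReal.ofReal (A * (V * t ^ j * ρ ^ 2) ^ n) := by
          intro x
          obtain ⟨h1, h2⟩ := integral_pow_blockFun_hermTrig_le χ j k l n mode c c' x
          have e2 : ∫⁻ z, ‖blockFun χ j (F z) x‖ₑ ^ (2 * n) ∂stdCPi ι =
              ENNReal.ofReal (∫ z, ‖blockFun χ j (F z) x‖ ^ (2 * n) ∂stdCPi ι) := by
            rw [ofReal_integral_eq_lintegral_ofReal h1 (.of_forall fun x => by positivity)]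
            refine lintegral_congr fun x => ?_
            rw [ENNReal.ofReal_pow (norm_nonneg _), ofReal_norm]
          rw [e2]
          refine ENNReal.ofReal_le_ofReal (h2.trans ?_)
          have := hVj j
          gcongr
        calc a j * ∫⁻ x, ∫⁻ z, ‖blockFun χ j (F z) x‖ₑ ^ (2 * n) ∂stdCPi ι ∂torusMeasure
            ≤ a j * ∫⁻ _x, ENNReal.ofReal (A * (V * t ^ j * ρ ^ 2) ^ n) ∂torusMeasure := by
              gcongr with x; exact e1 x
          _ = a j * ENNReal.ofReal (A * (V * t ^ j * ρ ^ 2) ^ n) := by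
              rw [lintegral_const, measure_univ, mul_one]
          _ = ENNReal.ofReal (B * ρ ^ (2 * n) * q ^ j) := by
              rw [← ENNReal.ofReal_mul (by positivity)]
              congr 1
              have e3 : (2 : ℝ) ^ (-α * ((j : ℝ) - 1)) = t * (t ^ j)⁻¹ := by
                rw [show -α * ((j : ℝ) - 1) = α + -(α * j) by ring, Real.rpow_add two_pos,
                  Real.rpow_neg zero_le_two, Real.rpow_mul zero_le_two, Real.rpow_natCast]
              rw [e3]
              simp only [B, q, div_pow, mul_pow, inv_pow, ← pow_mul]
              field_simp
              ring
    _ = ENNReal.ofReal (B * ρ ^ (2 * n) * (1 - q)⁻¹) := by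
        rw [← ENNReal.ofReal_tsum_of_nonneg (fun j => by positivity)
          ((summable_geometric_of_lt_one hq0 hq1).mul_left _), tsum_mul_left,
          tsum_geometric_of_lt_one hq0 hq1]
    _ = _ := by
        rw [← ENNReal.ofReal_pow hρ, show B * ρ ^ (2 * n) * (1 - q)⁻¹ =
          (B * (1 - q)⁻¹) * ρ ^ (2 * n) by ring, ENNReal.ofReal_mul
          (mul_nonneg hB (inv_nonneg.2 (by linarith)))]
        rfl

/-! ### Complex Gaussian vectors -/

variable {ι : Type*} [Fintype ι]

lemma exists_re_lin (L : StrongDual ℝ (ι → ℂ)) : ∃ a : ι → ℂ, ∀ x, L x = (lin a x).re := by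
  classical
  refine ⟨fun i => L (Pi.single i 1) - Complex.I * L (Pi.single i Complex.I), fun x => ?_⟩
  have h1 : x = ∑ i, ((x i).re • (Pi.single i (1 : ℂ) : ι → ℂ) + (x i).im • (Pi.single i Complex.I : ι → ℂ)) := by
    conv_lhs => rw [← Finset.univ_sum_single x]
    refine Finset.sum_congr rfl fun i _ => ?_
    rw [← Pi.single_smul, ← Pi.single_smul, ← Pi.single_add]
    congr 1
    simp
  conv_lhs => rw [h1]
  simp only [map_sum, map_add, map_smul, smul_eq_mul, lin, Complex.re_sum]
  refine Finset.sum_congr rfl fun i _ => ?_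
  simp
  ring

lemma integrable_apply_mul {ν : Measure (ι → ℂ)} [IsGaussian ν] (i j : ι) :
    Integrable (fun x => x i * x j) ν ∧ Integrable (fun x => x i * conj (x j)) ν := by
  constructor <;>
  · refine integrable_of_poly_bound (C := 1) (N := 2) (by fun_prop) fun x => ?_
    have h1 := norm_apply_le_one_add x i
    have h2 := norm_apply_le_one_add x j
    simp only [norm_mul, RCLike.norm_conj]
    nlinarith [norm_nonneg (x i), norm_nonneg (x j), norm_nonneg x]

lemma integral_sq_re_lin {ν : Measure (ι → ℂ)} [IsGaussian ν] (a : ι → ℂ) :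
    ∫ x, (lin a x).re ^ 2 ∂ν = ((∑ i, ∑ j, a i * conj (a j) * ∫ x, x i * conj (x j) ∂ν).re +
      (∑ i, ∑ j, a i * a j * ∫ x, x i * x j ∂ν).re) / 2 := by
  have h1 : ∀ x : ι → ℂ, (lin a x).re ^ 2 = (((∑ i, ∑ j, a i * conj (a j) * (x i * conj (x j))) +
      ∑ i, ∑ j, a i * a j * (x i * x j)) / 2 : ℂ).re := by
    intro x
    have e1 : ∑ i, ∑ j, a i * conj (a j) * (x i * conj (x j)) = lin a x * conj (lin a x) := by
      rw [lin, map_sum, Finset.sum_mul_sum]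
      refine Finset.sum_congr rfl fun i _ => Finset.sum_congr rfl fun j _ => ?_
      rw [map_mul]; ring
    have e2 : ∑ i, ∑ j, a i * a j * (x i * x j) = lin a x * lin a x := by
      rw [lin, Finset.sum_mul_sum]
      exact Finset.sum_congr rfl fun i _ => Finset.sum_congr rfl fun j _ => by ring
    rw [e1, e2, ← mul_add]
    generalize lin a x = y
    simp [Complex.add_re]
    ring
  have i1 : ∀ i j, Integrable (fun x : ι → ℂ => a i * conj (a j) * (x i * conj (x j))) ν := fun i j =>
    (integrable_apply_mul i j).2.const_mul _
  have i2 : ∀ i j, Integrable (fun x : ι → ℂ => a i * a j * (x i * x j)) ν := fun i j =>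
    (integrable_apply_mul i j).1.const_mul _
  have i3 : Integrable (fun x : ι → ℂ => ∑ i, ∑ j, a i * conj (a j) * (x i * conj (x j))) ν :=
    integrable_finsetSum _ fun i _ => integrable_finsetSum _ fun j _ => i1 i j
  have i4 : Integrable (fun x : ι → ℂ => ∑ i, ∑ j, a i * a j * (x i * x j)) ν :=
    integrable_finsetSum _ fun i _ => integrable_finsetSum _ fun j _ => i2 i j
  simp_rw [h1]
  refine (integral_re ((i3.add i4).div_const 2)).trans ?_
  simp only [Pi.add_apply]
  rw [integral_div, integral_add i3 i4,
    integral_finsetSum _ fun i _ => integrable_finsetSum _ fun j _ => i1 i j,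
    integral_finsetSum _ fun i _ => integrable_finsetSum _ fun j _ => i2 i j]
  simp_rw [integral_finsetSum _ fun j _ => i1 _ j, integral_finsetSum _ fun j _ => i2 _ j,
    integral_const_mul]
  simp [Complex.add_re]

/-- A centered complex Gaussian vector is determined by its covariance and pseudo-covariance. -/
lemma ext_of_covariance {ν ν' : Measure (ι → ℂ)} [IsGaussian ν] [IsGaussian ν']
    (h0 : ∀ i, ∫ x, x i ∂ν = 0) (h0' : ∀ i, ∫ x, x i ∂ν' = 0)
    (h1 : ∀ i j, ∫ x, x i * conj (x j) ∂ν = ∫ x, x i * conj (x j) ∂ν')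
    (h2 : ∀ i j, ∫ x, x i * x j ∂ν = ∫ x, x i * x j ∂ν') : ν = ν' := by
  have key : ∀ {η : Measure (ι → ℂ)} [IsGaussian η], (∀ i, ∫ x, x i ∂η = 0) →
      ∀ L : StrongDual ℝ (ι → ℂ), ∫ x, L x ∂η = 0 := by
    intro η _ h L
    have hint : Integrable (id : (ι → ℂ) → ι → ℂ) η :=
      (IsGaussian.memLp_id η 1 (by simp)).integrable le_rfl
    have e1 : ∫ x, L (id x) ∂η = L (∫ x, id x ∂η) := L.integral_comp_comm hint
    have e2 : ∫ x, id x ∂η = 0 := by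
      funext i
      rw [eval_integral (fun i => hint.eval i)]
      exact h i
    rw [e2, map_zero] at e1
    exact e1
  -- A centered Gaussian law is determined by the variances of real functionals; these are real
  -- parts of complex linear forms, whose second moments involve only covariance and
  -- pseudo-covariance.
  refine Measure.ext_of_charFunDual ?_
  ext L
  rw [IsGaussian.charFunDual_eq, IsGaussian.charFunDual_eq, integral_complex_ofReal,
    integral_complex_ofReal, key h0, key h0', variance_of_integral_eq_zero (by fun_prop) (key h0 L),
    variance_of_integral_eq_zero (by fun_prop) (key h0' L)]
  obtain ⟨a, ha⟩ := exists_re_lin L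
  simp_rw [ha, integral_sq_re_lin, h1, h2]

lemma integral_apply_stdCPi (i : ι) : ∫ z, z i ∂stdCPi ι = 0 := by
  classical
  simpa using integral_monomial_eq_zero (ι := ι) (A := Fin 1) (B := Fin 0) (fun _ => i) Fin.elim0
    (by simp)

lemma integral_apply_mul_stdCPi (i j : ι) : ∫ z, z i * z j ∂stdCPi ι = 0 := by
  classical
  simpa [Fin.prod_univ_two] using integral_monomial_eq_zero (ι := ι) (A := Fin 2) (B := Fin 0) ![i, j] Fin.elim0
    (by simp)

lemma integral_apply_mul_conj_stdCPi [DecidableEq ι] (i j : ι) :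
    ∫ z, z i * conj (z j) ∂stdCPi ι = if i = j then 1 else 0 := by
  have := integral_monomial_eq_card (ι := ι) (A := Fin 1) (fun _ => i) (fun _ => j)
  simp only [Fin.prod_univ_one] at this
  rw [this]
  by_cases h : i = j
  · subst h
    simp [Finset.filter_true_of_mem, Function.comp_def]
  · have h1 : ∀ σ : Equiv.Perm (Fin 1), ¬ ((fun _ : Fin 1 => i) ∘ σ = fun _ => j) := fun σ hσ =>
      h (congrFun hσ 0)
    simp [h1, h]

/-- Identification of the law of a complex Gaussian vector. -/
lemma map_eq_map_stdCPi {Ω : Type*} [MeasurableSpace Ω] {P : Measure Ω} {ι' : Type*} [Fintype ι']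
    {X : Ω → ι' → ℂ} (hX : HasGaussianLaw X P) (A : ι' → ι → ℂ) (h0 : ∀ i, ∫ ω, X ω i ∂P = 0)
    (h1 : ∀ i j, ∫ ω, X ω i * conj (X ω j) ∂P = ∑ r, A i r * conj (A j r))
    (h2 : ∀ i j, ∫ ω, X ω i * X ω j ∂P = 0) :
    P.map X = (stdCPi ι).map fun z i => lin (A i) z := by
  classical
  have hm := hX.aemeasurable
  have := hX.isGaussian_map
  have hc : Continuous fun (z : ι → ℂ) i => lin (A i) z := continuous_pi fun i => continuous_lin (A i)
  have hg : IsGaussian ((stdCPi ι).map fun z i => lin (A i) z) := by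
    let T : (ι → ℂ) →L[ℝ] (ι' → ℂ) :=
      { toFun := fun z i => lin (A i) z
        map_add' := fun x y => funext fun i => lin_add _ _ _
        map_smul' := fun r x => funext fun i => by
          simp only [lin, Pi.smul_apply, Complex.real_smul, RingHom.id_apply, Finset.mul_sum]
          exact Finset.sum_congr rfl fun _ _ => by ring
        cont := hc }
    exact inferInstanceAs (IsGaussian ((stdCPi ι).map T))
  have i1 : ∀ i : ι, Integrable (fun z : ι → ℂ => z i) (stdCPi ι) := fun i =>
    integrable_of_poly_bound (C := 1) (N := 1) (by fun_prop) fun z => by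
      simpa using norm_apply_le_one_add z i
  refine ext_of_covariance (fun i => ?_) (fun i => ?_) (fun i j => ?_) fun i j => ?_
  · rw [integral_map hm (measurable_pi_apply i).aestronglyMeasurable]; exact h0 i
  · rw [integral_map hc.aemeasurable (measurable_pi_apply i).aestronglyMeasurable]
    simp only [lin]
    rw [integral_finsetSum _ fun r _ => (i1 r).const_mul _]
    simp [integral_const_mul, integral_apply_stdCPi]
  · rw [integral_map hm (by fun_prop), integral_map hc.aemeasurable (by fun_prop), h1]
    have e1 : ∀ z : ι → ℂ, lin (A i) z * conj (lin (A j) z) =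
        ∑ r, ∑ s, (A i r * conj (A j s)) * (z r * conj (z s)) := by
      intro z
      rw [lin, lin, map_sum, Finset.sum_mul_sum]
      refine Finset.sum_congr rfl fun r _ => Finset.sum_congr rfl fun s _ => ?_
      rw [map_mul]; ring
    have i2 : ∀ r s, Integrable (fun z : ι → ℂ => (A i r * conj (A j s)) * (z r * conj (z s)))
        (stdCPi ι) := fun r s => (integrable_apply_mul r s).2.const_mul _
    simp_rw [e1]
    rw [integral_finsetSum _ fun r _ => integrable_finsetSum _ fun s _ => i2 r s]
    simp_rw [integral_finsetSum _ fun s _ => i2 _ s, integral_const_mul,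
      integral_apply_mul_conj_stdCPi]
    simp
  · rw [integral_map hm (by fun_prop), integral_map hc.aemeasurable (by fun_prop), h2]
    have e1 : ∀ z : ι → ℂ, lin (A i) z * lin (A j) z =
        ∑ r, ∑ s, (A i r * A j s) * (z r * z s) := by
      intro z
      rw [lin, lin, Finset.sum_mul_sum]
      exact Finset.sum_congr rfl fun r _ => Finset.sum_congr rfl fun s _ => by ring
    have i2 : ∀ r s, Integrable (fun z : ι → ℂ => (A i r * A j s) * (z r * z s))
        (stdCPi ι) := fun r s => (integrable_apply_mul r s).1.const_mul _
    simp_rw [e1]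
    rw [integral_finsetSum _ fun r _ => integrable_finsetSum _ fun s _ => i2 r s]
    simp_rw [integral_finsetSum _ fun s _ => i2 _ s, integral_const_mul, integral_apply_mul_stdCPi]
    simp

/-! ### Dyadic chaining -/

/-- The largest dyadic number of level `N` below `t`. -/
def dyadicFloor (N : ℕ) (t : ℝ≥0) : ℝ≥0 := (⌊t * 2 ^ N⌋₊ : ℝ≥0) / 2 ^ N

lemma dyadicFloor_le (N : ℕ) (t : ℝ≥0) : dyadicFloor N t ≤ t := by
  rw [dyadicFloor, div_le_iff₀ (by positivity)]
  exact Nat.floor_le (zero_le)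

lemma tendsto_dyadicFloor (t : ℝ≥0) : Tendsto (fun N => dyadicFloor N t) atTop (𝓝 t) := by
  have h1 : Tendsto (fun N : ℕ => t - (1 / 2) ^ N) atTop (𝓝 (t - 0)) :=
    Tendsto.sub tendsto_const_nhds (NNReal.tendsto_pow_atTop_nhds_zero_of_lt_one (by
      rw [← NNReal.coe_lt_coe]; norm_num))
  rw [tsub_zero] at h1
  refine tendsto_of_tendsto_of_tendsto_of_le_of_le h1 tendsto_const_nhds (fun N => ?_)
    fun N => dyadicFloor_le N t
  show t - (1 / 2) ^ N ≤ dyadicFloor N t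
  rw [tsub_le_iff_right, dyadicFloor, one_div, inv_pow, ← one_div, ← add_div, le_div_iff₀ (by positivity)]
  exact (Nat.lt_floor_add_one _).le

section Chaining

variable {E : Type*} [NormedAddCommGroup E]

/-- The increments over dyadic intervals of level `N` in `[0, T]` are at most `C * r ^ N`. -/
def DyadicIncrementsLE (f : ℝ≥0 → E) (T : ℕ) (C r : ℝ) : Prop :=
  ∀ N i : ℕ, i < T * 2 ^ N → ‖f ((i + 1 : ℕ) / 2 ^ N) - f (i / 2 ^ N)‖ ≤ C * r ^ N

variable {f : ℝ≥0 → E} {T : ℕ} {C r : ℝ}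

lemma floor_mul_two_pow_le {t : ℝ≥0} (ht : t ≤ T) (N : ℕ) : ⌊t * 2 ^ N⌋₊ ≤ T * 2 ^ N := by
  refine Nat.floor_le_of_le ?_
  push_cast
  gcongr

lemma DyadicIncrementsLE.norm_sub_le_of_le (h : DyadicIncrementsLE f T C r) (hC : 0 ≤ C) (hr : 0 ≤ r)
    {N a b : ℕ} (hab : a ≤ b) (hba : b ≤ a + 1) (hb : b ≤ T * 2 ^ N) :
    ‖f (b / 2 ^ N) - f (a / 2 ^ N)‖ ≤ C * r ^ N := by
  rcases Nat.eq_or_lt_of_le hab with h1 | h1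
  · rw [h1, sub_self, norm_zero]; positivity
  · have : b = a + 1 := by omega
    subst this
    exact h N a (by omega)

lemma DyadicIncrementsLE.norm_dyadicFloor_succ (h : DyadicIncrementsLE f T C r) (hC : 0 ≤ C)
    (hr : 0 ≤ r) {t : ℝ≥0} (ht : t ≤ T) (N : ℕ) :
    ‖f (dyadicFloor (N + 1) t) - f (dyadicFloor N t)‖ ≤ C * r ^ (N + 1) := by
  set a := ⌊t * 2 ^ N⌋₊
  have h1 : dyadicFloor N t = ((2 * a : ℕ) : ℝ≥0) / 2 ^ (N + 1) := by
    rw [dyadicFloor, pow_succ]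
    push_cast
    rw [mul_comm (2 : ℝ≥0), mul_div_mul_right _ _ two_ne_zero]
  have h2 : (a : ℝ≥0) ≤ t * 2 ^ N := Nat.floor_le (zero_le)
  have h3 : t * 2 ^ N < a + 1 := Nat.lt_floor_add_one _
  rw [h1]
  refine h.norm_sub_le_of_le hC hr (Nat.le_floor ?_) ?_ (floor_mul_two_pow_le ht _)
  · push_cast
    rw [pow_succ, ← mul_assoc, mul_comm (2 : ℝ≥0)]
    gcongr
  · refine Nat.lt_succ_iff.1 ((Nat.floor_lt (zero_le)).2 ?_)
    push_cast
    calc t * 2 ^ (N + 1) = 2 * (t * 2 ^ N) := by rw [pow_succ]; ring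
      _ < 2 * (a + 1) := by gcongr
      _ = _ := by ring

lemma DyadicIncrementsLE.norm_dyadicFloor_sub (h : DyadicIncrementsLE f T C r) (hC : 0 ≤ C)
    (hr : 0 ≤ r) {s t : ℝ≥0} (hst : s ≤ t) (ht : t ≤ T) {N : ℕ} (hN : t ≤ s + (2 ^ N)⁻¹) :
    ‖f (dyadicFloor N t) - f (dyadicFloor N s)‖ ≤ C * r ^ N := by
  refine h.norm_sub_le_of_le hC hr (Nat.floor_mono (by gcongr)) ?_ (floor_mul_two_pow_le ht _)
  rw [← Nat.floor_add_one zero_le]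
  refine Nat.floor_mono ?_
  calc t * 2 ^ N ≤ (s + (2 ^ N)⁻¹) * 2 ^ N := by gcongr
    _ = _ := by rw [add_mul, inv_mul_cancel₀ (by positivity)]

lemma DyadicIncrementsLE.norm_sub_le_of_tendsto (h : DyadicIncrementsLE f T C r) (hC : 0 ≤ C)
    (hr : 0 ≤ r) (hr1 : r < 1) {t : ℝ≥0} (ht : t ≤ T) {y : E}
    (hy : Tendsto (fun N => f (dyadicFloor N t)) atTop (𝓝 y)) (N : ℕ) :
    ‖y - f (dyadicFloor N t)‖ ≤ C / (1 - r) * r ^ N := by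
  have := dist_le_of_le_geometric_of_tendsto r C hr1 (f := fun N => f (dyadicFloor N t)) (fun N => by
    rw [dist_comm, dist_eq_norm]
    refine (h.norm_dyadicFloor_succ hC hr ht N).trans ?_
    exact mul_le_mul_of_nonneg_left (pow_le_pow_of_le_one hr hr1.le N.le_succ) hC) hy N
  rw [dist_comm, dist_eq_norm] at this
  refine this.trans_eq (by ring)

/-- The values at the dyadic floors of `t` form a geometric Cauchy sequence, since consecutive
floors are equal or adjacent. Continuity of the limit holds because times within `2 ^ (-N)` have
equal or adjacent floors at level `N`. -/
lemma exists_continuous_of_dyadicIncrementsLE [CompleteSpace E] {r : ℝ} (hr : 0 ≤ r) (hr1 : r < 1)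
    (h : ∀ T : ℕ, ∃ C, 0 ≤ C ∧ DyadicIncrementsLE f T C r) :
    ∃ g : C(ℝ≥0, E), ∀ t, Tendsto (fun N => f (dyadicFloor N t)) atTop (𝓝 (g t)) := by
  have h1 : ∀ t, ∃ y, Tendsto (fun N => f (dyadicFloor N t)) atTop (𝓝 y) := by
    intro t
    obtain ⟨T, hT⟩ := exists_nat_ge t
    obtain ⟨C, hC, hf⟩ := h T
    refine cauchySeq_tendsto_of_complete (cauchySeq_of_le_geometric r (C * r) hr1 fun N => ?_)
    rw [dist_comm, dist_eq_norm, mul_assoc, ← pow_succ']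
    exact hf.norm_dyadicFloor_succ hC hr hT N
  choose g hg using h1
  refine ⟨⟨g, ?_⟩, hg⟩
  rw [Metric.continuous_iff]
  intro t ε hε
  obtain ⟨T, hT⟩ := exists_nat_ge (t + 1)
  obtain ⟨C, hC, hf⟩ := h T
  have h2 : Tendsto (fun N : ℕ => (2 * (C / (1 - r)) + C) * r ^ N) atTop (𝓝 0) := by
    simpa using (tendsto_pow_atTop_nhds_zero_of_lt_one hr hr1).const_mul (2 * (C / (1 - r)) + C)
  obtain ⟨N, hN⟩ := (h2.eventually (gt_mem_nhds hε)).exists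
  have key : ∀ s t : ℝ≥0, s ≤ t → t ≤ T → t ≤ s + (2 ^ N)⁻¹ → dist (g t) (g s) < ε := by
    intro s t hst ht hts
    refine lt_of_le_of_lt ?_ hN
    rw [dist_eq_norm]
    calc ‖g t - g s‖ = ‖(g t - f (dyadicFloor N t)) - (g s - f (dyadicFloor N s)) +
        (f (dyadicFloor N t) - f (dyadicFloor N s))‖ := by congr 1; abel
      _ ≤ (C / (1 - r) * r ^ N + C / (1 - r) * r ^ N) + C * r ^ N :=
        norm_add_le_of_le (norm_sub_le_of_le (hf.norm_sub_le_of_tendsto hC hr hr1 ht (hg t) N)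
          (hf.norm_sub_le_of_tendsto hC hr hr1 (hst.trans ht) (hg s) N))
          (hf.norm_dyadicFloor_sub hC hr hst ht hts)
      _ = _ := by ring
  refine ⟨min 1 ((2 ^ N)⁻¹), by positivity, fun s hs => ?_⟩
  rw [NNReal.dist_eq] at hs
  have hs1 := abs_lt.1 (hs.trans_le (min_le_left _ _))
  have hs2 := abs_lt.1 (hs.trans_le (min_le_right _ _))
  rcases le_total s t with hst | hst
  · rw [dist_comm]
    refine key s t hst ((le_add_of_nonneg_right zero_le_one).trans hT) ?_
    rw [← NNReal.coe_le_coe]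
    push_cast
    linarith
  · refine key t s hst (le_trans ?_ hT) ?_
    · rw [← NNReal.coe_le_coe]
      push_cast
      linarith
    · rw [← NNReal.coe_le_coe]
      push_cast
      linarith

/-- The weighted sum of powers of dyadic increments. -/
def dyadicSum (p : ℕ) (f : ℝ≥0 → E) (T : ℕ) : ℝ≥0∞ :=
  ∑' N : ℕ, ENNReal.ofReal ((3 / 2) ^ N) *
    ∑ i ∈ Finset.range (T * 2 ^ N), ‖f ((i + 1 : ℕ) / 2 ^ N) - f (i / 2 ^ N)‖ₑ ^ p

/-- The rate of decay in `DyadicIncrementsLE` given by `dyadicSum`. -/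
def dyadicRate (p : ℕ) : ℝ := (2 / 3 : ℝ) ^ (1 / p : ℝ)

lemma dyadicRate_nonneg (p : ℕ) : 0 ≤ dyadicRate p := Real.rpow_nonneg (by norm_num) _

lemma dyadicRate_lt_one {p : ℕ} (hp : p ≠ 0) : dyadicRate p < 1 :=
  Real.rpow_lt_one (by norm_num) (by norm_num) (by positivity)

lemma dyadicIncrementsLE_of_dyadicSum {p : ℕ} (hp : p ≠ 0) (h : dyadicSum p f T ≠ ∞) :
    DyadicIncrementsLE f T ((dyadicSum p f T).toReal ^ (1 / p : ℝ)) (dyadicRate p) := by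
  intro N i hi
  have h1 : ENNReal.ofReal ((3 / 2) ^ N) * ‖f ((i + 1 : ℕ) / 2 ^ N) - f (i / 2 ^ N)‖ₑ ^ p ≤
      dyadicSum p f T := by
    refine le_trans ?_ (ENNReal.le_tsum N)
    gcongr
    exact Finset.single_le_sum (f := fun i : ℕ => ‖f ((i + 1 : ℕ) / 2 ^ N) - f (i / 2 ^ N)‖ₑ ^ p)
      (fun _ _ => zero_le) (Finset.mem_range.2 hi)
  rw [← ofReal_norm, ← ENNReal.ofReal_pow (norm_nonneg _), ← ENNReal.ofReal_mul (by positivity),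
    ENNReal.ofReal_le_iff_le_toReal h] at h1
  have h2 : ‖f ((i + 1 : ℕ) / 2 ^ N) - f (i / 2 ^ N)‖ ^ p ≤ (dyadicSum p f T).toReal * (2 / 3) ^ N := by
    rw [show (2 / 3 : ℝ) = (3 / 2)⁻¹ by norm_num, inv_pow, ← div_eq_mul_inv,
      le_div_iff₀ (by positivity)]
    linarith
  have h3 := Real.rpow_le_rpow (by positivity) h2 (by positivity : (0 : ℝ) ≤ 1 / p)
  rw [one_div, Real.pow_rpow_inv_natCast (norm_nonneg _) hp, Real.mul_rpow (by positivity) (by positivity)]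
    at h3
  refine h3.trans_eq ?_
  rw [dyadicRate, one_div, ← Real.rpow_natCast (2 / 3) N, ← Real.rpow_mul (by norm_num),
    mul_comm (N : ℝ), Real.rpow_mul (by norm_num), Real.rpow_natCast]

variable {Ω : Type*} [MeasurableSpace Ω] {P : Measure Ω}

/-- Level `N` has `T * 2 ^ N` intervals, each contributing at most `K * 4 ^ (-N)`. The weight `(3 /
2) ^ N` leaves the series of `(3 / 4) ^ N` with sum `4`, and being geometric it forces a geometric
decay of the increments. -/
lemma lintegral_dyadicSum_le {p : ℕ} {Y : ℝ≥0 → Ω → E} {T : ℕ} {K : ℝ≥0∞}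
    (hm : ∀ s t, AEMeasurable (fun ω => ‖Y t ω - Y s ω‖ₑ) P)
    (hinc : ∀ s t : ℝ≥0, s ≤ t → t ≤ T → ∫⁻ ω, ‖Y t ω - Y s ω‖ₑ ^ p ∂P ≤ K * (t - s : ℝ≥0) ^ 2) :
    AEMeasurable (fun ω => dyadicSum p (fun t => Y t ω) T) P ∧
    ∫⁻ ω, dyadicSum p (fun t => Y t ω) T ∂P ≤ 4 * T * K := by
  have hm1 : ∀ N i : ℕ, AEMeasurable
      (fun ω => ‖Y ((i + 1 : ℕ) / 2 ^ N) ω - Y (i / 2 ^ N) ω‖ₑ ^ p) P := fun N i => (hm _ _).pow_const _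
  have hm2 : ∀ N : ℕ, AEMeasurable (fun ω => ENNReal.ofReal ((3 / 2) ^ N) *
      ∑ i ∈ Finset.range (T * 2 ^ N), ‖Y ((i + 1 : ℕ) / 2 ^ N) ω - Y (i / 2 ^ N) ω‖ₑ ^ p) P :=
    fun N => (Finset.aemeasurable_fun_sum _ fun i _ => hm1 N i).const_mul _
  refine ⟨AEMeasurable.tsum hm2, ?_⟩
  simp only [dyadicSum]
  rw [lintegral_tsum hm2]
  calc _ ≤ ∑' N : ℕ, (T * K) * ENNReal.ofReal ((3 / 4) ^ N) := by
        refine ENNReal.tsum_le_tsum fun N => ?_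
        rw [lintegral_const_mul'' _ (Finset.aemeasurable_fun_sum _ fun i _ => hm1 N i),
          lintegral_finsetSum' _ fun i _ => hm1 N i]
        have h1 : ∀ i ∈ Finset.range (T * 2 ^ N),
            ∫⁻ ω, ‖Y ((i + 1 : ℕ) / 2 ^ N) ω - Y (i / 2 ^ N) ω‖ₑ ^ p ∂P ≤
              K * ENNReal.ofReal ((1 / 4) ^ N) := by
          intro i hi
          have h2 : ((i + 1 : ℕ) : ℝ≥0) / 2 ^ N - (i : ℝ≥0) / 2 ^ N = (2 ^ N)⁻¹ := by
            rw [← NNReal.sub_div]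
            simp
          refine (hinc _ _ (by gcongr; simp) ?_).trans_eq ?_
          · rw [div_le_iff₀ (by positivity)]
            exact_mod_cast Finset.mem_range.1 hi
          · rw [h2, ← ENNReal.ofReal_coe_nnreal, ← ENNReal.ofReal_pow (by positivity)]
            congr 2
            push_cast
            rw [one_div, inv_pow, inv_pow, ← pow_mul, mul_comm, pow_mul]; norm_num
        calc _ ≤ ENNReal.ofReal ((3 / 2) ^ N) * ∑ _i ∈ Finset.range (T * 2 ^ N),
              K * ENNReal.ofReal ((1 / 4) ^ N) := by gcongr with i hi; exact h1 i hi
          _ = (T * K) * (ENNReal.ofReal ((3 / 2) ^ N) * ENNReal.ofReal (2 ^ N) *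
              ENNReal.ofReal ((1 / 4) ^ N)) := by
              rw [Finset.sum_const, Finset.card_range, nsmul_eq_mul]
              push_cast
              rw [ENNReal.ofReal_pow zero_le_two, ENNReal.ofReal_ofNat]
              ring
          _ = _ := by
              rw [← ENNReal.ofReal_mul (by positivity), ← ENNReal.ofReal_mul (by positivity),
                ← mul_pow, ← mul_pow]
              norm_num
    _ = (T * K) * 4 := by
        rw [ENNReal.tsum_mul_left, ← ENNReal.ofReal_tsum_of_nonneg (fun N => by positivity)
          (summable_geometric_of_lt_one (by norm_num) (by norm_num)),
          tsum_geometric_of_lt_one (by norm_num) (by norm_num)]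
        norm_num
    _ = _ := by ring

/-- Moments of the supremum of a continuous process. -/
lemma exists_lintegral_iSup_le (p : ℕ) (hp : p ≠ 0) (T : ℕ) : ∃ C : ℝ≥0, ∀ {E : Type*}
    [NormedAddCommGroup E] {Ω : Type*} [MeasurableSpace Ω] {P : Measure Ω} {Y : ℝ≥0 → Ω → E} {K : ℝ≥0∞},
    (∀ᵐ ω ∂P, Continuous fun t => Y t ω) → (∀ t, AEMeasurable (fun ω => ‖Y t ω‖ₑ) P) →
    (∀ s t, AEMeasurable (fun ω => ‖Y t ω - Y s ω‖ₑ) P) →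
    (∀ s t : ℝ≥0, s ≤ t → t ≤ T → ∫⁻ ω, ‖Y t ω - Y s ω‖ₑ ^ p ∂P ≤ K * (t - s : ℝ≥0) ^ 2) →
    (∀ t : ℝ≥0, t ≤ T → ∫⁻ ω, ‖Y t ω‖ₑ ^ p ∂P ≤ K) →
    ∫⁻ ω, (⨆ (t : ℝ≥0) (_ : t ≤ T), ‖Y t ω‖ₑ) ^ p ∂P ≤ C * K := by
  set r := dyadicRate p
  have hr := dyadicRate_nonneg p
  have hr1 := dyadicRate_lt_one hp
  have hr2 : 0 < 1 - r := by linarith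
  refine ⟨2 ^ p * ((T + 1) + (Real.toNNReal (1 / (1 - r))) ^ p * (4 * T)), ?_⟩
  intro E _ Ω _ P Y K hc hmY hm hinc h0
  obtain ⟨hS, hS2⟩ := lintegral_dyadicSum_le hm hinc
  have hm0 : ∀ i : ℕ, AEMeasurable (fun ω => ‖Y i ω‖ₑ ^ p) P := fun i => (hmY _).pow_const _
  have hpt : ∀ᵐ ω ∂P, (⨆ (t : ℝ≥0) (_ : t ≤ T), ‖Y t ω‖ₑ) ^ p ≤
      2 ^ p * (∑ i ∈ Finset.range (T + 1), ‖Y i ω‖ₑ ^ p +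
        ENNReal.ofReal (1 / (1 - r)) ^ p * dyadicSum p (fun t => Y t ω) T) := by
    filter_upwards [hc] with ω hω
    set A := ∑ i ∈ Finset.range (T + 1), ‖Y i ω‖ₑ ^ p
    set S := dyadicSum p (fun t => Y t ω) T
    by_cases hSt : S = ∞
    · have : ENNReal.ofReal (1 / (1 - r)) ^ p * S = ∞ := by
        rw [hSt]
        exact ENNReal.mul_top (by simp [hr2])
      rw [this, add_top, ENNReal.mul_top (by simp)]
      exact le_top
    have hH := dyadicIncrementsLE_of_dyadicSum hp hSt
    set C := S.toReal ^ (1 / p : ℝ)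
    have hC : 0 ≤ C := by positivity
    have e1 : ∀ t : ℝ≥0, t ≤ T → ‖Y t ω‖ₑ ≤
        A ^ (1 / p : ℝ) + (ENNReal.ofReal (1 / (1 - r)) ^ p * S) ^ (1 / p : ℝ) := by
      intro t ht
      -- At level `0` the dyadic floor is the integer part, so the path is compared with its values
      -- at finitely many integer times.
      have e2 := hH.norm_sub_le_of_tendsto hC hr hr1 ht
        ((hω.tendsto t).comp (tendsto_dyadicFloor t)) 0
      have e3 : dyadicFloor 0 t = (⌊t⌋₊ : ℝ≥0) := by simp [dyadicFloor]
      rw [e3, pow_zero, mul_one] at e2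
      have e4 : ‖Y (⌊t⌋₊ : ℝ≥0) ω‖ₑ ≤ A ^ (1 / p : ℝ) := by
        rw [one_div, ENNReal.le_rpow_inv_iff (by positivity), ENNReal.rpow_natCast]
        refine Finset.single_le_sum (f := fun i : ℕ => ‖Y i ω‖ₑ ^ p) (fun _ _ => zero_le)
          (Finset.mem_range.2 (Nat.lt_succ_iff.2 (Nat.floor_le_of_le ht)))
      have e5 : ‖Y t ω - Y (⌊t⌋₊ : ℝ≥0) ω‖ₑ ≤
          (ENNReal.ofReal (1 / (1 - r)) ^ p * S) ^ (1 / p : ℝ) := by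
        rw [one_div (p : ℝ), ENNReal.le_rpow_inv_iff (by positivity), ENNReal.rpow_natCast,
          ← ofReal_norm, ← ENNReal.ofReal_toReal hSt, ← ENNReal.ofReal_pow (norm_nonneg _),
          ← ENNReal.ofReal_pow (by positivity), ← ENNReal.ofReal_mul (by positivity)]
        refine ENNReal.ofReal_le_ofReal ?_
        calc ‖Y t ω - Y (⌊t⌋₊ : ℝ≥0) ω‖ ^ p ≤ (C / (1 - r)) ^ p := by gcongr
          _ = (1 / (1 - r)) ^ p * S.toReal := by
            rw [div_eq_mul_one_div, mul_pow, mul_comm]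
            congr 1
            simp only [C]
            rw [one_div, Real.rpow_inv_natCast_pow ENNReal.toReal_nonneg hp]
      calc ‖Y t ω‖ₑ = ‖Y (⌊t⌋₊ : ℝ≥0) ω + (Y t ω - Y (⌊t⌋₊ : ℝ≥0) ω)‖ₑ := by rw [add_sub_cancel]
        _ ≤ _ := (enorm_add_le _ _).trans (add_le_add e4 e5)
    have e6 : ∀ x y : ℝ≥0∞, (x ^ (1 / p : ℝ) + y ^ (1 / p : ℝ)) ^ p ≤ 2 ^ p * (x + y) := by
      intro x y
      have hxy : ∀ z, (z ^ (1 / p : ℝ)) ^ p = z := fun z : ℝ≥0∞ => by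
        rw [one_div, ENNReal.rpow_inv_natCast_pow hp]
      calc (x ^ (1 / p : ℝ) + y ^ (1 / p : ℝ)) ^ p
          ≤ (2 * max (x ^ (1 / p : ℝ)) (y ^ (1 / p : ℝ))) ^ p := by
            gcongr
            rw [two_mul]
            exact add_le_add (le_max_left _ _) (le_max_right _ _)
        _ ≤ 2 ^ p * (x + y) := by
            rw [mul_pow]
            gcongr
            rcases le_total (x ^ (1 / p : ℝ)) (y ^ (1 / p : ℝ)) with h | h
            · rw [max_eq_right h, hxy]; exact le_add_self
            · rw [max_eq_left h, hxy]; exact le_self_add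
    refine le_trans ?_ (e6 _ _)
    gcongr
    exact iSup₂_le e1
  calc _ ≤ _ := lintegral_mono_ae hpt
    _ = 2 ^ p * (∑ i ∈ Finset.range (T + 1), ∫⁻ ω, ‖Y i ω‖ₑ ^ p ∂P +
        ENNReal.ofReal (1 / (1 - r)) ^ p * ∫⁻ ω, dyadicSum p (fun t => Y t ω) T ∂P) := by
        have hA := Finset.aemeasurable_fun_sum (Finset.range (T + 1)) fun i _ => hm0 i
        rw [lintegral_const_mul'' (f := fun ω => ∑ i ∈ Finset.range (T + 1), ‖Y i ω‖ₑ ^ p +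
            ENNReal.ofReal (1 / (1 - r)) ^ p * dyadicSum p (fun t => Y t ω) T) _
            (hA.add (hS.const_mul _)), lintegral_add_left' hA,
          lintegral_finsetSum' _ fun i _ => hm0 i, lintegral_const_mul'' _ hS]
    _ ≤ 2 ^ p * (∑ _i ∈ Finset.range (T + 1), K + ENNReal.ofReal (1 / (1 - r)) ^ p * (4 * T * K)) := by
        gcongr with i hi
        exact h0 i (by exact_mod_cast Nat.lt_succ_iff.1 (Finset.mem_range.1 hi))
    _ = _ := by
        rw [Finset.sum_const, Finset.card_range, nsmul_eq_mul, ENNReal.ofReal]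
        push_cast
        ring

/-- Existence of a continuous modification. -/
lemma exists_continuous_modification [CompleteSpace E] {p : ℕ} (hp : p ≠ 0) {K : ℝ≥0∞} (hK : K ≠ ∞)
    {Y : ℝ≥0 → Ω → E} (hm : ∀ s t, AEMeasurable (fun ω => ‖Y t ω - Y s ω‖ₑ) P)
    (hinc : ∀ s t : ℝ≥0, s ≤ t → ∫⁻ ω, ‖Y t ω - Y s ω‖ₑ ^ p ∂P ≤ K * (t - s : ℝ≥0) ^ 2) :
    ∃ g : Ω → C(ℝ≥0, E), ∀ t, ∀ᵐ ω ∂P, g ω t = Y t ω := by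
  classical
  have h1 : ∀ᵐ ω ∂P, ∀ T : ℕ, dyadicSum p (fun t => Y t ω) T < ∞ := by
    rw [ae_all_iff]
    intro T
    obtain ⟨h1, h2⟩ := lintegral_dyadicSum_le (P := P) (T := T) hm fun s t hs _ => hinc s t hs
    exact ae_lt_top' h1 (ne_top_of_le_ne_top (ENNReal.mul_ne_top (ENNReal.mul_ne_top (by simp)
      (by simp)) hK) h2)
  have h2 : ∀ ω, (∀ T : ℕ, dyadicSum p (fun t => Y t ω) T < ∞) → ∃ g : C(ℝ≥0, E), ∀ t,
      Tendsto (fun N => Y (dyadicFloor N t) ω) atTop (𝓝 (g t)) := fun ω hω =>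
    exists_continuous_of_dyadicIncrementsLE (dyadicRate_nonneg p) (dyadicRate_lt_one hp) fun T =>
      ⟨_, by positivity, dyadicIncrementsLE_of_dyadicSum hp (hω T).ne⟩
  choose! g hg using h2
  refine ⟨g, fun t => ?_⟩
  -- The limit along dyadic times must be identified with `Y t`: the moment of the increment tends
  -- to zero, and Fatou's lemma gives almost sure equality.
  have h4 : Tendsto (fun N => ∫⁻ ω, ‖Y t ω - Y (dyadicFloor N t) ω‖ₑ ^ p ∂P) atTop (𝓝 0) := by
    have e1 : Tendsto (fun N => K * ((t - dyadicFloor N t : ℝ≥0) : ℝ≥0∞) ^ 2) atTop (𝓝 (K * 0)) := by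
      refine ENNReal.Tendsto.const_mul ?_ (.inr hK)
      have e2 : Tendsto (fun N => (t - dyadicFloor N t) ^ 2) atTop (𝓝 ((t - t) ^ 2)) :=
        (tendsto_const_nhds.sub (tendsto_dyadicFloor t)).pow 2
      rw [tsub_self, zero_pow two_ne_zero] at e2
      simpa only [ENNReal.coe_pow, ENNReal.coe_zero] using ENNReal.tendsto_coe.2 e2
    rw [mul_zero] at e1
    exact tendsto_of_tendsto_of_tendsto_of_le_of_le tendsto_const_nhds e1 (fun _ => zero_le)
      fun N => hinc _ _ (dyadicFloor_le N t)
  have h5 : ∀ᵐ ω ∂P, ‖Y t ω - g ω t‖ₑ ^ p = 0 := by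
    have e1 : ∀ᵐ ω ∂P, Tendsto (fun N => ‖Y t ω - Y (dyadicFloor N t) ω‖ₑ ^ p) atTop
        (𝓝 (‖Y t ω - g ω t‖ₑ ^ p)) := by
      filter_upwards [h1] with ω hω
      exact ((ENNReal.continuous_pow p).tendsto _).comp
        ((continuous_enorm.tendsto _).comp (tendsto_const_nhds.sub (hg ω hω t)))
    have e3 : AEMeasurable (fun ω => ‖Y t ω - g ω t‖ₑ ^ p) P :=
      aemeasurable_of_tendsto_metrizable_ae atTop (fun N => (hm (dyadicFloor N t) t).pow_const _) e1
    have e4 : ∫⁻ ω, ‖Y t ω - g ω t‖ₑ ^ p ∂P = 0 := by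
      rw [lintegral_congr_ae (e1.mono fun ω h => h.liminf_eq.symm)]
      exact le_antisymm ((lintegral_liminf_le' fun N => (hm _ _).pow_const _).trans_eq h4.liminf_eq)
        zero_le
    exact (lintegral_eq_zero_iff' e3).1 e4
  filter_upwards [h5] with ω hω
  have := pow_eq_zero_iff hp |>.1 hω
  rw [enorm_eq_zero, sub_eq_zero] at this
  exact this.symm

end Chaining

lemma hasGaussianLaw_pi {ι Ω : Type*} [Fintype ι] [MeasurableSpace Ω] {P : Measure Ω} {Y : ι → Ω → ℂ}
    (h : IsGaussianProcess Y P) : HasGaussianLaw (fun ω i => Y i ω) P :=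
  (h.hasGaussianLaw Finset.univ).map (ContinuousLinearMap.pi fun i : ι =>
    ContinuousLinearMap.proj (R := ℝ) (φ := fun _ : (Finset.univ : Finset ι) => ℂ)
      ⟨i, Finset.mem_univ i⟩)

/-! ### Stationary Ornstein–Uhlenbeck coefficients -/

/-- The stationary variance of the mode `m`. -/
def ouVar (μ : ℂ) (m : Mode) : ℝ := (2 * μ.re * eigenvalue m)⁻¹

lemma ouVar_pos {μ : ℂ} (hμ : 0 < μ.re) (m : Mode) : 0 < ouVar μ m := by
  have := eigenvalue_pos m
  unfold ouVar
  positivity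

/-- The family `X t m` is distributed as the Fourier coefficients of the stationary solution. -/
structure IsOU {Ω : Type*} [MeasurableSpace Ω] (μ : ℂ) (P : Measure Ω) (X : ℝ≥0 → Mode → Ω → ℂ) :
    Prop where
  gaussian : IsGaussianProcess (fun p : ℝ≥0 × Mode => X p.1 p.2) P
  mean : ∀ t m, ∫ ω, X t m ω ∂P = 0
  cov : ∀ s t : ℝ≥0, s ≤ t → ∀ m n, ∫ ω, X t m ω * conj (X s n ω) ∂P =
    if m = n then Complex.exp (-μ * eigenvalue m * ((t : ℝ) - s : ℝ)) * ouVar μ m else 0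
  pseudoCov : ∀ s t m n, ∫ ω, X t m ω * X s n ω ∂P = 0

/-- The partial Fourier sum `∑ m ∈ S, a m • e_m`. -/
def trigSum (S : Finset Mode) (a : Mode → ℂ) : C(Torus, ℂ) := ∑ m ∈ S, a m • UnitAddTorus.mFourier m

lemma cutoff_eq_trigSum (n : ℕ) (f : Mode → ℂ) : cutoff n f = trigSum (ball n) f := rfl

lemma trigSum_congr {S : Finset Mode} {a b : Mode → ℂ} (h : ∀ m ∈ S, a m = b m) :
    trigSum S a = trigSum S b := Finset.sum_congr rfl fun m hm => by rw [h m hm]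

lemma trigSum_mem_Trig {S : Finset Mode} {r : ℝ} (hS : S ⊆ ball r) (a : Mode → ℂ) :
    trigSum S a ∈ Trig r :=
  Submodule.sum_mem _ fun _ hm => Submodule.smul_mem _ _ (mFourier_mem_Trig (mem_ball.1 (hS hm)))

/-- The variance of `∑ m ∈ S, θ m X m e_m`. -/
def wickVar (μ : ℂ) (S : Finset Mode) (θ : Mode → ℂ) : ℝ := ∑ m ∈ S, ‖θ m‖ ^ 2 * ouVar μ m

/-- The Wick power of `∑ m ∈ S, θ m x m e_m`. -/
def wickPoly (μ : ℂ) (k l : ℕ) (S : Finset Mode) (θ x : Mode → ℂ) : C(Torus, ℂ) :=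
  herm k l (trigSum S (θ * x)) (star (trigSum S (θ * x))) (wickVar μ S θ)

lemma wickPoly_congr (μ : ℂ) (k l : ℕ) {S : Finset Mode} (θ : Mode → ℂ) {x y : Mode → ℂ}
    (h : ∀ m ∈ S, x m = y m) : wickPoly μ k l S θ x = wickPoly μ k l S θ y := by
  rw [wickPoly, wickPoly, trigSum_congr (a := θ * x) (b := θ * y) fun m hm => by
    rw [Pi.mul_apply, Pi.mul_apply, h m hm]]

lemma wickPoly_mono (μ : ℂ) (k l : ℕ) {S S' : Finset Mode} (hS : S ⊆ S') {θ : Mode → ℂ}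
    (h : ∀ m ∈ S', m ∉ S → θ m = 0) (x : Mode → ℂ) :
    wickPoly μ k l S θ x = wickPoly μ k l S' θ x := by
  have h1 : trigSum S (θ * x) = trigSum S' (θ * x) :=
    Finset.sum_subset hS fun m hm hm' => by
      rw [Pi.mul_apply, h m hm hm', zero_mul]; exact zero_smul ℂ (UnitAddTorus.mFourier m)
  have h2 : wickVar μ S θ = wickVar μ S' θ :=
    Finset.sum_subset hS fun m hm hm' => by rw [h m hm hm']; simp
  rw [wickPoly, wickPoly, h1, h2]

lemma wickPoly_mem_Trig (μ : ℂ) (k l : ℕ) {S : Finset Mode} {r : ℝ} (hr : 0 ≤ r) (hS : S ⊆ ball r)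
    (θ x : Mode → ℂ) : wickPoly μ k l S θ x ∈ Trig ((k + l) * r) :=
  herm_mem_Trig hr (trigSum_mem_Trig hS _) (star_mem_Trig (trigSum_mem_Trig hS _)) k l _

lemma continuous_wickPoly (μ : ℂ) (k l : ℕ) (S : Finset Mode) (θ : Mode → ℂ) {Y : Type*}
    [TopologicalSpace Y] {x : Y → Mode → ℂ} (hx : ∀ m, Continuous fun y => x y m) :
    Continuous fun y => wickPoly μ k l S θ (x y) := by
  have h : Continuous fun y => trigSum S (θ * x y) := by
    unfold trigSum
    simp only [Pi.mul_apply]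
    fun_prop
  exact continuous_herm h (continuous_star.comp h) k l _

lemma measurable_besovENorm_fc (χ : DyadicPartition) (γ : ℝ) :
    Measurable[borel C(Torus, ℂ)] fun f : C(Torus, ℂ) => χ.besovENorm γ (fc f) := by
  borelize C(Torus, ℂ)
  refine Measurable.iSup fun j => Continuous.measurable ?_
  refine Continuous.enorm (f := fun f : C(Torus, ℂ) => χ.weightedBlocks γ (fc f) j) ?_
  exact (continuous_blockFun χ j).const_smul
    (((2 : ℝ) ^ (γ * ((j : ℝ) - 1)) : ℝ) : ℂ)

lemma measurable_besovENorm_comp (χ : DyadicPartition) (γ : ℝ) {Y : Type*} [TopologicalSpace Y]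
    [MeasurableSpace Y] [OpensMeasurableSpace Y] {F : Y → C(Torus, ℂ)} (hF : Continuous F) :
    Measurable fun y => χ.besovENorm γ (fc (F y)) := by
  borelize C(Torus, ℂ)
  exact (measurable_besovENorm_fc χ γ).comp hF.measurable

/-! ### The joint law of the coefficients at two times. -/

section TwoTimes

variable {μ : ℂ} {S : Finset Mode}

/-- The coefficients of `X s` (index `0`) and `X t` (index `1`) in terms of independent Gaussians,
where `τ = t - s`. -/
def ouCoeff (μ : ℂ) (τ : ℝ) (m : Mode) (a b : Fin 2) : ℂ :=
  if a = 0 then (if b = 0 then (√(ouVar μ m) : ℂ) else 0)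
  else if b = 0 then √(ouVar μ m) * Complex.exp (-μ * eigenvalue m * τ)
  else √(ouVar μ m) * √(1 - ‖Complex.exp (-μ * eigenvalue m * τ)‖ ^ 2)

lemma norm_exp_le_one (hμ : 0 < μ.re) (m : Mode) {τ : ℝ} (hτ : 0 ≤ τ) :
    ‖Complex.exp (-μ * eigenvalue m * τ)‖ ≤ 1 := by
  rw [Complex.norm_exp, Real.exp_le_one_iff]
  have h1 := eigenvalue_pos m
  have : (-μ * eigenvalue m * τ).re = -(μ.re * eigenvalue m * τ) := by simp
  rw [this, neg_nonpos]
  positivity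

/-- Stationarity: the variance is the same at both times, so one renormalization constant serves for
both. -/
lemma sum_norm_sq_ouCoeff (hμ : 0 < μ.re) {τ : ℝ} (hτ : 0 ≤ τ) (m : Mode) (a : Fin 2) :
    ∑ b, ‖ouCoeff μ τ m a b‖ ^ 2 = ouVar μ m := by
  have h0 := (ouVar_pos hμ m).le
  have h1 := norm_exp_le_one hμ m hτ
  have h2 : 0 ≤ 1 - ‖Complex.exp (-μ * eigenvalue m * τ)‖ ^ 2 := by
    nlinarith [norm_nonneg (Complex.exp (-μ * eigenvalue m * τ))]
  rw [Fin.sum_univ_two]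
  fin_cases a
  · simp [ouCoeff, Real.sq_sqrt h0]
  · simp only [ouCoeff, Fin.mk_one, Fin.isValue, one_ne_zero, if_false, if_true, norm_mul, mul_pow,
      Complex.norm_real, Real.norm_eq_abs, sq_abs, Real.sq_sqrt h0, Real.sq_sqrt h2]
    ring

/-- The vector of the coefficients at two times. -/
def twoTimes {Ω : Type*} (X : ℝ≥0 → Mode → Ω → ℂ) (S : Finset Mode) (s t : ℝ≥0) (ω : Ω)
    (i : S × Fin 2) : ℂ := X (if i.2 = 0 then s else t) i.1 ω

variable {Ω : Type*} [MeasurableSpace Ω] {P : Measure Ω} {X : ℝ≥0 → Mode → Ω → ℂ}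

lemma IsOU.hasGaussianLaw_twoTimes (hX : IsOU μ P X) (s t : ℝ≥0) :
    HasGaussianLaw (twoTimes X S s t) P := by
  have h := hX.gaussian.comp_right fun i : S × Fin 2 => ((if i.2 = 0 then s else t), (i.1 : Mode))
  exact hasGaussianLaw_pi h

/-- The later value is the damped earlier value plus an independent innovation, so two independent
Gaussians per mode suffice. Both sides are circular Gaussian, and it is enough to compare
covariances in the four cases of times. -/
lemma IsOU.map_twoTimes (hμ : 0 < μ.re) (hX : IsOU μ P X) {s t : ℝ≥0} (hst : s ≤ t) :
    P.map (twoTimes X S s t) = (stdCPi (S × Fin 2)).map fun z i =>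
      lin (fun r => if r.1 = i.1 then ouCoeff μ ((t : ℝ) - s : ℝ) i.1 i.2 r.2 else 0) z := by
  classical
  have hτ : (0 : ℝ) ≤ (t : ℝ) - s := sub_nonneg.2 hst
  refine map_eq_map_stdCPi (hX.hasGaussianLaw_twoTimes s t) _ (fun i => hX.mean _ _) ?_
    fun i j => hX.pseudoCov _ _ _ _
  rintro ⟨m, a⟩ ⟨n, b⟩
  have e1 : ∑ r : S × Fin 2, (if r.1 = m then ouCoeff μ ((t : ℝ) - s : ℝ) m a r.2 else 0) *
      conj (if r.1 = n then ouCoeff μ ((t : ℝ) - s : ℝ) n b r.2 else 0) =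
      if m = n then ∑ c, ouCoeff μ ((t : ℝ) - s : ℝ) m a c * conj (ouCoeff μ ((t : ℝ) - s : ℝ) m b c)
      else 0 := by
    rw [Fintype.sum_prod_type, Finset.sum_eq_single m]
    · split_ifs with h
      · subst h; simp
      · simp
    · intro r _ hr
      simp [hr]
    · simp
  refine Eq.trans ?_ e1.symm
  set w := Complex.exp (-μ * eigenvalue m * ((t : ℝ) - s : ℝ))
  have hv : ((√(ouVar μ m) : ℝ) : ℂ) * √(ouVar μ m) = ouVar μ m := by
    rw [← Complex.ofReal_mul, Real.mul_self_sqrt (ouVar_pos hμ _).le]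
  have e0 : ∀ s : ℝ≥0, ∫ ω, X s m ω * conj (X s n ω) ∂P = if m = n then (ouVar μ m : ℂ) else 0 := by
    intro s
    rw [hX.cov s s le_rfl]
    simp only [Subtype.ext_iff, sub_self, Complex.ofReal_zero, mul_zero, Complex.exp_zero, one_mul]
  have e01 : ∫ ω, X t m ω * conj (X s n ω) ∂P = if m = n then w * ouVar μ m else 0 := by
    rw [hX.cov s t hst]
    simp only [Subtype.ext_iff, w]
  have e10 : ∫ ω, X s m ω * conj (X t n ω) ∂P = if m = n then conj w * ouVar μ m else 0 := by
    have : ∀ ω, X s m ω * conj (X t n ω) = conj (X t n ω * conj (X s m ω)) := fun ω => by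
      rw [map_mul, Complex.conj_conj, mul_comm]
    simp_rw [this]
    rw [integral_conj, hX.cov s t hst]
    by_cases h : m = n
    · subst h; simp [w]
    · have : (n : Mode) ≠ m := fun h' => h (Subtype.ext h'.symm)
      simp [h, this]
  fin_cases a <;> fin_cases b <;>
    simp only [twoTimes, ouCoeff, Fin.sum_univ_two, Fin.zero_eta, Fin.mk_one, Fin.isValue, one_ne_zero,
      if_true, if_false, map_zero, mul_zero, add_zero, zero_mul]
  · rw [e0, Complex.conj_ofReal, hv]
  · rw [e10, map_mul, Complex.conj_ofReal, ← mul_assoc, hv, mul_comm]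
  · rw [e01, Complex.conj_ofReal, mul_right_comm, hv, mul_comm]
  · have h2 : 0 ≤ 1 - ‖w‖ ^ 2 := by
      have := norm_exp_le_one hμ m hτ
      nlinarith [norm_nonneg w]
    rw [e0, map_mul, map_mul, Complex.conj_ofReal, Complex.conj_ofReal, mul_mul_mul_comm, hv,
      mul_mul_mul_comm, hv, ← Complex.ofReal_mul, Real.mul_self_sqrt h2]
    simp only [w]
    rw [Complex.mul_conj']
    push_cast
    congr 1
    ring

/-- The coefficients of the Gaussian field at the first or second time. -/
def fieldCoeff (μ : ℂ) (S : Finset Mode) (θ : Mode → ℂ) (τ : ℝ) (a : Fin 2) (i : S × Fin 2) : ℂ :=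
  θ i.1 * ouCoeff μ τ i.1 a i.2

/-- Indexing the Gaussians by `S × Fin 2` lets every mode occur twice, so Wick polynomials at either
of the two times are `hermTrig`s of one common vector. -/
lemma wickPoly_eq_hermTrig (hμ : 0 < μ.re) (k l : ℕ) (θ : Mode → ℂ) {τ : ℝ} (hτ : 0 ≤ τ) (a : Fin 2)
    (z : S × Fin 2 → ℂ) (x : Mode → ℂ)
    (hx : ∀ m : S, x m = ∑ b, ouCoeff μ τ m a b * z (m, b)) :
    wickPoly μ k l S θ x = hermTrig (fun i : S × Fin 2 => i.1) k l (fieldCoeff μ S θ τ a) z := by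
  have h1 : trigSum S (θ * x) = trigPoly (fun i : S × Fin 2 => i.1) (fieldCoeff μ S θ τ a * z) := by
    rw [trigSum, trigPoly, Fintype.sum_prod_type, ← Finset.sum_coe_sort]
    refine Finset.sum_congr rfl fun m _ => ?_
    refine Eq.trans ?_ (Finset.sum_smul (s := Finset.univ)
      (f := fun b => (fieldCoeff μ S θ τ a * z) (m, b)) (x := UnitAddTorus.mFourier (m : Mode)))
    rw [Pi.mul_apply, hx, Finset.mul_sum]
    congr 1
    refine Finset.sum_congr rfl fun b _ => ?_
    simp only [Pi.mul_apply, fieldCoeff]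
    ring
  have h2 : wickVar μ S θ = ∑ i, ‖fieldCoeff μ S θ τ a i‖ ^ 2 := by
    rw [wickVar, Fintype.sum_prod_type, ← Finset.sum_coe_sort]
    refine Finset.sum_congr rfl fun m _ => ?_
    simp only [fieldCoeff, norm_mul, mul_pow]
    rw [← Finset.mul_sum, sum_norm_sq_ouCoeff hμ hτ]
  rw [wickPoly, hermTrig, h1, h2]

/-- Transfer of expectations of functions of two Wick polynomials to the standard Gaussian measure. -/
lemma IsOU.lintegral_wickPoly_sub (hμ : 0 < μ.re) (hX : IsOU μ P X) {s t : ℝ≥0} (hst : s ≤ t)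
    (χ : DyadicPartition) (γ : ℝ) (k l n : ℕ) (θ θ' : Mode → ℂ) (a b : Fin 2) :
    ∫⁻ ω, χ.besovENorm γ (fc (wickPoly μ k l S θ (X (if a = 0 then s else t) · ω) -
        wickPoly μ k l S θ' (X (if b = 0 then s else t) · ω))) ^ n ∂P =
      ∫⁻ z, χ.besovENorm γ (fc (
        hermTrig (fun i : S × Fin 2 => i.1) k l (fieldCoeff μ S θ ((t : ℝ) - s : ℝ) a) z -
        hermTrig (fun i : S × Fin 2 => i.1) k l (fieldCoeff μ S θ' ((t : ℝ) - s : ℝ) b) z)) ^ n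
        ∂stdCPi (S × Fin 2) := by
  classical
  let ex : Fin 2 → (S × Fin 2 → ℂ) → Mode → ℂ := fun a y m => if h : m ∈ S then y (⟨m, h⟩, a) else 0
  have hex : ∀ a m, Continuous fun y => ex a y m := by
    intro a m
    simp only [ex]
    split_ifs <;> fun_prop
  let G : (S × Fin 2 → ℂ) → ℝ≥0∞ := fun y =>
    χ.besovENorm γ (fc (wickPoly μ k l S θ (ex a y) - wickPoly μ k l S θ' (ex b y))) ^ n
  have hG : Measurable G := (measurable_besovENorm_comp χ γ
    ((continuous_wickPoly μ k l S θ (hex a)).sub (continuous_wickPoly μ k l S θ' (hex b)))).pow_const n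
  have hτ : (0 : ℝ) ≤ (t : ℝ) - s := sub_nonneg.2 hst
  have hm := (hX.hasGaussianLaw_twoTimes (S := S) s t).aemeasurable
  have hc : Continuous fun (z : S × Fin 2 → ℂ) (i : S × Fin 2) =>
      lin (fun r => if r.1 = i.1 then ouCoeff μ ((t : ℝ) - s : ℝ) i.1 i.2 r.2 else 0) z :=
    continuous_pi fun i => continuous_lin _
  calc _ = ∫⁻ ω, G (twoTimes X S s t ω) ∂P := by
        refine lintegral_congr fun ω => ?_
        simp only [G]
        rw [wickPoly_congr μ k l θ (y := ex a (twoTimes X S s t ω)) fun m hm => by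
            simp [ex, hm, twoTimes],
          wickPoly_congr μ k l θ' (y := ex b (twoTimes X S s t ω)) fun m hm => by
            simp [ex, hm, twoTimes]]
    _ = ∫⁻ y, G y ∂P.map (twoTimes X S s t) := (lintegral_map' hG.aemeasurable hm).symm
    _ = _ := by
        rw [hX.map_twoTimes hμ hst, lintegral_map hG hc.measurable]
        refine lintegral_congr fun z => ?_
        simp only [G]
        have key : ∀ (a : Fin 2) (m : S), ex a (fun i : S × Fin 2 =>
            lin (fun r => if r.1 = i.1 then ouCoeff μ ((t : ℝ) - s : ℝ) i.1 i.2 r.2 else 0) z) m =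
            ∑ b, ouCoeff μ ((t : ℝ) - s : ℝ) m a b * z (m, b) := by
          intro a m
          simp only [ex, m.2, dif_pos, lin]
          rw [Fintype.sum_prod_type, Finset.sum_eq_single m]
          · simp
          · intro r _ hr
            simp [hr]
          · simp
        rw [wickPoly_eq_hermTrig hμ k l θ hτ a z _ (key a),
          wickPoly_eq_hermTrig hμ k l θ' hτ b z _ (key b)]

end TwoTimes

/-! ### Moment bounds for Wick powers of the stationary solution -/

/-- Interpolation between the linear bound and the trivial bound `2`. It buys a small power of the
time step with the same small power of the eigenvalue. -/
lemma norm_exp_neg_sub_one_le {w : ℂ} (hw : 0 ≤ w.re) {e : ℝ} (he : 0 ≤ e) (he1 : e ≤ 1) :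
    ‖Complex.exp (-w) - 1‖ ≤ 2 * ‖w‖ ^ e := by
  rcases le_total ‖w‖ 1 with h | h
  · calc ‖Complex.exp (-w) - 1‖ ≤ 2 * ‖-w‖ := Complex.norm_exp_sub_one_le (by rwa [norm_neg])
      _ ≤ 2 * ‖w‖ ^ e := by
        rw [norm_neg]
        gcongr
        calc ‖w‖ = ‖w‖ ^ (1 : ℝ) := (Real.rpow_one _).symm
          _ ≤ ‖w‖ ^ e := Real.rpow_le_rpow_of_exponent_ge' (norm_nonneg _) h he he1
  · have h1 : ‖Complex.exp (-w)‖ ≤ 1 := by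
      rw [Complex.norm_exp, Real.exp_le_one_iff, Complex.neg_re]; linarith
    have h2 : 1 ≤ ‖w‖ ^ e := Real.one_le_rpow h he
    calc ‖Complex.exp (-w) - 1‖ ≤ 1 + 1 := (norm_sub_le _ _).trans (add_le_add h1 (by simp))
      _ ≤ _ := by linarith

lemma sqrt_one_sub_sq_norm_exp_neg_le {w : ℂ} {e : ℝ} (he : 0 ≤ e)
    (he1 : e ≤ 1 / 2) : √(1 - ‖Complex.exp (-w)‖ ^ 2) ≤ 2 * ‖w‖ ^ e := by
  refine Real.sqrt_le_iff.2 ⟨by positivity, ?_⟩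
  have h0 : (2 * ‖w‖ ^ e) ^ 2 = 4 * ‖w‖ ^ (e * 2) := by
    rw [mul_pow, ← Real.rpow_natCast (‖w‖ ^ e), ← Real.rpow_mul (norm_nonneg _)]; norm_num
  rw [h0]
  rcases le_total ‖w‖ 1 with h | h
  · have h1 : 1 - 2 * ‖w‖ ≤ ‖Complex.exp (-w)‖ ^ 2 := by
      rw [Complex.norm_exp, ← Real.exp_nat_mul, Complex.neg_re]
      have := Real.add_one_le_exp ((2 : ℕ) * -w.re)
      have h3 := (abs_le.1 (Complex.abs_re_le_norm w)).2
      push_cast at this ⊢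
      linarith
    have h2 : ‖w‖ ≤ ‖w‖ ^ (e * 2) := by
      calc ‖w‖ = ‖w‖ ^ (1 : ℝ) := (Real.rpow_one _).symm
        _ ≤ _ := Real.rpow_le_rpow_of_exponent_ge' (norm_nonneg _) h (by positivity) (by linarith)
    linarith [norm_nonneg w]
  · have h2 : 1 ≤ ‖w‖ ^ (e * 2) := Real.one_le_rpow h (by positivity)
    nlinarith [sq_nonneg ‖Complex.exp (-w)‖]

section

variable {μ : ℂ}

lemma sqrt_ouVar_le (hμ : 0 < μ.re) (m : Mode) : √(ouVar μ m) ≤ (√μ.re)⁻¹ * (br m)⁻¹ := by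
  rw [← Real.sqrt_inv, Real.sqrt_le_iff]
  have h0 := br_pos m
  refine ⟨by positivity, ?_⟩
  rw [mul_pow, Real.sq_sqrt (by positivity), inv_pow, ← mul_inv, ouVar]
  refine inv_anti₀ (by positivity) ?_
  have := br_sq_le m
  nlinarith

lemma norm_ouCoeff_le (hμ : 0 < μ.re) {τ : ℝ} (hτ : 0 ≤ τ) (m : Mode) (a b : Fin 2) :
    ‖ouCoeff μ τ m a b‖ ≤ (√μ.re)⁻¹ * (br m)⁻¹ := by
  refine le_trans ?_ (sqrt_ouVar_le hμ m)
  refine Real.le_sqrt_of_sq_le ?_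
  rw [← sum_norm_sq_ouCoeff hμ hτ m a]
  exact Finset.single_le_sum (f := fun b => ‖ouCoeff μ τ m a b‖ ^ 2) (fun _ _ => by positivity)
    (Finset.mem_univ b)

/-- The exponent `κ / 4` of `eigenvalue m * τ` splits into `τ ^ (κ / 4)` and, as the eigenvalue
grows quadratically, `br m ^ (κ / 2)`. This is the amount of extra growth tolerated by the lattice
sums. -/
lemma norm_ouCoeff_sub_le (hμ : 0 < μ.re) {τ : ℝ} (hτ : 0 ≤ τ) (m : Mode) (b : Fin 2) {κ : ℝ}
    (hκ : 0 ≤ κ) (hκ1 : κ ≤ 1) : ‖ouCoeff μ τ m 1 b - ouCoeff μ τ m 0 b‖ ≤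
      τ ^ (κ / 4) * (16 * (1 + ‖μ‖) * (√μ.re)⁻¹ * ((br m)⁻¹ * br m ^ (κ / 2))) := by
  have hb := br_pos m
  have hl := eigenvalue_pos m
  set w : ℂ := μ * eigenvalue m * τ
  have hw : -μ * eigenvalue m * τ = -w := by simp only [w]; ring
  have hwre : 0 ≤ w.re := by
    have : w.re = μ.re * eigenvalue m * τ := by simp [w]
    rw [this]; positivity
  have hwn : ‖w‖ = ‖μ‖ * eigenvalue m * τ := by
    simp only [w]
    rw [norm_mul, norm_mul, Complex.norm_real, Complex.norm_real, Real.norm_of_nonneg hl.le,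
      Real.norm_of_nonneg hτ]
  have h1 : ‖ouCoeff μ τ m 1 b - ouCoeff μ τ m 0 b‖ ≤ √(ouVar μ m) * (2 * ‖w‖ ^ (κ / 4)) := by
    fin_cases b
    · simp only [ouCoeff, Fin.zero_eta, Fin.isValue, one_ne_zero, if_false, if_true]
      rw [hw, ← mul_sub_one, norm_mul, Complex.norm_real, Real.norm_of_nonneg (Real.sqrt_nonneg _)]
      gcongr
      exact norm_exp_neg_sub_one_le hwre (by linarith) (by linarith)
    · simp only [ouCoeff, Fin.mk_one, Fin.isValue, one_ne_zero, if_false, if_true]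
      rw [hw, sub_zero, norm_mul, Complex.norm_real, Real.norm_of_nonneg (Real.sqrt_nonneg _),
        Complex.norm_real, Real.norm_of_nonneg (Real.sqrt_nonneg _)]
      gcongr
      exact sqrt_one_sub_sq_norm_exp_neg_le (by linarith) (by linarith)
  have h2 : ‖w‖ ^ (κ / 4) ≤ (1 + ‖μ‖) * (8 * br m ^ (κ / 2)) * τ ^ (κ / 4) := by
    rw [hwn, Real.mul_rpow (by positivity) hτ, Real.mul_rpow (norm_nonneg _) hl.le]
    gcongr
    · calc ‖μ‖ ^ (κ / 4) ≤ (1 + ‖μ‖) ^ (κ / 4) := by gcongr; linarith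
        _ ≤ (1 + ‖μ‖) ^ (1 : ℝ) :=
          Real.rpow_le_rpow_of_exponent_le (by linarith [norm_nonneg μ]) (by linarith)
        _ = _ := Real.rpow_one _
    · calc eigenvalue m ^ (κ / 4) ≤ (64 * br m ^ 2) ^ (κ / 4) := by gcongr; exact eigenvalue_le m
        _ = 64 ^ (κ / 4) * br m ^ (κ / 2) := by
          rw [Real.mul_rpow (by norm_num) (by positivity), ← Real.rpow_natCast (br m),
            ← Real.rpow_mul hb.le]
          congr 2
          push_cast; ring
        _ ≤ 64 ^ (1 / 2 : ℝ) * br m ^ (κ / 2) := by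
          gcongr
          · norm_num
          · linarith
        _ = _ := by
          rw [show (64 : ℝ) = 8 ^ (2 : ℝ) by norm_num, ← Real.rpow_mul (by norm_num)]
          norm_num
  calc _ ≤ _ := h1
    _ ≤ ((√μ.re)⁻¹ * (br m)⁻¹) * (2 * ((1 + ‖μ‖) * (8 * br m ^ (κ / 2)) * τ ^ (κ / 4))) := by
        gcongr
        exact sqrt_ouVar_le hμ m
    _ = _ := by ring

variable {Ω : Type*} [MeasurableSpace Ω] {P : Measure Ω} {X : ℝ≥0 → Mode → Ω → ℂ}

lemma atMostTwo_fst (S : Finset Mode) : AtMostTwo fun i : S × Fin 2 => (i.1 : Mode) := by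
  classical
  intro m
  by_cases hm : m ∈ S
  · refine (Finset.card_le_card (t := Finset.univ.image fun b : Fin 2 => ((⟨m, hm⟩ : S), b)) ?_).trans
      (Finset.card_image_le.trans (by simp))
    intro i hi
    have := (Finset.mem_filter.1 hi).2
    exact Finset.mem_image.2 ⟨i.2, Finset.mem_univ _, Prod.ext (Subtype.ext this.symm) rfl⟩
  · rw [Finset.filter_false_of_mem]
    · simp
    · rintro i - rfl
      exact hm i.1.2

/-- A change of weights and a step in time are both perturbations of the coefficients of the same
Gaussian vector, of relative size `ρ * br m ^ (κ / 2)` with `ρ` given or `ρ = (t - s) ^ (κ / 4)`.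
One chaos estimate handles both. -/
lemma IsOU.exists_moments (hμ : 0 < μ.re) (hX : IsOU μ P X) (χ : DyadicPartition) {α : ℝ}
    (hα : 0 < α) (hα1 : α ≤ 1) (k l : ℕ) : ∃ κ : ℝ, 0 < κ ∧ κ ≤ 1 ∧ ∀ n : ℕ, 2 < n * α → ∃ C : ℝ≥0,
      ∀ (S : Finset Mode) (θ θ' : Mode → ℂ) (ρ : ℝ), 0 ≤ ρ → (∀ m, ‖θ m‖ ≤ 2) → (∀ m, ‖θ' m‖ ≤ 2) →
      (∀ m, ‖θ m - θ' m‖ ≤ ρ * br m ^ (κ / 2)) → ∀ s t : ℝ≥0, s ≤ t →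
      ∫⁻ ω, χ.besovENorm (-α) (fc (wickPoly μ k l S θ (X s · ω) -
        wickPoly μ k l S θ' (X s · ω))) ^ (2 * n) ∂P ≤ C * ENNReal.ofReal ρ ^ (2 * n) ∧
      ∫⁻ ω, χ.besovENorm (-α) (fc (wickPoly μ k l S θ (X t · ω) -
        wickPoly μ k l S θ (X s · ω))) ^ (2 * n) ∂P ≤
          C * ENNReal.ofReal (((t : ℝ) - s) ^ (κ / 4)) ^ (2 * n) := by
  obtain ⟨κ, hκ, hκ1, h⟩ := exists_lintegral_besovENorm_hermTrig_le χ hα hα1 k l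
  set M : ℝ := 32 * (1 + ‖μ‖) * (√μ.re)⁻¹
  have hsq : 0 < (√μ.re)⁻¹ := by positivity
  have hM : 0 ≤ M := by positivity
  refine ⟨κ, hκ, hκ1, fun n hn => ?_⟩
  obtain ⟨C, hC⟩ := h n hn M hM
  refine ⟨C, fun S θ θ' ρ hρ hθ hθ' hθθ' s t hst => ?_⟩
  have hτ : (0 : ℝ) ≤ (t : ℝ) - s := sub_nonneg.2 hst
  have hpow : ∀ m, (br m)⁻¹ * br m ^ (κ / 2) = br m ^ (-1 + κ / 2) := fun m => by
    rw [Real.rpow_add (br_pos m), Real.rpow_neg_one]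
  have hbd : ∀ (θ : Mode → ℂ), (∀ m, ‖θ m‖ ≤ 2) → ∀ (a : Fin 2) (i : S × Fin 2),
      ‖fieldCoeff μ S θ ((t : ℝ) - s : ℝ) a i‖ ≤ M * br i.1 ^ (-1 + κ / 2) := by
    intro θ hθ a i
    have e1 : 1 ≤ br (i.1 : Mode) ^ (κ / 2) := Real.one_le_rpow (one_le_br _) (by linarith)
    have e2 := br_pos (i.1 : Mode)
    rw [fieldCoeff, norm_mul]
    calc _ ≤ 2 * ((√μ.re)⁻¹ * (br i.1)⁻¹) :=
          mul_le_mul (hθ _) (norm_ouCoeff_le hμ hτ _ _ _) (norm_nonneg _) zero_le_two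
      _ = 2 * (√μ.re)⁻¹ * ((br i.1)⁻¹ * 1) := by ring
      _ ≤ M * ((br i.1)⁻¹ * br i.1 ^ (κ / 2)) := by
          have : 2 * (√μ.re)⁻¹ ≤ M := by
            refine mul_le_mul_of_nonneg_right ?_ hsq.le
            linarith [norm_nonneg μ]
          gcongr
      _ = _ := by rw [hpow]
  constructor
  · have e0 := hX.lintegral_wickPoly_sub hμ hst (S := S) χ (-α) k l (2 * n) θ θ' 0 0
    simp only [if_true] at e0
    rw [e0]
    refine hC _ _ (atMostTwo_fst S) _ _ ρ κ hρ le_rfl (hbd θ hθ 0) (hbd θ' hθ' 0) fun i => ?_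
    rw [fieldCoeff, fieldCoeff, ← sub_mul, norm_mul]
    have e2 := br_pos (i.1 : Mode)
    have e3 : 0 ≤ br (i.1 : Mode) ^ (κ / 2) := Real.rpow_nonneg e2.le _
    calc _ ≤ (ρ * br i.1 ^ (κ / 2)) * ((√μ.re)⁻¹ * (br i.1)⁻¹) :=
          mul_le_mul (hθθ' _) (norm_ouCoeff_le hμ hτ _ _ _) (norm_nonneg _) (by positivity)
      _ = ρ * ((√μ.re)⁻¹ * ((br i.1)⁻¹ * br i.1 ^ (κ / 2))) := by ring
      _ ≤ ρ * (M * ((br i.1)⁻¹ * br i.1 ^ (κ / 2))) := by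
          have : (√μ.re)⁻¹ ≤ M := le_mul_of_one_le_left hsq.le (by linarith [norm_nonneg μ])
          gcongr
      _ = _ := by rw [hpow]
  · have e0 := hX.lintegral_wickPoly_sub hμ hst (S := S) χ (-α) k l (2 * n) θ θ 1 0
    simp only [if_true, one_ne_zero, if_false] at e0
    rw [e0]
    refine hC _ _ (atMostTwo_fst S) _ _ _ κ (Real.rpow_nonneg hτ _) le_rfl (hbd θ hθ 1) (hbd θ hθ 0)
      fun i => ?_
    rw [fieldCoeff, fieldCoeff, ← mul_sub, norm_mul]
    calc _ ≤ 2 * (((t : ℝ) - s) ^ (κ / 4) * (16 * (1 + ‖μ‖) * (√μ.re)⁻¹ *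
          ((br i.1)⁻¹ * br i.1 ^ (κ / 2)))) :=
          mul_le_mul (hθ _) (norm_ouCoeff_sub_le hμ hτ _ _ hκ.le hκ1) (norm_nonneg _) zero_le_two
      _ = ((t : ℝ) - s) ^ (κ / 4) * (M * ((br i.1)⁻¹ * br i.1 ^ (κ / 2))) := by
          simp only [M]; ring
      _ = _ := by rw [hpow]

end

/-! ### Multiplication by trigonometric polynomials -/

section MulOp

variable {χ : DyadicPartition} {γ : ℝ}

variable (χ γ) in
/-- Multiplication by (the truncation to the ball of radius `r` of) a continuous function. -/
def mulOp (r : ℝ) : C(Torus, ℂ) →ₗ[ℂ] χ.HolderBesov γ →L[ℂ] χ.HolderBesov γ where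
  toFun f := ∑ m ∈ ball r, fc f m • (χ.shift m : χ.HolderBesov γ →L[ℂ] χ.HolderBesov γ)
  map_add' f g := by
    rw [← Finset.sum_add_distrib]
    refine Finset.sum_congr rfl fun m _ => ?_
    rw [map_add, Pi.add_apply]
    exact add_smul (fc f m) (fc g m) (χ.shift m : χ.HolderBesov γ →L[ℂ] χ.HolderBesov γ)
  map_smul' c f := by
    simp only [map_smul, Pi.smul_apply, smul_eq_mul, mul_smul, Finset.smul_sum, RingHom.id_apply]

lemma mulOp_apply (r : ℝ) (f : C(Torus, ℂ)) (F : χ.HolderBesov γ) :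
    mulOp χ γ r f F = ∑ m ∈ ball r, fc f m • χ.shift m F := by
  rw [mulOp, LinearMap.coe_mk, AddHom.coe_mk, sum_apply]
  rfl

lemma continuous_mulOp (r : ℝ) : Continuous (mulOp χ γ r) := by
  have : ⇑(mulOp χ γ r) = fun f => ∑ m ∈ ball r, fc f m •
      (χ.shift m : χ.HolderBesov γ →L[ℂ] χ.HolderBesov γ) := rfl
  rw [this]
  have := continuous_fc
  fun_prop

variable (χ γ) in
/-- Trigonometric polynomials of degree at most `r` as elements of `𝒞^γ`. -/
def toBesov (r : ℝ) : C(Torus, ℂ) →ₗ[ℂ] χ.HolderBesov γ :=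
  (ContinuousLinearMap.apply ℂ (χ.HolderBesov γ) (DyadicPartition.HolderBesov.one χ γ)).toLinearMap.comp
    (mulOp χ γ r)

lemma toBesov_apply (r : ℝ) (f : C(Torus, ℂ)) :
    toBesov χ γ r f = mulOp χ γ r f (DyadicPartition.HolderBesov.one χ γ) := rfl

lemma continuous_toBesov (r : ℝ) : Continuous (toBesov χ γ r) :=
  (ContinuousLinearMap.apply ℂ (χ.HolderBesov γ)
    (DyadicPartition.HolderBesov.one χ γ)).continuous.comp (continuous_mulOp r)

lemma coeff_mulOp (r : ℝ) (f : C(Torus, ℂ)) (F : χ.HolderBesov γ) (q : Mode) :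
    (mulOp χ γ r f F).coeff q = ∑ m ∈ ball r, fc f m * F.coeff (q - m) := by
  rw [mulOp_apply, DyadicPartition.HolderBesov.coeff_sum, Finset.sum_apply]
  rfl

lemma coeff_toBesov {r : ℝ} {f : C(Torus, ℂ)} (hf : f ∈ Trig r) : (toBesov χ γ r f).coeff = fc f := by
  funext q
  rw [toBesov_apply, mulOp_apply, DyadicPartition.HolderBesov.coeff_sum_smul_shift_one]
  split_ifs with h
  · rfl
  · exact (hf q h).symm

lemma fc_mul {r : ℝ} {f : C(Torus, ℂ)} (hf : f ∈ Trig r) (g : C(Torus, ℂ)) (q : Mode) :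
    fc (f * g) q = ∑ m ∈ ball r, fc f m * fc g (q - m) := by
  conv_lhs => rw [eq_sum_fc hf]
  rw [Finset.sum_mul, map_sum, Finset.sum_apply]
  refine Finset.sum_congr rfl fun m _ => ?_
  rw [smul_mul_assoc, map_smul, Pi.smul_apply, fc_mul_mFourier, smul_eq_mul]

lemma enorm_toBesov {r : ℝ} {f : C(Torus, ℂ)} (hf : f ∈ Trig r) :
    ‖toBesov χ γ r f‖ₑ = χ.besovENorm γ (fc f) := by
  rw [DyadicPartition.HolderBesov.enorm_eq, coeff_toBesov hf]

end MulOp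

/-! ### Suprema of Wick powers over compact time intervals -/

lemma ennreal_add_pow_le (x y : ℝ≥0∞) (p : ℕ) : (x + y) ^ p ≤ 2 ^ p * (x ^ p + y ^ p) := by
  calc (x + y) ^ p ≤ (2 * max x y) ^ p := by
        gcongr
        rw [two_mul]
        exact add_le_add (le_max_left _ _) (le_max_right _ _)
    _ ≤ 2 ^ p * (x ^ p + y ^ p) := by
        rw [mul_pow]
        gcongr
        rcases le_total x y with h | h
        · rw [max_eq_right h]; exact le_add_self
        · rw [max_eq_left h]; exact le_self_add

lemma exists_subset_ball (S : Finset Mode) : ∃ r : ℝ, 0 ≤ r ∧ S ⊆ ball r :=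
  ⟨∑ m ∈ S, ‖freq m‖, Finset.sum_nonneg fun _ _ => norm_nonneg _, fun _ hm => mem_ball.2
    (Finset.single_le_sum (f := fun m => ‖freq m‖) (fun _ _ => norm_nonneg _) hm)⟩

variable {Ω : Type*} [MeasurableSpace Ω] {P : Measure Ω} {μ : ℂ}

lemma aestronglyMeasurable_wickPoly (k l : ℕ) (S : Finset Mode) (θ : Mode → ℂ) {x : Ω → Mode → ℂ}
    (hx : ∀ m, AEMeasurable (fun ω => x ω m) P) :
    AEStronglyMeasurable (fun ω => wickPoly μ k l S θ (x ω)) P := by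
  have h : AEStronglyMeasurable (fun ω => trigSum S (θ * x ω)) P := by
    unfold trigSum
    refine Finset.aestronglyMeasurable_fun_sum _ fun m _ => ?_
    exact ((hx m).aestronglyMeasurable.const_mul (θ m)).smul_const _
  unfold wickPoly herm
  refine Finset.aestronglyMeasurable_fun_sum _ fun m _ => AEStronglyMeasurable.const_smul (𝕜 := ℂ) ?_ _
  exact (h.pow _).mul ((continuous_star.comp_aestronglyMeasurable h).pow _)

variable {X : ℝ≥0 → Mode → Ω → ℂ}

lemma IsOU.aemeasurable (hX : IsOU μ P X) (t : ℝ≥0) (m : Mode) : AEMeasurable (fun ω => X t m ω) P :=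
  hX.gaussian.aemeasurable (t, m)

/-- The difference of two weighted Wick powers is small because the weights are close, and its time
increments are small because each Wick power is Hölder in time. Interpolating between the two bounds
keeps half of each: enough Hölder regularity for chaining, and a factor `ρ ^ n`. -/
lemma IsOU.exists_sup_moments (hμ : 0 < μ.re) (hX : IsOU μ P X)
    (hc : ∀ᵐ ω ∂P, ∀ m, Continuous fun t => X t m ω) (χ : DyadicPartition) {α : ℝ}
    (hα : 0 < α) (hα1 : α ≤ 1) (k l : ℕ) : ∃ κ : ℝ, 0 < κ ∧ κ ≤ 1 ∧ ∃ n₀ : ℕ, ∀ n : ℕ, n₀ ≤ n → ∀ T : ℕ,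
      ∃ C : ℝ≥0, ∀ (S : Finset Mode) (θ θ' : Mode → ℂ) (ρ : ℝ), 0 ≤ ρ → ρ ≤ 1 → (∀ m, ‖θ m‖ ≤ 2) →
      (∀ m, ‖θ' m‖ ≤ 2) → (∀ m, ‖θ m - θ' m‖ ≤ ρ * br m ^ (κ / 2)) →
      ∫⁻ ω, (⨆ (t : ℝ≥0) (_ : t ≤ T), χ.besovENorm (-α) (fc (wickPoly μ k l S θ (X t · ω) -
        wickPoly μ k l S θ' (X t · ω)))) ^ (2 * n) ∂P ≤ C * ENNReal.ofReal ρ ^ n := by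
  obtain ⟨κ, hκ, hκ1, h⟩ := hX.exists_moments hμ χ hα hα1 k l
  obtain ⟨N₁, hN₁⟩ := exists_nat_gt (2 / α)
  obtain ⟨N₂, hN₂⟩ := exists_nat_gt (8 / κ)
  -- `N₁` ensures `2 < n * α` for the Besov moments, `N₂` ensures `κ / 4 * n ≥ 2`, so that the time
  -- factor is bounded by a multiple of `(t - s) ^ 2` as chaining requires.
  refine ⟨κ, hκ, hκ1, max 1 (max N₁ N₂), fun n hn T => ?_⟩
  have hn0 : 2 * n ≠ 0 := by have := le_max_left 1 (max N₁ N₂); omega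
  have hn1 : 2 < n * α := by
    rw [div_lt_iff₀ hα] at hN₁
    refine hN₁.trans_le ?_
    gcongr
    exact_mod_cast ((le_max_left _ _).trans (le_max_right _ _)).trans hn
  have hn2 : 8 ≤ κ * n := by
    rw [div_lt_iff₀ hκ] at hN₂
    refine hN₂.le.trans ?_
    rw [mul_comm]
    gcongr
    exact_mod_cast ((le_max_right _ _).trans (le_max_right _ _)).trans hn
  obtain ⟨C₀, hC₀⟩ := h n hn1
  obtain ⟨C₁, hC₁⟩ := exists_lintegral_iSup_le (2 * n) hn0 T
  set A : ℝ≥0 := 2 ^ (2 * n) * 2 * C₀ * (T + 1) ^ n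
  refine ⟨C₁ * A, fun S θ θ' ρ hρ hρ1 hθ hθ' hθθ' => ?_⟩
  obtain ⟨R, hR, hS⟩ := exists_subset_ball S
  set r : ℝ := (k + l) * R
  set F : (Mode → ℂ) → ℝ≥0 → Ω → χ.HolderBesov (-α) := fun θ t ω =>
    toBesov χ (-α) r (wickPoly μ k l S θ (X t · ω))
  have hF : ∀ (θ₁ θ₂ : Mode → ℂ) (s t : ℝ≥0) ω, ‖F θ₁ s ω - F θ₂ t ω‖ₑ = χ.besovENorm (-α)
      (fc (wickPoly μ k l S θ₁ (X s · ω) - wickPoly μ k l S θ₂ (X t · ω))) := by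
    intro θ₁ θ₂ s t ω
    simp only [F]
    rw [← map_sub]
    exact enorm_toBesov ((Trig _).sub_mem (wickPoly_mem_Trig μ k l hR hS _ _)
      (wickPoly_mem_Trig μ k l hR hS _ _))
  have hFm : ∀ θ t, AEStronglyMeasurable (F θ t) P := fun θ t =>
    (continuous_toBesov r).comp_aestronglyMeasurable
      (aestronglyMeasurable_wickPoly k l S θ fun m => hX.aemeasurable t m)
  set Y : ℝ≥0 → Ω → χ.HolderBesov (-α) := fun t ω => F θ t ω - F θ' t ω
  have hYm : ∀ t, AEStronglyMeasurable (Y t) P := fun t => (hFm θ t).sub (hFm θ' t)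
  have hbase : ∀ t, ∫⁻ ω, ‖Y t ω‖ₑ ^ (2 * n) ∂P ≤ C₀ * ENNReal.ofReal ρ ^ (2 * n) := by
    intro t
    simp only [Y, hF]
    exact (hC₀ S θ θ' ρ hρ hθ hθ' hθθ' t t le_rfl).1
  have htime : ∀ θ, (∀ m, ‖θ m‖ ≤ 2) → ∀ s t : ℝ≥0, s ≤ t → ∫⁻ ω, ‖F θ t ω - F θ s ω‖ₑ ^ (2 * n) ∂P ≤
      C₀ * ENNReal.ofReal (((t : ℝ) - s) ^ (κ / 4)) ^ (2 * n) := by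
    intro θ hθ s t hst
    simp only [hF]
    refine (hC₀ S θ θ 0 le_rfl hθ hθ (fun m => by simp) s t hst).2
  have hpow : ∀ (s t : ℝ≥0), s ≤ t → t ≤ T →
      ENNReal.ofReal (((t : ℝ) - s) ^ (κ / 4)) ^ n ≤ (T + 1) ^ n * ((t - s : ℝ≥0) : ℝ≥0∞) ^ 2 := by
    intro s t hst ht
    have hτ : (0 : ℝ) ≤ (t : ℝ) - s := sub_nonneg.2 hst
    have hτT : (t : ℝ) - s ≤ T := by
      have : (t : ℝ) ≤ T := by exact_mod_cast ht
      linarith [s.2]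
    have e1 : ((t - s : ℝ≥0) : ℝ≥0∞) = ENNReal.ofReal ((t : ℝ) - s) := by
      rw [← ENNReal.ofReal_coe_nnreal, NNReal.coe_sub hst]
    have e2 : ((T : ℝ≥0∞) + 1) = ENNReal.ofReal (T + 1) := by
      rw [ENNReal.ofReal_add (by positivity) zero_le_one]; simp
    rw [e1, e2, ← ENNReal.ofReal_pow (by positivity), ← ENNReal.ofReal_pow (by positivity),
      ← ENNReal.ofReal_pow hτ, ← ENNReal.ofReal_mul (by positivity)]
    refine ENNReal.ofReal_le_ofReal ?_
    set τ := (t : ℝ) - s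
    rcases hτ.eq_or_lt with h0 | h0
    · rw [← h0, Real.zero_rpow (by positivity), zero_pow (by omega)]
      positivity
    rw [← Real.rpow_natCast (τ ^ _), ← Real.rpow_mul hτ]
    calc τ ^ (κ / 4 * n) = τ ^ (κ / 4 * n - 2) * τ ^ 2 := by
          rw [← Real.rpow_natCast τ 2, ← Real.rpow_add h0]
          congr 1
          push_cast; ring
      _ ≤ (T + 1) ^ n * τ ^ 2 := by
          gcongr
          calc τ ^ (κ / 4 * n - 2) ≤ (T + 1 : ℝ) ^ (κ / 4 * n - 2) := by
                gcongr
                · linarith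
                · linarith
            _ ≤ (T + 1 : ℝ) ^ (n : ℝ) := by
                refine Real.rpow_le_rpow_of_exponent_le (by simp) ?_
                have : κ * n ≤ 1 * n := by gcongr
                linarith [show (0 : ℝ) ≤ n by positivity]
            _ = _ := Real.rpow_natCast _ _
  have hT1 : (1 : ℝ≥0∞) ≤ (T + 1) ^ n := one_le_pow₀ le_add_self
  have key := hC₁ (P := P) (Y := Y) (K := A * ENNReal.ofReal ρ ^ n) ?_ (fun t => (hYm t).enorm)
    (fun s t => ((hYm t).sub (hYm s)).enorm) ?_ ?_
  · simp only [Y, hF] at key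
    refine key.trans_eq ?_
    push_cast
    ring
  · filter_upwards [hc] with ω hω
    exact ((continuous_toBesov r).comp (continuous_wickPoly μ k l S θ hω)).sub
      ((continuous_toBesov r).comp (continuous_wickPoly μ k l S θ' hω))
  · intro s t hst ht
    have e1 : ∫⁻ ω, ‖Y t ω - Y s ω‖ₑ ^ (2 * n) ∂P ≤
        2 ^ (2 * n) * (2 * (C₀ * ENNReal.ofReal ρ ^ (2 * n))) := by
      calc _ ≤ ∫⁻ ω, 2 ^ (2 * n) * (‖Y t ω‖ₑ ^ (2 * n) + ‖Y s ω‖ₑ ^ (2 * n)) ∂P := by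
            refine lintegral_mono fun ω => (pow_le_pow_left' (enorm_sub_le) _).trans
              (ennreal_add_pow_le _ _ _)
        _ = 2 ^ (2 * n) * (∫⁻ ω, ‖Y t ω‖ₑ ^ (2 * n) ∂P + ∫⁻ ω, ‖Y s ω‖ₑ ^ (2 * n) ∂P) := by
            rw [lintegral_const_mul' _ _ (by simp), lintegral_add_left' ((hYm t).enorm.pow_const _)]
        _ ≤ _ := by
            rw [two_mul ((C₀ : ℝ≥0∞) * _)]
            gcongr
            · exact hbase t
            · exact hbase s
    have e2 : ∫⁻ ω, ‖Y t ω - Y s ω‖ₑ ^ (2 * n) ∂P ≤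
        2 ^ (2 * n) * (2 * (C₀ * ENNReal.ofReal (((t : ℝ) - s) ^ (κ / 4)) ^ (2 * n))) := by
      calc _ ≤ ∫⁻ ω, 2 ^ (2 * n) * (‖F θ t ω - F θ s ω‖ₑ ^ (2 * n) +
            ‖F θ' t ω - F θ' s ω‖ₑ ^ (2 * n)) ∂P := by
            refine lintegral_mono fun ω => ?_
            have : Y t ω - Y s ω = (F θ t ω - F θ s ω) - (F θ' t ω - F θ' s ω) := by
              simp only [Y]; abel
            simp only [this]
            exact (pow_le_pow_left' (enorm_sub_le) _).trans (ennreal_add_pow_le _ _ _)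
        _ = 2 ^ (2 * n) * (∫⁻ ω, ‖F θ t ω - F θ s ω‖ₑ ^ (2 * n) ∂P +
            ∫⁻ ω, ‖F θ' t ω - F θ' s ω‖ₑ ^ (2 * n) ∂P) := by
            rw [lintegral_const_mul' _ _ (by simp),
              lintegral_add_left' (show AEMeasurable (fun ω => ‖F θ t ω - F θ s ω‖ₑ ^ (2 * n)) P from
                ((hFm θ t).sub (hFm θ s)).enorm.pow_const _)]
        _ ≤ _ := by
            rw [two_mul ((C₀ : ℝ≥0∞) * _)]
            gcongr
            · exact htime θ hθ s t hst
            · exact htime θ' hθ' s t hst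
    have e3 : ∫⁻ ω, ‖Y t ω - Y s ω‖ₑ ^ (2 * n) ∂P ≤ 2 ^ (2 * n) * (2 * (C₀ *
        (ENNReal.ofReal ρ ^ n * ENNReal.ofReal (((t : ℝ) - s) ^ (κ / 4)) ^ n))) := by
      -- The minimum of two `2n`-th powers is at most the product of the `n`-th powers.
      rcases le_total (ENNReal.ofReal ρ) (ENNReal.ofReal (((t : ℝ) - s) ^ (κ / 4))) with hxy | hxy
      · refine e1.trans ?_
        rw [two_mul n, pow_add (ENNReal.ofReal ρ)]
        gcongr
      · refine e2.trans ?_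
        rw [two_mul n, pow_add (ENNReal.ofReal (((t : ℝ) - s) ^ (κ / 4)))]
        gcongr
    refine e3.trans ?_
    calc _ ≤ 2 ^ (2 * n) * (2 * (C₀ * (ENNReal.ofReal ρ ^ n *
          ((T + 1) ^ n * ((t - s : ℝ≥0) : ℝ≥0∞) ^ 2)))) := by
          gcongr
          exact hpow s t hst ht
      _ = _ := by simp only [A]; push_cast; ring
  · intro t ht
    refine (hbase t).trans ?_
    calc C₀ * ENNReal.ofReal ρ ^ (2 * n) ≤ C₀ * ENNReal.ofReal ρ ^ n := by
          gcongr 1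
          exact pow_le_pow_right_of_le_one' (ENNReal.ofReal_le_one.2 hρ1) (by omega)
      _ ≤ 2 ^ (2 * n) * 2 * C₀ * (T + 1) ^ n * ENNReal.ofReal ρ ^ n := by
          gcongr 1
          have h4 : (1 : ℝ≥0∞) ≤ 2 ^ (2 * n) * 2 :=
            one_le_mul (one_le_pow₀ one_le_two) one_le_two
          calc (C₀ : ℝ≥0∞) = 1 * C₀ * 1 := by ring
            _ ≤ _ := by gcongr
      _ = _ := by simp only [A]; push_cast; ring

/-! ### The stochastic convolution -/

/-- A limit in the `p`-th mean and an almost everywhere limit coincide, by Fatou's lemma. -/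
lemma ae_eq_of_tendsto_of_lintegral {Y E : Type*} [MeasurableSpace Y] {ν : Measure Y}
    [NormedAddCommGroup E] {F : ℕ → Y → E} {f g : Y → E} {p : ℕ} (hp : p ≠ 0)
    (hm : ∀ N, AEMeasurable (fun y => ‖f y - F N y‖ₑ) ν)
    (h : Tendsto (fun N => ∫⁻ y, ‖f y - F N y‖ₑ ^ p ∂ν) atTop (𝓝 0))
    (hg : ∀ᵐ y ∂ν, Tendsto (fun N => F N y) atTop (𝓝 (g y))) : f =ᵐ[ν] g := by
  have e1 : ∀ᵐ y ∂ν, Tendsto (fun N => ‖f y - F N y‖ₑ ^ p) atTop (𝓝 (‖f y - g y‖ₑ ^ p)) :=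
    hg.mono fun y hy => ((ENNReal.continuous_pow p).tendsto _).comp
      ((continuous_enorm.tendsto _).comp (tendsto_const_nhds.sub hy))
  have e3 : AEMeasurable (fun y => ‖f y - g y‖ₑ ^ p) ν :=
    aemeasurable_of_tendsto_metrizable_ae atTop (fun N => (hm N).pow_const _) e1
  have e4 : ∫⁻ y, ‖f y - g y‖ₑ ^ p ∂ν = 0 := by
    rw [lintegral_congr_ae (e1.mono fun y h => h.liminf_eq.symm)]
    exact le_antisymm ((lintegral_liminf_le' fun N => (hm N).pow_const _).trans_eq h.liminf_eq) zero_le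
  filter_upwards [(lintegral_eq_zero_iff' e3).1 e4] with y hy
  have := pow_eq_zero_iff hp |>.1 hy
  rwa [enorm_eq_zero, sub_eq_zero] at this

lemma integral_norm_sq_sum {Y ι : Type*} [MeasurableSpace Y] {ν : Measure Y} [Fintype ι]
    {f : ι → Y → ℂ} (hf : ∀ i, MemLp (f i) 2 ν) (c : ι → ℂ) :
    ((∫ y, ‖∑ i, c i * f i y‖ ^ 2 ∂ν : ℝ) : ℂ) =
      ∑ i, ∑ j, c i * conj (c j) * ∫ y, f i y * conj (f j y) ∂ν := by
  have h1 : ∀ y, ((‖∑ i, c i * f i y‖ ^ 2 : ℝ) : ℂ) =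
      ∑ i, ∑ j, c i * conj (c j) * (f i y * conj (f j y)) := by
    intro y
    rw [Complex.ofReal_pow, ← Complex.mul_conj', map_sum, Finset.sum_mul_sum]
    refine Finset.sum_congr rfl fun i _ => Finset.sum_congr rfl fun j _ => ?_
    rw [map_mul]; ring
  have h2 : ∀ i j, Integrable (fun y => c i * conj (c j) * (f i y * conj (f j y))) ν := fun i j =>
    ((hf i).integrable_mul (hf j).star).const_mul _
  rw [← integral_complex_ofReal]
  simp_rw [h1]
  rw [integral_finsetSum _ fun i _ => integrable_finsetSum _ fun j _ => h2 i j]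
  simp_rw [integral_finsetSum _ fun j _ => h2 _ j, integral_const_mul]

section Kernel

variable {μ : ℂ}

/-- The time part of the heat kernel in the mode `m`. -/
def timeKer (μ : ℂ) (m : Mode) (t s : ℝ) : ℂ :=
  (Set.Iic t).indicator (fun s : ℝ => Complex.exp (-μ * eigenvalue m * ((t - s : ℝ) : ℂ))) s

lemma kernelCoeff_eq (t : ℝ) (p : ℝ × Torus) (m : Mode) : kernelCoeff μ (t - p.1) p.2 m =
    timeKer μ m t p.1 * UnitAddTorus.mFourier (-m) p.2 := by
  rw [kernelCoeff, timeKer, Set.indicator_apply]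
  simp only [sub_nonneg, Set.mem_Iic]
  split_ifs <;> simp

lemma timeKer_mul_conj_timeKer (m : Mode) {s t : ℝ} (hst : s ≤ t) (r : ℝ) :
    timeKer μ m t r * conj (timeKer μ m s r) = (Set.Iic s).indicator (fun r : ℝ =>
      Complex.exp (-μ * eigenvalue m * ((t - s : ℝ) : ℂ)) *
        Complex.exp (((2 * μ.re * eigenvalue m : ℝ) : ℂ) * (-s : ℂ)) *
        Complex.exp (((2 * μ.re * eigenvalue m : ℝ) : ℂ) * r)) r := by
  rw [timeKer, timeKer, Set.indicator_apply, Set.indicator_apply, Set.indicator_apply]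
  by_cases h : r ≤ s
  · rw [if_pos (show r ∈ Set.Iic t from h.trans hst), if_pos (show r ∈ Set.Iic s from h),
      if_pos (show r ∈ Set.Iic s from h), ← Complex.exp_conj, ← Complex.exp_add, ← Complex.exp_add,
      ← Complex.exp_add]
    congr 1
    have h2 : (2 * μ.re : ℂ) = μ + conj μ := by rw [Complex.add_conj]; push_cast; ring
    simp only [map_mul, map_neg, Complex.conj_ofReal]
    push_cast
    rw [h2]
    ring
  · rw [if_neg (show r ∉ Set.Iic s from h), if_neg (show r ∉ Set.Iic s from h), map_zero, mul_zero]

lemma integrable_timeKer_mul_conj (hμ : 0 < μ.re) (m : Mode) {s t : ℝ} (hst : s ≤ t) :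
    Integrable fun r => timeKer μ m t r * conj (timeKer μ m s r) := by
  have h0 := eigenvalue_pos m
  simp_rw [timeKer_mul_conj_timeKer m hst]
  rw [integrable_indicator_iff measurableSet_Iic]
  refine Integrable.const_mul ?_ _
  exact integrableOn_exp_mul_complex_Iic (by rw [Complex.ofReal_re]; positivity) s

lemma integral_timeKer_mul_conj (hμ : 0 < μ.re) (m : Mode) {s t : ℝ} (hst : s ≤ t) :
    ∫ r, timeKer μ m t r * conj (timeKer μ m s r) =
      Complex.exp (-μ * eigenvalue m * ((t - s : ℝ) : ℂ)) * ouVar μ m := by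
  have h0 := eigenvalue_pos m
  simp_rw [timeKer_mul_conj_timeKer m hst]
  rw [integral_indicator measurableSet_Iic, integral_const_mul,
    integral_exp_mul_complex_Iic (by rw [Complex.ofReal_re]; positivity), mul_assoc, mul_div_assoc',
    ← Complex.exp_add, ouVar, Complex.ofReal_inv]
  congr 1
  rw [← mul_add, neg_add_cancel, mul_zero, Complex.exp_zero, one_div]

lemma measurable_timeKer (m : Mode) (t : ℝ) : Measurable (timeKer μ m t) := by
  unfold timeKer
  exact Measurable.indicator (by fun_prop) measurableSet_Iic

lemma memLp_timeKer (hμ : 0 < μ.re) (m : Mode) (t : ℝ) : MemLp (timeKer μ m t) 2 volume := by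
  refine (memLp_two_iff_integrable_sq_norm (measurable_timeKer m t).aestronglyMeasurable).2 ?_
  refine (integrable_timeKer_mul_conj hμ m (le_refl t)).norm.congr (.of_forall fun r => ?_)
  show ‖_ * _‖ = ‖_‖ ^ 2
  rw [norm_mul, RCLike.norm_conj, sq]

lemma memLp_kernelCoeff (hμ : 0 < μ.re) (m : Mode) (t : ℝ) :
    MemLp (fun p : ℝ × Torus => kernelCoeff μ (t - p.1) p.2 m) 2 spaceTimeMeasure := by
  simp_rw [kernelCoeff_eq]
  have hmeas : AEStronglyMeasurable (fun p : ℝ × Torus => timeKer μ m t p.1 *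
      UnitAddTorus.mFourier (-m) p.2) spaceTimeMeasure :=
    (((measurable_timeKer m t).comp measurable_fst).mul
      ((UnitAddTorus.mFourier (-m)).continuous.measurable.comp measurable_snd)).aestronglyMeasurable
  refine (memLp_two_iff_integrable_sq_norm hmeas).2 ?_
  have h := ((memLp_two_iff_integrable_sq_norm (measurable_timeKer m t).aestronglyMeasurable).1
    (memLp_timeKer hμ m t)).mul_prod (integrable_const (1 : ℝ) (μ := torusMeasure))
  refine h.congr (.of_forall fun p => ?_)
  simp [norm_mul, norm_mFourier_apply]

/-- The kernel whose stochastic integral is the `m`-th coefficient of the solution at time `t`. -/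
def kerL2 (hμ : 0 < μ.re) (t : ℝ) (m : Mode) : SpaceTimeL2 := (memLp_kernelCoeff hμ m t).toLp

lemma coeFn_kerL2 (hμ : 0 < μ.re) (t : ℝ) (m : Mode) :
    kerL2 hμ t m =ᵐ[spaceTimeMeasure] fun p => kernelCoeff μ (t - p.1) p.2 m := MemLp.coeFn_toLp _

lemma integral_mFourier_mul_conj (m n : Mode) : ∫ y, UnitAddTorus.mFourier (-m) y *
    conj (UnitAddTorus.mFourier (-n) y) ∂torusMeasure = if m = n then 1 else 0 := by
  have h := congrFun (fc_mFourier n) m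
  rw [fc_apply, Pi.single_apply] at h
  rw [← h]
  refine integral_congr_ae (.of_forall fun y => ?_)
  simp only
  rw [← UnitAddTorus.mFourier_neg, neg_neg]

/-- The kernel is a product in space and time: orthogonality of characters decouples the modes, and
the time integral is that of an exponential. By the isometry this is the covariance of the
stationary solution. -/
lemma integral_kerL2 (hμ : 0 < μ.re) {s t : ℝ} (hst : s ≤ t) (m n : Mode) :
    ∫ p, kerL2 hμ t m p * conj (kerL2 hμ s n p) ∂spaceTimeMeasure =
      if m = n then Complex.exp (-μ * eigenvalue m * ((t - s : ℝ) : ℂ)) * ouVar μ m else 0 := by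
  have h1 : ∫ p, kerL2 hμ t m p * conj (kerL2 hμ s n p) ∂spaceTimeMeasure =
      ∫ p : ℝ × Torus, (timeKer μ m t p.1 * conj (timeKer μ n s p.1)) *
        (UnitAddTorus.mFourier (-m) p.2 * conj (UnitAddTorus.mFourier (-n) p.2)) ∂spaceTimeMeasure := by
    refine integral_congr_ae ?_
    filter_upwards [coeFn_kerL2 hμ t m, coeFn_kerL2 hμ s n] with p h1 h2
    rw [h1, h2, kernelCoeff_eq, kernelCoeff_eq, map_mul]
    ring
  rw [h1]
  refine (integral_prod_mul (μ := volume) (ν := torusMeasure)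
    (fun r => timeKer μ m t r * conj (timeKer μ n s r)) (fun y => UnitAddTorus.mFourier (-m) y *
      conj (UnitAddTorus.mFourier (-n) y))).trans ?_
  rw [integral_mFourier_mul_conj]
  split_ifs with h
  · subst h
    rw [mul_one, integral_timeKer_mul_conj hμ m hst]
  · rw [mul_zero]

variable {Ω : Type*} [MeasurableSpace Ω] {P : Measure Ω} {ξ : SpaceTimeL2 → Ω → ℂ}

lemma IsComplexWhiteNoise.isOU (hξ : IsComplexWhiteNoise P ξ) (hμ : 0 < μ.re) :
    IsOU μ P fun t m => ξ (kerL2 hμ t m) where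
  gaussian := hξ.gaussian.comp_right fun p : ℝ≥0 × Mode => kerL2 hμ p.1 p.2
  mean t m := hξ.mean _
  cov s t hst m n := (hξ.cov _ _).trans (integral_kerL2 hμ (NNReal.coe_le_coe.2 hst) m n)
  pseudoCov s t m n := hξ.pseudoCov _ _

lemma IsOU.congr {X Y : ℝ≥0 → Mode → Ω → ℂ} (hX : IsOU μ P X) (h : ∀ t m, X t m =ᵐ[P] Y t m) :
    IsOU μ P Y where
  gaussian := hX.gaussian.congr fun p => h p.1 p.2
  mean t m := by rw [← hX.mean t m]; exact integral_congr_ae (h t m).symm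
  cov s t hst m n := by
    rw [← hX.cov s t hst m n]
    refine integral_congr_ae ?_
    filter_upwards [h t m, h s n] with ω h1 h2
    rw [h1, h2]
  pseudoCov s t m n := by
    rw [← hX.pseudoCov s t m n]
    refine integral_congr_ae ?_
    filter_upwards [h t m, h s n] with ω h1 h2
    rw [h1, h2]

lemma pairing_mFourier (f : Mode → ℂ) (m : Mode) : pairing f (UnitAddTorus.mFourier m) = f m := by
  rw [pairing, ← fc_eq_mFourierCoeff, fc_mFourier, tsum_eq_single m]
  · simp
  · intro n hn
    simp [Pi.single_eq_of_ne hn]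

/-- The Fourier coefficients of a stationary solution are given by the stochastic convolution. -/
lemma IsStationarySolution.coeff_ae_eq {χ : DyadicPartition} {γ : ℝ} {Z : Ω → χ.PathSpace γ}
    (hZ : IsStationarySolution χ γ μ P ξ Z) (hμ : 0 < μ.re) (t : ℝ≥0) (m : Mode) :
    (fun ω => (Z ω t).coeff m) =ᵐ[P] ξ (kerL2 hμ t m) := by
  obtain ⟨u, hu, h⟩ := hZ.mild t _ (isSmooth_mFourier m)
  have h1 : u = kerL2 hμ t m := by
    refine Lp.ext ?_
    filter_upwards [hu, coeFn_kerL2 hμ t m] with p h1 h2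
    rw [h1, h2, pairing_mFourier]
  filter_upwards [h] with ω hω
  rw [← h1, ← hω, pairing_mFourier]

lemma IsStationarySolution.isOU {χ : DyadicPartition} {γ : ℝ} {Z : Ω → χ.PathSpace γ}
    (hZ : IsStationarySolution χ γ μ P ξ Z) (hξ : IsComplexWhiteNoise P ξ) (hμ : 0 < μ.re) :
    IsOU μ P fun t m ω => (Z ω t).coeff m :=
  (hξ.isOU hμ).congr fun t m => (hZ.coeff_ae_eq hμ t m).symm

lemma IsComplexWhiteNoise.memLp (hξ : IsComplexWhiteNoise P ξ) (u : SpaceTimeL2) :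
    MemLp (ξ u) 2 P := (hξ.gaussian.hasGaussianLaw_eval u).memLp_two

/-- The isometry property of the white noise. -/
lemma IsComplexWhiteNoise.integral_norm_sq_sum_sub (hξ : IsComplexWhiteNoise P ξ) (u : SpaceTimeL2)
    {ι : Type*} (S : Finset ι) (a : ι → ℂ) (v : ι → SpaceTimeL2) :
    ∫⁻ ω, ‖ξ u ω - ∑ i ∈ S, a i * ξ (v i) ω‖ₑ ^ 2 ∂P = ‖u - ∑ i ∈ S, a i • v i‖ₑ ^ 2 := by
  -- With `u` adjoined as an extra index of coefficient `1`, the difference is a single linear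
  -- combination, whose second moment the covariance identifies with the one in `L²`.
  let w : Option S → SpaceTimeL2 := fun o => o.elim u fun i => v i
  let c : Option S → ℂ := fun o => o.elim 1 fun i => -a i
  have h1 : ∀ (g : SpaceTimeL2 → ℂ),
      ∑ o, c o * g (w o) = g u - ∑ i ∈ S, a i * g (v i) := by
    intro g
    rw [Fintype.sum_option, ← Finset.sum_coe_sort S]
    simp [w, c, sub_eq_add_neg]
  have h2 : (∫ ω, ‖ξ u ω - ∑ i ∈ S, a i * ξ (v i) ω‖ ^ 2 ∂P : ℝ) =
      ∫ p, ‖u p - ∑ i ∈ S, a i * v i p‖ ^ 2 ∂spaceTimeMeasure := by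
    have e1 := integral_norm_sq_sum (f := fun o => ξ (w o)) (fun o => hξ.memLp (w o)) c
    have e2 := integral_norm_sq_sum (f := fun o p => w o p) (fun o => Lp.memLp (w o)) c
    simp_rw [hξ.cov] at e1
    rw [← e2] at e1
    have e3 := Complex.ofReal_injective e1
    simpa only [fun ω => h1 fun v => ξ v ω, fun p => h1 fun v => v p] using e3
  have hL : MemLp (fun ω => ξ u ω - ∑ i ∈ S, a i * ξ (v i) ω) 2 P :=
    (hξ.memLp u).sub (memLp_finsetSum _ fun i _ => (hξ.memLp (v i)).const_mul (a i))
  have h3 : ∫⁻ ω, ‖ξ u ω - ∑ i ∈ S, a i * ξ (v i) ω‖ₑ ^ 2 ∂P =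
      ENNReal.ofReal (∫ ω, ‖ξ u ω - ∑ i ∈ S, a i * ξ (v i) ω‖ ^ 2 ∂P) := by
    rw [ofReal_integral_eq_lintegral_ofReal hL.norm.integrable_sq (.of_forall fun _ => by positivity)]
    refine lintegral_congr fun ω => ?_
    rw [ENNReal.ofReal_pow (norm_nonneg _), ofReal_norm]
  rw [h3, h2, ← ofReal_norm, ← ENNReal.ofReal_pow (norm_nonneg _)]
  congr 1
  have h4 : ∀ f : SpaceTimeL2, ‖f‖ ^ 2 = ∫ p, ‖f p‖ ^ 2 ∂spaceTimeMeasure := by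
    intro f
    have e1 := L2.inner_def (𝕜 := ℂ) f f
    rw [inner_self_eq_norm_sq_to_K] at e1
    have e2 : ∀ p, inner ℂ (f p) (f p) = ((‖f p‖ ^ 2 : ℝ) : ℂ) := fun p => by
      rw [inner_self_eq_norm_sq_to_K]; simp
    simp_rw [e2] at e1
    rw [integral_complex_ofReal] at e1
    exact Complex.ofReal_injective (by simpa using e1)
  rw [h4]
  refine integral_congr_ae ?_
  have h5 : ⇑(∑ i ∈ S, a i • v i) =ᵐ[spaceTimeMeasure] fun p => ∑ i ∈ S, a i * v i p := by
    have e1 := Lp.coeFn_finsetSum S fun i => a i • v i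
    have e2 : ∀ᵐ p ∂spaceTimeMeasure, ∀ i ∈ S, (a i • v i : SpaceTimeL2) p = a i * v i p := by
      rw [Finset.eventually_all]
      exact fun i _ => Lp.coeFn_smul (a i) (v i)
    filter_upwards [e1, e2] with p h1 h2
    rw [h1]
    simp only [Finset.sum_apply]
    exact Finset.sum_congr rfl h2
  filter_upwards [Lp.coeFn_sub u (∑ i ∈ S, a i • v i), h5] with p h6 h7
  rw [h6, Pi.sub_apply, h7]

lemma enorm_kerL2_sq (hμ : 0 < μ.re) (t : ℝ) (m : Mode) :
    ‖kerL2 hμ t m‖ ^ 2 = ouVar μ m := by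
  have e1 := L2.inner_def (𝕜 := ℂ) (kerL2 hμ t m) (kerL2 hμ t m)
  rw [inner_self_eq_norm_sq_to_K] at e1
  have e2 := integral_kerL2 hμ (le_refl t) m m
  rw [if_pos rfl, sub_self, Complex.ofReal_zero, mul_zero, Complex.exp_zero, one_mul] at e2
  have e3 : ∫ p, inner ℂ (kerL2 hμ t m p) (kerL2 hμ t m p) ∂spaceTimeMeasure = ouVar μ m := by
    rw [← e2]
    rfl
  rw [e3] at e1
  exact Complex.ofReal_injective (by simpa using e1)

end Kernel

/-! ### Continuous modifications and the mild formulation -/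

lemma tendsto_ball : Tendsto (fun N : ℕ => ball N) atTop atTop := by
  refine tendsto_atTop_finset_of_monotone (fun a b h m hm => mem_ball.2 ((mem_ball.1 hm).trans
    (by exact_mod_cast h))) fun m => ?_
  obtain ⟨N, hN⟩ := exists_nat_ge ‖freq m‖
  exact ⟨N, mem_ball.2 hN⟩

variable {μ : ℂ} {Ω : Type*} [MeasurableSpace Ω] {P : Measure Ω}

/-- The fourth moment of a circular complex Gaussian variable. -/
lemma lintegral_enorm_pow_four {D : Ω → ℂ} (hD : HasGaussianLaw D P) (h0 : ∫ ω, D ω ∂P = 0)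
    {v : ℝ} (hv : 0 ≤ v) (h1 : ∫ ω, D ω * conj (D ω) ∂P = v) (h2 : ∫ ω, D ω * D ω ∂P = 0) :
    ∫⁻ ω, ‖D ω‖ₑ ^ 4 ∂P = ENNReal.ofReal (2 * v ^ 2) := by
  have hv2 : ((√v : ℝ) : ℂ) * √v = v := by rw [← Complex.ofReal_mul, Real.mul_self_sqrt hv]
  have hg : HasGaussianLaw (fun ω (_ : Fin 1) => D ω) P :=
    hD.map (ContinuousLinearMap.pi fun _ : Fin 1 => ContinuousLinearMap.id ℝ ℂ)
  have hm := map_eq_map_stdCPi hg (fun _ (_ : Fin 1) => ((√v : ℝ) : ℂ)) (fun _ => h0)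
    (fun _ _ => by rw [h1]; simp [hv2]) (fun _ _ => h2)
  have hF : Measurable fun x : Fin 1 → ℂ => ‖x 0‖ₑ ^ 4 := by fun_prop
  have hc := continuous_lin fun _ : Fin 1 => ((√v : ℝ) : ℂ)
  have e1 : ∫⁻ ω, ‖D ω‖ₑ ^ 4 ∂P = ∫⁻ z, ‖lin (fun _ : Fin 1 => ((√v : ℝ) : ℂ)) z‖ₑ ^ 4 ∂stdCPi (Fin 1) := by
    have a1 := lintegral_map' (μ := P) hF.aemeasurable hg.aemeasurable
    have a2 := lintegral_map (μ := stdCPi (Fin 1)) hF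
      (g := fun z (_ : Fin 1) => lin (fun _ : Fin 1 => ((√v : ℝ) : ℂ)) z)
      (measurable_pi_lambda _ fun _ => hc.measurable)
    rw [hm] at a1
    exact a1.symm.trans a2
  have e2 : Integrable (fun z => ‖lin (fun _ : Fin 1 => ((√v : ℝ) : ℂ)) z‖ ^ 4) (stdCPi (Fin 1)) := by
    refine integrable_of_poly_bound (C := √v ^ 4) (N := 4) (by fun_prop) fun z => ?_
    have : ‖z 0‖ ≤ 1 + ‖z‖ := (norm_le_pi_norm z 0).trans (by linarith)
    simp only [lin, Finset.univ_unique, Finset.sum_singleton, norm_mul, norm_pow, norm_norm,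
      Complex.norm_real, mul_pow, Real.norm_of_nonneg (Real.sqrt_nonneg v)]
    gcongr
    exact this
  have e3 := integral_lin_pow (fun _ : Fin 1 => ((√v : ℝ) : ℂ)) 2 2
  rw [if_pos rfl] at e3
  have e4 : ∫ z, ‖lin (fun _ : Fin 1 => ((√v : ℝ) : ℂ)) z‖ ^ 4 ∂stdCPi (Fin 1) = 2 * v ^ 2 := by
    refine Complex.ofReal_injective ?_
    rw [← integral_complex_ofReal]
    refine (integral_congr_ae (.of_forall fun z => ?_)).trans (e3.trans ?_)
    · show ((‖_‖ ^ 4 : ℝ) : ℂ) = _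
      rw [← mul_pow, Complex.mul_conj']
      push_cast
      ring
    · simp [Real.sq_sqrt hv, Nat.factorial]
  rw [e1, ← e4, ofReal_integral_eq_lintegral_ofReal e2 (.of_forall fun _ => by positivity)]
  refine lintegral_congr fun z => ?_
  rw [ENNReal.ofReal_pow (norm_nonneg _), ofReal_norm]

variable {X : ℝ≥0 → Mode → Ω → ℂ}

lemma IsOU.isProbabilityMeasure (hX : IsOU μ P X) : IsProbabilityMeasure P :=
  hX.gaussian.isProbabilityMeasure

lemma IsOU.memLp_two (hX : IsOU μ P X) (t : ℝ≥0) (m : Mode) : MemLp (X t m) 2 P :=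
  (hX.gaussian.hasGaussianLaw_eval (t, m)).memLp_two

lemma IsOU.integral_mul_conj_self (hX : IsOU μ P X) (t : ℝ≥0) (m : Mode) :
    ∫ ω, X t m ω * conj (X t m ω) ∂P = ouVar μ m := by
  rw [hX.cov t t le_rfl, if_pos rfl]
  simp

/-- The increment is circular Gaussian with variance at most linear in `t - s`, so its fourth moment
is quadratic. The constant depends on the mode, which is harmless since continuity is obtained mode
by mode. -/
lemma IsOU.lintegral_sub_pow_four_le (hμ : 0 < μ.re) (hX : IsOU μ P X) (m : Mode) {s t : ℝ≥0}
    (hst : s ≤ t) : ∫⁻ ω, ‖X t m ω - X s m ω‖ₑ ^ 4 ∂P ≤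
      ENNReal.ofReal (2 * (4 * ouVar μ m * (‖μ‖ * eigenvalue m)) ^ 2) * (t - s : ℝ≥0) ^ 2 := by
  have hτ : (0 : ℝ) ≤ (t : ℝ) - s := sub_nonneg.2 hst
  have hv := ouVar_pos hμ m
  have hl := eigenvalue_pos m
  set w : ℂ := μ * eigenvalue m * ((t : ℝ) - s : ℝ) with hw
  have i1 : ∀ a b : ℝ≥0, Integrable (fun ω => X a m ω * X b m ω) P := fun a b =>
    (hX.memLp_two a m).integrable_mul (hX.memLp_two b m)
  have i2 : ∀ a b : ℝ≥0, Integrable (fun ω => X a m ω * conj (X b m ω)) P := fun a b =>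
    (hX.memLp_two a m).integrable_mul (hX.memLp_two b m).star
  have c1 : ∫ ω, X t m ω * conj (X s m ω) ∂P = Complex.exp (-w) * ouVar μ m := by
    rw [hX.cov s t hst, if_pos rfl, hw, neg_mul, neg_mul]
  have c2 : ∫ ω, X s m ω * conj (X t m ω) ∂P = conj (Complex.exp (-w)) * ouVar μ m := by
    rw [← Complex.conj_ofReal (ouVar μ m), ← map_mul, ← c1, ← integral_conj]
    refine integral_congr_ae (.of_forall fun ω => ?_)
    simp only [map_mul, Complex.conj_conj, mul_comm]
  set v : ℝ := 2 * (1 - Complex.exp (-w)).re * ouVar μ m with hvdef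
  have h1 : ∫ ω, (X t m ω - X s m ω) * conj (X t m ω - X s m ω) ∂P = v := by
    have e : ∀ ω, (X t m ω - X s m ω) * conj (X t m ω - X s m ω) =
        (X t m ω * conj (X t m ω) - X t m ω * conj (X s m ω)) -
          (X s m ω * conj (X t m ω) - X s m ω * conj (X s m ω)) := fun ω => by rw [map_sub]; ring
    simp_rw [e]
    rw [integral_sub (by exact (i2 _ _).sub (i2 _ _)) (by exact (i2 _ _).sub (i2 _ _)),
      integral_sub (i2 _ _) (i2 _ _), integral_sub (i2 _ _) (i2 _ _), c1, c2, hX.integral_mul_conj_self, hX.integral_mul_conj_self]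
    have h3 := Complex.add_conj (Complex.exp (-w))
    rw [hvdef, Complex.sub_re, Complex.one_re]
    push_cast at h3 ⊢
    linear_combination (-(ouVar μ m : ℂ)) * h3
  have h2 : ∫ ω, (X t m ω - X s m ω) * (X t m ω - X s m ω) ∂P = 0 := by
    have e : ∀ ω, (X t m ω - X s m ω) * (X t m ω - X s m ω) =
        (X t m ω * X t m ω - X t m ω * X s m ω) - (X s m ω * X t m ω - X s m ω * X s m ω) :=
      fun ω => by ring
    simp_rw [e]
    rw [integral_sub (by exact (i1 _ _).sub (i1 _ _)) (by exact (i1 _ _).sub (i1 _ _)),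
      integral_sub (i1 _ _) (i1 _ _), integral_sub (i1 _ _) (i1 _ _)]
    simp only [hX.pseudoCov, sub_zero]
  have hwre : 0 ≤ w.re := by
    rw [hw, Complex.mul_re, Complex.mul_re]
    simp only [Complex.ofReal_re, Complex.ofReal_im, mul_zero, sub_zero]
    positivity
  have hv0 : 0 ≤ v := by
    have : ‖Complex.exp (-w)‖ ≤ 1 := by rw [Complex.norm_exp, Complex.neg_re]; simpa using hwre
    have := (Complex.re_le_norm _).trans this
    rw [hvdef, Complex.sub_re, Complex.one_re]
    have : 0 ≤ 1 - (Complex.exp (-w)).re := by linarith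
    positivity
  have hv1 : v ≤ 4 * ouVar μ m * (‖μ‖ * eigenvalue m) * ((t : ℝ) - s) := by
    have hre : (1 - Complex.exp (-w)).re ≤ 2 * ‖w‖ := by
      refine (Complex.re_le_norm _).trans ?_
      rw [norm_sub_rev]
      rcases le_total ‖w‖ 1 with h | h
      · have := Complex.norm_exp_sub_one_le (x := -w) (by simpa using h)
        simpa using this
      · have : ‖Complex.exp (-w)‖ ≤ 1 := by rw [Complex.norm_exp, Complex.neg_re]; simpa using hwre
        refine (norm_sub_le _ _).trans ?_
        rw [norm_one]; linarith
    have hn : ‖w‖ = ‖μ‖ * eigenvalue m * ((t : ℝ) - s) := by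
      rw [hw, norm_mul, norm_mul, Complex.norm_real, Complex.norm_real, Real.norm_of_nonneg hl.le,
        Real.norm_of_nonneg hτ]
    rw [hn] at hre
    calc v ≤ 2 * (2 * (‖μ‖ * eigenvalue m * ((t : ℝ) - s))) * ouVar μ m := by rw [hvdef]; gcongr
      _ = _ := by ring
  have hg : HasGaussianLaw (fun ω => X t m ω - X s m ω) P :=
    hX.gaussian.hasGaussianLaw_fun_sub (s := (t, m)) (t := (s, m))
  have h0 : ∫ ω, (X t m ω - X s m ω) ∂P = 0 := by
    have := hX.isProbabilityMeasure
    rw [integral_sub ((hX.memLp_two t m).integrable one_le_two)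
      ((hX.memLp_two s m).integrable one_le_two), hX.mean, hX.mean, sub_zero]
  rw [lintegral_enorm_pow_four hg h0 hv0 h1 h2]
  have e1 : ((t - s : ℝ≥0) : ℝ≥0∞) = ENNReal.ofReal ((t : ℝ) - s) := by
    rw [← ENNReal.ofReal_coe_nnreal, NNReal.coe_sub hst]
  rw [e1, ← ENNReal.ofReal_pow hτ, ← ENNReal.ofReal_mul (by positivity)]
  refine ENNReal.ofReal_le_ofReal ?_
  calc 2 * v ^ 2 ≤ 2 * (4 * ouVar μ m * (‖μ‖ * eigenvalue m) * ((t : ℝ) - s)) ^ 2 := by gcongr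
    _ = _ := by ring

/-- Chaining gives a continuous modification of each mode without any measurability. Outside a
measurable null set it agrees with `X` at all dyadic times, hence is a pointwise limit of measurable
variables; on that set the path is replaced by `0`. -/
lemma IsOU.exists_continuous (hμ : 0 < μ.re) (hX : IsOU μ P X) (hXm : ∀ t m, Measurable (X t m)) :
    ∃ Y : ℝ≥0 → Mode → Ω → ℂ, (∀ t m, X t m =ᵐ[P] Y t m) ∧ (∀ t m, Measurable (Y t m)) ∧
      ∀ ω m, Continuous fun t => Y t m ω := by
  have h1 : ∀ m, ∃ g : Ω → C(ℝ≥0, ℂ), ∀ t, ∀ᵐ ω ∂P, g ω t = X t m ω := fun m =>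
    exists_continuous_modification (p := 4) (by norm_num) ENNReal.ofReal_ne_top
      (fun s t => ((hXm t m).sub (hXm s m)).enorm.aemeasurable)
      fun s t hst => hX.lintegral_sub_pow_four_le hμ m hst
  choose g hg using h1
  have hA : ∀ᵐ ω ∂P, ∀ (m : Mode) (a N : ℕ), g m ω ((a : ℝ≥0) / 2 ^ N) = X ((a : ℝ≥0) / 2 ^ N) m ω := by
    simp only [ae_all_iff]
    exact fun m a N => hg m _
  obtain ⟨A, hA1, hAm, hAP⟩ := exists_measurable_superset_of_null hA
  classical
  have hY : ∀ ω ∉ A, ∀ (m : Mode) (a N : ℕ), g m ω ((a : ℝ≥0) / 2 ^ N) = X ((a : ℝ≥0) / 2 ^ N) m ω := fun ω hω => by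
    by_contra h
    exact hω (hA1 h)
  refine ⟨fun t m ω => if ω ∈ A then 0 else g m ω t, fun t m => ?_, fun t m => ?_, fun ω m => ?_⟩
  · filter_upwards [measure_eq_zero_iff_ae_notMem.1 hAP, hg m t] with ω h1 h2
    rw [if_neg h1, h2]
  · refine measurable_of_tendsto_metrizable
      (f := fun N ω => if ω ∈ A then 0 else X (dyadicFloor N t) m ω)
      (fun N => Measurable.ite hAm measurable_const (hXm _ m)) (tendsto_pi_nhds.2 fun ω => ?_)
    by_cases hω : ω ∈ A
    · simp only [if_pos hω, tendsto_const_nhds]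
    · simp only [if_neg hω]
      have := ((g m ω).continuous.tendsto t).comp (tendsto_dyadicFloor t)
      exact this.congr fun N => hY ω hω m _ N
  · by_cases hω : ω ∈ A
    · simp only [if_pos hω, continuous_const]
    · simp only [if_neg hω]
      exact (g m ω).continuous

section Wick

variable {χ : DyadicPartition} {γ : ℝ} {Z : Ω → χ.PathSpace γ}

/-- Distinct modes are uncorrelated and characters have modulus one, so the variance of the
truncated field is the sum of the variances of its modes. -/
lemma renorm_eq (hZ : IsOU μ P fun t m ω => (Z ω t).coeff m) (n : ℕ) (t : ℝ≥0) (x : Torus) :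
    renorm P Z n t x = wickVar μ (ball n) 1 := by
  have h1 : ∀ ω, cutoff n (Z ω t).coeff x =
      ∑ m : ball n, UnitAddTorus.mFourier (m : Mode) x * (Z ω t).coeff m := by
    intro ω
    rw [cutoff_eq_trigSum, trigSum, ContinuousMap.sum_apply, ← Finset.sum_coe_sort]
    exact Finset.sum_congr rfl fun m _ => mul_comm _ _
  have h2 := integral_norm_sq_sum (f := fun (m : ball n) ω => (Z ω t).coeff m)
    (fun m => hZ.memLp_two t m) fun m => UnitAddTorus.mFourier (m : Mode) x
  rw [renorm]
  simp_rw [h1]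
  refine Complex.ofReal_injective (h2.trans ?_)
  rw [wickVar, ← Finset.sum_coe_sort (ball n) fun m => ‖(1 : Mode → ℂ) m‖ ^ 2 * ouVar μ m,
    Complex.ofReal_sum]
  refine Finset.sum_congr rfl fun m _ => ?_
  rw [Finset.sum_eq_single m]
  · rw [hZ.integral_mul_conj_self t m, Complex.mul_conj', norm_mFourier_apply]
    simp
  · intro m' _ hm'
    rw [hZ.cov t t le_rfl, if_neg fun h => hm' (Subtype.ext h.symm), mul_zero]
  · simp

lemma approxWick_eq (hZ : IsOU μ P fun t m ω => (Z ω t).coeff m) (k l n : ℕ) (ω : Ω) (t : ℝ≥0) :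
    approxWick P Z k l n ω t = wickPoly μ k l (ball n) 1 (Z ω t).coeff := by
  funext x
  rw [approxWick, renorm_eq hZ, hermite_eq_herm, wickPoly, herm_continuousMap_apply, one_mul,
    cutoff_eq_trigSum]
  rfl

/-- A path space valued random variable whose Fourier coefficients are given by the stochastic
convolution is a stationary solution. -/
lemma isStationarySolution_of_coeff (hμ : 0 < μ.re) {ξ : SpaceTimeL2 → Ω → ℂ}
    (hξ : IsComplexWhiteNoise P ξ) (hZm : Measurable Z)
    (hZ : ∀ t : ℝ≥0, ∀ m, (fun ω => (Z ω t).coeff m) =ᵐ[P] ξ (kerL2 hμ t m)) :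
    IsStationarySolution χ γ μ P ξ Z := by
  refine ⟨hZm, fun t φ hφ => ?_⟩
  have hOU : IsOU μ P fun t m ω => (Z ω t).coeff m := (hξ.isOU hμ).congr fun t m => (hZ t m).symm
  have := hOU.isProbabilityMeasure
  set a : Mode → ℂ := fun m => conj (UnitAddTorus.mFourierCoeff φ m) with ha
  have hna : ∀ m, ‖a m‖ = ‖UnitAddTorus.mFourierCoeff φ m‖ := fun m => RCLike.norm_conj _
  have hbs : Summable fun m => br m ^ (-4 : ℝ) := summable_br_rpow (by norm_num)
  have hb4 : ∀ m : Mode, br m ^ (-4 : ℝ) = ((br m)⁻¹) ^ 4 := fun m => by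
    rw [Real.rpow_neg (br_pos m).le, inv_pow]; norm_cast
  have hkn : ∀ m, ‖kerL2 hμ t m‖ ≤ (√μ.re)⁻¹ * (br m)⁻¹ := fun m => by
    refine le_trans (le_of_eq ?_) (sqrt_ouVar_le hμ m)
    rw [← enorm_kerL2_sq hμ t m, Real.sqrt_sq (norm_nonneg _)]
  -- The kernel has norm at most a multiple of `(br m)⁻¹`, and `br m * ‖a m‖` is square summable;
  -- writing the product as `(br m)⁻¹ ^ 2` times `br m * ‖a m‖` leaves the summable `br m ^ (-4)`.
  have hsum1 : Summable fun m => ‖a m‖ * ‖kerL2 hμ t m‖ := by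
    refine Summable.of_nonneg_of_le (fun m => by positivity) (fun m => ?_)
      ((hbs.add hφ.summable).mul_left (√μ.re)⁻¹)
    have h1 : ‖a m‖ * (br m)⁻¹ ≤ ((br m)⁻¹) ^ 4 + br m ^ 2 * ‖a m‖ ^ 2 := by
      have hb := br_pos m
      have e : ‖a m‖ * (br m)⁻¹ = (br m)⁻¹ ^ 2 * (br m * ‖a m‖) := by field_simp
      rw [e]
      nlinarith [sq_nonneg ((br m)⁻¹ ^ 2 - br m * ‖a m‖), sq_nonneg ((br m)⁻¹ ^ 2 + br m * ‖a m‖)]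
    calc ‖a m‖ * ‖kerL2 hμ t m‖ ≤ ‖a m‖ * ((√μ.re)⁻¹ * (br m)⁻¹) := by gcongr; exact hkn m
      _ = (√μ.re)⁻¹ * (‖a m‖ * (br m)⁻¹) := by ring
      _ ≤ _ := by rw [hb4, ← hna]; gcongr
  have hsumL : Summable fun m => a m • kerL2 hμ t m :=
    Summable.of_norm (hsum1.congr fun m => (norm_smul _ _).symm)
  set u := ∑' m, a m • kerL2 hμ t m
  have hu : Tendsto (fun N : ℕ => ‖u - ∑ m ∈ ball N, a m • kerL2 hμ t m‖ₑ ^ 2) atTop (𝓝 0) := by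
    have h1 : Tendsto (fun N : ℕ => ∑ m ∈ ball N, a m • kerL2 hμ t m) atTop (𝓝 u) :=
      hsumL.hasSum.comp tendsto_ball
    have h2 := (ENNReal.continuous_pow 2).tendsto _ |>.comp
      ((continuous_enorm.tendsto _).comp ((tendsto_const_nhds (x := u)).sub h1))
    simpa [Function.comp_def] using h2
  refine ⟨u, ?_, ?_⟩
  · refine ae_eq_of_tendsto_of_lintegral (p := 2) two_ne_zero
      (F := fun N => (∑ m ∈ ball N, a m • kerL2 hμ t m : SpaceTimeL2)) (fun N => ?_) ?_ ?_
    · exact ((Lp.aestronglyMeasurable u).sub (Lp.aestronglyMeasurable _)).enorm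
    · refine hu.congr fun N => ?_
      rw [Lp.enorm_def, eLpNorm_eq_lintegral_rpow_enorm_toReal two_ne_zero ENNReal.ofNat_ne_top,
        ← ENNReal.rpow_natCast, ← ENNReal.rpow_mul, ENNReal.toReal_ofNat,
        show (1 / 2 * ((2 : ℕ) : ℝ) : ℝ) = 1 by norm_num, ENNReal.rpow_one]
      simp only [ENNReal.rpow_ofNat]
      refine lintegral_congr_ae ?_
      filter_upwards [Lp.coeFn_sub u (∑ m ∈ ball N, a m • kerL2 hμ t m)] with p hp
      rw [hp, Pi.sub_apply]
    -- At time lag zero the kernel has no decay, so the null set `s = t` is discarded. For a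
    -- positive lag the exponential is bounded by a multiple of `br m ^ (-4)`, and the partial sums
    -- converge pointwise to the pairing.
    · have h1 : ∀ᵐ p ∂spaceTimeMeasure, p.1 ≠ (t : ℝ) := by
        have : ∀ᵐ r : ℝ ∂volume, r ≠ t := Measure.ae_ne volume (t : ℝ)
        exact Measure.quasiMeasurePreserving_fst.ae this
      have h2 : ∀ᵐ p ∂spaceTimeMeasure, ∀ m, kerL2 hμ t m p = kernelCoeff μ ((t : ℝ) - p.1) p.2 m :=
        ae_all_iff.2 fun m => coeFn_kerL2 hμ t m
      have h3 : ∀ᵐ p ∂spaceTimeMeasure, ∀ N : ℕ, (∑ m ∈ ball N, a m • kerL2 hμ t m : SpaceTimeL2) p =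
          ∑ m ∈ ball N, a m * kerL2 hμ t m p := by
        refine ae_all_iff.2 fun N => ?_
        have e1 := Lp.coeFn_finsetSum (ball N) fun m => a m • kerL2 hμ t m
        have e2 : ∀ᵐ p ∂spaceTimeMeasure, ∀ m ∈ ball N,
            (a m • kerL2 hμ t m : SpaceTimeL2) p = a m * kerL2 hμ t m p := by
          rw [Finset.eventually_all]
          exact fun i _ => Lp.coeFn_smul (a i) (kerL2 hμ t i)
        filter_upwards [e1, e2] with p h1 h2
        rw [h1]
        simp only [Finset.sum_apply]
        exact Finset.sum_congr rfl h2
      filter_upwards [h1, h2, h3] with p hp1 hp2 hp3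
      simp only [hp3, hp2]
      have hs : Summable fun m => a m * kernelCoeff μ ((t : ℝ) - p.1) p.2 m := by
        by_cases hpt : 0 ≤ (t : ℝ) - p.1
        swap
        · simp only [kernelCoeff, if_neg hpt, mul_zero, summable_zero]
        have hτ : 0 < (t : ℝ) - p.1 := lt_of_le_of_ne hpt (sub_ne_zero.2 hp1.symm).symm
        set τ := (t : ℝ) - p.1
        obtain ⟨M, hM⟩ : ∃ M, ∀ m, ‖a m‖ ≤ M :=
          ⟨‖(⟨φ, hφ.continuous⟩ : C(Torus, ℂ))‖, fun m => by
            rw [hna]; exact norm_fc_le ⟨φ, hφ.continuous⟩ m⟩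
        refine Summable.of_norm_bounded (hbs.mul_left (M * (8 / (μ.re * τ) ^ 2))) fun m => ?_
        have hl := eigenvalue_pos m
        have hy : 0 < μ.re * eigenvalue m * τ := by positivity
        rw [norm_mul, kernelCoeff, if_pos hpt, norm_mul, norm_mFourier_apply, mul_one,
          Complex.norm_exp]
        have e1 : (-μ * eigenvalue m * τ : ℂ).re = -(μ.re * eigenvalue m * τ) := by
          simp [Complex.mul_re]
        rw [e1, mul_assoc M]
        have e2 : Real.exp (-(μ.re * eigenvalue m * τ)) ≤ 2 / (μ.re * eigenvalue m * τ) ^ 2 := by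
          rw [Real.exp_neg, ← one_div, div_le_div_iff₀ (Real.exp_pos _) (by positivity)]
          have := Real.quadratic_le_exp_of_nonneg hy.le
          nlinarith
        have e3 : 2 / (μ.re * eigenvalue m * τ) ^ 2 ≤ 8 / (μ.re * τ) ^ 2 * br m ^ (-4 : ℝ) := by
          have hb := br_pos m
          have hb2 := br_sq_le m
          have hb3 : br m ^ 2 * br m ^ 2 ≤ (2 * eigenvalue m) * (2 * eigenvalue m) := by gcongr
          rw [hb4, inv_pow, ← div_eq_mul_inv, div_div, div_le_div_iff₀ (by positivity) (by positivity)]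
          have : 0 ≤ (μ.re * τ) ^ 2 := by positivity
          nlinarith
        exact mul_le_mul (hM m) (e2.trans e3) (Real.exp_pos _).le ((norm_nonneg _).trans (hM m))
      have h4 := hs.hasSum.comp tendsto_ball
      rw [pairing]
      simpa only [Function.comp_def, ha, mul_comm] using h4
  · have h1 : ∀ᵐ ω ∂P, ∀ m, (Z ω t).coeff m = ξ (kerL2 hμ t m) ω := ae_all_iff.2 fun m => hZ t m
    have hE : ∀ m, ∫⁻ ω, ‖a m * ξ (kerL2 hμ t m) ω‖ₑ ∂P ≤ ENNReal.ofReal (‖a m‖ * ‖kerL2 hμ t m‖) := by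
      intro m
      have h2 := hξ.integral_norm_sq_sum_sub (kerL2 hμ t m) (∅ : Finset (Fin 1)) 0 0
      simp only [Finset.sum_empty, sub_zero] at h2
      have h3 : eLpNorm (ξ (kerL2 hμ t m)) 1 P ≤ eLpNorm (ξ (kerL2 hμ t m)) 2 P :=
        eLpNorm_le_eLpNorm_of_exponent_le one_le_two (hξ.memLp _).1
      rw [eLpNorm_one_eq_lintegral_enorm,
        eLpNorm_eq_lintegral_rpow_enorm_toReal two_ne_zero ENNReal.ofNat_ne_top] at h3
      simp only [ENNReal.toReal_ofNat, ENNReal.rpow_ofNat, h2] at h3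
      rw [← ENNReal.rpow_natCast, ← ENNReal.rpow_mul] at h3
      norm_num at h3
      simp_rw [enorm_mul]
      rw [lintegral_const_mul' _ _ enorm_ne_top, ENNReal.ofReal_mul (norm_nonneg _), ofReal_norm,
        ofReal_norm]
      gcongr
    -- First moments are bounded by the summable norms in `hsum1`, so the pairing with the solution
    -- converges absolutely almost surely.
    have h2 : ∀ᵐ ω ∂P, Summable fun m => a m * ξ (kerL2 hμ t m) ω := by
      have e1 : ∫⁻ ω, ∑' m, ‖a m * ξ (kerL2 hμ t m) ω‖ₑ ∂P ≠ ∞ := by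
        rw [lintegral_tsum fun m => ((hξ.measurable _).const_mul _).enorm.aemeasurable]
        refine ne_top_of_le_ne_top ?_ (ENNReal.tsum_le_tsum hE)
        rw [← ENNReal.ofReal_tsum_of_nonneg (fun m => by positivity) hsum1]
        exact ENNReal.ofReal_ne_top
      filter_upwards [ae_lt_top' (AEMeasurable.tsum fun m =>
        ((hξ.measurable _).const_mul _).enorm.aemeasurable) e1] with ω hω
      refine Summable.of_enorm ?_
      exact hω.ne
    refine (ae_eq_of_tendsto_of_lintegral (p := 2) two_ne_zero (f := ξ u)
      (F := fun N ω => ∑ m ∈ ball N, a m * ξ (kerL2 hμ t m) ω) (fun N => ?_) ?_ ?_).symm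
    · exact ((hξ.measurable u).sub (Finset.measurable_fun_sum _ fun m _ =>
        (hξ.measurable _).const_mul _)).enorm.aemeasurable
    · exact hu.congr fun N => (hξ.integral_norm_sq_sum_sub u (ball N) a _).symm
    · filter_upwards [h1, h2] with ω hω1 hω2
      have h4 := hω2.hasSum.comp tendsto_ball
      rw [pairing]
      simp_rw [hω1]
      simpa only [Function.comp_def, ha, mul_comm] using h4

end Wick

/-! ### Random variables in path spaces -/

section PathSup

variable {E : Type*} [NormedAddCommGroup E]

/-- The supremum of the norm of a path on `[0, T]`. -/
def pathSup (T : ℝ≥0) (f : C(ℝ≥0, E)) : ℝ≥0∞ := ⨆ (t : ℝ≥0) (_ : t ≤ T), ‖f t‖ₑ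

lemma enorm_le_pathSup {T t : ℝ≥0} (ht : t ≤ T) (f : C(ℝ≥0, E)) : ‖f t‖ₑ ≤ pathSup T f :=
  le_iSup₂_of_le t ht le_rfl

lemma pathSup_mono {S T : ℝ≥0} (h : S ≤ T) (f : C(ℝ≥0, E)) : pathSup S f ≤ pathSup T f :=
  iSup₂_le fun _ ht => enorm_le_pathSup (ht.trans h) f

lemma lowerSemicontinuous_pathSup (T : ℝ≥0) : LowerSemicontinuous (pathSup T : C(ℝ≥0, E) → ℝ≥0∞) :=
  lowerSemicontinuous_biSup fun t _ =>
    (continuous_enorm.comp (continuous_eval_const t)).lowerSemicontinuous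

lemma measurable_pathSup [MeasurableSpace C(ℝ≥0, E)] [BorelSpace C(ℝ≥0, E)] (T : ℝ≥0) :
    Measurable (pathSup T : C(ℝ≥0, E) → ℝ≥0∞) := (lowerSemicontinuous_pathSup T).measurable

lemma tendsto_iff_pathSup {ι : Type*} {l : Filter ι} {F : ι → C(ℝ≥0, E)} {f : C(ℝ≥0, E)} :
    Tendsto F l (𝓝 f) ↔ ∀ T : ℕ, Tendsto (fun i => pathSup T (f - F i)) l (𝓝 0) := by
  rw [ContinuousMap.tendsto_iff_forall_isCompact_tendstoUniformlyOn]
  refine ⟨fun h T => ?_, fun h K hK => ?_⟩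
  · have h1 := EMetric.tendstoUniformlyOn_iff.1 (h _ (isCompact_Icc (a := (0 : ℝ≥0)) (b := T)))
    rw [ENNReal.tendsto_nhds_zero]
    intro ε hε
    filter_upwards [h1 ε hε] with i hi
    refine iSup₂_le fun t ht => ?_
    rw [ContinuousMap.sub_apply, ← edist_eq_enorm_sub]
    exact (hi t ⟨zero_le, ht⟩).le
  · obtain ⟨B, hB⟩ := hK.bddAbove
    obtain ⟨T, hT⟩ := exists_nat_ge B
    refine EMetric.tendstoUniformlyOn_iff.2 fun ε hε => ?_
    filter_upwards [(h T).eventually_lt_const hε] with i hi t ht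
    rw [edist_eq_enorm_sub]
    exact (enorm_le_pathSup ((hB ht).trans hT) (f - F i)).trans_lt hi

/-- The `j`-th increment is measured on `[0, j]` only. On `[0, T]` this still controls all
increments from index `T` on, which is all that convergence there needs. -/
lemma exists_tendsto_of_tsum_ne_top [CompleteSpace E] {f : ℕ → C(ℝ≥0, E)}
    (h : ∑' j : ℕ, pathSup j (f (j + 1) - f j) ≠ ∞) : ∃ g, Tendsto f atTop (𝓝 g) := by
  set d : ℕ → ℝ≥0∞ := fun j => pathSup j (f (j + 1) - f j) with hd
  have h1 : ∀ T : ℕ, ∀ t : ℝ≥0, t ≤ T → ∀ n : ℕ, edist (f (n + T) t) (f (n.succ + T) t) ≤ d (n + T) := by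
    intro T t ht n
    rw [edist_comm, edist_eq_enorm_sub, show n.succ + T = n + T + 1 by omega]
    refine enorm_le_pathSup (ht.trans ?_) (f (n + T + 1) - f (n + T))
    exact_mod_cast Nat.le_add_left T n
  have h2 : ∀ T, ∑' n, d (n + T) ≠ ∞ := fun T =>
    ne_top_of_le_ne_top h (ENNReal.tsum_comp_le_tsum_of_injective (add_left_injective T) d)
  have h3 : ∀ t, ∃ y, Tendsto (fun n => f n t) atTop (𝓝 y) := by
    intro t
    obtain ⟨T, hT⟩ := exists_nat_ge t
    obtain ⟨y, hy⟩ := cauchySeq_tendsto_of_complete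
      (cauchySeq_of_edist_le_of_tsum_ne_top (fun n => d (n + T)) (h1 T t hT) (h2 T))
    exact ⟨y, (tendsto_add_atTop_iff_nat T).1 hy⟩
  choose g hg using h3
  have h4 : ∀ T : ℕ, TendstoUniformlyOn (fun n t => f n t) g atTop (Set.Iic (T : ℝ≥0)) := by
    intro T
    refine EMetric.tendstoUniformlyOn_iff.2 fun ε hε => ?_
    have h5 := ENNReal.tendsto_sum_nat_add (fun n => d (n + T)) (h2 T)
    have h6 := h5.eventually_lt_const hε
    have h7 : ∀ᶠ n in atTop, ∀ t ∈ Set.Iic (T : ℝ≥0), edist (g t) (f (n + T) t) < ε := by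
      filter_upwards [h6] with n hn t ht
      rw [edist_comm]
      refine (edist_le_tsum_of_edist_le_of_tendsto (fun n => d (n + T)) (h1 T t ht)
        ((tendsto_add_atTop_iff_nat T).2 (hg t)) n).trans_lt ?_
      simpa only [add_comm n] using hn
    obtain ⟨N, hN⟩ := eventually_atTop.1 h7
    refine eventually_atTop.2 ⟨N + T, fun n hn => ?_⟩
    have := hN (n - T) (by omega)
    rwa [Nat.sub_add_cancel (by omega)] at this
  have h5 : TendstoLocallyUniformly (fun n t => f n t) g atTop := by
    intro u hu t
    obtain ⟨T, hT⟩ := exists_nat_gt t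
    exact ⟨Set.Iic T, Iic_mem_nhds hT, h4 T u hu⟩
  refine ⟨⟨g, h5.continuous (Eventually.frequently (.of_forall fun n => (f n).continuous))⟩, ?_⟩
  exact ContinuousMap.tendsto_iff_tendstoLocallyUniformly.2 h5

end PathSup

lemma lintegral_rpow_le {Ω : Type*} [MeasurableSpace Ω] {P : Measure Ω} [IsProbabilityMeasure P]
    {f : Ω → ℝ≥0∞} (hf : AEMeasurable f P) {p q : ℝ} (hp : 0 < p) (hpq : p ≤ q) :
    ∫⁻ ω, f ω ^ p ∂P ≤ (∫⁻ ω, f ω ^ q ∂P) ^ (p / q) := by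
  have h := eLpNorm'_le_eLpNorm'_of_exponent_le hp hpq P hf.aestronglyMeasurable
  simp only [eLpNorm'_eq_lintegral_enorm, enorm_eq_self] at h
  have h2 := ENNReal.rpow_le_rpow h hp.le
  rwa [← ENNReal.rpow_mul, ← ENNReal.rpow_mul, one_div_mul_cancel hp.ne', ENNReal.rpow_one,
    one_div_mul_eq_div] at h2

variable {Ω : Type*} [MeasurableSpace Ω] {P : Measure Ω} {E : Type*} [NormedAddCommGroup E]

/-- A sequence tending to zero in mean has a subsequence that is almost surely summable. -/
lemma exists_subseq_ae_tsum {D : ℕ → ℕ → Ω → ℝ≥0∞} (hm : ∀ i n, AEMeasurable (D i n) P)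
    (h : ∀ i, Tendsto (fun n => ∫⁻ ω, D i n ω ∂P) atTop (𝓝 0)) :
    ∃ φ : ℕ → ℕ, StrictMono φ ∧ ∀ᵐ ω ∂P, ∀ i, Tendsto (fun j => D i (φ j) ω) atTop (𝓝 0) := by
  obtain ⟨φ, hφ, h1⟩ := extraction_forall_of_eventually (P := fun j n => ∀ i ∈ Finset.range (j + 1),
    ∫⁻ ω, D i n ω ∂P < (1 / 2) ^ j) fun j => (Finset.eventually_all _).2 fun i _ =>
      (h i).eventually_lt_const (ENNReal.pow_pos (by simp) j)
  refine ⟨φ, hφ, ae_all_iff.2 fun i => ?_⟩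
  have h2 : ∫⁻ ω, ∑' j, D i (φ (j + i)) ω ∂P ≠ ∞ := by
    rw [lintegral_tsum fun j => hm i _]
    refine ne_top_of_le_ne_top ?_ (ENNReal.tsum_le_tsum fun j =>
      (h1 (j + i) i (Finset.mem_range.2 (by omega))).le.trans
        (pow_le_pow_of_le_one zero_le (by simp) (Nat.le_add_right j i)))
    simp [ENNReal.tsum_geometric]
  filter_upwards [ae_lt_top' (AEMeasurable.tsum fun j => hm i _) h2] with ω hω
  exact (tendsto_add_atTop_iff_nat i).1 (ENNReal.tendsto_atTop_zero_of_tsum_ne_top hω.ne)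

section Limit

variable [CompleteSpace E] [SecondCountableTopology C(ℝ≥0, E)] [MeasurableSpace C(ℝ≥0, E)]
  [BorelSpace C(ℝ≥0, E)]

/-- A Cauchy sequence of path space valued random variables converges. -/
lemma exists_limit {F : ℕ → Ω → C(ℝ≥0, E)} (hF : ∀ n, Measurable (F n))
    (h : ∀ T : ℕ, ∃ a : ℕ → ℝ≥0∞, Tendsto a atTop (𝓝 0) ∧
      ∀ n N, n ≤ N → ∫⁻ ω, pathSup T (F N ω - F n ω) ∂P ≤ a n) :
    ∃ W : Ω → C(ℝ≥0, E), Measurable W ∧ ∃ φ : ℕ → ℕ, StrictMono φ ∧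
      ∀ᵐ ω ∂P, Tendsto (fun j => F (φ j) ω) atTop (𝓝 (W ω)) := by
  choose a ha haF using h
  obtain ⟨φ, hφ, h1⟩ := extraction_forall_of_eventually (P := fun j n => a j n < (1 / 2) ^ j)
    fun j => (ha j).eventually_lt_const (ENNReal.pow_pos (by simp) j)
  have hm : ∀ j : ℕ, Measurable fun ω => pathSup j (F (φ (j + 1)) ω - F (φ j) ω) := fun j =>
    (measurable_pathSup j).comp ((hF _).sub (hF _))
  have h2 : ∫⁻ ω, ∑' j : ℕ, pathSup j (F (φ (j + 1)) ω - F (φ j) ω) ∂P ≠ ∞ := by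
    rw [lintegral_tsum fun j => (hm j).aemeasurable]
    refine ne_top_of_le_ne_top ?_ (ENNReal.tsum_le_tsum fun j =>
      (haF j _ _ (hφ.monotone (Nat.le_succ j))).trans (h1 j).le)
    simp [ENNReal.tsum_geometric]
  obtain ⟨W, hW, hlim⟩ := measurable_limit_of_tendsto_metrizable_ae (μ := P) (L := atTop)
    (f := fun j => F (φ j)) (fun j => (hF _).aemeasurable) (by
      filter_upwards [ae_lt_top' (AEMeasurable.tsum fun j => (hm j).aemeasurable) h2] with ω hω
      exact exists_tendsto_of_tsum_ne_top hω.ne)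
  exact ⟨W, hW, φ, hφ, hlim⟩

/-- Fatou's lemma with lower semicontinuity of the supremum norm: bounds that are uniform in `N`
pass to the almost sure limit along a subsequence. -/
lemma lintegral_pathSup_sub_le {F : ℕ → Ω → C(ℝ≥0, E)} (hF : ∀ n, Measurable (F n))
    {G W : Ω → C(ℝ≥0, E)} (hG : Measurable G) {φ : ℕ → ℕ} (hφ : StrictMono φ)
    (hW : ∀ᵐ ω ∂P, Tendsto (fun j => F (φ j) ω) atTop (𝓝 (W ω))) (T : ℝ≥0) {p : ℝ} (hp : 0 ≤ p)
    {n : ℕ} {c : ℝ≥0∞} (h : ∀ N, n ≤ N → ∫⁻ ω, pathSup T (F N ω - G ω) ^ p ∂P ≤ c) :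
    ∫⁻ ω, pathSup T (W ω - G ω) ^ p ∂P ≤ c := by
  have hl : LowerSemicontinuous fun f : C(ℝ≥0, E) => pathSup T f ^ p :=
    (ENNReal.continuous_rpow_const (y := p)).comp_lowerSemicontinuous (lowerSemicontinuous_pathSup T)
      (ENNReal.monotone_rpow_of_nonneg hp)
  calc ∫⁻ ω, pathSup T (W ω - G ω) ^ p ∂P
      ≤ ∫⁻ ω, liminf (fun j => pathSup T (F (φ j) ω - G ω) ^ p) atTop ∂P := by
        refine lintegral_mono_ae (hW.mono fun ω hω => ?_)
        exact (hl.le_liminf (W ω - G ω)).trans (liminf_le_liminf_of_le (hω.sub tendsto_const_nhds))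
    _ ≤ liminf (fun j => ∫⁻ ω, pathSup T (F (φ j) ω - G ω) ^ p ∂P) atTop :=
        lintegral_liminf_le' fun j =>
          (((measurable_pathSup T).comp ((hF _).sub hG)).pow_const _).aemeasurable
    _ ≤ c := by
        refine (liminf_le_liminf ?_).trans_eq (liminf_const c)
        exact eventually_atTop.2 ⟨n, fun j hj => h _ (hj.trans (hφ.id_le j))⟩

end Limit

/-! ### Existence of the Wick powers -/

/-- The partial Fourier sums of a path of Fourier coefficients. -/
def trigPath (S : Finset Mode) (x : C(ℝ≥0, Mode → ℂ)) : C(ℝ≥0, C(Torus, ℂ)) where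
  toFun t := trigSum S (x t)
  continuous_toFun := by unfold trigSum; fun_prop

/-- The Hermite polynomial of a path of trigonometric polynomials of degree at most `r`. -/
def hermPath (χ : DyadicPartition) (γ : ℝ) (k l : ℕ) (r : ℝ) (c : ℂ) :
    C(C(ℝ≥0, C(Torus, ℂ)), χ.PathSpace γ) where
  toFun f := (⟨fun g => toBesov χ γ ((k + l) * r) (herm k l g (star g) c),
    (continuous_toBesov _).comp (continuous_herm continuous_id continuous_star k l c)⟩ :
      C(C(Torus, ℂ), χ.HolderBesov γ)).comp f
  continuous_toFun := ContinuousMap.continuous_postcomp _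

lemma hermPath_apply (χ : DyadicPartition) (γ : ℝ) (k l : ℕ) (r : ℝ) (c : ℂ)
    (f : C(ℝ≥0, C(Torus, ℂ))) (t : ℝ≥0) : hermPath χ γ k l r c f t =
      toBesov χ γ ((k + l) * r) (herm k l (f t) (star (f t)) c) := rfl

lemma coeff_hermPath (χ : DyadicPartition) (γ : ℝ) (k l : ℕ) {r : ℝ} (hr : 0 ≤ r) (c : ℂ)
    {f : C(ℝ≥0, C(Torus, ℂ))} {t : ℝ≥0} (hf : f t ∈ Trig r) :
    (hermPath χ γ k l r c f t).coeff = fc (herm k l (f t) (star (f t)) c) := by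
  rw [hermPath_apply, coeff_toBesov (herm_mem_Trig hr hf (star_mem_Trig hf) k l c)]

/-- Multiplication of the coefficients of a path by `θ`. -/
def scalePath (θ : Mode → ℂ) (x : C(ℝ≥0, Mode → ℂ)) : C(ℝ≥0, Mode → ℂ) where
  toFun t := θ * x t
  continuous_toFun := continuous_const.mul x.continuous

/-- The path of the Wick powers of the partial sums over the modes of size at most `n`. -/
def wickPath (χ : DyadicPartition) (γ : ℝ) (μ : ℂ) (k l n : ℕ) (θ : Mode → ℂ)
    (x : C(ℝ≥0, Mode → ℂ)) : χ.PathSpace γ :=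
  hermPath χ γ k l n (wickVar μ (ball n) θ) (trigPath (ball n) (scalePath θ x))

lemma coeff_wickPath (χ : DyadicPartition) (γ : ℝ) (μ : ℂ) (k l n : ℕ) (θ : Mode → ℂ)
    (x : C(ℝ≥0, Mode → ℂ)) (t : ℝ≥0) :
    (wickPath χ γ μ k l n θ x t).coeff = fc (wickPoly μ k l (ball n) θ (x t)) := by
  rw [wickPath, coeff_hermPath χ γ k l n.cast_nonneg _ (trigSum_mem_Trig subset_rfl _), wickPoly]
  rfl

variable {μ : ℂ} {Ω : Type*} [MeasurableSpace Ω] {P : Measure Ω}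

lemma measurable_wickPath (χ : DyadicPartition) {γ : ℝ} (hγ : γ ≤ 0) (k l n : ℕ)
    (θ : Mode → ℂ) {x : Ω → C(ℝ≥0, Mode → ℂ)} (hx : ∀ t m, Measurable fun ω => x ω t m) :
    Measurable fun ω => wickPath χ γ μ k l n θ (x ω) := by
  refine (DyadicPartition.measurable_path_iff χ hγ).2 fun t m => ?_
  simp_rw [coeff_wickPath]
  have h : Continuous fun y : Mode → ℂ => fc (wickPoly μ k l (ball n) θ y) m :=
    (continuous_fc m).comp (continuous_wickPoly μ k l (ball n) θ fun m => continuous_apply m)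
  exact h.measurable.comp (measurable_pi_lambda _ fun m => hx t m)

/-- The cutoff at level `n` as a weight: it differs from `1` only where `br m ≥ 1 + n`, so the error
is small relative to the growth `br m ^ (κ / 2)`. -/
lemma one_sub_indicator_le {κ : ℝ} (hκ : 0 < κ) (n : ℕ) (m : Mode) :
    ‖(1 : Mode → ℂ) m - (Set.indicator (↑(ball n)) 1 : Mode → ℂ) m‖ ≤
      ((1 + n : ℝ) ^ (-(κ / 2))) * br m ^ (κ / 2) := by
  have hb := br_pos m
  by_cases hm : m ∈ (ball n : Set Mode)
  · rw [Set.indicator_of_mem hm, sub_self, norm_zero]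
    positivity
  · rw [Set.indicator_of_notMem hm, sub_zero, Pi.one_apply, norm_one, Real.rpow_neg (by positivity),
      ← div_eq_inv_mul, one_le_div (by positivity)]
    have h1 : (n : ℝ) < ‖freq m‖ := by simpa [mem_ball] using hm
    exact Real.rpow_le_rpow (by positivity) (by rw [br]; linarith) (by positivity)

lemma tendsto_one_add_rpow {κ : ℝ} (hκ : 0 < κ) :
    Tendsto (fun n : ℕ => (1 + n : ℝ) ^ (-(κ / 2))) atTop (𝓝 0) :=
  (tendsto_rpow_neg_atTop (by positivity)).comp
    (tendsto_atTop_add_const_left _ _ tendsto_natCast_atTop_atTop)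

lemma one_add_rpow_le_one {κ : ℝ} (hκ : 0 < κ) (n : ℕ) : (1 + n : ℝ) ^ (-(κ / 2)) ≤ 1 :=
  Real.rpow_le_one_of_one_le_of_nonpos (by simp) (by linarith)

lemma wickPoly_indicator (μ : ℂ) (k l : ℕ) {n N : ℕ} (h : n ≤ N) (x : Mode → ℂ) :
    wickPoly μ k l (ball n) 1 x = wickPoly μ k l (ball N) (Set.indicator (↑(ball n)) 1) x := by
  classical
  have hs : ball (n : ℝ) ⊆ ball (N : ℝ) := fun m hm =>
    mem_ball.2 ((mem_ball.1 hm).trans (by exact_mod_cast h))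
  rw [← wickPoly_mono μ k l hs fun m _ hm => Set.indicator_of_notMem (by exact_mod_cast hm) _]
  have h1 : ∀ m ∈ ball (n : ℝ), (Set.indicator (↑(ball n)) 1 : Mode → ℂ) m = 1 := fun m hm =>
    Set.indicator_of_mem (by exact_mod_cast hm) _
  have h2 : trigSum (ball n) (Set.indicator (↑(ball n)) 1 * x) = trigSum (ball n) (1 * x) :=
    trigSum_congr fun m hm => by rw [Pi.mul_apply, h1 m hm, Pi.mul_apply, Pi.one_apply]
  have h3 : wickVar μ (ball n) (Set.indicator (↑(ball n)) 1) = wickVar μ (ball n) 1 :=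
    Finset.sum_congr rfl fun m hm => by rw [h1 m hm, Pi.one_apply]
  rw [wickPoly, wickPoly, h2, h3]

/-- Uniform moment bounds for the differences of the approximate Wick powers. -/
lemma IsOU.exists_lintegral_wickPath_sub_le (hμ : 0 < μ.re) {x : Ω → C(ℝ≥0, Mode → ℂ)}
    (hX : IsOU μ P fun t m ω => x ω t m) (hx : ∀ t m, Measurable fun ω => x ω t m)
    (χ : DyadicPartition) {α : ℝ} (hα : 0 < α) (hα1 : α ≤ 1) (k l : ℕ) {p : ℝ} (hp : 0 < p) (T : ℕ) :
    ∃ κ : ℝ, 0 < κ ∧ ∃ a : ℝ → ℝ≥0∞, Tendsto a (𝓝 0) (𝓝 0) ∧ ∀ (N : ℕ) (θ θ' : Mode → ℂ) (ρ : ℝ), 0 ≤ ρ →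
      ρ ≤ 1 → (∀ m, ‖θ m‖ ≤ 2) → (∀ m, ‖θ' m‖ ≤ 2) → (∀ m, ‖θ m - θ' m‖ ≤ ρ * br m ^ (κ / 2)) →
      ∫⁻ ω, pathSup T (wickPath χ (-α) μ k l N θ (x ω) - wickPath χ (-α) μ k l N θ' (x ω)) ^ p ∂P ≤
        a ρ := by
  have := hX.isProbabilityMeasure
  obtain ⟨κ, hκ, -, n₀, h⟩ := hX.exists_sup_moments hμ
    (.of_forall fun ω m => (continuous_apply m).comp (x ω).continuous) χ hα hα1 k l
  obtain ⟨q₀, hq₀⟩ := exists_nat_ge p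
  set q := n₀ + q₀ + 1
  obtain ⟨C, hC⟩ := h q (by omega) T
  have hq : (0 : ℝ) < ((2 * q : ℕ) : ℝ) := by positivity
  have hpq : p ≤ ((2 * q : ℕ) : ℝ) := hq₀.trans (by exact_mod_cast (by omega : q₀ ≤ 2 * q))
  refine ⟨κ, hκ, fun ρ => (C * ENNReal.ofReal ρ ^ q) ^ (p / ((2 * q : ℕ) : ℝ)),
    ?_, fun N θ θ' ρ hρ hρ1 hθ hθ' hθθ' => ?_⟩
  · have hcont : Continuous fun y : ℝ => (C * ENNReal.ofReal y ^ q) ^ (p / ((2 * q : ℕ) : ℝ)) :=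
      ENNReal.continuous_rpow_const.comp ((ENNReal.continuous_const_mul ENNReal.coe_ne_top).comp
        ((ENNReal.continuous_pow q).comp ENNReal.continuous_ofReal))
    have h2 := hcont.tendsto 0
    rwa [ENNReal.ofReal_zero, zero_pow (by omega), mul_zero,
      ENNReal.zero_rpow_of_pos (by positivity)] at h2
  · have hm : Measurable fun ω => pathSup T (wickPath χ (-α) μ k l N θ (x ω) -
        wickPath χ (-α) μ k l N θ' (x ω)) := by
      have := DyadicPartition.polishSpace_pathSpace (χ := χ) (γ := -α) (by linarith)
      exact (measurable_pathSup T).comp ((measurable_wickPath χ (by linarith) k l N θ hx).sub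
        (measurable_wickPath χ (by linarith) k l N θ' hx))
    refine (lintegral_rpow_le hm.aemeasurable hp hpq).trans ?_
    refine ENNReal.rpow_le_rpow ?_ (by positivity)
    refine le_trans (le_of_eq ?_) (hC (ball N) θ θ' ρ hρ hρ1 hθ hθ' hθθ')
    refine lintegral_congr fun ω => ?_
    rw [ENNReal.rpow_natCast, pathSup]
    congr 1
    refine iSup_congr fun t => iSup_congr fun _ => ?_
    rw [DyadicPartition.HolderBesov.enorm_eq, ContinuousMap.sub_apply,
      DyadicPartition.HolderBesov.coeff_sub, coeff_wickPath, coeff_wickPath, ← map_sub]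

/-- The Wick power at level `n` is the one at level `N` with the weight cut off at `n`, so the
Cauchy property is an instance of continuity in the weight. -/
lemma IsOU.exists_wickPath_bound (hμ : 0 < μ.re) {x : Ω → C(ℝ≥0, Mode → ℂ)}
    (hX : IsOU μ P fun t m ω => x ω t m) (hx : ∀ t m, Measurable fun ω => x ω t m)
    (χ : DyadicPartition) {α : ℝ} (hα : 0 < α) (hα1 : α ≤ 1) (k l : ℕ) {p : ℝ} (hp : 0 < p) (T : ℕ) :
    ∃ a : ℕ → ℝ≥0∞, Tendsto a atTop (𝓝 0) ∧ ∀ n N, n ≤ N →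
      ∫⁻ ω, pathSup T (wickPath χ (-α) μ k l N 1 (x ω) - wickPath χ (-α) μ k l n 1 (x ω)) ^ p ∂P ≤
        a n := by
  obtain ⟨κ, hκ, a, ha, h⟩ := hX.exists_lintegral_wickPath_sub_le hμ hx χ hα hα1 k l hp T
  refine ⟨_, ha.comp (tendsto_one_add_rpow hκ), fun n N hnN => ?_⟩
  refine le_trans (le_of_eq ?_) (h N 1 (Set.indicator (↑(ball n)) 1)
    ((1 + n : ℝ) ^ (-(κ / 2))) (by positivity) (one_add_rpow_le_one hκ n) (fun m => by simp)
    (fun m => (norm_indicator_le_norm_self _ _).trans (by simp)) (one_sub_indicator_le hκ n))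
  have e : ∀ ω, wickPath χ (-α) μ k l n 1 (x ω) =
      wickPath χ (-α) μ k l N (Set.indicator (↑(ball n)) 1) (x ω) := fun ω =>
    ContinuousMap.ext fun t => DyadicPartition.HolderBesov.coeff_injective (by
      rw [coeff_wickPath, coeff_wickPath, wickPoly_indicator μ k l hnN])
  simp_rw [e]

/-- A continuous Ornstein–Uhlenbeck process has Wick powers. -/
lemma IsOU.exists_wickPowers (hμ : 0 < μ.re) {x : Ω → C(ℝ≥0, Mode → ℂ)}
    (hX : IsOU μ P fun t m ω => x ω t m) (hx : ∀ t m, Measurable fun ω => x ω t m)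
    (χ : DyadicPartition) {α : ℝ} (hα : 0 < α) (hα1 : α ≤ 1) :
    ∃ W : Ω → χ.WickSpace (-α), Measurable W ∧ (∀ᵐ ω ∂P, ∀ t, (W ω 1 0 t).coeff = x ω t) ∧
      ∀ (k l : ℕ) (p : ℝ) (T : ℝ≥0), 0 < p → Tendsto (fun n : ℕ => ∫⁻ ω, pathSup T (W ω k l -
        wickPath χ (-α) μ k l n 1 (x ω)) ^ p ∂P) atTop (𝓝 0) := by
  have hγ : -α ≤ 0 := by linarith
  have := DyadicPartition.polishSpace_pathSpace (χ := χ) hγ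
  have hm : ∀ k l n, Measurable fun ω => wickPath χ (-α) μ k l n 1 (x ω) := fun k l n =>
    measurable_wickPath χ hγ k l n 1 hx
  have h1 : ∀ k l : ℕ, ∃ W : Ω → χ.PathSpace (-α), Measurable W ∧ ∃ φ : ℕ → ℕ, StrictMono φ ∧
      ∀ᵐ ω ∂P, Tendsto (fun j => wickPath χ (-α) μ k l (φ j) 1 (x ω)) atTop (𝓝 (W ω)) := by
    intro k l
    refine exists_limit (hm k l) fun T => ?_
    obtain ⟨a, ha, hb⟩ := hX.exists_wickPath_bound hμ hx χ hα hα1 k l one_pos T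
    exact ⟨a, ha, fun n N hnN => by simpa using hb n N hnN⟩
  choose W hWm φ hφ hW using h1
  refine ⟨fun ω k l => W k l ω, measurable_pi_lambda _ fun k => measurable_pi_lambda _ fun l => hWm k l,
    ?_, fun k l p T hp => ?_⟩
  · filter_upwards [hW 1 0] with ω hω t
    funext m
    have e1 : Tendsto (fun j => (wickPath χ (-α) μ 1 0 (φ 1 0 j) 1 (x ω) t).coeff m) atTop
        (𝓝 ((W 1 0 ω t).coeff m)) :=
      (((DyadicPartition.HolderBesov.continuous_coeff m).comp
        (continuous_eval_const t)).tendsto _).comp hω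
    refine tendsto_nhds_unique e1 (tendsto_const_nhds.congr' ?_)
    obtain ⟨n, hn⟩ := exists_nat_ge ‖freq m‖
    filter_upwards [(hφ 1 0).tendsto_atTop.eventually_ge_atTop n] with j hj
    have hmj : m ∈ ball (φ 1 0 j : ℝ) := mem_ball.2 (hn.trans (by exact_mod_cast hj))
    rw [coeff_wickPath, wickPoly, herm]
    simp only [Nat.zero_le, min_eq_right, zero_add, Finset.range_one, Finset.sum_singleton, pow_zero,
      Nat.factorial_zero, Nat.choose_zero_right, Nat.cast_one, mul_one, one_smul, Nat.sub_zero, pow_one,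
      Nat.sub_self, one_mul]
    rw [trigSum, fc_sum_smul, if_pos hmj]
  · obtain ⟨T', hT'⟩ := exists_nat_ge T
    obtain ⟨a, ha, hb⟩ := hX.exists_wickPath_bound hμ hx χ hα hα1 k l hp T'
    refine tendsto_of_tendsto_of_tendsto_of_le_of_le tendsto_const_nhds ha (fun _ => zero_le) fun n => ?_
    refine (lintegral_mono fun ω => ?_).trans
      (lintegral_pathSup_sub_le (hm k l) (hm k l n) (hφ k l) (hW k l) T' hp.le fun N hN => hb n N hN)
    exact ENNReal.rpow_le_rpow (pathSup_mono hT' _) hp.le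

/-- A priori the solution is only a family of continuous coefficients. Its limit Wick power of order
`(1, 0)` has the same coefficients and takes values in the path space, so it serves as the solution
itself. -/
theorem exists_isStationarySolution_isWickPowers (χ : DyadicPartition) {α : ℝ} (hα : 0 < α)
    (hα1 : α ≤ 1) (hμ : 0 < μ.re) {ξ : SpaceTimeL2 → Ω → ℂ} (hξ : IsComplexWhiteNoise P ξ) :
    ∃ (Z : Ω → χ.PathSpace (-α)) (W : Ω → χ.WickSpace (-α)),
      IsStationarySolution χ (-α) μ P ξ Z ∧ IsWickPowers P Z W := by
  obtain ⟨Y, hY, hYm, hYc⟩ := (hξ.isOU hμ).exists_continuous hμ fun t m => hξ.measurable _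
  set x : Ω → C(ℝ≥0, Mode → ℂ) := fun ω => ⟨fun t m => Y t m ω, continuous_pi (hYc ω)⟩
  have hX : IsOU μ P fun t m ω => x ω t m := (hξ.isOU hμ).congr hY
  obtain ⟨W, hWm, hWx, hW⟩ := hX.exists_wickPowers hμ hYm χ hα hα1
  have hZc : ∀ t : ℝ≥0, ∀ m, (fun ω => x ω t m) =ᵐ[P] fun ω => (W ω 1 0 t).coeff m := fun t m =>
    hWx.mono fun ω h => (congrFun (h t) m).symm
  refine ⟨fun ω => W ω 1 0, W, isStationarySolution_of_coeff hμ hξ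
    ((measurable_pi_apply 0).comp ((measurable_pi_apply 1).comp hWm))
    fun t m => (hZc t m).symm.trans (hY t m).symm, hWm, fun k l p T hp => ?_⟩
  refine (hW k l p T (by linarith)).congr fun n => lintegral_congr_ae ?_
  filter_upwards [hWx] with ω hω
  simp only [pathSup]
  congr 1
  refine iSup_congr fun t => iSup_congr fun _ => ?_
  rw [DyadicPartition.HolderBesov.enorm_eq, ContinuousMap.sub_apply,
    DyadicPartition.HolderBesov.coeff_sub, coeff_wickPath, approxWick_eq (hX.congr hZc), hω t]
  rfl

/-! ### Translation of Wick powers -/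

section Algebra

variable {R : Type*} [CommRing R] [Algebra ℂ R]

/-- Subset-of-a-subset identity for binomial coefficients, then the binomial theorem; it is the
one-variable half of `herm_add`. -/
lemma sum_choose_mul_choose {R : Type*} [CommRing R] (k m : ℕ) (x u : R) :
    ∑ i ∈ Finset.range (k + 1), ((k.choose i : R) * (i.choose m : R)) * (u ^ (k - i) * x ^ (i - m)) =
      (k.choose m : R) * (x + u) ^ (k - m) := by
  rcases lt_or_ge k m with hkm | hkm
  · rw [Nat.choose_eq_zero_of_lt hkm, Nat.cast_zero, zero_mul]
    refine Finset.sum_eq_zero fun i hi => ?_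
    rw [Nat.choose_eq_zero_of_lt ((Finset.mem_range_succ_iff.1 hi).trans_lt hkm)]
    simp
  obtain ⟨d, rfl⟩ := Nat.exists_eq_add_of_le hkm
  rw [add_assoc, Finset.sum_range_add, Finset.sum_eq_zero, zero_add, Nat.add_sub_cancel_left, add_pow,
    Finset.mul_sum]
  · refine Finset.sum_congr rfl fun i hi => ?_
    have hi' := Finset.mem_range_succ_iff.1 hi
    have h := Nat.choose_mul (n := m + d) (k := m + i) (s := m) (by omega)
    rw [Nat.add_sub_cancel_left, Nat.add_sub_cancel_left] at h
    rw [← Nat.cast_mul, h, Nat.add_sub_cancel_left, show m + d - (m + i) = d - i by omega]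
    push_cast
    ring
  · intro i hi
    rw [Nat.choose_eq_zero_of_lt (Finset.mem_range.1 hi)]
    simp

/-- The binomial formula for complex Hermite polynomials. -/
lemma herm_add (k l : ℕ) (x y u v : R) (c : ℂ) : herm k l (x + u) (y + v) c =
    ∑ i ∈ Finset.range (k + 1), ∑ j ∈ Finset.range (l + 1),
      ((k.choose i : ℂ) * (l.choose j : ℂ)) • ((u ^ (k - i) * v ^ (l - j)) * herm i j x y c) := by
  have h1 : ∀ i ∈ Finset.range (k + 1), ∀ j ∈ Finset.range (l + 1), herm i j x y c =
      ∑ m ∈ Finset.range (min k l + 1), ((m.factorial : ℂ) * (i.choose m : ℂ) * (j.choose m : ℂ) *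
        (-c) ^ m) • (x ^ (i - m) * y ^ (j - m)) := by
    intro i hi j hj
    have hi' := Finset.mem_range_succ_iff.1 hi
    have hj' := Finset.mem_range_succ_iff.1 hj
    refine Finset.sum_subset (Finset.range_mono (by omega)) fun m _ hm => ?_
    rw [Finset.mem_range_succ_iff] at hm
    rcases lt_or_ge i m with h | h
    · rw [Nat.choose_eq_zero_of_lt h]; simp
    · rw [Nat.choose_eq_zero_of_lt (show j < m by omega)]; simp
  rw [herm, Finset.sum_congr rfl fun i hi => Finset.sum_congr rfl fun j hj => by rw [h1 i hi j hj]]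
  simp only [Finset.mul_sum, Finset.smul_sum]
  rw [Finset.sum_congr rfl fun i _ => Finset.sum_comm, Finset.sum_comm]
  refine Finset.sum_congr rfl fun m _ => ?_
  have e1 := sum_choose_mul_choose k m x u
  have e2 := sum_choose_mul_choose l m y v
  have e3 : ((m.factorial : ℂ) * (k.choose m : ℂ) * (l.choose m : ℂ) * (-c) ^ m) •
      ((x + u) ^ (k - m) * (y + v) ^ (l - m)) = ((m.factorial : ℂ) * (-c) ^ m) •
      (((k.choose m : R) * (x + u) ^ (k - m)) * ((l.choose m : R) * (y + v) ^ (l - m))) := by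
    simp only [Algebra.smul_def, map_mul, map_natCast]
    ring
  rw [e3, ← e1, ← e2, Finset.sum_mul_sum, Finset.smul_sum]
  refine Finset.sum_congr rfl fun i _ => ?_
  rw [Finset.smul_sum]
  refine Finset.sum_congr rfl fun j _ => ?_
  simp only [Algebra.smul_def, map_mul, map_natCast]
  ring

/-- Change of the variance in complex Hermite polynomials. -/
lemma herm_add_right (k l : ℕ) (x y : R) (c d : ℂ) : herm k l x y (c + d) =
    ∑ m ∈ Finset.range (min k l + 1), ((m.factorial : ℂ) * (k.choose m : ℂ) * (l.choose m : ℂ) *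
      (-d) ^ m) • herm (k - m) (l - m) x y c := by
  have h1 : ∀ m ∈ Finset.range (min k l + 1), ((m.factorial : ℂ) * (k.choose m : ℂ) *
      (l.choose m : ℂ) * (-d) ^ m) • herm (k - m) (l - m) x y c =
      ∑ p ∈ Finset.range (min k l + 1 - m), ((m.factorial : ℂ) * (k.choose m : ℂ) * (l.choose m : ℂ) *
        (-d) ^ m * ((p.factorial : ℂ) * ((k - m).choose p : ℂ) * ((l - m).choose p : ℂ) * (-c) ^ p)) •
        (x ^ (k - m - p) * y ^ (l - m - p)) := by
    intro m hm
    have hm' := Finset.mem_range_succ_iff.1 hm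
    rw [herm, Finset.smul_sum, show min (k - m) (l - m) + 1 = min k l + 1 - m by omega]
    simp only [smul_smul]
  rw [Finset.sum_congr rfl h1, ← Finset.sum_range_diag_flip, herm]
  refine Finset.sum_congr rfl fun n hn => ?_
  have hn' := Finset.mem_range_succ_iff.1 hn
  rw [neg_add_rev, add_pow, Finset.mul_sum, Finset.sum_smul]
  refine Finset.sum_congr rfl fun m hm => ?_
  have hm' := Finset.mem_range_succ_iff.1 hm
  have a1 := Nat.choose_mul (n := k) (k := n) (s := m) hm'
  have a2 := Nat.choose_mul (n := l) (k := n) (s := m) hm'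
  have a3 := Nat.choose_mul_factorial_mul_factorial hm'
  rw [Nat.sub_sub, Nat.sub_sub, Nat.add_sub_cancel' hm']
  congr 1
  have b1 : (k.choose n : ℂ) * (n.choose m : ℂ) = (k.choose m : ℂ) * ((k - m).choose (n - m) : ℂ) := by
    exact_mod_cast a1
  have b2 : (l.choose n : ℂ) * (n.choose m : ℂ) = (l.choose m : ℂ) * ((l - m).choose (n - m) : ℂ) := by
    exact_mod_cast a2
  have b3 : (n.choose m : ℂ) * (m.factorial : ℂ) * ((n - m).factorial : ℂ) = (n.factorial : ℂ) := by
    exact_mod_cast a3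
  linear_combination ((-d) ^ m * (-c) ^ (n - m)) * ((-(k.choose n : ℂ) * l.choose n * n.choose m) * b3 +
    ((m.factorial : ℂ) * (n - m).factorial) * ((l.choose n * n.choose m) * b1 +
      (k.choose m * (k - m).choose (n - m)) * b2))

end Algebra

variable {χ : DyadicPartition} {γ : ℝ}

/-- Pointwise product of a path of trigonometric polynomials and a path of distributions. -/
def mulPath (r : ℝ) (f : C(ℝ≥0, C(Torus, ℂ))) (F : χ.PathSpace γ) : χ.PathSpace γ where
  toFun t := mulOp χ γ r (f t) (F t)
  continuous_toFun := ((continuous_mulOp r).comp f.continuous).clm_apply F.continuous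

lemma continuous_mulPath (r : ℝ) :
    Continuous fun p : C(ℝ≥0, C(Torus, ℂ)) × χ.PathSpace γ => mulPath r p.1 p.2 := by
  refine ContinuousMap.continuous_of_continuous_uncurry _ ?_
  have h1 : Continuous fun q : (C(ℝ≥0, C(Torus, ℂ)) × χ.PathSpace γ) × ℝ≥0 => q.1.1 q.2 := by fun_prop
  have h2 : Continuous fun q : (C(ℝ≥0, C(Torus, ℂ)) × χ.PathSpace γ) × ℝ≥0 => q.1.2 q.2 := by fun_prop
  exact ((continuous_mulOp r).comp h1).clm_apply h2

/-- The map on Wick powers that corresponds to the translation by a path `h` of trigonometric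
polynomials of degree at most `r`. -/
def translate (r : ℝ) (h : C(ℝ≥0, C(Torus, ℂ))) (w : χ.WickSpace γ) : χ.WickSpace γ := fun k l =>
  ∑ i ∈ Finset.range (k + 1), ∑ j ∈ Finset.range (l + 1), ((k.choose i : ℂ) * (l.choose j : ℂ)) •
    mulPath ((k + l) * r) (h ^ (k - i) * star h ^ (l - j)) (w i j)

/-- Multiplication by trigonometric polynomials of bounded degree is continuous on distributions,
jointly in both arguments. This is why translations are restricted to such paths, with the degree
`r` as a parameter. -/
lemma continuous_translate (r : ℝ) :
    Continuous fun p : C(ℝ≥0, C(Torus, ℂ)) × χ.WickSpace γ => translate r p.1 p.2 := by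
  refine continuous_pi fun k => continuous_pi fun l => continuous_finsetSum _ fun i _ =>
    continuous_finsetSum _ fun j _ => ?_
  have hs : Continuous fun f : C(ℝ≥0, C(Torus, ℂ)) => star f :=
    ContinuousMap.continuous_postcomp (⟨star, continuous_star⟩ : C(C(Torus, ℂ), C(Torus, ℂ)))
  have hw : Continuous fun p : C(ℝ≥0, C(Torus, ℂ)) × χ.WickSpace γ => p.2 i j := by fun_prop
  have h := (continuous_mulPath (χ := χ) (γ := γ) ((k + l) * r)).comp
    (((continuous_fst.pow (k - i)).mul ((hs.comp continuous_fst).pow (l - j))).prodMk hw)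
  exact (continuous_const_smul ((k.choose i : ℂ) * (l.choose j : ℂ))).comp h

lemma coeff_mulOp_of_coeff_eq {r : ℝ} {f g : C(Torus, ℂ)} {F : χ.HolderBesov γ} (hf : f ∈ Trig r)
    (hF : F.coeff = fc g) : (mulOp χ γ r f F).coeff = fc (f * g) := by
  funext q
  rw [coeff_mulOp, fc_mul hf, hF]

lemma coeff_translate {r : ℝ} (hr : 0 ≤ r) {h : C(ℝ≥0, C(Torus, ℂ))} {w : χ.WickSpace γ} {t : ℝ≥0}
    (hh : h t ∈ Trig r) {x : C(Torus, ℂ)} {c : ℂ}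
    (hw : ∀ i j, (w i j t).coeff = fc (herm i j x (star x) c)) (k l : ℕ) :
    (translate r h w k l t).coeff = fc (herm k l (x + h t) (star (x + h t)) c) := by
  rw [star_add, herm_add, translate, ContinuousMap.sum_apply, DyadicPartition.HolderBesov.coeff_sum,
    map_sum]
  refine Finset.sum_congr rfl fun i hi => ?_
  rw [ContinuousMap.sum_apply, DyadicPartition.HolderBesov.coeff_sum, map_sum]
  refine Finset.sum_congr rfl fun j hj => ?_
  rw [ContinuousMap.smul_apply, DyadicPartition.HolderBesov.coeff_smul, map_smul]
  congr 1
  refine coeff_mulOp_of_coeff_eq ?_ (hw i j)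
  have h1 : ((k - i : ℕ) : ℝ) ≤ k := by exact_mod_cast Nat.sub_le k i
  have h2 : ((l - j : ℕ) : ℝ) ≤ l := by exact_mod_cast Nat.sub_le l j
  refine Trig_mono ?_ (mul_mem_Trig (pow_mem_Trig hh (k - i))
    (pow_mem_Trig (star_mem_Trig hh) (l - j)))
  rw [← add_mul]
  gcongr

/-! ### The Cameron–Martin theorem -/

section Real

variable {Ω : Type*} [MeasurableSpace Ω] {P : Measure Ω}

lemma absolutelyContinuous_map_add_const {η : Ω → ℝ} (hη : HasGaussianLaw η P)
    (hv : 0 < Var[η; P]) (a : ℝ) : P.map (fun ω => η ω + a) ≪ P.map η := by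
  have h0 : Var[η; P].toNNReal ≠ 0 := (Real.toNNReal_pos.2 hv).ne'
  have h1 : P.map (fun ω => η ω + a) = (P.map η).map (· + a) :=
    (AEMeasurable.map_map_of_aemeasurable (g := (· + a)) (by fun_prop) hη.aemeasurable).symm
  rw [h1, hη.map_eq_gaussianReal, gaussianReal_map_add_const]
  exact (gaussianReal_absolutelyContinuous _ h0).trans (gaussianReal_absolutelyContinuous' _ h0)

/-- Shifts of a random vector in the direction `h` when the coordinate along `h` is an independent
nondegenerate Gaussian variable. -/
lemma absolutelyContinuous_map_add_smul {ι : Type*} [IsProbabilityMeasure P] {U : Ω → ι → ℂ}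
    {η : Ω → ℝ} (hU : AEMeasurable U P) (hη : HasGaussianLaw η P) (hv : 0 < Var[η; P])
    (hind : IndepFun U η P) (h : ι → ℂ) (a : ℝ) :
    P.map (fun ω i => U ω i + ((η ω + a : ℝ) : ℂ) * h i) ≪
      P.map (fun ω i => U ω i + ((η ω : ℝ) : ℂ) * h i) := by
  set Φ : (ι → ℂ) × ℝ → ι → ℂ := fun p i => p.1 i + (p.2 : ℂ) * h i
  have hΦ : Measurable Φ := by
    refine measurable_pi_lambda _ fun i => ?_
    fun_prop
  have hind2 : IndepFun U (fun ω => η ω + a) P :=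
    hind.comp measurable_id (measurable_id.add_const a)
  have e1 := (indepFun_iff_map_prod_eq_prod_map_map hU hη.aemeasurable).1 hind
  have e2 := (indepFun_iff_map_prod_eq_prod_map_map hU (hη.aemeasurable.add_const a)).1 hind2
  have m1 : P.map (fun ω i => U ω i + ((η ω : ℝ) : ℂ) * h i) = (P.map fun ω => (U ω, η ω)).map Φ :=
    (AEMeasurable.map_map_of_aemeasurable hΦ.aemeasurable (hU.prodMk hη.aemeasurable)).symm
  have m2 : P.map (fun ω i => U ω i + ((η ω + a : ℝ) : ℂ) * h i) =
      (P.map fun ω => (U ω, η ω + a)).map Φ :=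
    (AEMeasurable.map_map_of_aemeasurable hΦ.aemeasurable
      (hU.prodMk (hη.aemeasurable.add_const a))).symm
  rw [m1, m2, e1, e2]
  have := Measure.isProbabilityMeasure_map (μ := P) hη.aemeasurable
  exact (Measure.AbsolutelyContinuous.rfl.prod (absolutelyContinuous_map_add_const hη hv a)).map hΦ

end Real

variable {μ : ℂ} {Ω : Type*} [MeasurableSpace Ω] {P : Measure Ω} {ξ : SpaceTimeL2 → Ω → ℂ}

/-- The real or imaginary part. -/
def rePart : Bool → ℂ →L[ℝ] ℝ
  | true => Complex.reCLM
  | false => Complex.imCLM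

section Decomposition

lemma IsComplexWhiteNoise.integrable_mul (hξ : IsComplexWhiteNoise P ξ) (u v : SpaceTimeL2) :
    Integrable (fun ω => ξ u ω * ξ v ω) P := (hξ.memLp u).integrable_mul (hξ.memLp v)

lemma IsComplexWhiteNoise.integrable_mul_conj (hξ : IsComplexWhiteNoise P ξ) (u v : SpaceTimeL2) :
    Integrable (fun ω => ξ u ω * conj (ξ v ω)) P := (hξ.memLp u).integrable_mul (hξ.memLp v).star

/-- The covariance with the real Gaussian variable `2 Re ξ(v)`. -/
lemma IsComplexWhiteNoise.integral_mul_re (hξ : IsComplexWhiteNoise P ξ) (v u : SpaceTimeL2) :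
    ∫ ω, ξ u ω * ((2 * (ξ v ω).re : ℝ) : ℂ) ∂P = ∫ p, u p * conj (v p) ∂spaceTimeMeasure := by
  have h : ∀ ω, ξ u ω * ((2 * (ξ v ω).re : ℝ) : ℂ) = ξ u ω * ξ v ω + ξ u ω * conj (ξ v ω) := fun ω => by
    rw [← mul_add, Complex.add_conj]
  simp_rw [h]
  rw [integral_add (hξ.integrable_mul u v) (hξ.integrable_mul_conj u v), hξ.pseudoCov, hξ.cov, zero_add]

lemma IsComplexWhiteNoise.hasGaussianLaw_re (hξ : IsComplexWhiteNoise P ξ) (v : SpaceTimeL2) : HasGaussianLaw (fun ω => 2 * (ξ v ω).re) P :=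
  (hξ.gaussian.hasGaussianLaw_eval v).map ((2 : ℝ) • Complex.reCLM)

lemma IsComplexWhiteNoise.integral_re (hξ : IsComplexWhiteNoise P ξ) (v : SpaceTimeL2) : ∫ ω, 2 * (ξ v ω).re ∂P = 0 := by
  have := hξ.gaussian.isProbabilityMeasure
  have h1 := Complex.reCLM.integral_comp_comm ((hξ.memLp v).integrable one_le_two)
  rw [integral_const_mul, show ∫ ω, (ξ v ω).re ∂P = 0 by simpa [hξ.mean] using h1, mul_zero]

lemma IsComplexWhiteNoise.variance_re (hξ : IsComplexWhiteNoise P ξ) (v : SpaceTimeL2) :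
    ((Var[fun ω => 2 * (ξ v ω).re; P] : ℝ) : ℂ) = 2 * ∫ p, v p * conj (v p) ∂spaceTimeMeasure := by
  have h1 := hξ.integral_mul_re v v
  rw [variance_of_integral_eq_zero (hξ.hasGaussianLaw_re v).aemeasurable (hξ.integral_re v), ← h1]
  have h2 : ∫ ω, (2 * (ξ v ω).re) ^ 2 ∂P = 2 * ∫ ω, (ξ v ω * ((2 * (ξ v ω).re : ℝ) : ℂ)).re ∂P := by
    rw [← integral_const_mul]
    refine integral_congr_ae (.of_forall fun ω => ?_)
    simp only [Complex.re_mul_ofReal]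
    ring
  have h3 : Integrable (fun ω => ξ v ω * ((2 * (ξ v ω).re : ℝ) : ℂ)) P :=
    (hξ.memLp v).integrable_mul (hξ.hasGaussianLaw_re v).memLp_two.ofReal
  have h4 := Complex.reCLM.integral_comp_comm h3
  simp only [Complex.reCLM_apply] at h4
  rw [h2, h4, h1]
  have h5 : (∫ p, v p * conj (v p) ∂spaceTimeMeasure).im = 0 := by
    have : ∀ p, v p * conj (v p) = ((‖v p‖ ^ 2 : ℝ) : ℂ) := fun p => by
      rw [Complex.mul_conj']; push_cast; rfl
    simp_rw [this]
    rw [integral_complex_ofReal, Complex.ofReal_im]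
  push_cast
  congr 1
  exact Complex.ext (by simp) (by simp [h5])

/-- The stochastic integrals, with their components along `ξ v` removed, are independent of
`Re (ξ v)`. -/
lemma IsComplexWhiteNoise.indepFun_sub (hξ : IsComplexWhiteNoise P ξ) (v : SpaceTimeL2) {ι : Type*}
    (u : ι → SpaceTimeL2)
    (hv : 0 < Var[fun ω => 2 * (ξ v ω).re; P]) :
    IndepFun (fun ω i => ξ (u i) ω - ((2 * (ξ v ω).re : ℝ) : ℂ) *
      ((∫ p, u i p * conj (v p) ∂spaceTimeMeasure) / (Var[fun ω => 2 * (ξ v ω).re; P] : ℝ)))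
      (fun ω => 2 * (ξ v ω).re) P := by
  classical
  have := hξ.gaussian.isProbabilityMeasure
  set σ := Var[fun ω => 2 * (ξ v ω).re; P] with hσ
  set η : Ω → ℝ := fun ω => 2 * (ξ v ω).re with hηdef
  have hη : HasGaussianLaw η P := hξ.hasGaussianLaw_re v
  set c : ι → ℂ := fun i => (∫ p, u i p * conj (v p) ∂spaceTimeMeasure) / (σ : ℝ) with hc
  set U : ι → Ω → ℂ := fun i ω => ξ (u i) ω - (η ω : ℂ) * c i with hU
  have hU2 : ∀ i, MemLp (U i) 2 P := fun i =>
    (hξ.memLp (u i)).sub (hη.memLp_two.ofReal.mul_const (c i))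
  have hU0 : ∀ i, ∫ ω, U i ω ∂P = 0 := by
    intro i
    simp only [hU]
    rw [integral_sub (by exact (hξ.memLp _).integrable one_le_two)
      (by exact (hη.memLp_two.ofReal.mul_const (c i)).integrable one_le_two), hξ.mean, integral_mul_const,
      integral_complex_ofReal, hξ.integral_re v]
    simp
  have hUη : ∀ i, ∫ ω, U i ω * (η ω : ℂ) ∂P = 0 := by
    intro i
    have e : ∀ ω, U i ω * (η ω : ℂ) = ξ (u i) ω * (η ω : ℂ) - ((η ω ^ 2 : ℝ) : ℂ) * c i := fun ω => by
      simp only [hU]; push_cast; ring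
    simp_rw [e]
    rw [integral_sub (by exact (hξ.memLp _).integrable_mul hη.memLp_two.ofReal)
      (by exact (hη.memLp_two.integrable_sq.ofReal).mul_const _), hξ.integral_mul_re v, integral_mul_const,
      integral_complex_ofReal, ← variance_of_integral_eq_zero hη.aemeasurable (hξ.integral_re v), hc]
    have : (σ : ℂ) ≠ 0 := by exact_mod_cast hv.ne'
    rw [mul_div_cancel₀ _ this, sub_self]
  -- Independence from zero correlation needs joint Gaussianity. It is checked on real and imaginary
  -- parts, each a real linear function of finitely many values of the noise.
  have hG : IsGaussianProcess (Sum.elim (fun (q : ι × Bool) ω => rePart q.2 (U q.1 ω))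
      (fun (_ : Unit) => η)) P := by
    refine hξ.gaussian.of_isGaussianProcess fun s => ?_
    rcases s with ⟨i, b⟩ | _
    · let p (w : ({u i, v} : Finset SpaceTimeL2)) : (({u i, v} : Finset SpaceTimeL2) → ℂ) →L[ℝ] ℂ :=
        ContinuousLinearMap.proj w
      refine ⟨{u i, v}, (rePart b).comp (p ⟨u i, by simp⟩ -
        ((2 : ℝ) • (Complex.reCLM.comp (p ⟨v, by simp⟩))).smulRight (c i)), fun ω => ?_⟩
      simp [hU, hηdef, p, Finset.restrict_def]
    · let p : (({v} : Finset SpaceTimeL2) → ℂ) →L[ℝ] ℂ := ContinuousLinearMap.proj ⟨v, by simp⟩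
      exact ⟨{v}, (2 : ℝ) • (Complex.reCLM.comp p), fun ω => by simp [hηdef, p, Finset.restrict_def]⟩
  have hI := hG.indepFun_of_covariance_eq_zero
    (fun q => ((rePart q.2).continuous.measurable.comp_aemeasurable (hU2 q.1).1.aemeasurable))
    (fun _ => hη.aemeasurable) fun q _ => by
      have a1 : MemLp (fun ω => rePart q.2 (U q.1 ω)) 2 P := (rePart q.2).comp_memLp' (hU2 q.1)
      have a2 : Integrable (fun ω => U q.1 ω * (η ω : ℂ)) P :=
        (hU2 q.1).integrable_mul hη.memLp_two.ofReal
      rw [covariance_eq_sub a1 hη.memLp_two]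
      have b1 := (rePart q.2).integral_comp_comm a2
      have b2 : ∫ ω, η ω ∂P = 0 := hξ.integral_re v
      rw [hUη, map_zero] at b1
      rw [b2, mul_zero, sub_zero, ← b1]
      refine integral_congr_ae (.of_forall fun ω => ?_)
      show rePart q.2 (U q.1 ω) * η ω = rePart q.2 (U q.1 ω * (η ω : ℂ))
      rcases q with ⟨i, _ | _⟩
      · exact (Complex.im_mul_ofReal (U i ω) (η ω)).symm
      · exact (Complex.re_mul_ofReal (U i ω) (η ω)).symm
  have hφ : Measurable fun (x : ι × Bool → ℝ) (i : ι) => (x (i, true) : ℂ) + x (i, false) * Complex.I := by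
    fun_prop
  have hψ : Measurable fun y : Unit → ℝ => y () := measurable_pi_apply ()
  have hcomp := hI.comp hφ hψ
  refine hcomp.congr (.of_forall fun ω => ?_) (.of_forall fun ω => rfl)
  funext i
  exact Complex.re_add_im (U i ω)

end Decomposition

variable {χ : DyadicPartition} {γ : ℝ}

lemma pathCoeff_add (f g : χ.PathSpace γ) : χ.pathCoeff (f + g) = χ.pathCoeff f + χ.pathCoeff g := rfl

/-- The law of the stationary solution is quasi-invariant under translations by elements of the
Cameron–Martin space. -/
theorem IsStationarySolution.absolutelyContinuous_map_add {Z : Ω → χ.PathSpace γ} (hγ : γ ≤ 0)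
    (hμ : 0 < μ.re) (hξ : IsComplexWhiteNoise P ξ) (hZ : IsStationarySolution χ γ μ P ξ Z)
    (g : SpaceTimeL2) {h : χ.PathSpace γ}
    (hg : ∀ t m, (h t).coeff m = ∫ p, kerL2 hμ t m p * g p ∂spaceTimeMeasure) :
    P.map (fun ω => Z ω + h) ≪ P.map Z := by
  have := hξ.gaussian.isProbabilityMeasure
  have := χ.polishSpace_pathSpace hγ
  -- The conjugate turns the bilinear pairing with `g` into the covariance with `2 Re ξ(v)`.
  set v : SpaceTimeL2 := star g
  have hgv : ∀ t m, (h t).coeff m = ∫ p, kerL2 hμ t m p * conj (v p) ∂spaceTimeMeasure := by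
    intro t m
    rw [hg]
    refine integral_congr_ae ?_
    filter_upwards [Lp.coeFn_star g] with p hp
    rw [hp, Pi.star_apply, RCLike.star_def, Complex.conj_conj]
  set σ := Var[fun ω => 2 * (ξ v ω).re; P] with hσ
  have hσv := hξ.variance_re v
  -- If the Gaussian coordinate is degenerate then `v = 0`, hence `h = 0` and there is nothing to
  -- translate.
  rcases eq_or_lt_of_le (variance_nonneg (fun ω => 2 * (ξ v ω).re) P) with h0 | hpos
  · have h1 : v =ᵐ[spaceTimeMeasure] 0 := by
      rw [← h0] at hσv
      have e : ∀ p, v p * conj (v p) = ((‖v p‖ ^ 2 : ℝ) : ℂ) := fun p => by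
        rw [Complex.mul_conj']; push_cast; rfl
      simp_rw [e] at hσv
      rw [integral_complex_ofReal] at hσv
      have h2 : ∫ p, ‖v p‖ ^ 2 ∂spaceTimeMeasure = 0 := by
        rcases mul_eq_zero.1 hσv.symm with h | h
        · norm_num at h
        · exact_mod_cast h
      have h3 := (integral_eq_zero_iff_of_nonneg (fun p => by positivity)
        (Lp.memLp v).norm.integrable_sq).1 h2
      filter_upwards [h3] with p hp
      simpa using hp
    have h2 : h = 0 := by
      refine ContinuousMap.ext fun t => DyadicPartition.HolderBesov.coeff_injective (funext fun m => ?_)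
      rw [hgv t m]
      refine (integral_eq_zero_of_ae ?_).trans rfl
      filter_upwards [h1] with p hp
      rw [hp]
      simp
    simp only [h2, add_zero]
    exact Measure.AbsolutelyContinuous.rfl
  set k : ℕ × Mode → SpaceTimeL2 := fun q => kerL2 hμ (TopologicalSpace.denseSeq ℝ≥0 q.1) q.2
  have hind := hξ.indepFun_sub v k hpos
  set d : ℕ × Mode → ℂ := fun q => (∫ p, k q p * conj (v p) ∂spaceTimeMeasure) / (σ : ℝ) with hd
  -- The coordinates equal an independent part plus `2 Re ξ(v)` times `d`. A shift of that real
  -- variable by `σ` therefore moves the coordinates by exactly those of `h`, and shifting a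
  -- nondegenerate real Gaussian preserves null sets.
  have hdh : ∀ q, χ.pathCoeff h q = σ * d q := fun q => by
    have : (σ : ℂ) ≠ 0 := by exact_mod_cast hpos.ne'
    rw [hd, mul_div_cancel₀ _ this]
    exact hgv _ _
  have hU : AEMeasurable (fun ω q => ξ (k q) ω - ((2 * (ξ v ω).re : ℝ) : ℂ) * d q) P := by
    refine (measurable_pi_lambda _ fun q => (hξ.measurable _).sub (Measurable.mul_const ?_ _)).aemeasurable
    have := hξ.measurable v
    fun_prop
  have hac := absolutelyContinuous_map_add_smul hU (hξ.hasGaussianLaw_re v) hpos hind d σ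
  have hZk : ∀ᵐ ω ∂P, ∀ q, χ.pathCoeff (Z ω) q = ξ (k q) ω :=
    ae_all_iff.2 fun q => hZ.coeff_ae_eq hμ _ _
  have e1 : (fun ω q => ξ (k q) ω - ((2 * (ξ v ω).re : ℝ) : ℂ) * d q + ((2 * (ξ v ω).re : ℝ) : ℂ) * d q)
      =ᵐ[P] fun ω => χ.pathCoeff (Z ω) := by
    filter_upwards [hZk] with ω hω
    funext q
    rw [hω, sub_add_cancel]
  have e2 : (fun ω q => ξ (k q) ω - ((2 * (ξ v ω).re : ℝ) : ℂ) * d q +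
      ((2 * (ξ v ω).re + σ : ℝ) : ℂ) * d q) =ᵐ[P] fun ω => χ.pathCoeff (Z ω + h) := by
    filter_upwards [hZk] with ω hω
    funext q
    rw [pathCoeff_add, Pi.add_apply, hω, hdh]
    push_cast
    ring
  rw [Measure.map_congr e1, Measure.map_congr e2] at hac
  have hemb := χ.measurableEmbedding_pathCoeff hγ
  -- Null sets are carried from the countable coordinates back to path space by the measurable
  -- embedding.
  intro A hA
  have hm : Measurable fun ω => Z ω + h := hZ.measurable.add_const h
  obtain ⟨B, hAB, hB, hB0⟩ := exists_measurable_superset_of_null hA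
  refine measure_mono_null hAB ?_
  have h1 : P.map (fun ω => χ.pathCoeff (Z ω)) (χ.pathCoeff '' B) = 0 := by
    rw [Measure.map_apply (by exact hemb.measurable.comp hZ.measurable) (hemb.measurableSet_image.2 hB)]
    rw [Measure.map_apply hZ.measurable hB] at hB0
    refine measure_mono_null (fun ω hω => ?_) hB0
    obtain ⟨z, hz, hzz⟩ := hω
    rw [Set.mem_preimage, ← hemb.injective hzz]
    exact hz
  have h2 := hac h1
  rw [Measure.map_apply (by exact hemb.measurable.comp hm) (hemb.measurableSet_image.2 hB)] at h2
  rw [Measure.map_apply hm hB]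
  refine measure_mono_null (fun ω (hω : Z ω + h ∈ B) => ?_) h2
  exact Set.mem_image_of_mem χ.pathCoeff hω

/-! ### Smooth paths of trigonometric polynomials -/

variable {μ : ℂ}

/-- The Duhamel formula for compactly supported functions. -/
lemma integral_exp_mul_deriv_add {c : ℝ → ℂ} (hc : ContDiff ℝ 1 c) (hs : HasCompactSupport c) (a : ℂ)
    (t : ℝ) : ∫ s in Set.Iic t, Complex.exp (-a * ((t : ℂ) - s)) * (deriv c s + a * c s) = c t := by
  set F : ℝ → ℂ := fun s => Complex.exp (-a * ((t : ℂ) - s)) * c s with hF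
  have hE : ∀ s : ℝ, HasDerivAt (fun s : ℝ => Complex.exp (-a * ((t : ℂ) - s)))
      (Complex.exp (-a * ((t : ℂ) - s)) * a) s := by
    intro s
    have h1 : HasDerivAt (fun s : ℝ => -a * ((t : ℂ) - s)) a s := by
      have := ((hasDerivAt_id s).ofReal_comp.const_sub (t : ℂ)).const_mul (-a)
      simpa using this
    exact h1.cexp
  have hd : ∀ s, deriv F s = Complex.exp (-a * ((t : ℂ) - s)) * (deriv c s + a * c s) := by
    intro s
    have h2 := (hc.differentiable one_ne_zero s).hasDerivAt
    have h3 : deriv F s = _ := ((hE s).mul h2).deriv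
    rw [h3]
    ring
  have hFc : ContDiff ℝ 1 F := by
    refine ContDiff.mul ?_ hc
    exact (contDiff_const.mul (contDiff_const.sub Complex.ofRealCLM.contDiff)).cexp
  have h := HasCompactSupport.integral_Iic_deriv_eq hFc hs.mul_left t
  simp_rw [hd] at h
  rw [h, hF]
  simp

lemma integral_kerL2_mul (hμ : 0 < μ.re) (g : SpaceTimeL2) (t : ℝ) (m : Mode) :
    ∫ p, kerL2 hμ t m p * g p ∂spaceTimeMeasure = ∫ s in Set.Iic t,
      Complex.exp (-μ * eigenvalue m * ((t : ℂ) - s)) *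
        UnitAddTorus.mFourierCoeff (fun y => g (s, y)) m := by
  have h1 : ∫ p, kerL2 hμ t m p * g p ∂spaceTimeMeasure =
      ∫ p, kernelCoeff μ (t - p.1) p.2 m * g p ∂spaceTimeMeasure := by
    refine integral_congr_ae ?_
    filter_upwards [coeFn_kerL2 hμ t m] with p hp
    rw [hp]
  have h2 : Integrable (fun p => kernelCoeff μ (t - p.1) p.2 m * g p) spaceTimeMeasure :=
    (memLp_kernelCoeff hμ m t).integrable_mul (Lp.memLp g)
  rw [h1, integral_prod _ h2, ← integral_indicator measurableSet_Iic]
  refine integral_congr_ae (.of_forall fun s => ?_)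
  have hk : ∀ y, kernelCoeff μ (t - s) y m = timeKer μ m t s * UnitAddTorus.mFourier (-m) y := fun y =>
    kernelCoeff_eq t (s, y) m
  simp only [hk, timeKer, Set.indicator_apply, Complex.ofReal_sub]
  split_ifs with h
  · rw [mFourierCoeff_eq, ← integral_const_mul]
    refine integral_congr_ae (.of_forall fun y => ?_)
    simp only [smul_eq_mul, mul_assoc]
  · simp

/-- Paths of Fourier coefficients that extend to compactly supported `C¹` functions. -/
def IsSmoothPath (x : C(ℝ≥0, Mode → ℂ)) : Prop :=
  ∀ m, ∃ c : ℝ → ℂ, ContDiff ℝ 1 c ∧ HasCompactSupport c ∧ ∀ t : ℝ≥0, x t m = c t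

/-- Weierstrass approximation of real and imaginary parts on `[0, N]`, multiplied by a bump function
equal to one there. -/
lemma exists_smooth_near (f : C(ℝ≥0, ℂ)) (N : ℕ) : ∃ c : ℝ → ℂ, ContDiff ℝ 1 c ∧ HasCompactSupport c ∧
    ∀ t : ℝ≥0, t ≤ N → ‖c t - f t‖ ≤ 1 / (N + 1) := by
  have hN : (0 : ℝ) < 1 / (2 * (N + 1)) := by positivity
  have hf : Continuous fun s : ℝ => f s.toNNReal := f.continuous.comp continuous_real_toNNReal
  obtain ⟨p, hp⟩ := exists_polynomial_near_of_continuousOn 0 N (fun s => (f s.toNNReal).re)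
    (Complex.continuous_re.comp hf).continuousOn _ hN
  obtain ⟨q, hq⟩ := exists_polynomial_near_of_continuousOn 0 N (fun s => (f s.toNNReal).im)
    (Complex.continuous_im.comp hf).continuousOn _ hN
  let b : ContDiffBump (0 : ℝ) := ⟨N + 1, N + 2, by positivity, by linarith⟩
  refine ⟨fun s => (b s : ℂ) * ((p.eval s : ℝ) + (q.eval s : ℝ) * Complex.I), ?_, ?_, fun t ht => ?_⟩
  · have h1 : ∀ {g : ℝ → ℝ}, ContDiff ℝ 1 g → ContDiff ℝ 1 fun s => (g s : ℂ) := fun hg =>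
      Complex.ofRealCLM.contDiff.comp hg
    have hpoly : ∀ p : Polynomial ℝ, ContDiff ℝ 1 fun s => p.eval s := fun p => by
      simpa only [Polynomial.coe_aeval_eq_eval] using p.contDiff_aeval (𝕜 := ℝ) (R := ℝ) 1
    exact (h1 b.contDiff).mul ((h1 (hpoly p)).add ((h1 (hpoly q)).mul contDiff_const))
  · have h2 : HasCompactSupport fun s => (b s : ℂ) := b.hasCompactSupport.comp_left Complex.ofReal_zero
    exact h2.mul_right
  · have ht' : (t : ℝ) ∈ Set.Icc (0 : ℝ) N := ⟨t.2, by exact_mod_cast ht⟩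
    have hb : b t = 1 := b.one_of_mem_closedBall (by
      refine mem_closedBall_zero_iff.2 ((Real.norm_of_nonneg ht'.1).trans_le ?_)
      exact ht'.2.trans (by show (N : ℝ) ≤ N + 1; linarith))
    have h1 := hp t ht'
    have h2 := hq t ht'
    simp only [Real.toNNReal_coe] at h1 h2
    have e : (b t : ℂ) * ((p.eval (t : ℝ) : ℝ) + (q.eval (t : ℝ) : ℝ) * Complex.I) - f t =
        ((p.eval (t : ℝ) - (f t).re : ℝ) : ℂ) + ((q.eval (t : ℝ) - (f t).im : ℝ) : ℂ) * Complex.I := by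
      rw [hb]
      nth_rw 1 [← Complex.re_add_im (f t)]
      push_cast
      ring
    rw [e]
    refine (norm_add_le _ _).trans ?_
    rw [norm_mul, Complex.norm_I, mul_one, Complex.norm_real, Complex.norm_real, Real.norm_eq_abs,
      Real.norm_eq_abs]
    have : (1 : ℝ) / (N + 1) = 1 / (2 * (N + 1)) + 1 / (2 * (N + 1)) := by field_simp; norm_num
    linarith

/-- Smooth paths are dense. -/
lemma exists_isSmoothPath_tendsto (x : C(ℝ≥0, Mode → ℂ)) : ∃ y : ℕ → C(ℝ≥0, Mode → ℂ),
    (∀ i, IsSmoothPath (y i)) ∧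
      ∀ S, Tendsto (fun i => trigPath S (y i)) atTop (𝓝 (trigPath S x)) := by
  have h1 : ∀ (i : ℕ) (m : Mode), ∃ c : ℝ → ℂ, ContDiff ℝ 1 c ∧ HasCompactSupport c ∧
      ∀ t : ℝ≥0, t ≤ i → ‖c t - x t m‖ ≤ 1 / (i + 1) := fun i m =>
    exists_smooth_near ⟨fun t => x t m, (continuous_apply m).comp x.continuous⟩ i
  choose c hc hcs hcx using h1
  refine ⟨fun i => ⟨fun t m => c i m t, continuous_pi fun m =>
    (hc i m).continuous.comp NNReal.continuous_coe⟩, fun i m => ⟨c i m, hc i m, hcs i m, fun _ => rfl⟩,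
    fun S => tendsto_iff_pathSup.2 fun T => ?_⟩
  have h2 : Tendsto (fun i : ℕ => ENNReal.ofReal (S.card * (1 / (i + 1)))) atTop (𝓝 0) := by
    have := ENNReal.tendsto_ofReal (tendsto_one_div_add_atTop_nhds_zero_nat.const_mul (S.card : ℝ))
    simpa using this
  refine tendsto_of_tendsto_of_tendsto_of_le_of_le' tendsto_const_nhds h2 (.of_forall fun _ => zero_le) ?_
  filter_upwards [eventually_ge_atTop T] with i hi
  refine iSup₂_le fun t ht => ?_
  rw [← ofReal_norm]
  refine ENNReal.ofReal_le_ofReal ?_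
  have e : (trigPath S x - trigPath S (⟨fun t m => c i m t, continuous_pi fun m =>
      (hc i m).continuous.comp NNReal.continuous_coe⟩)) t =
      ∑ m ∈ S, (x t m - c i m t) • UnitAddTorus.mFourier m := by
    show trigSum S (x t) - trigSum S (fun m => c i m t) = _
    rw [trigSum, trigSum, ← Finset.sum_sub_distrib]
    exact Finset.sum_congr rfl fun m _ => (sub_smul _ _ _).symm
  rw [e]
  refine (norm_sum_le _ _).trans ?_
  rw [← nsmul_eq_mul]
  refine Finset.sum_le_card_nsmul _ _ _ fun m _ => ?_
  rw [norm_smul, UnitAddTorus.mFourier_norm, mul_one, norm_sub_rev]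
  exact hcx i m t (ht.trans (by exact_mod_cast hi))

/-- Smooth paths of trigonometric polynomials are driven by a square integrable forcing. -/
lemma exists_forcing {x : C(ℝ≥0, Mode → ℂ)} (hx : IsSmoothPath x) (S : Finset Mode) :
    ∃ g : SpaceTimeL2, ∀ (t : ℝ≥0) (m : Mode), ∫ s in Set.Iic (t : ℝ),
      Complex.exp (-μ * eigenvalue m * (((t : ℝ) : ℂ) - s)) *
        UnitAddTorus.mFourierCoeff (fun y => g (s, y)) m = fc (trigPath S x t) m := by
  choose c hc hcs hcx using hx
  -- The forcing is the equation applied to the path. The path has compact support on the whole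
  -- line, so Duhamel's integral from `-∞` reproduces it without an initial term.
  set f : Mode → ℝ → ℂ := fun m s => deriv (c m) s + μ * eigenvalue m * c m s with hf
  have hfc : ∀ m, Continuous (f m) := fun m =>
    (hc m).continuous_deriv le_rfl |>.add (continuous_const.mul (hc m).continuous)
  have hfs : ∀ m, HasCompactSupport (f m) := fun m => (hcs m).deriv.add (hcs m).mul_left
  set G : ℝ × Torus → ℂ := fun p => trigSum S (fun m => f m p.1) p.2 with hG
  have hGe : ∀ p, G p = ∑ m ∈ S, f m p.1 * UnitAddTorus.mFourier m p.2 := fun p => by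
    simp only [hG, trigSum, ContinuousMap.sum_apply]
    rfl
  have hGL : MemLp G 2 spaceTimeMeasure := by
    have e : G = fun p => ∑ m ∈ S, f m p.1 * UnitAddTorus.mFourier m p.2 := funext hGe
    rw [e]
    refine memLp_finsetSum _ fun m _ => ?_
    have hcont : Continuous fun p : ℝ × Torus => f m p.1 * UnitAddTorus.mFourier m p.2 :=
      ((hfc m).comp continuous_fst).mul ((UnitAddTorus.mFourier m).continuous.comp continuous_snd)
    refine hcont.memLp_of_hasCompactSupport ?_
    refine HasCompactSupport.intro ((hfs m).isCompact.prod isCompact_univ) fun p hp => ?_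
    have : p.1 ∉ tsupport (f m) := fun h => hp ⟨h, Set.mem_univ _⟩
    rw [image_eq_zero_of_notMem_tsupport this, zero_mul]
  refine ⟨hGL.toLp, fun t m => ?_⟩
  have h1 : ∀ᵐ s : ℝ, UnitAddTorus.mFourierCoeff (fun y => (hGL.toLp : SpaceTimeL2) (s, y)) m =
      if m ∈ S then f m s else 0 := by
    have h2 := Measure.ae_ae_of_ae_prod hGL.coeFn_toLp
    filter_upwards [h2] with s hs
    have h3 : UnitAddTorus.mFourierCoeff (fun y => (hGL.toLp : SpaceTimeL2) (s, y)) m =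
        fc (trigSum S fun m => f m s) m := by
      rw [mFourierCoeff_eq, fc_apply]
      refine integral_congr_ae ?_
      filter_upwards [hs] with y hy
      rw [hy, smul_eq_mul]
    rw [h3, trigSum, fc_sum_smul]
  have h4 : fc (trigPath S x t) m = if m ∈ S then c m t else 0 := by
    show fc (trigSum S (x t)) m = _
    rw [trigSum, fc_sum_smul, hcx]
  rw [h4]
  refine (setIntegral_congr_ae measurableSet_Iic
    (g := fun s : ℝ => Complex.exp (-μ * eigenvalue m * (((t : ℝ) : ℂ) - s)) *
      if m ∈ S then f m s else 0) (h1.mono fun s hs _ => by rw [hs])).trans ?_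
  split_ifs with h
  · have := integral_exp_mul_deriv_add (hc m) (hcs m) (μ * eigenvalue m) t
    simpa only [neg_mul] using this
  · simp

lemma represents_continuousMap (f : C(Torus, ℂ)) : Represents (fc f) f :=
  ⟨integrable_continuousMap f, fun _ => rfl⟩

lemma IsSmoothPath.mem_hermiteSet {x : C(ℝ≥0, Mode → ℂ)} (hx : IsSmoothPath x) (χ : DyadicPartition)
    (γ : ℝ) (n : ℕ) {R : ℝ} (hR : 0 ≤ R) :
    (fun k l => hermPath χ γ k l n R (trigPath (ball n) x)) ∈ hermiteSet χ γ μ := by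
  refine ⟨fun t => trigPath (ball n) x t, ?_, R, hR, fun k l t => ?_⟩
  · obtain ⟨g, hg⟩ := exists_forcing (μ := μ) hx (ball n)
    exact ⟨g, fun t => ⟨(trigPath (ball n) x t).continuous.memLp_of_hasCompactSupport
      (HasCompactSupport.of_compactSpace _), fun m => (hg t m).symm⟩⟩
  · rw [coeff_hermPath χ γ k l n.cast_nonneg _ (trigSum_mem_Trig subset_rfl _)]
    have h := represents_continuousMap (herm k l (trigPath (ball n) x t) (star (trigPath (ball n) x t)) R)
    have e : (fun y => hermite k l (trigPath (ball n) x t y) R) =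
        herm k l (trigPath (ball n) x t) (star (trigPath (ball n) x t)) R := by
      funext y
      rw [hermite_eq_herm, herm_continuousMap_apply]
      rfl
    rw [e]
    exact h

/-- Hermite polynomials of trigonometric paths are limits of elements of the skeleton. -/
lemma mem_closure_hermiteSet (x : C(ℝ≥0, Mode → ℂ)) (χ : DyadicPartition) (γ : ℝ) (n : ℕ) {R : ℝ}
    (hR : 0 ≤ R) : (fun k l => hermPath χ γ k l n R (trigPath (ball n) x)) ∈
      closure (hermiteSet χ γ μ) := by
  obtain ⟨y, hy, hyx⟩ := exists_isSmoothPath_tendsto x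
  refine mem_closure_of_tendsto (b := atTop)
    (f := fun i k l => hermPath χ γ k l n R (trigPath (ball n) (y i))) (tendsto_pi_nhds.2 fun k => tendsto_pi_nhds.2 fun l => ?_)
    (.of_forall fun i => (hy i).mem_hermiteSet χ γ n hR)
  exact ((hermPath χ γ k l n R).continuous.tendsto _).comp (hyx (ball n))

/-! ### The support of the law of the Wick powers -/

section Maps

variable {χ : DyadicPartition} {γ : ℝ} {μ : ℂ}

lemma trigSum_add (S : Finset Mode) (a b : Mode → ℂ) : trigSum S (a + b) = trigSum S a + trigSum S b := by
  rw [trigSum, trigSum, trigSum, ← Finset.sum_add_distrib]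
  exact Finset.sum_congr rfl fun m _ => add_smul (a m) (b m) (UnitAddTorus.mFourier m)

lemma continuous_trigPath (S : Finset Mode) : Continuous (trigPath S) :=
  ContinuousMap.continuous_postcomp (⟨trigSum S, by unfold trigSum; fun_prop⟩ : C(Mode → ℂ, C(Torus, ℂ)))

lemma continuous_scalePath (θ : Mode → ℂ) : Continuous (scalePath θ) :=
  ContinuousMap.continuous_postcomp (⟨fun y => θ * y, by fun_prop⟩ : C(Mode → ℂ, Mode → ℂ))

/-- The path of the Fourier coefficients. -/
def coeffPath (z : χ.PathSpace γ) : C(ℝ≥0, Mode → ℂ) where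
  toFun t := (z t).coeff
  continuous_toFun := continuous_pi fun m =>
    (DyadicPartition.HolderBesov.continuous_coeff m).comp z.continuous

lemma continuous_coeffPath : Continuous (coeffPath : χ.PathSpace γ → C(ℝ≥0, Mode → ℂ)) :=
  ContinuousMap.continuous_postcomp (⟨DyadicPartition.HolderBesov.coeff,
    continuous_pi fun m => DyadicPartition.HolderBesov.continuous_coeff m⟩ :
      C(χ.HolderBesov γ, Mode → ℂ))

lemma continuous_wickPath (k l n : ℕ) (θ : Mode → ℂ) : Continuous (wickPath χ γ μ k l n θ) :=
  (hermPath χ γ k l n _).continuous.comp ((continuous_trigPath _).comp (continuous_scalePath θ))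

/-- The Wick powers up to the level `n`, as a function of the path. -/
def wickSeq (χ : DyadicPartition) (γ : ℝ) (μ : ℂ) (n : ℕ) (x : C(ℝ≥0, Mode → ℂ)) : χ.WickSpace γ :=
  fun k l => wickPath χ γ μ k l n 1 x

lemma continuous_wickSeq (n : ℕ) : Continuous (wickSeq χ γ μ n) :=
  continuous_pi fun k => continuous_pi fun l => continuous_wickPath k l n 1

lemma wickSpace_ext {w w' : χ.WickSpace γ} (h : ∀ k l t, (w k l t).coeff = (w' k l t).coeff) : w = w' :=
  funext fun k => funext fun l => ContinuousMap.ext fun t =>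
    DyadicPartition.HolderBesov.coeff_injective (h k l t)

lemma ball_mono {r s : ℝ} (h : r ≤ s) : ball r ⊆ ball s := fun _ hm => mem_ball.2 ((mem_ball.1 hm).trans h)

lemma trigSum_indicator {r n : ℕ} (h : r ≤ n) (a : Mode → ℂ) :
    trigSum (ball n) ((Set.indicator (↑(ball r)) 1 : Mode → ℂ) * a) = trigSum (ball r) a := by
  have hs : ball (r : ℝ) ⊆ ball n := ball_mono (by exact_mod_cast h)
  rw [trigSum, ← Finset.sum_subset hs]
  · refine Finset.sum_congr rfl fun m hm => ?_
    rw [Pi.mul_apply, Set.indicator_of_mem (by exact_mod_cast hm), Pi.one_apply, one_mul]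
  · intro m _ hm
    rw [Pi.mul_apply, Set.indicator_of_notMem (by exact_mod_cast hm), zero_mul]
    exact zero_smul ℂ (UnitAddTorus.mFourier m)

/-- Above the degree `r` of the shift, translating the approximate Wick powers is the same as
shifting the underlying path, with the renormalization constant unchanged. This links the continuous
map on Wick powers to the Cameron–Martin shift. -/
lemma translate_wickSeq {r n : ℕ} (h : r ≤ n) (x y : C(ℝ≥0, Mode → ℂ)) :
    translate r (trigPath (ball r) y) (wickSeq χ γ μ n x) =
      wickSeq χ γ μ n (x + scalePath (Set.indicator (↑(ball r)) 1) y) := by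
  refine wickSpace_ext fun k l t => ?_
  have h1 : ∀ i j, (wickSeq χ γ μ n x i j t).coeff = fc (herm i j (trigSum (ball n) (x t))
      (star (trigSum (ball n) (x t))) (wickVar μ (ball n) 1)) := fun i j => by
    rw [wickSeq, coeff_wickPath, wickPoly, one_mul]
  rw [coeff_translate r.cast_nonneg (trigSum_mem_Trig subset_rfl _) h1, wickSeq, coeff_wickPath, wickPoly,
    one_mul]
  have h2 : trigSum (ball n) (x t) + trigPath (ball r) y t =
      trigSum (ball n) ((x + scalePath (Set.indicator (↑(ball r)) 1) y) t) := by
    show _ = trigSum (ball n) (x t + (Set.indicator (↑(ball r)) 1 : Mode → ℂ) * y t)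
    rw [trigSum_add, trigSum_indicator h]
    rfl
  rw [h2]

/-- Every Hermite family of a trigonometric path is a translate of the constant one at the zero
path, so once the support is translation invariant only the constants remain to be found in it. -/
lemma hermPath_eq_translate (n : ℕ) (R : ℂ) (x : C(ℝ≥0, Mode → ℂ)) :
    (fun k l => hermPath χ γ k l n R (trigPath (ball n) x)) =
      translate n (trigPath (ball n) x) fun k l => hermPath χ γ k l (0 : ℝ) R 0 := by
  refine wickSpace_ext fun k l t => ?_
  have h1 : ∀ i j, (hermPath χ γ i j (0 : ℝ) R 0 t).coeff = fc (herm i j (0 : C(Torus, ℂ)) (star 0) R) :=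
    fun i j => coeff_hermPath χ γ i j le_rfl R (Submodule.zero_mem _)
  rw [coeff_translate n.cast_nonneg (trigSum_mem_Trig subset_rfl _) h1, zero_add,
    coeff_hermPath χ γ k l n.cast_nonneg _ (trigSum_mem_Trig subset_rfl _)]

end Maps

variable {χ : DyadicPartition} {γ : ℝ} {μ : ℂ} {Ω : Type*} [MeasurableSpace Ω] {P : Measure Ω}
  {ξ : SpaceTimeL2 → Ω → ℂ} {Z : Ω → χ.PathSpace γ} {W : Ω → χ.WickSpace γ}

/-- Almost sure convergence to the Wick powers along a subsequence. -/
lemma IsWickPowers.exists_subseq (hγ : γ ≤ 0) (hW : IsWickPowers P Z W) (hZm : Measurable Z)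
    (hZ : IsOU μ P fun t m ω => (Z ω t).coeff m) : ∃ φ : ℕ → ℕ, StrictMono φ ∧
      ∀ᵐ ω ∂P, Tendsto (fun j => wickSeq χ γ μ (φ j) (coeffPath (Z ω))) atTop (𝓝 (W ω)) := by
  have := χ.polishSpace_pathSpace hγ
  set D : ℕ → ℕ → Ω → ℝ≥0∞ := fun i n ω => pathSup (i.unpair.2.unpair.2 : ℕ)
    (W ω i.unpair.1 i.unpair.2.unpair.1 -
      wickPath χ γ μ i.unpair.1 i.unpair.2.unpair.1 n 1 (coeffPath (Z ω))) with hD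
  obtain ⟨φ, hφ, h⟩ := exists_subseq_ae_tsum (P := P) (D := D) (fun i n => by
      refine ((measurable_pathSup _).comp (Measurable.sub ?_ ?_)).aemeasurable
      · exact (measurable_pi_apply _).comp ((measurable_pi_apply _).comp hW.measurable)
      · exact ((continuous_wickPath _ _ _ _).comp continuous_coeffPath).measurable.comp hZm) fun i => by
      refine (hW.tendsto i.unpair.1 i.unpair.2.unpair.1 1 (i.unpair.2.unpair.2 : ℕ) le_rfl).congr fun n => ?_
      refine lintegral_congr fun ω => ?_
      rw [ENNReal.rpow_one]
      simp only [hD, pathSup]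
      refine iSup_congr fun t => iSup_congr fun _ => ?_
      rw [DyadicPartition.HolderBesov.enorm_eq, ContinuousMap.sub_apply,
        DyadicPartition.HolderBesov.coeff_sub, coeff_wickPath, approxWick_eq hZ]
      rfl
  refine ⟨φ, hφ, h.mono fun ω hω => tendsto_pi_nhds.2 fun k => tendsto_pi_nhds.2 fun l =>
    tendsto_iff_pathSup.2 fun T => ?_⟩
  simpa [hD, wickSeq] using hω (Nat.pair k (Nat.pair l T))

section Support

lemma wickVar_nonneg (hμ : 0 < μ.re) (S : Finset Mode) (θ : Mode → ℂ) : 0 ≤ wickVar μ S θ :=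
  Finset.sum_nonneg fun m _ => mul_nonneg (by positivity) (ouVar_pos hμ m).le

/-- The Wick powers are almost surely limits of Hermite families of trigonometric paths whose
parameter is the nonnegative variance of the truncated field. -/
theorem support_subset_closure_hermiteSet (hγ : γ ≤ 0) (hμ : 0 < μ.re) (hξ : IsComplexWhiteNoise P ξ)
    (hZ : IsStationarySolution χ γ μ P ξ Z) (hW : IsWickPowers P Z W) :
    (P.map W).support ⊆ closure (hermiteSet χ γ μ) := by
  have := χ.polishSpace_pathSpace hγ
  obtain ⟨φ, -, h⟩ := hW.exists_subseq hγ hZ.measurable (hZ.isOU hξ hμ)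
  refine Measure.support_subset_of_isClosed isClosed_closure ?_
  refine (ae_map_iff hW.measurable.aemeasurable isClosed_closure.measurableSet).2 ?_
  filter_upwards [h] with ω hω
  exact isClosed_closure.mem_of_tendsto hω (.of_forall fun j =>
    mem_closure_hermiteSet _ χ γ (φ j) (wickVar_nonneg hμ (ball (φ j)) 1))

lemma ae_mem_support (hγ : γ ≤ 0) (hWm : Measurable W) : ∀ᵐ ω ∂P, W ω ∈ (P.map W).support := by
  have := χ.polishSpace_pathSpace hγ
  exact ae_of_ae_map hWm.aemeasurable Measure.support_mem_ae

lemma forall_mem_support_of_ae (hγ : γ ≤ 0) (hWm : Measurable W) {F : χ.WickSpace γ → χ.WickSpace γ}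
    (hF : Continuous F) (h : ∀ᵐ ω ∂P, F (W ω) ∈ (P.map W).support) {w : χ.WickSpace γ}
    (hw : w ∈ (P.map W).support) : F w ∈ (P.map W).support := by
  have := χ.polishSpace_pathSpace hγ
  have hc : IsClosed (F ⁻¹' (P.map W).support) := Measure.isClosed_support.preimage hF
  exact Measure.support_subset_of_isClosed hc ((ae_map_iff hWm.aemeasurable hc.measurableSet).2 h) hw

/-- The support is invariant under translation by smooth paths of trigonometric polynomials. -/
lemma IsSmoothPath.translate_mem_support (hγ : γ ≤ 0) (hμ : 0 < μ.re) (hξ : IsComplexWhiteNoise P ξ)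
    (hZ : IsStationarySolution χ γ μ P ξ Z) (hW : IsWickPowers P Z W) {y : C(ℝ≥0, Mode → ℂ)}
    (hy : IsSmoothPath y) (r : ℕ) {w : χ.WickSpace γ} (hw : w ∈ (P.map W).support) :
    translate r (trigPath (ball r) y) w ∈ (P.map W).support := by
  have := χ.polishSpace_pathSpace hγ
  have := hξ.gaussian.isProbabilityMeasure
  refine forall_mem_support_of_ae hγ hW.measurable
    ((continuous_translate r).comp (Continuous.prodMk_right _)) ?_ hw
  set S := (P.map W).support
  let := TopologicalSpace.metrizableSpaceMetric (χ.WickSpace γ)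
  obtain ⟨φ, hφ, h⟩ := hW.exists_subseq hγ hZ.measurable (hZ.isOU hξ hμ)
  -- The Wick powers are not functions of an individual path, so membership of their limit in the
  -- support is rephrased through the approximations, as a measurable condition on the path alone. A
  -- condition of this form survives the absolutely continuous shift of the law.
  set A : Set (χ.PathSpace γ) := {z | Tendsto (fun j => Metric.infDist (wickSeq χ γ μ (φ j) (coeffPath z)) S)
    atTop (𝓝 0)}
  have hA : MeasurableSet A := measurableSet_tendsto _ fun j =>
    ((Metric.continuous_infDist_pt S).comp ((continuous_wickSeq _).comp continuous_coeffPath)).measurable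
  have hWS := ae_mem_support (P := P) hγ hW.measurable
  have hZA : ∀ᵐ z ∂P.map Z, z ∈ A := by
    refine (ae_map_iff hZ.measurable.aemeasurable hA).2 ?_
    filter_upwards [h, hWS] with ω h1 h2
    have h3 := ((Metric.continuous_infDist_pt S).tendsto _).comp h1
    rwa [Metric.infDist_zero_of_mem h2] at h3
  obtain ⟨g, hg⟩ := exists_forcing (μ := μ) hy (ball r)
  set H : χ.PathSpace γ := hermPath χ γ 1 0 r 0 (trigPath (ball r) y)
  have hH : ∀ t, (H t).coeff = fc (trigPath (ball r) y t) := fun t => by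
    rw [coeff_hermPath χ γ 1 0 r.cast_nonneg _ (trigSum_mem_Trig subset_rfl _)]
    simp [herm]
  have hac := hZ.absolutelyContinuous_map_add hγ hμ hξ g (h := H) fun t m => by
    rw [hH, ← hg t m, integral_kerL2_mul]
  have hZH := ae_of_ae_map (hZ.measurable.add_const H).aemeasurable (hac.ae_le hZA)
  filter_upwards [h, hZH, hWS] with ω h1 h2 h3
  have h4 := (((continuous_translate (χ := χ) (γ := γ) r).comp
    (Continuous.prodMk_right (trigPath (ball r) y))).tendsto _).comp h1
  have h5 : ∀ᶠ j in atTop, translate r (trigPath (ball r) y) (wickSeq χ γ μ (φ j) (coeffPath (Z ω))) =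
      wickSeq χ γ μ (φ j) (coeffPath (Z ω + H)) := by
    filter_upwards [hφ.tendsto_atTop.eventually_ge_atTop r] with j hj
    rw [translate_wickSeq hj]
    congr 1
    refine ContinuousMap.ext fun t => funext fun m => ?_
    show (Z ω t).coeff m + _ * y t m = (Z ω t).coeff m + (H t).coeff m
    rw [hH]
    show _ = _ + fc (trigSum (ball r) (y t)) m
    rw [trigSum, fc_sum_smul]
    congr 1
    by_cases hm : m ∈ ball (r : ℝ)
    · rw [if_pos hm, Set.indicator_of_mem (by exact_mod_cast hm), Pi.one_apply, one_mul]
    · rw [if_neg hm, Set.indicator_of_notMem (by exact_mod_cast hm), zero_mul]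
  have h6 := ((Metric.continuous_infDist_pt S).tendsto _).comp (h4.congr' h5)
  have h7 := tendsto_nhds_unique h6 h2
  have h8 : IsClosed S := Measure.isClosed_support
  rw [← h8.closure_eq]
  exact (Metric.mem_closure_iff_infDist_zero ⟨_, h3⟩).2 h7

/-- The support is invariant under translation by paths of trigonometric polynomials. -/
lemma translate_mem_support (hγ : γ ≤ 0) (hμ : 0 < μ.re) (hξ : IsComplexWhiteNoise P ξ)
    (hZ : IsStationarySolution χ γ μ P ξ Z) (hW : IsWickPowers P Z W) (y : C(ℝ≥0, Mode → ℂ)) (r : ℕ)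
    {w : χ.WickSpace γ} (hw : w ∈ (P.map W).support) :
    translate r (trigPath (ball r) y) w ∈ (P.map W).support := by
  obtain ⟨v, hv, hvy⟩ := exists_isSmoothPath_tendsto y
  have h := (((continuous_translate (χ := χ) (γ := γ) r).comp (Continuous.prodMk_left w)).tendsto _).comp
    (hvy (ball r))
  exact Measure.isClosed_support.mem_of_tendsto h
    (.of_forall fun i => (hv i).translate_mem_support hγ hμ hξ hZ hW r hw)

end Support

/-! ### The constant points of the support -/

section Weights

variable {μ : ℂ}

/-- Logarithmic divergence in two dimensions. Among the modes `(a, b)` with `0 ≤ b ≤ a` there are `a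
+ 1` for each `a`, with variance at least a constant times `(a + 1) ^ (-2)`, which leaves the
harmonic series. -/
lemma not_summable_ouVar (hμ : 0 < μ.re) : ¬ Summable (ouVar μ) := by
  intro h
  have hinj : Function.Injective fun p : (Σ a : ℕ, Fin (a + 1)) => (![(p.1 : ℤ), (p.2 : ℤ)] : Mode) := by
    rintro ⟨a, b⟩ ⟨a', b'⟩ hab
    have h0 : (a : ℤ) = a' := congrFun hab 0
    rw [Nat.cast_inj] at h0
    subst h0
    have h1 : (b : ℤ) = b' := congrFun hab 1
    have h2 : b = b' := Fin.ext (by exact_mod_cast h1)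
    rw [h2]
  have h1 := (h.comp_injective hinj).sigma
  have h2 : ∀ (a : ℕ) (b : Fin (a + 1)), (512 * μ.re * (a + 1 : ℝ) ^ 2)⁻¹ ≤
      ouVar μ (![(a : ℤ), (b : ℤ)] : Mode) := fun a b => by
    have e := eigenvalue_pos (![(a : ℤ), (b : ℤ)] : Mode)
    rw [ouVar]
    refine inv_anti₀ (by positivity) ?_
    have h3 : br (![(a : ℤ), (b : ℤ)] : Mode) ≤ 2 * (a + 1) := by
      rw [br, EuclideanSpace.norm_eq, Fin.sum_univ_two]
      have hb : ((b : ℕ) : ℝ) ≤ a := by exact_mod_cast Nat.lt_succ_iff.1 b.2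
      have h4 : √(‖(a : ℝ)‖ ^ 2 + ‖((b : ℕ) : ℝ)‖ ^ 2) ≤ 2 * a := by
        refine Real.sqrt_le_iff.2 ⟨by positivity, ?_⟩
        rw [Real.norm_natCast, Real.norm_natCast]
        nlinarith [(Nat.cast_nonneg (b : ℕ) : (0 : ℝ) ≤ (b : ℕ))]
      have h5 : √(‖freq ![(a : ℤ), (b : ℤ)] 0‖ ^ 2 + ‖freq ![(a : ℤ), (b : ℤ)] 1‖ ^ 2) ≤ 2 * a := by
        simpa [freq] using h4
      linarith
    have h6 := eigenvalue_le (![(a : ℤ), (b : ℤ)] : Mode)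
    have h7 := br_pos (![(a : ℤ), (b : ℤ)] : Mode)
    nlinarith [mul_le_mul_of_nonneg_left (h6.trans (mul_le_mul_of_nonneg_left
      (pow_le_pow_left₀ h7.le h3 2) (by norm_num : (0 : ℝ) ≤ 64))) (by positivity : 0 ≤ 2 * μ.re)]
  have h3 : Summable fun a : ℕ => (512 * μ.re)⁻¹ * (1 / ((a + 1 : ℕ) : ℝ)) := by
    refine Summable.of_nonneg_of_le (fun a => by positivity) (fun a => ?_) h1
    rw [tsum_fintype]
    refine le_trans (le_of_eq ?_) (Finset.sum_le_sum fun b _ => h2 a b)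
    rw [Finset.sum_const, Finset.card_univ, Fintype.card_fin, nsmul_eq_mul]
    push_cast
    field_simp
  have h4 := (summable_mul_left_iff (by positivity)).1 h3
  exact Real.not_summable_one_div_natCast ((summable_nat_add_iff 1).1 h4)

lemma wickVar_one (S : Finset Mode) : wickVar μ S 1 = ∑ m ∈ S, ouVar μ m :=
  Finset.sum_congr rfl fun m _ => by rw [Pi.one_apply, norm_one, one_pow, one_mul]

lemma monotone_wickVar (hμ : 0 < μ.re) : Monotone fun n : ℕ => wickVar μ (ball n) 1 := fun a b h =>
  Finset.sum_le_sum_of_subset_of_nonneg (ball_mono (by exact_mod_cast h)) fun m _ _ =>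
    mul_nonneg (by positivity) (ouVar_pos hμ m).le

lemma tendsto_wickVar (hμ : 0 < μ.re) : Tendsto (fun n : ℕ => wickVar μ (ball n) 1) atTop atTop := by
  refine tendsto_atTop_atTop_of_monotone (monotone_wickVar hμ) fun b => ?_
  by_contra! h
  refine not_summable_ouVar hμ (summable_of_sum_le (c := b) (fun m => (ouVar_pos hμ m).le) fun S => ?_)
  obtain ⟨n, hn⟩ := exists_nat_ge (∑ m ∈ S, ‖freq m‖)
  refine le_trans ?_ (h n).le
  rw [wickVar_one]
  exact Finset.sum_le_sum_of_subset_of_nonneg (fun m hm => mem_ball.2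
    ((Finset.single_le_sum (f := fun m => ‖freq m‖) (fun _ _ => norm_nonneg _) hm).trans hn))
    fun m _ _ => (ouVar_pos hμ m).le

/-- Weights that remove the low modes and lower the variance by `R`. -/
lemma exists_weight (hμ : 0 < μ.re) {R : ℝ} (hR : 0 ≤ R) : ∃ n₁ : ℕ, ∀ n ≥ n₁, ∃ (r : ℕ) (θ : Mode → ℂ),
    (∀ m, ‖θ m‖ ≤ 2) ∧ (∀ m ∈ ball (n : ℝ), θ m = 0) ∧ (∀ m ∉ ball (r : ℝ), θ m = 1) ∧
      ∀ N ≥ r, wickVar μ (ball N) 1 = wickVar μ (ball N) θ + R := by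
  obtain ⟨n₁, h₁⟩ := eventually_atTop.1 ((tendsto_wickVar hμ).eventually_ge_atTop R)
  refine ⟨n₁, fun n hn => ?_⟩
  set v : ℕ → ℝ := fun n => wickVar μ (ball n) 1 with hv
  obtain ⟨r, hnr, hr⟩ := (((tendsto_wickVar hμ).eventually_ge_atTop (2 * v n + 1)).and
    (eventually_ge_atTop n)).exists.imp fun _ h => h.symm
  have hRn : R ≤ v n := h₁ n hn
  have hr' : 2 * v n + 1 ≤ v r := hr
  -- Deleting the modes up to `n` removes the variance `v n`; multiplying the variance of the shell
  -- up to `r` by `1 + ρ` gives back `v n - R`, for a net loss of `R`. The choice `v r ≥ 2 * v n +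
  -- 1` makes `ρ ≤ 1`, which keeps the weights below `2`.
  set ρ := (v n - R) / (v r - v n)
  have hd : 0 < v r - v n := by linarith
  have hρ : 0 ≤ ρ := div_nonneg (by linarith) hd.le
  have hρ1 : ρ ≤ 1 := (div_le_one hd).2 (by linarith)
  have hnr' : ball (n : ℝ) ⊆ ball r := ball_mono (by exact_mod_cast hnr)
  refine ⟨r, fun m => if m ∈ ball (n : ℝ) then 0 else if m ∈ ball (r : ℝ) then (√(1 + ρ) : ℝ) else 1,
    fun m => ?_, fun m hm => if_pos hm, fun m hm => ?_, fun N hN => ?_⟩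
  · beta_reduce
    split_ifs
    · simp
    · rw [Complex.norm_real, Real.norm_of_nonneg (Real.sqrt_nonneg _)]
      exact Real.sqrt_le_iff.2 ⟨by norm_num, by linarith⟩
    · simp
  · exact (if_neg fun h => hm (hnr' h)).trans (if_neg hm)
  · have hrN : ball (r : ℝ) ⊆ ball N := ball_mono (by exact_mod_cast hN)
    have h2 : ∀ m, ‖(if m ∈ ball (n : ℝ) then 0 else if m ∈ ball (r : ℝ) then ((√(1 + ρ) : ℝ) : ℂ) else 1)‖ ^ 2 *
        ouVar μ m = ouVar μ m + ρ * (if m ∈ ball (r : ℝ) then ouVar μ m else 0) -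
          (1 + ρ) * (if m ∈ ball (n : ℝ) then ouVar μ m else 0) := fun m => by
      by_cases h3 : m ∈ ball (n : ℝ)
      · simp only [if_pos h3, if_pos (hnr' h3), norm_zero]; ring
      · by_cases h4 : m ∈ ball (r : ℝ)
        · simp only [if_neg h3, if_pos h4, Complex.norm_real, Real.norm_of_nonneg (Real.sqrt_nonneg _),
            Real.sq_sqrt (by linarith : 0 ≤ 1 + ρ)]
          ring
        · simp [if_neg h3, if_neg h4]
    have h5 : ρ * (v r - v n) = v n - R := div_mul_cancel₀ _ hd.ne'
    simp only [hv, wickVar_one] at h5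
    rw [wickVar_one, wickVar, Finset.sum_congr rfl fun m _ => h2 m, Finset.sum_sub_distrib,
      Finset.sum_add_distrib, ← Finset.mul_sum, ← Finset.mul_sum, Finset.sum_ite_mem, Finset.sum_ite_mem,
      Finset.inter_eq_right.2 hrN, Finset.inter_eq_right.2 (hnr'.trans hrN)]
    linarith

end Weights

/-! ### Reweighting the modes as a translation, and the excess variance `R`. -/

section Expansion

variable {χ : DyadicPartition} {γ : ℝ} {μ : ℂ}

lemma hermPath_wickVar_add (k l N : ℕ) (θ : Mode → ℂ) (R : ℂ) (x : C(ℝ≥0, Mode → ℂ)) :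
    hermPath χ γ k l N (wickVar μ (ball N) θ + R) (trigPath (ball N) (scalePath θ x)) =
      ∑ m ∈ Finset.range (min k l + 1), ((m.factorial : ℂ) * (k.choose m : ℂ) * (l.choose m : ℂ) *
        (-R) ^ m) • wickPath χ γ μ (k - m) (l - m) N θ x := by
  refine ContinuousMap.ext fun t => DyadicPartition.HolderBesov.coeff_injective ?_
  rw [coeff_hermPath χ γ k l N.cast_nonneg _ (trigSum_mem_Trig subset_rfl _), herm_add_right,
    ContinuousMap.sum_apply, DyadicPartition.HolderBesov.coeff_sum, map_sum]
  refine Finset.sum_congr rfl fun m _ => ?_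
  rw [ContinuousMap.smul_apply, DyadicPartition.HolderBesov.coeff_smul, map_smul, coeff_wickPath]
  rfl

/-- Weight zero produces the constant family. Written this way it has the same expansion as the
reweighted field, and the two can be subtracted term by term, including the terms of order `(0, 0)`.
-/
lemma hermPath_zero_eq (k l N : ℕ) (R : ℂ) (x : C(ℝ≥0, Mode → ℂ)) :
    hermPath χ γ k l (0 : ℝ) R 0 =
      hermPath χ γ k l N (wickVar μ (ball N) 0 + R) (trigPath (ball N) (scalePath 0 x)) := by
  refine ContinuousMap.ext fun t => DyadicPartition.HolderBesov.coeff_injective ?_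
  rw [coeff_hermPath χ γ k l N.cast_nonneg _ (trigSum_mem_Trig subset_rfl _),
    coeff_hermPath χ γ k l le_rfl _ (Submodule.zero_mem _)]
  have h1 : trigPath (ball N) (scalePath 0 x) t = 0 := by
    show trigSum (ball N) (0 * x t) = 0
    rw [zero_mul]
    exact Finset.sum_eq_zero fun m _ => zero_smul ℂ (UnitAddTorus.mFourier m)
  have h2 : wickVar μ (ball N) 0 = 0 := Finset.sum_eq_zero fun m _ => by simp
  rw [h1, h2, Complex.ofReal_zero, zero_add]
  rfl

/-- Multiplying the modes by `θ` adds `(θ - 1) x`, which lives on the modes up to `r` because `θ =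
1` beyond. The renormalization constant stays that of the full field, so it exceeds the variance of
the reweighted field by `R`. -/
lemma translate_wickSeq_eq {r N : ℕ} (h : r ≤ N) {θ : Mode → ℂ} (hθ : ∀ m ∉ ball (r : ℝ), θ m = 1) {R : ℝ}
    (hR : wickVar μ (ball N) 1 = wickVar μ (ball N) θ + R) (x : C(ℝ≥0, Mode → ℂ)) (k l : ℕ) :
    translate r (trigPath (ball r) (scalePath (θ - 1) x)) (wickSeq χ γ μ N x) k l =
      hermPath χ γ k l N (wickVar μ (ball N) θ + R) (trigPath (ball N) (scalePath θ x)) := by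
  have h1 : x + scalePath (Set.indicator (↑(ball r)) 1) (scalePath (θ - 1) x) = scalePath θ x := by
    refine ContinuousMap.ext fun t => funext fun m => ?_
    show x t m + (Set.indicator (↑(ball r)) 1 : Mode → ℂ) m * ((θ m - 1) * x t m) = θ m * x t m
    by_cases hm : m ∈ ball (r : ℝ)
    · rw [Set.indicator_of_mem (by exact_mod_cast hm), Pi.one_apply]
      ring
    · rw [Set.indicator_of_notMem (by exact_mod_cast hm), hθ m hm]
      ring
  rw [translate_wickSeq h, h1, wickSeq, wickPath, hR, Complex.ofReal_add]
  congr 2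
  refine ContinuousMap.ext fun t => ?_
  show (1 : Mode → ℂ) * (θ * x t) = θ * x t
  rw [one_mul]

end Expansion

lemma pathSup_sum_smul_le {E ι : Type*} [NormedAddCommGroup E] [NormedSpace ℂ E] (T : ℝ≥0) (S : Finset ι)
    (c : ι → ℂ) (f : ι → C(ℝ≥0, E)) : pathSup T (∑ i ∈ S, c i • f i) ≤ ∑ i ∈ S, ‖c i‖ₑ * pathSup T (f i) := by
  refine iSup₂_le fun t ht => ?_
  rw [ContinuousMap.sum_apply]
  refine (enorm_sum_le _ _).trans (Finset.sum_le_sum fun i _ => ?_)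
  rw [ContinuousMap.smul_apply, enorm_smul]
  exact mul_le_mul_right (enorm_le_pathSup ht _) _

variable {χ : DyadicPartition} {α : ℝ} {μ : ℂ} {Ω : Type*} [MeasurableSpace Ω] {P : Measure Ω}
  {ξ : SpaceTimeL2 → Ω → ℂ} {Z : Ω → χ.PathSpace (-α)} {W : Ω → χ.WickSpace (-α)}

/-- The translation that multiplies the modes of the underlying path by `θ`. -/
def rescale {γ : ℝ} (r : ℕ) (θ : Mode → ℂ) (z : χ.PathSpace γ) (w : χ.WickSpace γ) : χ.WickSpace γ :=
  translate r (trigPath (ball r) (scalePath (θ - 1) (coeffPath z))) w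

lemma continuous_rescale {γ : ℝ} (r : ℕ) (θ : Mode → ℂ) :
    Continuous fun p : χ.PathSpace γ × χ.WickSpace γ => rescale r θ p.1 p.2 := by
  have h1 : Continuous fun z : χ.PathSpace γ => trigPath (ball r) (scalePath (θ - 1) (coeffPath z)) :=
    (continuous_trigPath _).comp ((continuous_scalePath _).comp continuous_coeffPath)
  have h2 : Continuous fun p : χ.PathSpace γ × χ.WickSpace γ =>
      (trigPath (ball r) (scalePath (θ - 1) (coeffPath p.1)), p.2) :=
    (h1.comp continuous_fst).prodMk continuous_snd
  have h3 := (continuous_translate (χ := χ) (γ := γ) r).comp h2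
  exact h3

lemma continuous_wickSpace_apply {γ : ℝ} (k l : ℕ) : Continuous fun w : χ.WickSpace γ => w k l :=
  (continuous_apply l).comp (continuous_apply k)

lemma rescale_wickSeq_sub {γ : ℝ} {r N : ℕ} (h : r ≤ N) {θ : Mode → ℂ} (hθ : ∀ m ∉ ball (r : ℝ), θ m = 1)
    {R : ℝ} (hR : wickVar μ (ball N) 1 = wickVar μ (ball N) θ + R) (z : χ.PathSpace γ) (k l : ℕ) :
    rescale r θ z (wickSeq χ γ μ N (coeffPath z)) k l - hermPath χ γ k l (0 : ℝ) R 0 =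
      ∑ m ∈ Finset.range (min k l + 1), ((m.factorial : ℂ) * (k.choose m : ℂ) * (l.choose m : ℂ) *
        (-R) ^ m) • (wickPath χ γ μ (k - m) (l - m) N θ (coeffPath z) -
          wickPath χ γ μ (k - m) (l - m) N 0 (coeffPath z)) := by
  rw [rescale, translate_wickSeq_eq h hθ hR, hermPath_zero_eq (μ := μ) k l N R (coeffPath z),
    hermPath_wickVar_add, hermPath_wickVar_add, ← Finset.sum_sub_distrib]
  exact Finset.sum_congr rfl fun m _ => (smul_sub _ _ _).symm

lemma continuous_rescale_apply {γ : ℝ} (r : ℕ) (θ : Mode → ℂ) (k l : ℕ) :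
    Continuous fun p : χ.PathSpace γ × χ.WickSpace γ => rescale r θ p.1 p.2 k l := by
  have h := (continuous_wickSpace_apply k l).comp (continuous_rescale (χ := χ) (γ := γ) r θ)
  exact h

lemma continuous_rescale_wickSeq {γ : ℝ} (r : ℕ) (θ : Mode → ℂ) (k l N : ℕ) :
    Continuous fun z : χ.PathSpace γ => rescale r θ z (wickSeq χ γ μ N (coeffPath z)) k l := by
  have h2 : Continuous fun z : χ.PathSpace γ => (z, wickSeq χ γ μ N (coeffPath z)) :=
    continuous_id.prodMk ((continuous_wickSeq N).comp continuous_coeffPath)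
  have h := (continuous_rescale_apply r θ k l).comp h2
  exact h

lemma tendsto_rescale_apply {γ : ℝ} (r : ℕ) (θ : Mode → ℂ) (k l : ℕ) (z : χ.PathSpace γ)
    {v : ℕ → χ.WickSpace γ} {w : χ.WickSpace γ} (h : Tendsto v atTop (𝓝 w)) :
    Tendsto (fun j => rescale r θ z (v j) k l) atTop (𝓝 (rescale r θ z w k l)) := by
  have h2 := ((continuous_rescale_apply r θ k l).tendsto (z, w)).comp (tendsto_const_nhds.prodMk_nhds h)
  exact h2

attribute [irreducible] rescale

/-- The weights vanish on low modes and are bounded by `2`, so they tend to `0` relative to any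
growth `br m ^ (κ / 2)`. Continuity of Wick powers in the weight then replaces the reweighted field
by the field of weight zero, with the excess variance `R` left over. -/
lemma exists_tendsto_rescale (hα : 0 < α) (hα1 : α ≤ 1) (hμ : 0 < μ.re) (hZm : Measurable Z)
    (hZ : IsOU μ P fun t m ω => (Z ω t).coeff m) (hW : IsWickPowers P Z W) {R : ℝ} (hR : 0 ≤ R) :
    ∃ (r : ℕ → ℕ) (θ : ℕ → Mode → ℂ), ∀ k l T : ℕ, Tendsto (fun n => ∫⁻ ω, pathSup T
      (rescale (r n) (θ n) (Z ω) (W ω) k l - hermPath χ (-α) k l (0 : ℝ) R 0) ∂P) atTop (𝓝 0) := by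
  have hγ : -α ≤ 0 := by linarith
  have := χ.polishSpace_pathSpace hγ
  obtain ⟨n₁, h⟩ := exists_weight hμ hR
  choose r θ h1 h2 h3 h4 using fun n => h (n + n₁) (by omega)
  refine ⟨r, θ, fun k l T => ?_⟩
  obtain ⟨φ, hφ, hlim⟩ := hW.exists_subseq hγ hZm hZ
  have hx : ∀ t m, Measurable fun ω => coeffPath (Z ω) t m := fun t m => by
    have h : Continuous fun z : χ.PathSpace (-α) => coeffPath z t m :=
      ((continuous_apply m).comp (continuous_eval_const t)).comp continuous_coeffPath
    exact h.measurable.comp hZm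
  choose κ hκ a ha hb using fun m => IsOU.exists_lintegral_wickPath_sub_le hμ
    (x := fun ω => coeffPath (Z ω)) hZ hx χ hα hα1 (k - m) (l - m) one_pos T
  -- The factor `2` is the uniform bound on the weights; the rest is the gain from deleting all
  -- modes up to `n + n₁`. The exponent depends on the order of the Wick power, hence on `m`.
  set ρ : ℕ → ℕ → ℝ := fun m n => 2 * (1 + (n + n₁ : ℕ) : ℝ) ^ (-(κ m / 2)) with hρ
  have hρ0 : ∀ m, Tendsto (ρ m) atTop (𝓝 0) := fun m => by
    have h5 := ((tendsto_one_add_rpow (hκ m)).comp (tendsto_add_atTop_nat n₁)).const_mul 2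
    rwa [mul_zero] at h5
  have hρ1 : ∀ᶠ n in atTop, ∀ m ∈ Finset.range (min k l + 1), ρ m n ≤ 1 :=
    (Filter.eventually_all_finset _).2 fun m _ => ((hρ0 m).eventually_lt_const one_pos).mono fun _ h => h.le
  set c : ℕ → ℂ := fun m => (m.factorial : ℂ) * (k.choose m : ℂ) * (l.choose m : ℂ) * (-R) ^ m
  have hB : Tendsto (fun n => ∑ m ∈ Finset.range (min k l + 1), ‖c m‖ₑ * a m (ρ m n)) atTop (𝓝 0) := by
    rw [← Finset.sum_const_zero (s := Finset.range (min k l + 1)) (M := ℝ≥0∞)]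
    refine tendsto_finsetSum _ fun m _ => ?_
    rw [← mul_zero ‖c m‖ₑ]
    exact ENNReal.Tendsto.const_mul ((ha m).comp (hρ0 m)) (.inr enorm_ne_top)
  refine tendsto_of_tendsto_of_tendsto_of_le_of_le' tendsto_const_nhds hB (.of_forall fun _ => zero_le)
    (hρ1.mono fun n hn => ?_)
  have hcont : ∀ N, Measurable fun ω => rescale (r n) (θ n) (Z ω)
      (wickSeq χ (-α) μ N (coeffPath (Z ω))) k l := fun N => by
    have h := (continuous_rescale_wickSeq (χ := χ) (γ := -α) (μ := μ) (r n) (θ n) k l N).measurable.comp hZm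
    exact h
  have hlim' : ∀ᵐ ω ∂P, Tendsto (fun j => rescale (r n) (θ n) (Z ω)
      (wickSeq χ (-α) μ (φ j) (coeffPath (Z ω))) k l) atTop (𝓝 (rescale (r n) (θ n) (Z ω) (W ω) k l)) :=
    hlim.mono fun ω hω => tendsto_rescale_apply (r n) (θ n) k l (Z ω) hω
  have hm : ∀ (i j N : ℕ) (ϑ : Mode → ℂ), Measurable fun ω => wickPath χ (-α) μ i j N ϑ (coeffPath (Z ω)) :=
    fun i j N ϑ => ((continuous_wickPath i j N ϑ).comp continuous_coeffPath).measurable.comp hZm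
  have key := lintegral_pathSup_sub_le (P := P) (n := r n) (p := 1)
    hcont (measurable_const (a := hermPath χ (-α) k l (0 : ℝ) R 0)) hφ hlim'
    (T : ℝ≥0) zero_le_one (c := ∑ m ∈ Finset.range (min k l + 1), ‖c m‖ₑ * a m (ρ m n)) fun N hN => by
      simp only [ENNReal.rpow_one]
      calc _ ≤ ∫⁻ ω, ∑ m ∈ Finset.range (min k l + 1), ‖c m‖ₑ * pathSup T
              (wickPath χ (-α) μ (k - m) (l - m) N (θ n) (coeffPath (Z ω)) -
                wickPath χ (-α) μ (k - m) (l - m) N 0 (coeffPath (Z ω))) ∂P := by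
            refine lintegral_mono fun ω => ?_
            rw [rescale_wickSeq_sub hN (h3 n) (h4 n N hN)]
            exact pathSup_sum_smul_le _ _ _ _
        _ = ∑ m ∈ Finset.range (min k l + 1), ‖c m‖ₑ * ∫⁻ ω, pathSup T
              (wickPath χ (-α) μ (k - m) (l - m) N (θ n) (coeffPath (Z ω)) -
                wickPath χ (-α) μ (k - m) (l - m) N 0 (coeffPath (Z ω))) ∂P := by
            have hmm : ∀ m, Measurable fun ω => pathSup T
                (wickPath χ (-α) μ (k - m) (l - m) N (θ n) (coeffPath (Z ω)) -
                wickPath χ (-α) μ (k - m) (l - m) N 0 (coeffPath (Z ω))) := fun m =>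
              (measurable_pathSup _).comp ((hm _ _ _ _).sub (hm _ _ _ _))
            rw [lintegral_finsetSum _ fun m _ => (hmm m).const_mul _]
            exact Finset.sum_congr rfl fun m _ => lintegral_const_mul _ (hmm m)
        _ ≤ _ := by
            refine Finset.sum_le_sum fun m hmr => mul_le_mul_right ?_ _
            simp only [ENNReal.rpow_one] at hb
            refine hb m N (θ n) 0 (ρ m n) (by positivity) (hn m hmr) (h1 n) (fun m => by simp) fun q => ?_
            rw [Pi.zero_apply, sub_zero]
            by_cases hq : q ∈ ball ((n + n₁ : ℕ) : ℝ)
            · rw [h2 n q hq, norm_zero]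
              have := br_pos q
              positivity
            · have h5 := one_sub_indicator_le (hκ m) (n + n₁) q
              rw [Set.indicator_of_notMem (by exact_mod_cast hq), Pi.one_apply, sub_zero, norm_one] at h5
              rw [hρ, mul_assoc]
              linarith [h1 n q]
  simpa only [ENNReal.rpow_one] using key

/-- The translating path is built from `Z` itself and hence random, so Cameron–Martin does not apply
to it directly. But invariance of the support holds for every deterministic path, so it suffices to
fix one outcome for which `W` lies in the support and the rescaled Wick powers converge. -/
theorem hermPath_zero_mem_support (hα : 0 < α) (hα1 : α ≤ 1) (hμ : 0 < μ.re) (hξ : IsComplexWhiteNoise P ξ)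
    (hZ : IsStationarySolution χ (-α) μ P ξ Z) (hW : IsWickPowers P Z W) {R : ℝ} (hR : 0 ≤ R) :
    (fun k l => hermPath χ (-α) k l (0 : ℝ) R 0) ∈ (P.map W).support := by
  have hγ : -α ≤ 0 := by linarith
  have := χ.polishSpace_pathSpace hγ
  have := hξ.gaussian.isProbabilityMeasure
  obtain ⟨r, θ, h⟩ := exists_tendsto_rescale hα hα1 hμ hZ.measurable (hZ.isOU hξ hμ) hW hR
  obtain ⟨φ, -, hlim⟩ := exists_subseq_ae_tsum (P := P) (D := fun i n ω => pathSup (i.unpair.2.unpair.2 : ℕ)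
    (rescale (r n) (θ n) (Z ω) (W ω) i.unpair.1 i.unpair.2.unpair.1 -
      hermPath χ (-α) i.unpair.1 i.unpair.2.unpair.1 (0 : ℝ) R 0)) (fun i n => by
        refine ((measurable_pathSup _).comp (Measurable.sub ?_ measurable_const)).aemeasurable
        have h2 := (continuous_rescale_apply (χ := χ) (γ := -α) (r n) (θ n) i.unpair.1
          i.unpair.2.unpair.1).measurable.comp (hZ.measurable.prodMk hW.measurable)
        exact h2)
    fun i => h _ _ _
  obtain ⟨ω, h1, h2⟩ := (hlim.and (ae_mem_support (P := P) hγ hW.measurable)).exists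
  refine Measure.isClosed_support.mem_of_tendsto (f := fun j => rescale (r (φ j)) (θ (φ j)) (Z ω) (W ω))
    (b := atTop) (tendsto_pi_nhds.2 fun k => tendsto_pi_nhds.2 fun l => ?_)
    (.of_forall fun j => by
      rw [rescale]
      exact translate_mem_support hγ hμ hξ hZ hW _ _ h2)
  refine tendsto_iff_pathSup.2 fun T => ?_
  have h3 := h1 (Nat.pair k (Nat.pair l T))
  simp only [Nat.unpair_pair] at h3
  refine h3.congr fun j => iSup_congr fun t => iSup_congr fun _ => ?_
  rw [ContinuousMap.sub_apply, ContinuousMap.sub_apply, ← enorm_neg, neg_sub]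

/-- The Hermite polynomials of a path of trigonometric polynomials lie in the support. -/
theorem hermPath_mem_support (hα : 0 < α) (hα1 : α ≤ 1) (hμ : 0 < μ.re) (hξ : IsComplexWhiteNoise P ξ)
    (hZ : IsStationarySolution χ (-α) μ P ξ Z) (hW : IsWickPowers P Z W) {R : ℝ} (hR : 0 ≤ R)
    (n : ℕ) (x : C(ℝ≥0, Mode → ℂ)) :
    (fun k l => hermPath χ (-α) k l n R (trigPath (ball n) x)) ∈ (P.map W).support := by
  rw [hermPath_eq_translate]
  exact translate_mem_support (by linarith) hμ hξ hZ hW x n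
    (hermPath_zero_mem_support hα hα1 hμ hξ hZ hW hR)

/-! ### Powers of trigonometric polynomials with coefficients in `H¹` -/

section Monomials

variable {ι : Type} {k l : ℕ}

lemma trigPoly_pow_mul [Fintype ι] (mode : ι → Mode) (a : ι → ℂ) : trigPoly mode a ^ k * star (trigPoly mode a) ^ l =
    ∑ p : (Fin k → ι) × (Fin l → ι), chaosCoeff a p • UnitAddTorus.mFourier (totalMode mode p) := by
  ext x
  rw [ContinuousMap.mul_apply, ContinuousMap.pow_apply, ContinuousMap.pow_apply, ContinuousMap.star_apply,
    trigPoly_apply, star_sum, Fintype.sum_pow, Fintype.sum_pow, Finset.sum_mul_sum,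
    ContinuousMap.sum_apply, Fintype.sum_prod_type]
  refine Finset.sum_congr rfl fun I _ => Finset.sum_congr rfl fun J _ => ?_
  rw [ContinuousMap.smul_apply, mFourier_totalMode, smul_eq_mul, chaosCoeff]
  simp only [star_mul', Finset.prod_mul_distrib, RCLike.star_def]
  ring

lemma sum_prod_mul_prod [Fintype ι] (v : ι → ℝ) : ∑ p : (Fin k → ι) × (Fin l → ι),
    (∏ i, v (p.1 i)) * ∏ j, v (p.2 j) = (∑ i, v i) ^ (k + l) := by
  rw [Fintype.sum_prod_type, pow_add, Fintype.sum_pow, Fintype.sum_pow, Finset.sum_mul_sum]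

/-- The weight of a chaos component in `H¹`. -/
def brProd (mode : ι → Mode) (p : (Fin k → ι) × (Fin l → ι)) : ℝ :=
  (∏ i, br (mode (p.1 i))) * ∏ j, br (mode (p.2 j))

lemma brProd_pos (mode : ι → Mode) (p : (Fin k → ι) × (Fin l → ι)) : 0 < brProd mode p :=
  mul_pos (Finset.prod_pos fun _ _ => br_pos _) (Finset.prod_pos fun _ _ => br_pos _)

/-- Cauchy–Schwarz against the lattice sum of the chaos estimates with `κ = 0`: the bound for
variances of Gaussian chaos is also the bound for products of `H¹` functions. -/
lemma exists_sum_br_mul_le (k l : ℕ) {α : ℝ} (hα : 0 < α) (hα1 : α ≤ 1) : ∃ C : ℝ, 0 ≤ C ∧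
    ∀ (ι : Type) [Fintype ι] (mode : ι → Mode), AtMostTwo mode →
      ∀ d : (Fin k → ι) × (Fin l → ι) → ℂ, ∑ p, br (totalMode mode p) ^ (-α) * ‖d p‖ ≤
        C * √(∑ p, (‖d p‖ * brProd mode p) ^ 2) := by
  obtain ⟨κ₀, C, hκ₀, -, hC, h⟩ := sum_br_totalMode_le k l hα hα1
  refine ⟨√C, Real.sqrt_nonneg _, fun ι _ mode hm d => ?_⟩
  calc ∑ p, br (totalMode mode p) ^ (-α) * ‖d p‖ =
        ∑ p, (br (totalMode mode p) ^ (-α) * (brProd mode p)⁻¹) * (‖d p‖ * brProd mode p) := by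
        refine Finset.sum_congr rfl fun p _ => ?_
        have := (brProd_pos mode p).ne'
        field_simp
    _ ≤ √(∑ p : (Fin k → ι) × (Fin l → ι), (br (totalMode mode p) ^ (-α) * (brProd mode p)⁻¹) ^ 2) *
        √(∑ p, (‖d p‖ * brProd mode p) ^ 2) := Real.sum_mul_le_sqrt_mul_sqrt _ _ _
    _ ≤ _ := by
        refine mul_le_mul_of_nonneg_right (Real.sqrt_le_sqrt ?_) (Real.sqrt_nonneg _)
        refine le_trans (le_of_eq (Finset.sum_congr rfl fun p _ => ?_)) (h ι mode hm 0 hκ₀.le)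
        have h2 : ∀ m, br m ^ (-2 + 0 : ℝ) = (br m ^ 2)⁻¹ := fun m => by
          rw [add_zero, Real.rpow_neg (br_pos m).le, ← Real.rpow_natCast]
          norm_num
        simp only [h2, Finset.prod_inv_distrib, Finset.prod_pow]
        rw [mul_pow, ← Real.rpow_natCast (_ ^ _), ← Real.rpow_mul (br_pos _).le, inv_pow, brProd, mul_pow,
          mul_inv]
        congr 2
        push_cast
        ring

lemma norm_chaosCoeff_mul_brProd_sq (mode : ι → Mode) (a : ι → ℂ) (p : (Fin k → ι) × (Fin l → ι)) :
    (‖chaosCoeff a p‖ * brProd mode p) ^ 2 =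
      (∏ i, (‖a (p.1 i)‖ * br (mode (p.1 i))) ^ 2) * ∏ j, (‖a (p.2 j)‖ * br (mode (p.2 j))) ^ 2 := by
  simp only [chaosCoeff, brProd, norm_mul, norm_prod, RCLike.norm_conj, Finset.prod_pow,
    Finset.prod_mul_distrib]
  ring

/-- If all modes lie in `B` the coefficients agree; otherwise the truncated one vanishes. In both
cases the right side is a difference of products, and its sum over all components is a difference of
powers of partial sums. -/
lemma chaosCoeff_sub_indicator_sq_le (mode : ι → Mode) {a : ι → ℂ} {v : ι → ℝ}
    (h : ∀ i, (‖a i‖ * br (mode i)) ^ 2 ≤ v i) (B : Set ι) (p : (Fin k → ι) × (Fin l → ι)) :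
    (‖chaosCoeff a p - chaosCoeff (B.indicator a) p‖ * brProd mode p) ^ 2 ≤
      (∏ i, v (p.1 i)) * (∏ j, v (p.2 j)) -
        (∏ i, B.indicator v (p.1 i)) * ∏ j, B.indicator v (p.2 j) := by
  by_cases hp : (∀ i, p.1 i ∈ B) ∧ ∀ j, p.2 j ∈ B
  · simp [chaosCoeff, Set.indicator_of_mem (hp.1 _), Set.indicator_of_mem (hp.2 _)]
  · have h0 : ∀ {M : Type} [CommMonoidWithZero M] (u u' : ι → M) (_ : ∀ i ∉ B, u i = 0)
        (_ : ∀ i ∉ B, u' i = 0), (∏ i, u (p.1 i)) * ∏ j, u' (p.2 j) = 0 := by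
      intro M _ u u' hu hu'
      rcases not_and_or.1 hp with hp | hp
      · obtain ⟨i, hi⟩ := not_forall.1 hp
        rw [Finset.prod_eq_zero (Finset.mem_univ i) (hu _ hi), zero_mul]
      · obtain ⟨i, hi⟩ := not_forall.1 hp
        rw [Finset.prod_eq_zero (Finset.mem_univ i) (hu' _ hi), mul_zero]
    have h1 : chaosCoeff (B.indicator a) p = 0 := h0 (B.indicator a) (fun i => conj (B.indicator a i))
      (fun i hi => Set.indicator_of_notMem hi _)
      (fun i hi => by rw [Set.indicator_of_notMem hi, map_zero])
    rw [h1, h0 (B.indicator v) (B.indicator v) (fun i hi => Set.indicator_of_notMem hi _)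
      (fun i hi => Set.indicator_of_notMem hi _), sub_zero, sub_zero, norm_chaosCoeff_mul_brProd_sq]
    exact mul_le_mul (Finset.prod_le_prod (fun _ _ => sq_nonneg _) fun i _ => h _)
      (Finset.prod_le_prod (fun _ _ => sq_nonneg _) fun i _ => h _)
      (Finset.prod_nonneg fun _ _ => sq_nonneg _)
      (Finset.prod_nonneg fun _ _ => (sq_nonneg _).trans (h _))

lemma norm_weightedBlocks_mFourier_le (χ : DyadicPartition) {α : ℝ} (hα : 0 < α) (j : ℕ) (q : Mode) :
    ‖χ.weightedBlocks (-α) (fc (UnitAddTorus.mFourier q)) j‖ ≤ 6 ^ α * br q ^ (-α) := by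
  have hb := br_pos q
  have h1 : χ.block j (fc (UnitAddTorus.mFourier q)) = (χ.mult j q : ℂ) • UnitAddTorus.mFourier q :=
    blockFun_mFourier χ j q
  rw [χ.norm_weightedBlocks, h1, norm_smul, UnitAddTorus.mFourier_norm, mul_one, Complex.norm_real,
    Real.norm_of_nonneg (χ.mult_mem j q).1]
  by_cases h0 : χ.mult j q = 0
  · rw [h0, mul_zero]
    positivity
  · have h2 := χ.br_le_of_mult_ne_zero h0
    calc (2 : ℝ) ^ (-α * ((j : ℝ) - 1)) * χ.mult j q ≤ (2 : ℝ) ^ (-α * ((j : ℝ) - 1)) * 1 := by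
          gcongr
          exact (χ.mult_mem j q).2
      _ = (2 ^ j / 2) ^ (-α) := by
          rw [mul_one, mul_comm, Real.rpow_mul zero_le_two, Real.rpow_sub_one two_ne_zero, Real.rpow_natCast]
      _ ≤ (br q / 6) ^ (-α) :=
          Real.rpow_le_rpow_of_nonpos (by positivity) (by linarith) (by linarith)
      _ = _ := by
          rw [Real.div_rpow hb.le (by norm_num), Real.rpow_neg (by norm_num : (0 : ℝ) ≤ 6), div_inv_eq_mul,
            mul_comm]

end Monomials

lemma atMostTwo_val (S : Finset Mode) : AtMostTwo (Subtype.val : S → Mode) := by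
  intro m
  refine (Finset.card_le_one.2 fun a ha b hb => Subtype.ext ?_).trans one_le_two
  rw [(Finset.mem_filter.1 ha).2, (Finset.mem_filter.1 hb).2]

lemma trigSum_eq_trigPoly (S : Finset Mode) (b : Mode → ℂ) :
    trigSum S b = trigPoly (Subtype.val : S → Mode) fun i => b i :=
  (Finset.sum_coe_sort S fun m => b m • UnitAddTorus.mFourier m).symm

/-- Bound of the Besov norm of the difference of the powers of two partial Fourier sums. -/
lemma exists_norm_weightedBlocks_trigSum_sub_le (χ : DyadicPartition) {α : ℝ} (hα : 0 < α) (hα1 : α ≤ 1)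
    (k l : ℕ) : ∃ C : ℝ, 0 ≤ C ∧ ∀ (b : Mode → ℂ) (v : Mode → ℝ), (∀ m, (‖b m‖ * br m) ^ 2 ≤ v m) →
      ∀ n N : ℕ, n ≤ N → ∀ j, ‖χ.weightedBlocks (-α)
        (fc (trigSum (ball N) b ^ k * star (trigSum (ball N) b) ^ l -
          trigSum (ball n) b ^ k * star (trigSum (ball n) b) ^ l)) j‖ ≤
        C * √((∑ m ∈ ball N, v m) ^ (k + l) - (∑ m ∈ ball n, v m) ^ (k + l)) := by
  obtain ⟨C, hC, h⟩ := exists_sum_br_mul_le k l hα hα1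
  refine ⟨6 ^ α * C, by positivity, fun b v hv n N hnN j => ?_⟩
  set mode : ball (N : ℝ) → Mode := Subtype.val
  set B : Set (ball (N : ℝ)) := {i | (i : Mode) ∈ ball (n : ℝ)}
  set a : ball (N : ℝ) → ℂ := fun i => b i
  have hB : trigSum (ball n) b = trigPoly mode (B.indicator a) := by
    rw [← trigSum_indicator hnN, trigSum_eq_trigPoly]
    congr 1
    funext i
    by_cases hi : (i : Mode) ∈ ball (n : ℝ)
    · rw [Pi.mul_apply, Set.indicator_of_mem (by exact_mod_cast hi), Set.indicator_of_mem (by exact hi),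
        Pi.one_apply, one_mul]
    · rw [Pi.mul_apply, Set.indicator_of_notMem (by exact_mod_cast hi), zero_mul,
        Set.indicator_of_notMem (by exact hi)]
  have hv' : ∑ i : ball (N : ℝ), B.indicator (fun i : ball (N : ℝ) => v i) i = ∑ m ∈ ball (n : ℝ), v m := by
    have hs : ball (n : ℝ) ⊆ ball N := ball_mono (by exact_mod_cast hnN)
    rw [← Finset.inter_eq_right.2 hs, ← Finset.sum_ite_mem]
    refine Eq.trans (Finset.sum_congr rfl fun i _ => ?_)
      (Finset.sum_coe_sort (ball (N : ℝ)) fun m => if m ∈ ball (n : ℝ) then v m else 0)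
    rw [Set.indicator_apply]
    rfl
  have e : (fc (trigSum (ball N) b ^ k * star (trigSum (ball N) b) ^ l -
      trigSum (ball n) b ^ k * star (trigSum (ball n) b) ^ l)) =
      ∑ p : (Fin k → ball (N : ℝ)) × (Fin l → ball (N : ℝ)),
        (chaosCoeff a p - chaosCoeff (B.indicator a) p) • fc (UnitAddTorus.mFourier (totalMode mode p)) := by
    rw [hB, trigSum_eq_trigPoly, trigPoly_pow_mul, trigPoly_pow_mul, ← Finset.sum_sub_distrib, map_sum]
    refine Finset.sum_congr rfl fun p _ => ?_
    rw [← map_smul]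
    congr 1
    exact (sub_smul _ _ (UnitAddTorus.mFourier (totalMode mode p))).symm
  rw [e, map_sum, Finset.sum_apply]
  calc _ ≤ ∑ p : (Fin k → ball (N : ℝ)) × (Fin l → ball (N : ℝ)), 6 ^ α * (br (totalMode mode p) ^ (-α) *
        ‖chaosCoeff a p - chaosCoeff (B.indicator a) p‖) := by
        refine (norm_sum_le _ _).trans (Finset.sum_le_sum fun p _ => ?_)
        rw [map_smul, Pi.smul_apply, norm_smul]
        have := mul_le_mul_of_nonneg_left (norm_weightedBlocks_mFourier_le χ hα j (totalMode mode p))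
          (norm_nonneg (chaosCoeff a p - chaosCoeff (B.indicator a) p))
        linarith
    _ ≤ 6 ^ α * (C * √(∑ p, (‖chaosCoeff a p - chaosCoeff (B.indicator a) p‖ * brProd mode p) ^ 2)) := by
        rw [← Finset.mul_sum]
        gcongr
        exact h _ mode (atMostTwo_val _) _
    _ ≤ _ := by
        rw [mul_assoc]
        gcongr
        refine (Finset.sum_le_sum fun p _ => chaosCoeff_sub_indicator_sq_le mode (v := fun i => v i)
          (fun i => hv i) B p).trans_eq ?_
        rw [Finset.sum_sub_distrib, sum_prod_mul_prod fun i : ball (N : ℝ) => v i,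
          sum_prod_mul_prod (B.indicator fun i : ball (N : ℝ) => v i), hv', Finset.sum_coe_sort _ v]

/-- The embedding of `H¹` into `L^{2K}` for partial Fourier sums. -/
lemma exists_integral_pow_trigSum_le (K : ℕ) : ∃ C : ℝ, 0 ≤ C ∧ ∀ (b : Mode → ℂ) (v : Mode → ℝ),
    (∀ m, (‖b m‖ * br m) ^ 2 ≤ v m) → ∀ S : Finset Mode,
      ∫ x, ‖trigSum S b x‖ ^ (2 * K) ∂torusMeasure ≤ C * (∑ m ∈ S, v m) ^ K := by
  obtain ⟨C, hC, h⟩ := exists_sum_br_mul_le K K one_pos le_rfl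
  refine ⟨C, hC, fun b v hv S => ?_⟩
  set mode : S → Mode := Subtype.val
  set a : S → ℂ := fun i => b i
  have hv0 : 0 ≤ ∑ m ∈ S, v m := Finset.sum_nonneg fun m _ => (sq_nonneg _).trans (hv m)
  -- The integral is the zeroth Fourier coefficient, which only components of total frequency zero
  -- reach; for these the decay factor in the `H¹` estimate equals one.
  have h1 : ((∫ x, ‖trigSum S b x‖ ^ (2 * K) ∂torusMeasure : ℝ) : ℂ) =
      fc (trigPoly mode a ^ K * star (trigPoly mode a) ^ K) 0 := by
    rw [fc_apply, ← trigSum_eq_trigPoly, ← integral_complex_ofReal]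
    refine integral_congr_ae (.of_forall fun x => ?_)
    simp only [neg_zero, UnitAddTorus.mFourier_zero, ContinuousMap.one_apply, one_mul,
      ContinuousMap.mul_apply, ContinuousMap.pow_apply, ContinuousMap.star_apply, RCLike.star_def]
    rw [← mul_pow, Complex.mul_conj, Complex.normSq_eq_norm_sq, pow_mul]
    push_cast
    rfl
  have h2 : ∫ x, ‖trigSum S b x‖ ^ (2 * K) ∂torusMeasure =
      ‖fc (trigPoly mode a ^ K * star (trigPoly mode a) ^ K) 0‖ := by
    rw [← h1, Complex.norm_real, Real.norm_of_nonneg (integral_nonneg fun x => by positivity)]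
  rw [h2, trigPoly_pow_mul, map_sum, Finset.sum_apply]
  calc _ ≤ ∑ p : (Fin K → S) × (Fin K → S), br (totalMode mode p) ^ (-1 : ℝ) * ‖chaosCoeff a p‖ := by
        refine (norm_sum_le _ _).trans (Finset.sum_le_sum fun p _ => ?_)
        rw [map_smul, Pi.smul_apply, norm_smul, fc_mFourier, Pi.single_apply]
        split_ifs with h0
        · rw [← h0, br, freq_zero, norm_zero, add_zero, Real.one_rpow, norm_one, mul_comm]
        · rw [norm_zero, mul_zero]
          have := br_pos (totalMode mode p)
          positivity
    _ ≤ C * √(∑ p, (‖chaosCoeff a p‖ * brProd mode p) ^ 2) := h _ mode (atMostTwo_val _) _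
    _ ≤ C * √((∑ m ∈ S, v m) ^ (K + K)) := by
        gcongr
        rw [← Finset.sum_coe_sort S v, ← sum_prod_mul_prod fun i : S => v i]
        refine Finset.sum_le_sum fun p _ => ?_
        rw [norm_chaosCoeff_mul_brProd_sq]
        exact mul_le_mul (Finset.prod_le_prod (fun _ _ => sq_nonneg _) fun i _ => hv _)
          (Finset.prod_le_prod (fun _ _ => sq_nonneg _) fun i _ => hv _)
          (Finset.prod_nonneg fun _ _ => sq_nonneg _)
          (Finset.prod_nonneg fun _ _ => (sq_nonneg _).trans (hv _))
    _ = _ := by rw [pow_add, Real.sqrt_mul_self (by positivity)]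

/-! ### Fourier coefficients of Cameron–Martin paths -/

lemma tsum_enorm_sq_mFourierCoeff_le {φ : Torus → ℂ} (hφ : AEStronglyMeasurable φ torusMeasure) :
    ∑' m, ‖UnitAddTorus.mFourierCoeff φ m‖ₑ ^ 2 ≤ ∫⁻ y, ‖φ y‖ₑ ^ 2 ∂torusMeasure := by
  by_cases h : ∫⁻ y, ‖φ y‖ₑ ^ 2 ∂torusMeasure = ∞
  · rw [h]; exact le_top
  have hm : MemLp φ 2 torusMeasure := by
    refine ⟨hφ, (eLpNorm_lt_top_iff_lintegral_rpow_enorm_lt_top two_ne_zero ENNReal.ofNat_ne_top).2 ?_⟩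
    simpa using lt_top_iff_ne_top.2 h
  have h1 := UnitAddTorus.hasSum_sq_mFourierCoeff (hm.toLp φ)
  have h2 : ∀ m, UnitAddTorus.mFourierCoeff (hm.toLp φ) m = UnitAddTorus.mFourierCoeff φ m := fun m =>
    integral_congr_ae (hm.coeFn_toLp.mono fun y hy => by simp only [hy])
  have h3 : ∫ y, ‖hm.toLp φ y‖ ^ 2 ∂torusMeasure = ∫ y, ‖φ y‖ ^ 2 ∂torusMeasure :=
    integral_congr_ae (hm.coeFn_toLp.mono fun y hy => by simp only [hy])
  simp_rw [h2] at h1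
  replace h1 : HasSum (fun m => ‖UnitAddTorus.mFourierCoeff φ m‖ ^ 2) (∫ y, ‖φ y‖ ^ 2 ∂torusMeasure) :=
    h3 ▸ h1
  have h4 : ∀ z : ℂ, ‖z‖ₑ ^ 2 = ENNReal.ofReal (‖z‖ ^ 2) := fun z => by
    rw [ENNReal.ofReal_pow (norm_nonneg _), ofReal_norm]
  simp_rw [h4]
  rw [← ENNReal.ofReal_tsum_of_nonneg (fun m => by positivity) h1.summable, h1.tsum_eq,
    ofReal_integral_eq_lintegral_ofReal ((memLp_two_iff_integrable_sq_norm hφ).1 hm)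
      (.of_forall fun y => by positivity)]

lemma sq_lintegral_mul_le {X : Type*} [MeasurableSpace X] {ν : Measure X} {f g : X → ℝ≥0∞}
    (hf : AEMeasurable f ν) (hg : AEMeasurable g ν) :
    (∫⁻ x, f x * g x ∂ν) ^ 2 ≤ (∫⁻ x, f x ^ 2 ∂ν) * ∫⁻ x, g x ^ 2 ∂ν := by
  have h := ENNReal.lintegral_mul_le_Lp_mul_Lq ν
    ((Real.holderConjugate_iff (p := 2) (q := 2)).2 ⟨one_lt_two, by norm_num⟩) hf hg
  have h2 := pow_le_pow_left₀ (zero_le (a := ∫⁻ x, (f * g) x ∂ν)) h 2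
  rw [mul_pow, ← ENNReal.rpow_natCast (_ ^ _) 2, ← ENNReal.rpow_natCast ((∫⁻ x, g x ^ (2 : ℝ) ∂ν) ^ _) 2,
    ← ENNReal.rpow_mul, ← ENNReal.rpow_mul] at h2
  simpa using h2

/-- Cauchy–Schwarz in time bounds the squared coefficient by `ouVar μ m` times the energy of the
`m`-th mode of `g`. The first factor compensates `br m ^ 2`, and the energies are summable by
Bessel's inequality; neither depends on `t`. -/
lemma exists_summable_forall_norm_le {μ : ℂ} (hμ : 0 < μ.re) (g : SpaceTimeL2) :
    ∃ v : Mode → ℝ, Summable v ∧ ∀ (t : ℝ) (m : Mode), (‖∫ s in Set.Iic t,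
      Complex.exp (-μ * eigenvalue m * ((t : ℂ) - s)) * UnitAddTorus.mFourierCoeff (fun y => g (s, y)) m‖ *
        br m) ^ 2 ≤ v m := by
  have hg := Lp.memLp g
  set c : Mode → ℝ → ℂ := fun m s => UnitAddTorus.mFourierCoeff (fun y => g (s, y)) m with hc
  have hcm : ∀ m, AEStronglyMeasurable (c m) volume := fun m => by
    have h : AEStronglyMeasurable (fun p : ℝ × Torus => UnitAddTorus.mFourier (-m) p.2 • g p)
        ((volume : Measure ℝ).prod torusMeasure) :=
      ((UnitAddTorus.mFourier (-m)).continuous.comp continuous_snd).aestronglyMeasurable.smul hg.1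
    exact h.integral_prod_right'
  set G : Mode → ℝ≥0∞ := fun m => ∫⁻ s, ‖c m s‖ₑ ^ 2
  have hG : ∑' m, G m ≠ ∞ := by
    rw [← lintegral_tsum fun m => ((hcm m).enorm.pow_const 2)]
    have h1 : ∫⁻ s, ∑' m, ‖c m s‖ₑ ^ 2 ≤ ∫⁻ s, ∫⁻ y, ‖g (s, y)‖ₑ ^ 2 ∂torusMeasure := by
      refine lintegral_mono_ae ?_
      filter_upwards [hg.1.prodMk_left] with s hs
      exact tsum_enorm_sq_mFourierCoeff_le hs
    rw [← lintegral_prod (fun p => ‖g p‖ₑ ^ 2) (hg.1.enorm.pow_const 2)] at h1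
    have h2 := (eLpNorm_lt_top_iff_lintegral_rpow_enorm_lt_top two_ne_zero ENNReal.ofNat_ne_top).1 hg.2
    refine ne_top_of_le_ne_top h2.ne (h1.trans_eq ?_)
    simp
  refine ⟨fun m => μ.re⁻¹ * (G m).toReal, (ENNReal.summable_toReal hG).mul_left _, fun t m => ?_⟩
  have hGm : G m ≠ ∞ := ne_top_of_le_ne_top hG (ENNReal.le_tsum m)
  have hE := eigenvalue_pos m
  have hb := br_pos m
  have h1 : ∫ s in Set.Iic t, Complex.exp (-μ * eigenvalue m * ((t : ℂ) - s)) * c m s =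
      ∫ s, timeKer μ m t s * c m s := by
    rw [← integral_indicator measurableSet_Iic]
    refine integral_congr_ae (.of_forall fun s => ?_)
    simp only [timeKer, Set.indicator_apply, Complex.ofReal_sub]
    split_ifs <;> simp
  have h2 : ∫⁻ s, ‖timeKer μ m t s‖ₑ ^ 2 = ENNReal.ofReal (ouVar μ m) := by
    have h3 := integral_timeKer_mul_conj hμ m (le_refl t)
    have h4 : ∀ r, timeKer μ m t r * conj (timeKer μ m t r) = ((‖timeKer μ m t r‖ ^ 2 : ℝ) : ℂ) := fun r => by
      rw [Complex.mul_conj, Complex.normSq_eq_norm_sq]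
    simp_rw [h4] at h3
    rw [integral_complex_ofReal, sub_self, Complex.ofReal_zero, mul_zero, Complex.exp_zero, one_mul,
      Complex.ofReal_inj] at h3
    rw [← h3, ofReal_integral_eq_lintegral_ofReal ((memLp_two_iff_integrable_sq_norm
      (measurable_timeKer m t).aestronglyMeasurable).1 (memLp_timeKer hμ m t)) (.of_forall fun s => by positivity)]
    exact lintegral_congr fun s => by rw [ENNReal.ofReal_pow (norm_nonneg _), ofReal_norm]
  have h3 : ‖∫ s, timeKer μ m t s * c m s‖ₑ ^ 2 ≤ ENNReal.ofReal (ouVar μ m) * G m := by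
    rw [← h2]
    refine le_trans (pow_le_pow_left₀ zero_le (enorm_integral_le_lintegral_enorm _) 2) ?_
    simp_rw [enorm_mul]
    exact sq_lintegral_mul_le (measurable_timeKer m t).enorm.aemeasurable (hcm m).enorm
  have h4 : ‖∫ s, timeKer μ m t s * c m s‖ ^ 2 ≤ ouVar μ m * (G m).toReal := by
    have h5 := ENNReal.toReal_mono (ENNReal.mul_ne_top ENNReal.ofReal_ne_top hGm) h3
    rwa [ENNReal.toReal_pow, toReal_enorm, ENNReal.toReal_mul, ENNReal.toReal_ofReal (ouVar_pos hμ m).le] at h5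
  have h5 : ouVar μ m * br m ^ 2 ≤ μ.re⁻¹ := by
    rw [ouVar, inv_mul_le_iff₀ (by positivity)]
    have h6 : 2 * μ.re * eigenvalue m * μ.re⁻¹ = 2 * eigenvalue m := by field_simp
    rw [h6]
    exact br_sq_le m
  rw [h1, mul_pow]
  calc _ ≤ ouVar μ m * (G m).toReal * br m ^ 2 := mul_le_mul_of_nonneg_right h4 (sq_nonneg _)
    _ = ouVar μ m * br m ^ 2 * (G m).toReal := by ring
    _ ≤ _ := mul_le_mul_of_nonneg_right h5 ENNReal.toReal_nonneg

/-! ### Convergence of the Hermite polynomials of partial Fourier sums -/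

/-- Vitali's theorem for sequences that are bounded in `L²`. -/
lemma tendsto_integral_of_bound_sq {X : Type*} [MeasurableSpace X] {ν : Measure X} [IsFiniteMeasure ν]
    {F : ℕ → X → ℂ} {f : X → ℂ} (hF : ∀ n, MemLp (F n) 2 ν) (hf : Integrable f ν) {M : ℝ}
    (hM : ∀ n, ∫ x, ‖F n x‖ ^ 2 ∂ν ≤ M) (h : ∀ᵐ x ∂ν, Tendsto (fun n => F n x) atTop (𝓝 (f x))) :
    Tendsto (fun n => ∫ x, F n x ∂ν) atTop (𝓝 (∫ x, f x ∂ν)) := by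
  refine tendsto_integral_of_L1' f hf.1 (.of_forall fun n => (hF n).integrable one_le_two) ?_
  refine tendsto_Lp_finite_of_tendsto_ae le_rfl ENNReal.one_ne_top (fun n => (hF n).1)
    (memLp_one_iff_integrable.2 hf) (unifIntegrable_of le_rfl ENNReal.one_ne_top (fun n => (hF n).1)
      fun ε hε => ?_) h
  have hM0 : 0 ≤ M := (integral_nonneg fun x => by positivity).trans (hM 0)
  -- Chebyshev threshold: above `C` the modulus is at most its square divided by `C`. Adding `1`
  -- keeps `C` positive when `M = 0`.
  set C : ℝ≥0 := Real.toNNReal ((M + 1) / ε)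
  have hC : (C : ℝ) = (M + 1) / ε := Real.coe_toNNReal _ (by positivity)
  have hC0 : (0 : ℝ) < C := hC ▸ by positivity
  refine ⟨C, fun n => ?_⟩
  have hi := (memLp_two_iff_integrable_sq_norm (hF n).1).1 (hF n)
  rw [eLpNorm_one_eq_lintegral_enorm]
  calc _ ≤ ∫⁻ x, ENNReal.ofReal (‖F n x‖ ^ 2 / C) ∂ν := by
        refine lintegral_mono fun x => ?_
        by_cases hx : C ≤ ‖F n x‖₊
        · rw [Set.indicator_of_mem (by exact hx), ← ofReal_norm]
          refine ENNReal.ofReal_le_ofReal ((le_div_iff₀ hC0).2 ?_)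
          rw [sq]
          exact mul_le_mul_of_nonneg_left (by exact_mod_cast hx) (norm_nonneg _)
        · rw [Set.indicator_of_notMem (by exact hx), enorm_zero]
          exact zero_le
    _ = ENNReal.ofReal ((∫ x, ‖F n x‖ ^ 2 ∂ν) / C) := by
        rw [← integral_div, ofReal_integral_eq_lintegral_ofReal (hi.div_const _)
          (.of_forall fun x => by positivity)]
    _ ≤ _ := by
        refine ENNReal.ofReal_le_ofReal ((div_le_iff₀ hC0).2 ((hM n).trans ?_))
        rw [hC, mul_div_cancel₀ _ hε.ne']
        linarith

lemma exists_subseq_trigSum_tendsto {φ : Torus → ℂ} (hφ : MemLp φ 2 torusMeasure) :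
    ∃ ψ : ℕ → ℕ, StrictMono ψ ∧ ∀ᵐ y ∂torusMeasure, Tendsto (fun j =>
      trigSum (ball (ψ j)) (UnitAddTorus.mFourierCoeff φ) y) atTop (𝓝 (φ y)) := by
  have h1 := (UnitAddTorus.hasSum_mFourier_series_L2 (hφ.toLp φ)).comp tendsto_ball
  obtain ⟨ψ, hψ, h2⟩ := (tendstoInMeasure_of_tendsto_Lp h1).exists_seq_tendsto_ae
  refine ⟨ψ, hψ, ?_⟩
  have h3 : ∀ N : ℕ, (∑ m ∈ ball N, UnitAddTorus.mFourierCoeff (hφ.toLp φ) m •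
      UnitAddTorus.mFourierLp 2 m : Lp ℂ 2 torusMeasure) =ᵐ[torusMeasure]
        trigSum (ball N) (UnitAddTorus.mFourierCoeff φ) := fun N => by
    have e : (∑ m ∈ ball N, UnitAddTorus.mFourierCoeff (hφ.toLp φ) m •
        UnitAddTorus.mFourierLp 2 m : Lp ℂ 2 torusMeasure) =
        ContinuousMap.toLp 2 torusMeasure ℂ (trigSum (ball N) (UnitAddTorus.mFourierCoeff φ)) := by
      unfold trigSum
      rw [map_sum]
      refine Finset.sum_congr rfl fun m _ => ?_
      rw [map_smul]
      congr 1
      exact integral_congr_ae (hφ.coeFn_toLp.mono fun y hy => by simp only [hy])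
    rw [e]
    exact ContinuousMap.coeFn_toLp _ _
  filter_upwards [h2, ae_all_iff.2 h3, hφ.coeFn_toLp] with y hy h4 h5
  rw [← h5]
  exact hy.congr fun j => h4 (ψ j)

/-- The error is expressed by powers of the partial sums of the majorant `v` only. One rate
therefore serves all coefficient families dominated by `v`, in particular all times of a
Cameron–Martin path. -/
lemma exists_tendsto_norm_weightedBlocks_herm_sub_le (χ : DyadicPartition) {α : ℝ} (hα : 0 < α)
    (hα1 : α ≤ 1) (k l : ℕ) (R : ℂ) {v : Mode → ℝ} (hv : Summable v) :
    ∃ δ : ℕ → ℝ, Tendsto δ atTop (𝓝 0) ∧ ∀ b : Mode → ℂ, (∀ m, (‖b m‖ * br m) ^ 2 ≤ v m) →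
      ∀ n N : ℕ, n ≤ N → ∀ j, ‖χ.weightedBlocks (-α)
        (fc (herm k l (trigSum (ball N) b) (star (trigSum (ball N) b)) R -
          herm k l (trigSum (ball n) b) (star (trigSum (ball n) b)) R)) j‖ ≤ δ n := by
  choose C hC h using fun m => exists_norm_weightedBlocks_trigSum_sub_le χ hα hα1 (k - m) (l - m)
  set c : ℕ → ℂ := fun m => (m.factorial : ℂ) * (k.choose m : ℂ) * (l.choose m : ℂ) * (-R) ^ m
  set V := ∑' m, v m
  refine ⟨fun n => ∑ m ∈ Finset.range (min k l + 1),
    ‖c m‖ * (C m * √(V ^ (k - m + (l - m)) - (∑ q ∈ ball (n : ℝ), v q) ^ (k - m + (l - m)))), ?_,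
    fun b hb n N hnN j => ?_⟩
  · have h1 : Tendsto (fun n : ℕ => ∑ q ∈ ball (n : ℝ), v q) atTop (𝓝 V) := hv.hasSum.comp tendsto_ball
    have h2 : ∀ K, Continuous fun x : ℝ => √(V ^ K - x ^ K) := fun K => by fun_prop
    rw [← Finset.sum_const_zero (s := Finset.range (min k l + 1)) (M := ℝ)]
    refine tendsto_finsetSum _ fun m _ => ?_
    have h3 := ((((h2 (k - m + (l - m))).tendsto V).comp h1).const_mul (C m)).const_mul ‖c m‖
    simpa using h3
  · have hv0 : ∀ m, 0 ≤ v m := fun m => (sq_nonneg _).trans (hb m)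
    have e : herm k l (trigSum (ball N) b) (star (trigSum (ball N) b)) R -
        herm k l (trigSum (ball n) b) (star (trigSum (ball n) b)) R =
        ∑ m ∈ Finset.range (min k l + 1), c m •
          (trigSum (ball N) b ^ (k - m) * star (trigSum (ball N) b) ^ (l - m) -
            trigSum (ball n) b ^ (k - m) * star (trigSum (ball n) b) ^ (l - m)) := by
      rw [herm, herm, ← Finset.sum_sub_distrib]
      exact Finset.sum_congr rfl fun m _ => (smul_sub _ _ _).symm
    rw [e, map_sum, map_sum, Finset.sum_apply]
    refine (norm_sum_le _ _).trans (Finset.sum_le_sum fun m _ => ?_)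
    rw [map_smul, map_smul, Pi.smul_apply, norm_smul]
    refine mul_le_mul_of_nonneg_left ((h m b v hb n N hnN j).trans ?_) (norm_nonneg _)
    refine mul_le_mul_of_nonneg_left (Real.sqrt_le_sqrt (sub_le_sub_right ?_ _)) (hC m)
    exact pow_le_pow_left₀ (Finset.sum_nonneg fun m _ => hv0 m) (hv.sum_le_tsum _ fun m _ => hv0 m) _

/-- Each monomial of the Hermite polynomial is controlled by the embedding of `H¹` into every
`L^{2K}`; the uniform `L²` bound supplies the uniform integrability for Vitali's theorem. -/
lemma exists_integral_sq_herm_le (k l : ℕ) (R : ℂ) {v : Mode → ℝ} (hv : Summable v) :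
    ∃ M : ℝ, ∀ b : Mode → ℂ, (∀ m, (‖b m‖ * br m) ^ 2 ≤ v m) → ∀ S : Finset Mode,
      ∫ x, ‖herm k l (trigSum S b) (star (trigSum S b)) R x‖ ^ 2 ∂torusMeasure ≤ M := by
  choose C hC h using exists_integral_pow_trigSum_le
  set c : ℕ → ℂ := fun m => (m.factorial : ℂ) * (k.choose m : ℂ) * (l.choose m : ℂ) * (-R) ^ m
  set A := Finset.range (min k l + 1)
  refine ⟨A.card * ∑ m ∈ A, ‖c m‖ ^ 2 *
    (C (k - m + (l - m)) * (∑' q, v q) ^ (k - m + (l - m))), fun b hb S => ?_⟩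
  have hv0 : ∀ m, 0 ≤ v m := fun m => (sq_nonneg _).trans (hb m)
  set f := trigSum S b
  have hi : ∀ K, Integrable (fun x => ‖f x‖ ^ (2 * K)) torusMeasure := fun K =>
    (f.continuous.norm.pow _).integrable_of_hasCompactSupport (HasCompactSupport.of_compactSpace _)
  calc ∫ x, ‖herm k l f (star f) R x‖ ^ 2 ∂torusMeasure
      ≤ ∫ x, A.card * ∑ m ∈ A, ‖c m‖ ^ 2 * ‖f x‖ ^ (2 * (k - m + (l - m))) ∂torusMeasure := by
        refine integral_mono (((herm k l f (star f) R).continuous.norm.pow 2).integrable_of_hasCompactSupport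
          (HasCompactSupport.of_compactSpace _))
          ((integrable_finsetSum _ fun m _ => (hi _).const_mul _).const_mul _) fun x => ?_
        have h1 : ‖herm k l f (star f) R x‖ ≤ ∑ m ∈ A, ‖c m‖ * ‖f x‖ ^ (k - m + (l - m)) := by
          rw [herm_continuousMap_apply, herm]
          refine (norm_sum_le _ _).trans_eq (Finset.sum_congr rfl fun m _ => ?_)
          rw [norm_smul, norm_mul (f x ^ (k - m)), norm_pow (f x), norm_pow, ContinuousMap.star_apply, norm_star,
            pow_add]
        refine (pow_le_pow_left₀ (norm_nonneg _) h1 2).trans (sq_sum_le_card_mul_sum_sq.trans_eq ?_)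
        congr 1
        refine Finset.sum_congr rfl fun m _ => ?_
        rw [mul_pow, ← pow_mul, mul_comm _ 2]
    _ = A.card * ∑ m ∈ A, ‖c m‖ ^ 2 * ∫ x, ‖f x‖ ^ (2 * (k - m + (l - m))) ∂torusMeasure := by
        rw [integral_const_mul, integral_finsetSum _ fun m _ => (hi _).const_mul _]
        simp_rw [integral_const_mul]
    _ ≤ _ := by
        refine mul_le_mul_of_nonneg_left (Finset.sum_le_sum fun m _ =>
          mul_le_mul_of_nonneg_left ((h _ b v hb S).trans ?_) (sq_nonneg _)) (Nat.cast_nonneg _)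
        refine mul_le_mul_of_nonneg_left ?_ (hC _)
        exact pow_le_pow_left₀ (Finset.sum_nonneg fun m _ => hv0 m) (hv.sum_le_tsum _ fun m _ => hv0 m) _

/-- Besov estimates alone do not tell that the limit is the Hermite polynomial of the function
itself. Almost everywhere convergence of a subsequence of partial sums, with an `L²` bound,
identifies its Fourier coefficients. -/
lemma exists_tendsto_fc_herm {φ : Torus → ℂ} (hφ : MemLp φ 2 torusMeasure) {v : Mode → ℝ} (hv : Summable v)
    (hb : ∀ m, (‖UnitAddTorus.mFourierCoeff φ m‖ * br m) ^ 2 ≤ v m) (k l : ℕ) (R : ℝ)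
    (hint : Integrable (fun x => hermite k l (φ x) R) torusMeasure) :
    ∃ ψ : ℕ → ℕ, StrictMono ψ ∧ ∀ q, Tendsto (fun j => fc
      (herm k l (trigSum (ball (ψ j)) (UnitAddTorus.mFourierCoeff φ))
        (star (trigSum (ball (ψ j)) (UnitAddTorus.mFourierCoeff φ))) R) q) atTop
      (𝓝 (UnitAddTorus.mFourierCoeff (fun x => hermite k l (φ x) R) q)) := by
  obtain ⟨ψ, hψ, h⟩ := exists_subseq_trigSum_tendsto hφ
  obtain ⟨M, hM⟩ := exists_integral_sq_herm_le k l R hv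
  refine ⟨ψ, hψ, fun q => ?_⟩
  set G : ℕ → C(Torus, ℂ) := fun j => herm k l (trigSum (ball (ψ j)) (UnitAddTorus.mFourierCoeff φ))
        (star (trigSum (ball (ψ j)) (UnitAddTorus.mFourierCoeff φ))) R
  have hG : ∀ j, MemLp (fun x => UnitAddTorus.mFourier (-q) x * G j x) 2 torusMeasure := fun j =>
    (UnitAddTorus.mFourier (-q) * G j).continuous.memLp_of_hasCompactSupport
      (HasCompactSupport.of_compactSpace _)
  have hf : Integrable (fun x => UnitAddTorus.mFourier (-q) x * hermite k l (φ x) R) torusMeasure :=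
    hint.mono ((UnitAddTorus.mFourier (-q)).continuous.aestronglyMeasurable.mul hint.1)
      (.of_forall fun x => by rw [norm_mul, norm_mFourier_apply_eq_one, one_mul])
  refine tendsto_integral_of_bound_sq (ν := torusMeasure) hG hf (M := M) (fun j => ?_) ?_
  · refine le_trans (le_of_eq ?_) (hM _ hb (ball (ψ j)))
    refine integral_congr_ae (.of_forall fun x => ?_)
    show ‖UnitAddTorus.mFourier (-q) x * G j x‖ ^ 2 = ‖G j x‖ ^ 2
    rw [norm_mul, norm_mFourier_apply_eq_one, one_mul]
  · filter_upwards [h] with x hx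
    refine Tendsto.const_mul _ ?_
    have hc : Continuous fun z : ℂ => herm k l z (conj z) (R : ℂ) :=
      continuous_herm continuous_id Complex.continuous_conj k l R
    rw [hermite_eq_herm]
    refine ((hc.tendsto _).comp hx).congr fun j => ?_
    simp only [Function.comp]
    rw [herm_continuousMap_apply]
    rfl

lemma norm_weightedBlocks_le_of_tendsto (χ : DyadicPartition) {γ c : ℝ} {u : ℕ → Mode → ℂ} {w : Mode → ℂ}
    (h : ∀ q, Tendsto (fun j => u j q) atTop (𝓝 (w q))) (i : ℕ)
    (hc : ∀ᶠ j in atTop, ‖χ.weightedBlocks γ (u j) i‖ ≤ c) : ‖χ.weightedBlocks γ w i‖ ≤ c := by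
  have h1 : Tendsto (fun j => χ.weightedBlocks γ (u j) i) atTop (𝓝 (χ.weightedBlocks γ w i)) := by
    simp only [χ.weightedBlocks_apply, χ.block_apply]
    refine Tendsto.const_smul (tendsto_finsetSum _ fun m _ => ?_) _
    have h2 : Continuous fun z : ℂ => ((χ.mult i m : ℂ) * z) • UnitAddTorus.mFourier m := by fun_prop
    exact (h2.tendsto _).comp (h m)
  exact le_of_tendsto h1.norm hc

/-- The subsequence that identifies the limit depends on `t`, but it is only used to let the larger
index go to infinity in an estimate whose rate in `n` is independent of `t`. -/
lemma tendsto_hermPath {χ : DyadicPartition} {α : ℝ} (hα : 0 < α) (hα1 : α ≤ 1) {h : ℝ≥0 → Torus → ℂ}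
    (hh : ∀ t, MemLp (h t) 2 torusMeasure) {x : C(ℝ≥0, Mode → ℂ)}
    (hx : ∀ t, x t = UnitAddTorus.mFourierCoeff (h t)) {v : Mode → ℝ} (hv : Summable v)
    (hxv : ∀ t m, (‖x t m‖ * br m) ^ 2 ≤ v m) (k l : ℕ) (R : ℝ) {z : χ.PathSpace (-α)}
    (hz : ∀ t, Represents (z t).coeff fun y => hermite k l (h t y) R) :
    Tendsto (fun n : ℕ => hermPath χ (-α) k l n R (trigPath (ball n) x)) atTop (𝓝 z) := by
  obtain ⟨δ, hδ, hδ'⟩ := exists_tendsto_norm_weightedBlocks_herm_sub_le χ hα hα1 k l R hv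
  refine tendsto_iff_pathSup.2 fun T => ?_
  have h0 : Tendsto (fun n => ENNReal.ofReal (δ n)) atTop (𝓝 0) := by
    simpa using ENNReal.tendsto_ofReal hδ
  refine tendsto_of_tendsto_of_tendsto_of_le_of_le tendsto_const_nhds h0 (fun _ => zero_le) fun n => ?_
  refine iSup₂_le fun t _ => ?_
  rw [DyadicPartition.HolderBesov.enorm_eq, ContinuousMap.sub_apply, DyadicPartition.HolderBesov.coeff_sub,
    coeff_hermPath χ (-α) k l n.cast_nonneg _ (trigSum_mem_Trig subset_rfl _)]
  refine iSup_le fun i => ?_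
  rw [← ofReal_norm]
  refine ENNReal.ofReal_le_ofReal ?_
  obtain ⟨ψ, hψ, hlim⟩ := exists_tendsto_fc_herm (hh t) hv (fun m => hx t ▸ hxv t m) k l R (hz t).1
  rw [← hx t] at hlim
  refine norm_weightedBlocks_le_of_tendsto χ (u := fun j => fc
    (herm k l (trigSum (ball (ψ j)) (x t)) (star (trigSum (ball (ψ j)) (x t))) R -
      herm k l (trigSum (ball n) (x t)) (star (trigSum (ball n) (x t))) R)) (fun q => ?_) i ?_
  · simp only [map_sub, Pi.sub_apply]
    rw [(hz t).2 q]
    exact (hlim q).sub tendsto_const_nhds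
  · filter_upwards [hψ.tendsto_atTop.eventually_ge_atTop n] with j hj
    exact hδ' (x t) (hxv t) n (ψ j) hj i

/-! ### The skeleton lies in the support. -/

variable {χ : DyadicPartition} {α : ℝ} {μ : ℂ} {Ω : Type*} [MeasurableSpace Ω] {P : Measure Ω}
  {ξ : SpaceTimeL2 → Ω → ℂ} {Z : Ω → χ.PathSpace (-α)} {W : Ω → χ.WickSpace (-α)}

/-- Continuity in time of the coefficients of `h` comes from the component of order `(1, 0)`, which
represents `h` itself. The partial Fourier sums then form continuous trigonometric paths, whose
Hermite families are in the closed support. -/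
theorem hermiteSet_subset_support (hα : 0 < α) (hα1 : α ≤ 1) (hμ : 0 < μ.re) (hξ : IsComplexWhiteNoise P ξ)
    (hZ : IsStationarySolution χ (-α) μ P ξ Z) (hW : IsWickPowers P Z W) :
    hermiteSet χ (-α) μ ⊆ (P.map W).support := by
  rintro z ⟨h, ⟨g, hg⟩, R, hR, hz⟩
  obtain ⟨v, hv, hgv⟩ := exists_summable_forall_norm_le hμ g
  have hx : ∀ t, coeffPath (z 1 0) t = UnitAddTorus.mFourierCoeff (h t) := fun t => funext fun m => by
    have h1 : (fun y => hermite 1 0 (h t y) R) = h t := funext fun y => by simp [hermite]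
    have h2 := (hz 1 0 t).2 m
    rwa [h1] at h2
  refine Measure.isClosed_support.mem_of_tendsto (b := atTop) (tendsto_pi_nhds.2 fun k => tendsto_pi_nhds.2 fun l =>
    tendsto_hermPath hα hα1 (fun t => (hg t).1) hx hv (fun t m => ?_) k l R (hz k l))
    (.of_forall fun n => hermPath_mem_support hα hα1 hμ hξ hZ hW hR n _)
  rw [hx t, (hg t).2 m]
  exact hgv t m

end ComplexSHE

end

/-! ### The theorem. -/

open ComplexSHE
theorem mainTheorem3 (χ : DyadicPartition) (α : ℝ) (hα : α ∈ Set.Ioo (0 : ℝ) (1 / 2))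
    (μ : ℂ) (hμ : 0 < μ.re) {Ω : Type*} [MeasurableSpace Ω] (P : Measure Ω)
    [IsProbabilityMeasure P] (ξ : SpaceTimeL2 → Ω → ℂ) (hξ : IsComplexWhiteNoise P ξ) :
    (∃ (Z : Ω → χ.PathSpace (-α)) (W : Ω → χ.WickSpace (-α)),
      IsStationarySolution χ (-α) μ P ξ Z ∧ IsWickPowers P Z W) ∧
    ∀ (Z : Ω → χ.PathSpace (-α)) (W : Ω → χ.WickSpace (-α)),
      IsStationarySolution χ (-α) μ P ξ Z → IsWickPowers P Z W →
      (P.map W).support = closure (hermiteSet χ (-α) μ) := by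
  have hα1 : α ≤ 1 := by linarith [hα.2]
  refine ⟨exists_isStationarySolution_isWickPowers χ hα.1 hα1 hμ hξ, fun Z W hZ hW => ?_⟩
  exact (support_subset_closure_hermiteSet (by linarith [hα.1]) hμ hξ hZ hW).antisymm
    (closure_minimal (hermiteSet_subset_support hα.1 hα1 hμ hξ hZ hW) Measure.isClosed_support)
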